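/- Let $\mathbb T^2=\mathbb R^2/\mathbb Z^2$ with the uniform probability measure, $e_k(x)=e^{2\pi i k\cdot x}$, and for a finite signed measure $u$ on $\mathbb T^2$ and $\alpha\in\mathbb R$ let $\|u\|_{H^\alpha}^2=\sum_{k\in\mathbb Z^2}(1+|k|^2)^\alpha|\hat u_k|^2\in[0,\infty]$, $\hat u_k=\int e_{-k}\,du$. Let $G$ be the Green function with zero average of the Laplacian on $\mathbb T^2$ and $K=\nabla^\perp G$, $\nabla^\perp=(\partial_2,-\partial_1)$ acting on the first variable. Fix $\theta,\lambda>0$. For a real $M\ge 0$ and an integer $N\ge1$ the point vortices process $\omega_{M,N}$ is defined as follows. Let $(s_i,\varsigma_i,y_i)_i$ and $(t_j,\sigma_j,z_j)_j$ be two independent marked Poisson processes on $[0,\infty)$ defined on a probability space $(\Omega,\mathcal F,\mathbb P)$: the $s_i$, and the $t_j$, are the increasing jump times of a Poisson process of intensity $N\lambda$, and the marks are i.i.d., independent of the times, with uniform independent signs in $\{\pm1\}$ and positions in $\mathbb T^2$. Every point with $s_i\le M$ gives an initial vortex, with birth time $0$, initial position $y_i$ and initial intensity $\varsigma_i e^{-\theta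 s_i}/\sqrt N$; every $(t_j,\sigma_j,z_j)$ gives a vortex created at time $t_j$ in the position $z_j$ with intensity $\sigma_j/\sqrt N$. Write $b_v$, $p_v$, $\xi_v$ for the birth time, the position at birth and the intensity at birth of a vortex $v$, and $\xi_{v,t}=e^{-\theta(t-b_v)}\xi_v$ for $t\ge b_v$. The positions $x_{v,t}$ are random variables which almost surely satisfy, for all $v$ and all $t\geq 0$, $x_{v,t}=p_v$ if $t\le b_v$ and $$x_{v,t}=p_v+\int_{b_v}^t\ \sum_{w\ne v:\ b_w\le s}\xi_{w,s}\,K(x_{v,s},x_{w,s})\,ds\quad\text{if } t\ge b_v,$$ the integrand being integrable on $[b_v,t]$, and $$\omega_{M,N,t}=\sum_{v:\ b_v\le t}\xi_{v,t}\,\delta_{x_{v,t}},\qquad t\ge0 .$$ Let $(\mathcal F_t)_{t\ge0}$ be the filtration generated by the initial datum (the points $(s_i,\varsigma_i,y_i)$ with $s_i\le M$) and by the driving noise (the points $(t_j,\sigma_j,z_j)$ with $t_j\le t$), completed by the $\mathbb P$-null events of $\mathcal F$ and made right-continuous. Then for all $\delta,T>0$ there is a constant $C_{\delta,T}$ (depending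 on $\delta,T$ and on the fixed $\theta,\lambda$ only) such that for all $M\ge0$ and $N\ge1$, for every such process $\omega_{M,N}$, every $\mathcal F_t$-stopping time $\tau\le T$ and every $r>0$, $$\mathbb E\left[\|\omega_{M,N,\tau+r}-\omega_{M,N,\tau}\|_{H^{-3-\delta}}^2\right]\le C_{\delta,T}\cdot r .$$ In particular, the constant does not depend on $M$, $N$, $\tau$ or $r$. -/

import Mathlib

open MeasureTheory ProbabilityTheory
open scoped NNReal ENNReal

noncomputable section

namespace PointVortex

/-! ### The torus, its Green function and the Biot-Savart kernel -/

/-- The two-dimensional torus `ℝ² / ℤ²`. Its `volume` is the uniform probability measure. -/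
abbrev Torus : Type := UnitAddTorus (Fin 2)

/-- The quotient map `ℝ² → ℝ² / ℤ²`. -/
def toTorus (v : Fin 2 → ℝ) : Torus := fun i => (v i : UnitAddCircle)

/-- The squared Euclidean length `|k|²` of a frequency `k ∈ ℤ²`. -/
def freqSq (k : Fin 2 → ℤ) : ℝ := ∑ i, (k i : ℝ) ^ 2

/-- The heat kernel `p_t(x) = ∑_k exp(-4π²|k|²t) e_k(x)` of the Laplacian on the torus, `t > 0`,
where `e_k(x) = exp(2πi k·x)`. -/
def heatKernel (t : ℝ) (x : Torus) : ℝ :=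
  ∑' k : Fin 2 → ℤ,
    Real.exp (-(4 * Real.pi ^ 2 * freqSq k * t)) * (UnitAddTorus.mFourier k x).re

/-- The Green function with zero average of the Laplacian `Δ` on the torus (`Δ G(·,y) = δ_y - 1`),
that is `G(x,y) = -∫₀^∞ (p_t(x-y) - 1) dt`, for `x ≠ y`. Its Fourier coefficients in `x - y` are
`-1/(4π²|k|²)` for `k ≠ 0`, and `0` for `k = 0`. -/
def green (x y : Torus) : ℝ := -∫ t in Set.Ioi (0 : ℝ), (heatKernel t (x - y) - 1)

/-- The `i`-th partial derivative of `G` in its first variable. -/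
def greenDeriv (i : Fin 2) (x y : Torus) : ℝ :=
  deriv (fun h : ℝ => green (x + toTorus (Pi.single i h)) y) 0

/-- The Biot-Savart kernel `K = ∇^⊥ G`, with `∇^⊥ = (∂₂, -∂₁)` acting on the first variable. -/
def biotSavart (x y : Torus) : Fin 2 → ℝ := ![greenDeriv 1 x y, -greenDeriv 0 x y]

/-! ### Sobolev norms of finite signed measures -/

/-- The `k`-th Fourier coefficient `∫ e_{-k} dμ` of a finite signed measure. -/
def fourierCoeffMeasure (μ : SignedMeasure Torus) (k : Fin 2 → ℤ) : ℂ :=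
  ∫ᵛ x, UnitAddTorus.mFourier (-k) x ∂<•μ

/-- The squared Sobolev norm `∑_k (1+|k|²)^α |û_k|²` of `H^α`, as a number in `[0,∞]`. -/
def sobolevNormSq (α : ℝ) (μ : SignedMeasure Torus) : ℝ≥0∞ :=
  ∑' k : Fin 2 → ℤ, ENNReal.ofReal ((1 + freqSq k) ^ α * ‖fourierCoeffMeasure μ k‖ ^ 2)

/-! ### Marked Poisson processes -/

/-- A random sequence of times carrying marks `(σ, x)`, a sign `σ = ±1` and a position `x`. -/
structure MarkedPoints (Ω : Type*) [MeasurableSpace Ω] where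
  time : ℕ → Ω → ℝ
  mark : ℕ → Ω → ℝ × Torus
  measurable_time : ∀ i, Measurable (time i)
  measurable_mark : ∀ i, Measurable (mark i)

variable {Ω : Type*} [MeasurableSpace Ω]

/-- The number of points up to time `t`. -/
def MarkedPoints.count (p : MarkedPoints Ω) (t : ℝ≥0) (ω : Ω) : ℕ :=
  Set.ncard {i | p.time i ω ≤ t}

/-- The uniform distribution on `{1, -1}`. -/
def signMeasure : Measure ℝ :=
  (2⁻¹ : ℝ≥0∞) • Measure.dirac 1 + (2⁻¹ : ℝ≥0∞) • Measure.dirac (-1)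

/-- The times are the successive jump times of a Poisson process of intensity `rate`, and the
marks are i.i.d., independent of the times, with uniform independent sign and position. -/
structure MarkedPoints.IsPoisson (p : MarkedPoints Ω) (rate : ℝ≥0) (P : Measure Ω) : Prop where
  ordered : ∀ᵐ ω ∂P, 0 < p.time 0 ω ∧ StrictMono (fun i => p.time i ω) ∧
    Filter.Tendsto (fun i => p.time i ω) Filter.atTop Filter.atTop
  indep_increments : HasIndepIncrements p.count P
  law_increments : ∀ s t : ℝ≥0, s ≤ t →
    HasLaw (fun ω => p.count t ω - p.count s ω) (poissonMeasure (rate * (t - s))) P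
  indep_marks : iIndepFun p.mark P
  law_marks : ∀ i, HasLaw (p.mark i) (signMeasure.prod (volume : Measure Torus)) P
  indep_time_mark : IndepFun (fun ω i => p.time i ω) (fun ω i => p.mark i ω) P

/-- The `i`-th point as seen by an observer of the process on `(0, t]`: it is replaced by
`(0, 0, 0)` if it comes after time `t`. -/
def MarkedPoints.observed (p : MarkedPoints Ω) (t : ℝ) (i : ℕ) (ω : Ω) : ℝ × ℝ × Torus :=
  open scoped Classical in if p.time i ω ≤ t then (p.time i ω, p.mark i ω) else 0

/-- The σ-algebra of the observations of the process up to time `t`. -/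
@[reducible] def MarkedPoints.sigma (p : MarkedPoints Ω) (t : ℝ) : MeasurableSpace Ω :=
  ⨆ i, MeasurableSpace.comap (p.observed t i) inferInstance

theorem MarkedPoints.measurable_observed (p : MarkedPoints Ω) (t : ℝ) (i : ℕ) :
    Measurable (p.observed t i) := by
  classical
  exact Measurable.ite (measurableSet_le (p.measurable_time i) measurable_const)
    ((p.measurable_time i).prodMk (p.measurable_mark i)) measurable_const

theorem MarkedPoints.sigma_le (p : MarkedPoints Ω) (t : ℝ) :
    p.sigma t ≤ (inferInstance : MeasurableSpace Ω) :=
  iSup_le fun i => (p.measurable_observed t i).comap_le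

theorem MarkedPoints.sigma_mono (p : MarkedPoints Ω) {s t : ℝ} (h : s ≤ t) :
    p.sigma s ≤ p.sigma t := by
  classical
  refine iSup_mono fun i => ?_
  have hg : Measurable (fun q : ℝ × ℝ × Torus => if q.1 ≤ s then q else 0) :=
    Measurable.ite (measurableSet_le measurable_fst measurable_const) measurable_id
      measurable_const
  have e : p.observed s i =
      (fun q : ℝ × ℝ × Torus => if q.1 ≤ s then q else 0) ∘ p.observed t i := by
    funext ω
    simp only [MarkedPoints.observed, Function.comp]
    by_cases h1 : p.time i ω ≤ s
    · simp [h1, h1.trans h]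
    · by_cases h2 : p.time i ω ≤ t <;> simp [h1, h2]
  rw [e, ← MeasurableSpace.comap_comp]
  exact MeasurableSpace.comap_mono hg.comap_le

/-! ### The filtration of the initial datum and of the driving noise -/

/-- The `P`-null events. -/
@[reducible] def nullSigma (P : Measure Ω) : MeasurableSpace Ω :=
  MeasurableSpace.generateFrom {A | MeasurableSet A ∧ P A = 0}

/-- The filtration generated by the initial datum (the points of `init` in `(0, M]`), the points of
`noise` up to time `t`, and the null events. -/
def augmentedFiltration (init noise : MarkedPoints Ω) (M : ℝ) (P : Measure Ω) :
    Filtration ℝ≥0 (inferInstance : MeasurableSpace Ω) where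
  seq t := init.sigma M ⊔ noise.sigma t ⊔ nullSigma P
  mono' _ _ h := sup_le_sup (sup_le_sup le_rfl (noise.sigma_mono (by exact_mod_cast h))) le_rfl
  le' t := sup_le (sup_le (init.sigma_le M) (noise.sigma_le t))
    (MeasurableSpace.generateFrom_le fun _ hA => hA.1)

/-- Its right-continuous version; it satisfies the usual hypotheses. -/
def vortexFiltration (init noise : MarkedPoints Ω) (M : ℝ) (P : Measure Ω) :
    Filtration ℝ≥0 (inferInstance : MeasurableSpace Ω) :=
  (augmentedFiltration init noise M P).rightCont

/-! ### The system of point vortices with damping and creation -/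

/-- Labels of vortices: `inl i` is the `i`-th vortex of the initial datum, and `inr j` is the
vortex that is created at the `j`-th jump time of the driving noise. -/
abbrev Label : Type := ℕ ⊕ ℕ

/-- The vortices that take part in the dynamics: those of the initial datum come from the points of
`init` in `(0, M]`. -/
def Present (init : MarkedPoints Ω) (M : ℝ) : Label → Ω → Prop
  | .inl i, ω => init.time i ω ≤ M
  | .inr _, _ => True

/-- Birth times. -/
def birth (noise : MarkedPoints Ω) : Label → Ω → ℝ
  | .inl _, _ => 0
  | .inr j, ω => noise.time j ω

/-- The vortex `v` is present and is born at time `t` or before. -/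
def Active (init noise : MarkedPoints Ω) (M t : ℝ) (v : Label) (ω : Ω) : Prop :=
  Present init M v ω ∧ birth noise v ω ≤ t

/-- Positions at birth. -/
def startPos (init noise : MarkedPoints Ω) : Label → Ω → Torus
  | .inl i, ω => (init.mark i ω).2
  | .inr j, ω => (noise.mark j ω).2

/-- Intensities at birth, in the scaling `N`: the point `(s, σ, x)` of `init` gives an initial
vortex of intensity `σ e^{-θ s} / √N`, and the point `(t, σ, x)` of `noise` gives a new vortex of
intensity `σ / √N`. -/
def startIntensity (init noise : MarkedPoints Ω) (θ : ℝ) (N : ℕ) : Label → Ω → ℝ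
  | .inl i, ω => (init.mark i ω).1 * Real.exp (-(θ * init.time i ω)) / Real.sqrt N
  | .inr j, ω => (noise.mark j ω).1 / Real.sqrt N

/-- Intensities at time `t`, damped at rate `θ` from birth on. -/
def intensity (init noise : MarkedPoints Ω) (θ : ℝ) (N : ℕ) (v : Label) (t : ℝ) (ω : Ω) : ℝ :=
  startIntensity init noise θ N v ω *
    if t < birth noise v ω then 1 else Real.exp (-(θ * (t - birth noise v ω)))

/-- The velocity of vortex `v` at time `s`: the sum of `ξ_w K(x_v, x_w)` over the other vortices
`w` active at time `s` (almost surely finitely many). -/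
def velocity (init noise : MarkedPoints Ω) (θ M : ℝ) (N : ℕ) (x : Label → ℝ → Ω → Torus)
    (v : Label) (s : ℝ) (ω : Ω) : Fin 2 → ℝ :=
  ∑ᶠ (w : Label) (_ : Active init noise M s w ω ∧ w ≠ v),
    intensity init noise θ N w s ω • biotSavart (x v s ω) (x w s ω)

/-- The random trajectories `x v t`, `t ≥ 0`, almost surely solve the system of equations of the
point vortices: each vortex stays at its starting position until its birth, and is then transported
by the velocity field of the other active vortices. -/
structure IsVortexDynamics (init noise : MarkedPoints Ω) (θ M : ℝ) (N : ℕ)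
    (x : Label → ℝ → Ω → Torus) (P : Measure Ω) : Prop where
  measurable : ∀ v t, 0 ≤ t → Measurable (x v t)
  before_birth : ∀ᵐ ω ∂P, ∀ v, Present init M v ω →
    ∀ t, 0 ≤ t → t ≤ birth noise v ω → x v t ω = startPos init noise v ω
  integrable : ∀ᵐ ω ∂P, ∀ v, Present init M v ω → ∀ t, birth noise v ω ≤ t →
    IntervalIntegrable (fun s => velocity init noise θ M N x v s ω) volume (birth noise v ω) t
  after_birth : ∀ᵐ ω ∂P, ∀ v, Present init M v ω → ∀ t, birth noise v ω ≤ t →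
    x v t ω = startPos init noise v ω +
      toTorus (∫ s in (birth noise v ω)..t, velocity init noise θ M N x v s ω)

/-- The vorticity `ω_{M,N,t} = ∑ ξ_{v,t} δ_{x_{v,t}}`, the sum being over the vortices that are
active at time `t` (almost surely finitely many). -/
def vorticity (init noise : MarkedPoints Ω) (θ M : ℝ) (N : ℕ) (x : Label → ℝ → Ω → Torus)
    (t : ℝ) (ω : Ω) : SignedMeasure Torus :=
  ∑ᶠ (v : Label) (_ : Active init noise M t v ω),
    VectorMeasure.dirac (x v t ω) (intensity init noise θ N v t ω)

end PointVortex

end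

open MeasureTheory ProbabilityTheory
open scoped NNReal ENNReal

noncomputable section

namespace PointVortex

/-! ### One-dimensional heat kernel -/

/-! In Fourier variables the increment of a coefficient of the vorticity over (τ, τ+r] is the sum
over the vortices created in that interval plus the time integral of a drift (`coeffPath_sub`). The
drift is the damping -θû_k plus an interaction term. Because K is odd, that term is a double sum of
ξ_v ξ_w over v ≠ w against the symmetrised kernel `symKernel`. The factor e_k(x) - e_k(y)
compensates the singularity 1/‖x-y‖ of K, so the kernel is bounded by C|k|²
(`exists_norm_symKernel_le`).

Moments uniform in M and N come from the law at a fixed time: times, signs and positions are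
independent, and the positions are uniform (`map_timesSigns_cutPos`). With times and positions
fixed, the coefficient and the interaction are sums of order one and two in independent random
signs, so their second moments are controlled by ∑ ξ_v² and its square. This is a sum over Poisson
points of intensity Nλ, with exponentially decaying weights and a factor 1/N, so its second moment
is bounded uniformly (`lintegral_enstrophy_sq_le`).

The invariance of the uniform law is the hard point, since the trajectories are an arbitrary
measurable solution of a singular system. The kernel is replaced by the perpendicular gradient of a
trigonometric polynomial, time is discretised, and every step is split into shears, one for each
ordered pair of vortices and each frequency; every shear preserves the uniform measure exactly
(`measurePreserving_shear`). Collisions along this scheme are rare with bounds that do not depend on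
the regularisation (`exists_collision_bound`). The potential of a pair blows up logarithmically when
the pair is close; to first order the pair does not act on its own potential, since a gradient is
orthogonal to its rotation. The remaining terms involve three vortices, are integrable, and have the
same mean at every step because the scheme is measure preserving. Away from collisions the solution
follows the scheme by a discrete Gronwall argument (`scheme_close`). The solution is thus a limit in
probability of measure preserving maps (`exists_measurePreserving_approx`,
`map_prodMk_eq_of_dynamics`).

The created vortices carry centred independent signs, so different ones are orthogonal given the
past, and the number of creations in (s, t] is independent of the past up to s. This gives second
moment at most λr after a deterministic time, then after a stopping time discretised from the right,
and Fatou's lemma concludes (`lintegral_creation_sub_sq_le`).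

The drift after a random time is bounded by Cauchy-Schwarz and an integral over a deterministic
window. For r ≤ 1 the window is [0, T+r]; for r ≥ 1 a comparison with the increment over (0, r]
leaves two windows of length at most T, so no constant depends on r. Second moments of the drift
grow like (1+|k|²)², and (1+|k|²)^(-3-δ) leaves (1+|k|²)^(-1-δ), which is summable over ℤ². All this
is done for the first m points of each process on the event that no others matter, and a last use of
Fatou's lemma lets m tend to infinity. -/

open Complex in
/-- The heat kernel of the circle, as an entire function of the space variable. -/
def thetaC (t : ℝ) (z : ℂ) : ℂ := jacobiTheta₂ z (4 * Real.pi * t * I)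

/-- The `j`-th space derivative of the heat kernel of the circle. -/
def theta (j : ℕ) (t u : ℝ) : ℝ := (iteratedDeriv j (thetaC t) u).re

lemma im_thetaC_param_pos {t : ℝ} (ht : 0 < t) : 0 < (4 * Real.pi * t * Complex.I : ℂ).im := by
  have : (4 * Real.pi * t * Complex.I : ℂ) = ((4 * Real.pi * t : ℝ) : ℂ) * Complex.I := by
    push_cast; ring
  rw [this, Complex.im_ofReal_mul]
  simp; positivity

lemma differentiable_thetaC {t : ℝ} (ht : 0 < t) : Differentiable ℂ (thetaC t) :=
  fun z => differentiableAt_jacobiTheta₂_fst z (im_thetaC_param_pos ht)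

lemma thetaC_add_int (t : ℝ) (z : ℂ) (n : ℤ) : thetaC t (z + n) = thetaC t z := by
  have h : Function.Periodic (thetaC t) 1 := fun z => jacobiTheta₂_add_left z _
  simpa using h.int_mul n z

lemma hasSum_thetaC {t : ℝ} (ht : 0 < t) (z : ℂ) :
    HasSum (fun n : ℤ => Complex.exp (2 * Real.pi * Complex.I * n * z
      - 4 * Real.pi ^ 2 * n ^ 2 * t)) (thetaC t z) := by
  unfold thetaC
  convert hasSum_jacobiTheta₂_term z (im_thetaC_param_pos ht) using 2 with n
  rw [jacobiTheta₂_term]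
  congr 1
  linear_combination (4 * Real.pi ^ 2 * n ^ 2 * t : ℂ) * (-Complex.I_sq)

/-- Poisson summation, through the functional equation of the Jacobi theta function. The Fourier
series gives no decay as t tends to 0; this sum of Gaussian images does. -/
lemma hasSum_thetaC_gaussian {t : ℝ} (ht : 0 < t) (z : ℂ) :
    HasSum (fun n : ℤ => ((Real.sqrt (4 * Real.pi * t))⁻¹ : ℂ) *
      Complex.exp (-(z - n) ^ 2 / (4 * t))) (thetaC t z) := by
  have hpi : (Real.pi : ℂ) ≠ 0 := by exact_mod_cast Real.pi_ne_zero
  have htc : (t : ℂ) ≠ 0 := by exact_mod_cast ht.ne'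
  have him : 0 < (-1 / (4 * Real.pi * t * Complex.I) : ℂ).im := by
    have : (-1 / (4 * Real.pi * t * Complex.I) : ℂ)
        = (((4 * Real.pi * t)⁻¹ : ℝ) : ℂ) * Complex.I := by
      push_cast
      field_simp
      simp
    rw [this, Complex.im_ofReal_mul]
    simp; positivity
  have h := (hasSum_jacobiTheta₂_term (z / (4 * Real.pi * t * Complex.I)) him).mul_left
    (1 / (-Complex.I * (4 * Real.pi * t * Complex.I)) ^ (1 / 2 : ℂ)
      * Complex.exp (-Real.pi * Complex.I * z ^ 2 / (4 * Real.pi * t * Complex.I)))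
  rw [← jacobiTheta₂_functional_equation] at h
  refine (congrArg (fun f => HasSum f (thetaC t z)) (funext fun n => ?_)).mp h
  symm
  have h1 : (-Complex.I * (4 * Real.pi * t * Complex.I)) = ((4 * Real.pi * t : ℝ) : ℂ) := by
    push_cast
    linear_combination (-4 * Real.pi * t : ℂ) * Complex.I_sq
  have h2 : ((4 * Real.pi * t : ℝ) : ℂ) ^ (1 / 2 : ℂ) = (Real.sqrt (4 * Real.pi * t) : ℂ) := by
    rw [Real.sqrt_eq_rpow, Complex.ofReal_cpow (by positivity)]
    simp
  rw [h1, h2, jacobiTheta₂_term, one_div, mul_assoc (Real.sqrt (4 * Real.pi * t) : ℂ)⁻¹,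
    ← Complex.exp_add]
  congr 2
  field_simp
  ring

lemma summable_exp_neg_mul_int_sq {a : ℝ} (ha : 0 < a) :
    Summable fun n : ℤ => Real.exp (-(a * (n : ℝ) ^ 2)) := by
  have h := (HurwitzZeta.hasSum_int_evenKernel 0 (t := a / Real.pi) (by positivity)).summable
  convert h using 2 with n
  simp
  field_simp

/-- On the strip |Im z| ≤ √t the Gaussians lose only a factor exp(1/4). A complex strip is used,
rather than the real line, so that Cauchy's estimates on circles of radius √t give the derivatives.
-/
lemma norm_thetaC_le : ∃ C : ℝ, 0 < C ∧ ∀ t : ℝ, 0 < t → t ≤ 1 → ∀ z : ℂ, |z.im| ≤ Real.sqrt t →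
    ‖thetaC t z‖ ≤ C / Real.sqrt t * Real.exp (-(‖(z.re : UnitAddCircle)‖ ^ 2 / (8 * t))) := by
  have hsum : Summable fun n : ℤ => Real.exp (-((1 / 32) * (n : ℝ) ^ 2)) :=
    summable_exp_neg_mul_int_sq (by norm_num)
  refine ⟨Real.exp (1 / 4) * ∑' n : ℤ, Real.exp (-((1 / 32) * (n : ℝ) ^ 2)),
    mul_pos (Real.exp_pos _) (hsum.tsum_pos (fun _ => (Real.exp_pos _).le) 0 (Real.exp_pos _)),
    fun t ht ht1 z hz => ?_⟩
  -- By periodicity 0 is the integer nearest to the real part, so all other images are at least as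
  -- far away.
  wlog hr : round z.re = 0 generalizing z
  · have h := this (z + ((-round z.re : ℤ) : ℂ)) (by simpa using hz) (by
      have : (z + ((-round z.re : ℤ) : ℂ)).re = z.re + ((-round z.re : ℤ) : ℝ) := by simp
      rw [this, round_add_intCast]; simp)
    rw [thetaC_add_int] at h
    convert h using 5
    simp
  have hnorm : ‖(z.re : UnitAddCircle)‖ = |z.re| := by
    rw [UnitAddCircle.norm_eq, hr]; simp
  rw [hnorm, sq_abs]
  have hterm : ∀ n : ℤ, ‖((Real.sqrt (4 * Real.pi * t))⁻¹ : ℂ) *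
      Complex.exp (-(z - n) ^ 2 / (4 * t))‖ ≤ ((Real.sqrt t)⁻¹ * Real.exp (1 / 4)
        * Real.exp (-(z.re ^ 2 / (8 * t)))) * Real.exp (-((1 / 32) * (n : ℝ) ^ 2)) := by
    intro n
    rw [norm_mul, Complex.norm_exp, norm_inv, Complex.norm_real, Real.norm_of_nonneg (by positivity)]
    have e1 : (-(z - n) ^ 2 / (4 * t)).re = (-(z.re - n) ^ 2 + z.im ^ 2) / (4 * t) := by
      have : (-(z - n) ^ 2 / (4 * t)) = (-(z - n) ^ 2) / ((4 * t : ℝ) : ℂ) := by push_cast; ring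
      rw [this, Complex.div_ofReal_re]
      simp [pow_two]
      ring
    rw [e1, mul_assoc (Real.sqrt t)⁻¹, mul_assoc (Real.sqrt t)⁻¹]
    have h4 : Real.sqrt t ≤ Real.sqrt (4 * Real.pi * t) := by
      apply Real.sqrt_le_sqrt
      nlinarith [Real.pi_gt_three]
    have : (Real.sqrt (4 * Real.pi * t))⁻¹ ≤ (Real.sqrt t)⁻¹ :=
      inv_anti₀ (by positivity) h4
    refine mul_le_mul this ?_ (Real.exp_pos _).le (by positivity)
    rw [mul_assoc, ← Real.exp_add, ← Real.exp_add, Real.exp_le_exp]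
    have him : z.im ^ 2 ≤ t := by
      have := Real.sq_sqrt ht.le
      nlinarith [sq_abs z.im, abs_nonneg z.im, Real.sqrt_nonneg t]
    have hn : |z.re| ≤ |z.re - n| := by simpa [hr] using round_le z.re n
    have hn2 : z.re ^ 2 ≤ (z.re - n) ^ 2 := sq_le_sq.2 hn
    have hn3 : (n : ℝ) ^ 2 / 4 ≤ (z.re - n) ^ 2 := by
      have : |(n : ℝ)| ≤ 2 * |z.re - n| := by
        have := abs_sub_abs_le_abs_sub (n : ℝ) z.re
        rw [abs_sub_comm] at this
        linarith
      have := sq_le_sq' (by linarith [abs_nonneg (n : ℝ), abs_nonneg (z.re - n)]) this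
      rw [mul_pow, sq_abs, sq_abs] at this
      linarith
    -- One half of the Gaussian exponent keeps the decay in the distance to ℤ, the other half makes
    -- the sum over n converge uniformly for t ≤ 1.
    have h5 : (-(z.re - n) ^ 2 + z.im ^ 2) / (4 * t) =
        z.im ^ 2 / (4 * t) + (-((z.re - n) ^ 2 / (8 * t)) + -((z.re - n) ^ 2 / (8 * t))) := by
      field_simp; ring
    rw [h5]
    have h6 : z.im ^ 2 / (4 * t) ≤ 1 / 4 := by rw [div_le_div_iff₀ (by positivity) (by norm_num)]; linarith
    have h7 : z.re ^ 2 / (8 * t) ≤ (z.re - n) ^ 2 / (8 * t) := by gcongr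
    have h8 : 1 / 32 * (n : ℝ) ^ 2 ≤ (z.re - n) ^ 2 / (8 * t) := by
      rw [le_div_iff₀ (by positivity)]
      nlinarith [sq_nonneg (n : ℝ)]
    linarith
  have hs := hsum.mul_left ((Real.sqrt t)⁻¹ * Real.exp (1 / 4)
        * Real.exp (-(z.re ^ 2 / (8 * t))))
  have := tsum_of_norm_bounded hs.hasSum hterm
  rw [(hasSum_thetaC_gaussian ht z).tsum_eq, tsum_mul_left] at this
  refine this.trans (le_of_eq ?_)
  field_simp

/-- For large times only the mode n = 0 survives; on the unit strip the growth exp(2π|n|) of the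
other modes is absorbed by exp(-4π²n²t). -/
lemma norm_thetaC_sub_one_le : ∃ C : ℝ, 0 < C ∧ ∀ t : ℝ, 1 ≤ t → ∀ z : ℂ, |z.im| ≤ 1 →
    ‖thetaC t z - 1‖ ≤ C * Real.exp (-t) := by
  have hsum : Summable fun n : ℤ => Real.exp (-(1 * (n : ℝ) ^ 2)) :=
    summable_exp_neg_mul_int_sq (by norm_num)
  refine ⟨∑' n : ℤ, Real.exp (-(1 * (n : ℝ) ^ 2)),
    (hsum.tsum_pos (fun _ => (Real.exp_pos _).le) 0 (Real.exp_pos _)), fun t ht z hz => ?_⟩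
  have h := (hasSum_thetaC (by linarith : 0 < t) z).sub (hasSum_ite_eq (0 : ℤ) (1 : ℂ))
  have hb := hsum.mul_right (Real.exp (-t))
  rw [← h.tsum_eq, ← tsum_mul_right]
  refine tsum_of_norm_bounded hb.hasSum fun n => ?_
  by_cases hn : n = 0
  · simp [hn]; positivity
  rw [if_neg hn, sub_zero, Complex.norm_exp, ← Real.exp_add, Real.exp_le_exp]
  have e : (2 * Real.pi * Complex.I * n * z - 4 * Real.pi ^ 2 * n ^ 2 * t : ℂ)
      = ((2 * Real.pi * n : ℝ) : ℂ) * (Complex.I * z) - ((4 * Real.pi ^ 2 * n ^ 2 * t : ℝ) : ℂ) := by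
    push_cast; ring
  rw [e, Complex.sub_re, Complex.re_ofReal_mul, Complex.ofReal_re, Complex.I_mul_re]
  have hn1 : (1 : ℝ) ≤ |(n : ℝ)| := by exact_mod_cast Int.one_le_abs hn
  have h1 : 2 * Real.pi * n * -z.im ≤ 2 * Real.pi * |(n : ℝ)| := by
    have : (n : ℝ) * -z.im ≤ |(n : ℝ)| := by
      calc (n : ℝ) * -z.im ≤ |(n : ℝ) * -z.im| := le_abs_self _
        _ = |(n : ℝ)| * |z.im| := by rw [abs_mul, abs_neg]
        _ ≤ |(n : ℝ)| * 1 := by gcongr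
        _ = _ := mul_one _
    nlinarith [Real.pi_pos]
  have h2 : |(n : ℝ)| ≤ (n : ℝ) ^ 2 := by rw [← sq_abs]; nlinarith
  have hp := Real.pi_gt_three
  have h3 : 1 ≤ (n : ℝ) ^ 2 := hn1.trans h2
  have h4 : 2 * Real.pi * |(n : ℝ)| ≤ 2 * Real.pi * (n ^ 2 * t) := by
    have : |(n : ℝ)| ≤ n ^ 2 * t := by nlinarith
    gcongr
  have h5 : 1 * (n : ℝ) ^ 2 + t ≤ 2 * (n ^ 2 * t) := by nlinarith
  have h6 : 2 * (n ^ 2 * t) ≤ (4 * Real.pi ^ 2 - 2 * Real.pi) * (n ^ 2 * t) := by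
    have : (2 : ℝ) ≤ 4 * Real.pi ^ 2 - 2 * Real.pi := by nlinarith
    have h0 : (0 : ℝ) ≤ n ^ 2 * t := by positivity
    gcongr
  linarith

lemma sq_norm_coe_le_of_dist {u x s : ℝ} (h : |x - u| ≤ s) :
    ‖(u : UnitAddCircle)‖ ^ 2 ≤ 2 * ‖(x : UnitAddCircle)‖ ^ 2 + 2 * s ^ 2 := by
  have h1 : ‖(u : UnitAddCircle)‖ ≤ ‖(x : UnitAddCircle)‖ + s := by
    have : (u : UnitAddCircle) = (x : UnitAddCircle) - ((x - u : ℝ) : UnitAddCircle) := by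
      rw [AddCircle.coe_sub, sub_sub_cancel]
    rw [this]
    refine (norm_sub_le _ _).trans ?_
    have h2 : ‖((x - u : ℝ) : UnitAddCircle)‖ ≤ |x - u| := by
      rw [UnitAddCircle.norm_eq]
      simpa using round_le (x - u) 0
    linarith
  nlinarith [norm_nonneg (u : UnitAddCircle), sq_nonneg (‖(x : UnitAddCircle)‖ - s),
    norm_nonneg (x : UnitAddCircle)]

/-- Cauchy's estimate on a circle of radius √t, the length scale of the heat kernel. Moving the
point by √t costs a constant and halves the Gaussian rate, whence 16t in place of 8t. -/
lemma norm_iteratedDeriv_thetaC_le : ∃ C : ℝ, 0 < C ∧ ∀ j ≤ 2, ∀ t : ℝ, 0 < t → t ≤ 1 → ∀ u : ℝ,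
    ‖iteratedDeriv j (thetaC t) u‖ ≤ C / (Real.sqrt t * Real.sqrt t ^ j)
      * Real.exp (-(‖(u : UnitAddCircle)‖ ^ 2 / (16 * t))) := by
  obtain ⟨C, hC, h⟩ := norm_thetaC_le
  refine ⟨2 * (C * Real.exp (1 / 8)), by positivity, fun j hj t ht ht1 u => ?_⟩
  have hs : 0 < Real.sqrt t := Real.sqrt_pos.2 ht
  have key := Complex.norm_iteratedDeriv_le_of_forall_mem_sphere_norm_le (c := (u : ℂ)) j hs
    ((differentiable_thetaC ht).diffContOnCl)
    (C := C / Real.sqrt t * (Real.exp (1 / 8) * Real.exp (-(‖(u : UnitAddCircle)‖ ^ 2 / (16 * t)))))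
    fun z hz => by
      have hz' : ‖z - u‖ = Real.sqrt t := by simpa using hz
      have him : |z.im| ≤ Real.sqrt t := by
        have := Complex.abs_im_le_norm (z - u)
        simpa [hz'] using this
      have hre : |z.re - u| ≤ Real.sqrt t := by
        have := Complex.abs_re_le_norm (z - u)
        simpa [hz'] using this
      refine (h t ht ht1 z him).trans ?_
      gcongr
      rw [← Real.exp_add, Real.exp_le_exp]
      have := sq_norm_coe_le_of_dist hre
      rw [Real.sq_sqrt ht.le] at this
      have e : ‖(u : UnitAddCircle)‖ ^ 2 / (16 * t) ≤
          (2 * ‖(z.re : UnitAddCircle)‖ ^ 2 + 2 * t) / (16 * t) := by gcongr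
      have e2 : (2 * ‖(z.re : UnitAddCircle)‖ ^ 2 + 2 * t) / (16 * t) =
          ‖(z.re : UnitAddCircle)‖ ^ 2 / (8 * t) + 1 / 8 := by field_simp; ring
      linarith
  refine key.trans ?_
  have hf : (j.factorial : ℝ) ≤ 2 := by
    interval_cases j <;> norm_num [Nat.factorial]
  have e : 2 * (C * Real.exp (1 / 8)) / (Real.sqrt t * Real.sqrt t ^ j)
      * Real.exp (-(‖(u : UnitAddCircle)‖ ^ 2 / (16 * t))) = 2 * (C / Real.sqrt t *
        (Real.exp (1 / 8) * Real.exp (-(‖(u : UnitAddCircle)‖ ^ 2 / (16 * t))))) / Real.sqrt t ^ j := by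
    field_simp
  rw [e]
  gcongr

lemma norm_iteratedDeriv_thetaC_sub_one_le : ∃ C : ℝ, 0 < C ∧ ∀ j ≤ 2, ∀ t : ℝ, 1 ≤ t → ∀ u : ℝ,
    ‖iteratedDeriv j (thetaC t) u - if j = 0 then 1 else 0‖ ≤ C * Real.exp (-t) := by
  obtain ⟨C, hC, h⟩ := norm_thetaC_sub_one_le
  refine ⟨2 * C, by positivity, fun j hj t ht u => ?_⟩
  have hd : Differentiable ℂ (thetaC t) := differentiable_thetaC (by linarith)
  have key := Complex.norm_iteratedDeriv_le_of_forall_mem_sphere_norm_le (c := (u : ℂ)) j one_pos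
    (hd.sub_const 1).diffContOnCl (C := C * Real.exp (-t)) fun z hz => by
      have hz' : ‖z - u‖ = 1 := by simpa using hz
      have him : |z.im| ≤ 1 := by
        have := Complex.abs_im_le_norm (z - u)
        simpa [hz'] using this
      exact h t ht z him
  have hf : (j.factorial : ℝ) ≤ 2 := by
    interval_cases j <;> norm_num [Nat.factorial]
  have e : iteratedDeriv j (fun z => thetaC t z - 1) u =
      iteratedDeriv j (thetaC t) u - if j = 0 then 1 else 0 := by
    rcases j with _ | j
    · simp
    · rw [iteratedDeriv_succ', iteratedDeriv_succ']
      simp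
  rw [← e]
  refine key.trans ?_
  rw [one_pow, div_one, mul_assoc]
  gcongr

/-! ### Real derivatives -/

lemma hasDerivAt_theta (j : ℕ) {t : ℝ} (ht : 0 < t) (u : ℝ) :
    HasDerivAt (theta j t) (theta (j + 1) t u) u := by
  have hd : Differentiable ℂ (iteratedDeriv j (thetaC t)) :=
    (differentiable_thetaC ht).contDiff.differentiable_iteratedDeriv j (by exact_mod_cast WithTop.coe_lt_top _)
  have := (hd (u : ℂ)).hasDerivAt
  rw [← iteratedDeriv_succ] at this
  exact this.real_of_complex

lemma abs_theta_le : ∃ C : ℝ, 0 < C ∧ ∀ j ≤ 2, ∀ t : ℝ, 0 < t → t ≤ 1 → ∀ u : ℝ,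
    |theta j t u| ≤ C / (Real.sqrt t * Real.sqrt t ^ j)
      * Real.exp (-(‖(u : UnitAddCircle)‖ ^ 2 / (16 * t))) := by
  obtain ⟨C, hC, h⟩ := norm_iteratedDeriv_thetaC_le
  exact ⟨C, hC, fun j hj t ht ht1 u => (Complex.abs_re_le_norm _).trans (h j hj t ht ht1 u)⟩

lemma abs_theta_sub_one_le : ∃ C : ℝ, 0 < C ∧ ∀ j ≤ 2, ∀ t : ℝ, 1 ≤ t → ∀ u : ℝ,
    |theta j t u - if j = 0 then 1 else 0| ≤ C * Real.exp (-t) := by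
  obtain ⟨C, hC, h⟩ := norm_iteratedDeriv_thetaC_sub_one_le
  refine ⟨C, hC, fun j hj t ht u => le_trans (le_of_eq ?_)
    ((Complex.abs_re_le_norm _).trans (h j hj t ht u))⟩
  rw [theta]
  split_ifs <;> simp

lemma hasSum_theta_zero {t : ℝ} (ht : 0 < t) (u : ℝ) :
    HasSum (fun n : ℤ => (Real.sqrt (4 * Real.pi * t))⁻¹ * Real.exp (-(u - n) ^ 2 / (4 * t)))
      (theta 0 t u) := by
  have h := Complex.hasSum_re (hasSum_thetaC_gaussian ht u)
  rw [theta, iteratedDeriv_zero]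
  convert h using 2 with n
  have : ((Real.sqrt (4 * Real.pi * t))⁻¹ : ℂ) * Complex.exp (-(u - n) ^ 2 / (4 * t)) =
     (((Real.sqrt (4 * Real.pi * t))⁻¹ * Real.exp (-(u - n) ^ 2 / (4 * t)) : ℝ) : ℂ) := by
    push_cast; rfl
  rw [this, Complex.ofReal_re]

/-- One term of a sum of positive Gaussians. -/
lemma theta_zero_ge {t : ℝ} (ht : 0 < t) (u : ℝ) :
    (Real.sqrt (4 * Real.pi * t))⁻¹ * Real.exp (-u ^ 2 / (4 * t)) ≤ theta 0 t u := by
  have h := hasSum_theta_zero ht u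
  simpa using le_hasSum h 0 fun n _ => by positivity

lemma theta_zero_nonneg {t : ℝ} (ht : 0 < t) (u : ℝ) : 0 ≤ theta 0 t u :=
  le_trans (by positivity) (theta_zero_ge ht u)

lemma theta_one_eq {t : ℝ} (ht : 0 < t) (u : ℝ) :
    theta 1 t u = (jacobiTheta₂' u (4 * Real.pi * t * Complex.I)).re := by
  rw [theta, iteratedDeriv_one]
  congr 1
  exact (hasDerivAt_jacobiTheta₂_fst (u : ℂ) (im_thetaC_param_pos ht)).deriv

lemma continuousOn_theta_zero_time (u : ℝ) : ContinuousOn (fun t => theta 0 t u) (Set.Ioi 0) := by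
  intro t ht
  apply ContinuousAt.continuousWithinAt
  have h := continuousAt_jacobiTheta₂ (u : ℂ) (im_thetaC_param_pos ht)
  have h2 : ContinuousAt (fun t : ℝ => ((u : ℂ), (4 * Real.pi * t * Complex.I : ℂ))) t := by
    fun_prop
  have h3 := Complex.continuous_re.continuousAt.comp (ContinuousAt.comp (x := t) h h2)
  refine h3.congr (Filter.Eventually.of_forall fun s => ?_)
  simp [theta, thetaC]

lemma continuousOn_theta_one_time (u : ℝ) : ContinuousOn (fun t => theta 1 t u) (Set.Ioi 0) := by
  intro t ht
  apply ContinuousAt.continuousWithinAt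
  have h := continuousAt_jacobiTheta₂' (u : ℂ) (im_thetaC_param_pos ht)
  have h2 : ContinuousAt (fun t : ℝ => ((u : ℂ), (4 * Real.pi * t * Complex.I : ℂ))) t := by
    fun_prop
  have h3 := Complex.continuous_re.continuousAt.comp (ContinuousAt.comp (x := t) h h2)
  refine h3.congr ?_
  filter_upwards [Ioi_mem_nhds ht] with s hs
  rw [theta_one_eq hs]
  rfl

lemma hasSum_theta_one {t : ℝ} (ht : 0 < t) (u : ℝ) :
    HasSum (fun n : ℤ => 2 * Real.pi * Complex.I * n * Complex.exp (2 * Real.pi * Complex.I * n * u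
      - 4 * Real.pi ^ 2 * n ^ 2 * t)) (deriv (thetaC t) u) := by
  have e : deriv (thetaC t) u = _ :=
    (hasDerivAt_jacobiTheta₂_fst (u : ℂ) (im_thetaC_param_pos ht)).deriv
  rw [e]
  refine (congrArg (fun f => HasSum f _) (funext fun n => ?_)).mp
    (hasSum_jacobiTheta₂'_term (u : ℂ) (im_thetaC_param_pos ht))
  rw [jacobiTheta₂'_term, jacobiTheta₂_term]
  congr 2
  linear_combination (4 * Real.pi ^ 2 * n ^ 2 * t : ℂ) * (Complex.I_sq)

lemma thetaC_ofReal_im (t u : ℝ) : (thetaC t u).im = 0 := by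
  rw [← Complex.conj_eq_iff_im, thetaC, jacobiTheta₂_conj]
  simp [Complex.conj_ofReal, map_ofNat]

lemma thetaC_ofReal (t u : ℝ) : thetaC t u = (theta 0 t u : ℂ) := by
  apply Complex.ext <;> simp [theta, thetaC_ofReal_im]

/-! ### Two-dimensional heat kernel -/

/-- Mixed derivatives of the heat kernel of the torus, on the universal cover. -/
def heatD (a b : ℕ) (t : ℝ) (v : Fin 2 → ℝ) : ℝ := theta a t (v 0) * theta b t (v 1)

lemma norm_coe_le_abs (x : ℝ) : ‖(x : UnitAddCircle)‖ ≤ |x| := by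
  rw [UnitAddCircle.norm_eq]
  simpa using round_le x 0

lemma toTorus_add (v w : Fin 2 → ℝ) : toTorus (v + w) = toTorus v + toTorus w := by
  ext i; simp [toTorus]

lemma toTorus_neg (v : Fin 2 → ℝ) : toTorus (-v) = -toTorus v := by
  ext i; simp [toTorus]

@[simp] lemma toTorus_zero : toTorus 0 = 0 := by
  ext i; simp [toTorus]

lemma norm_toTorus_le (v : Fin 2 → ℝ) : ‖toTorus v‖ ≤ ‖v‖ := by
  refine (pi_norm_le_iff_of_nonneg (norm_nonneg _)).2 fun i => ?_
  exact (norm_coe_le_abs (v i)).trans (norm_le_pi_norm v i)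

lemma continuous_toTorus : Continuous toTorus :=
  continuous_pi fun i => (AddCircle.continuous_mk' (1 : ℝ)).comp (continuous_apply i)

/-- The lift with coordinates nearest to 0: on it the norms of ℝ² and of the torus agree. -/
lemma exists_toTorus_eq (z : Torus) : ∃ v, toTorus v = z ∧ ∀ i, |v i| = ‖z i‖ := by
  have h : ∀ i, ∃ u : ℝ, (u : UnitAddCircle) = z i ∧ |u| = ‖z i‖ := fun i => by
    obtain ⟨x, hx⟩ := QuotientAddGroup.mk_surjective (z i)
    refine ⟨x - round x, ?_, ?_⟩
    · rw [← hx]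
      have : ((round x : ℝ) : UnitAddCircle) = 0 := by
        have := AddCircle.coe_add_period (1 : ℝ) 0
        rw [AddCircle.coe_eq_zero_iff]
        exact ⟨round x, by simp⟩
      rw [AddCircle.coe_sub, this, sub_zero]
    · rw [← hx]
      exact (UnitAddCircle.norm_eq (x := x)).symm
  choose v h1 h2 using h
  exact ⟨v, funext h1, h2⟩

lemma norm_torus_le_half (z : Torus) : ‖z‖ ≤ 1 / 2 := by
  refine (pi_norm_le_iff_of_nonneg (by norm_num)).2 fun i => ?_
  simpa using AddCircle.norm_le_half_period (1 : ℝ) (x := z i) one_ne_zero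

lemma norm_toTorus_sq_le (v : Fin 2 → ℝ) :
    ‖toTorus v‖ ^ 2 ≤ ‖(v 0 : UnitAddCircle)‖ ^ 2 + ‖(v 1 : UnitAddCircle)‖ ^ 2 := by
  have h : ‖toTorus v‖ ≤ max ‖(v 0 : UnitAddCircle)‖ ‖(v 1 : UnitAddCircle)‖ := by
    refine (pi_norm_le_iff_of_nonneg (by positivity)).2 fun i => ?_
    fin_cases i
    · exact le_max_left _ _
    · exact le_max_right _ _
  have h2 := pow_le_pow_left₀ (norm_nonneg _) h 2
  rcases max_choice ‖(v 0 : UnitAddCircle)‖ ‖(v 1 : UnitAddCircle)‖ with e | e <;> rw [e] at h2 <;>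
    nlinarith [sq_nonneg ‖(v 0 : UnitAddCircle)‖, sq_nonneg ‖(v 1 : UnitAddCircle)‖]

/-- The constant is 1 + 512: y^m ≤ 1 + y⁴, and y⁴ ≤ 512 exp(y²/16) by the quadratic term of the
exponential. -/
lemma pow_mul_exp_neg_sq_le {y : ℝ} (hy : 0 ≤ y) {m : ℕ} (hm : m ≤ 4) :
    y ^ m * Real.exp (-(y ^ 2 / 16)) ≤ 513 := by
  have h1 : y ^ m ≤ 1 + y ^ 4 := by
    rcases le_total y 1 with h | h
    · have := pow_le_one₀ hy h (n := m)
      have := pow_nonneg hy 4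
      linarith
    · have := pow_le_pow_right₀ h hm
      linarith
  have h2 : (y ^ 2 / 16) ^ 2 / 2 ≤ Real.exp (y ^ 2 / 16) := by
    have := Real.quadratic_le_exp_of_nonneg (x := y ^ 2 / 16) (by positivity)
    have h0 : 0 ≤ y ^ 2 / 16 := by positivity
    linarith
  have h3 : 1 ≤ Real.exp (y ^ 2 / 16) := Real.one_le_exp (by positivity)
  rw [Real.exp_neg, ← div_eq_mul_inv, div_le_iff₀ (Real.exp_pos _)]
  nlinarith

/-- Parabolic scaling: each space derivative costs 1/√t, and powers of ‖x‖/√t are absorbed by the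
Gaussian, so √t may be traded for ‖x‖. -/
lemma abs_heatD_small : ∃ C : ℝ, 0 < C ∧ ∀ a b : ℕ, a + b ≤ 2 → ∀ t : ℝ, 0 < t → t ≤ 1 → ∀ v,
    |heatD a b t v| * Real.sqrt t ^ (2 + a + b) ≤ C ∧
    |heatD a b t v| * ‖toTorus v‖ ^ (2 + a + b) ≤ C := by
  obtain ⟨C, hC, h⟩ := abs_theta_le
  refine ⟨C ^ 2 * 513, by positivity, fun a b hab t ht ht1 v => ?_⟩
  have hs : 0 < Real.sqrt t := Real.sqrt_pos.2 ht
  have h1 := h a (by omega) t ht ht1 (v 0)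
  have h2 := h b (by omega) t ht ht1 (v 1)
  have key : |heatD a b t v| ≤ C ^ 2 / Real.sqrt t ^ (2 + a + b) *
      Real.exp (-(‖toTorus v‖ ^ 2 / (16 * t))) := by
    rw [heatD, abs_mul]
    refine (mul_le_mul h1 h2 (abs_nonneg _) (by positivity)).trans ?_
    rw [show ∀ A B D E : ℝ, A * B * (D * E) = (A * D) * (B * E) by intros; ring, ← Real.exp_add]
    have e : C / (Real.sqrt t * Real.sqrt t ^ a) * (C / (Real.sqrt t * Real.sqrt t ^ b)) =
        C ^ 2 / Real.sqrt t ^ (2 + a + b) := by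
      field_simp; ring
    rw [e]
    gcongr
    have : ‖toTorus v‖ ^ 2 / (16 * t) ≤
        (‖(v 0 : UnitAddCircle)‖ ^ 2 + ‖(v 1 : UnitAddCircle)‖ ^ 2) / (16 * t) := by
      gcongr; exact norm_toTorus_sq_le v
    rw [add_div] at this
    linarith
  constructor
  · calc |heatD a b t v| * Real.sqrt t ^ (2 + a + b) ≤ C ^ 2 / Real.sqrt t ^ (2 + a + b) *
      Real.exp (-(‖toTorus v‖ ^ 2 / (16 * t))) * Real.sqrt t ^ (2 + a + b) := by gcongr
      _ = C ^ 2 * Real.exp (-(‖toTorus v‖ ^ 2 / (16 * t))) := by field_simp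
      _ ≤ C ^ 2 * 513 := by
        gcongr
        have : Real.exp (-(‖toTorus v‖ ^ 2 / (16 * t))) ≤ 1 := Real.exp_le_one_iff.2 (by
          have : 0 ≤ ‖toTorus v‖ ^ 2 / (16 * t) := by positivity
          linarith)
        linarith
  · calc |heatD a b t v| * ‖toTorus v‖ ^ (2 + a + b) ≤ C ^ 2 / Real.sqrt t ^ (2 + a + b) *
      Real.exp (-(‖toTorus v‖ ^ 2 / (16 * t))) * ‖toTorus v‖ ^ (2 + a + b) := by gcongr
      _ = C ^ 2 * ((‖toTorus v‖ / Real.sqrt t) ^ (2 + a + b) *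
          Real.exp (-((‖toTorus v‖ / Real.sqrt t) ^ 2 / 16))) := by
        have e2 : (‖toTorus v‖ / Real.sqrt t) ^ 2 / 16 = ‖toTorus v‖ ^ 2 / (16 * t) := by
          rw [div_pow, Real.sq_sqrt ht.le, div_div, mul_comm t]
        rw [e2]
        rw [div_pow]; ring
      _ ≤ C ^ 2 * 513 := by
        gcongr
        exact pow_mul_exp_neg_sq_le (by positivity) (by omega)

lemma abs_heatD_large : ∃ C : ℝ, 0 < C ∧ ∀ a b : ℕ, a + b ≤ 2 → ∀ t : ℝ, 1 ≤ t → ∀ v,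
    |heatD a b t v - if a + b = 0 then 1 else 0| ≤ C * Real.exp (-t) := by
  obtain ⟨C, hC, h⟩ := abs_theta_sub_one_le
  refine ⟨C * (C + 1) + C, by positivity, fun a b hab t ht v => ?_⟩
  have h1 := h a (by omega) t ht (v 0)
  have h2 := h b (by omega) t ht (v 1)
  have he : Real.exp (-t) ≤ 1 := Real.exp_le_one_iff.2 (by linarith)
  have he0 := Real.exp_pos (-t)
  set x := theta a t (v 0)
  set y := theta b t (v 1)
  set p : ℝ := if a = 0 then 1 else 0 with hp
  set q : ℝ := if b = 0 then 1 else 0 with hq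
  have hpq : (if a + b = 0 then 1 else 0 : ℝ) = p * q := by
    rw [hp, hq]
    by_cases ha : a = 0 <;> by_cases hb : b = 0 <;> simp [ha, hb]
  have hp1 : |p| ≤ 1 := by rw [hp]; split_ifs <;> simp
  have hq1 : |q| ≤ 1 := by rw [hq]; split_ifs <;> simp
  have hy : |y| ≤ C + 1 := by
    have : |y| ≤ |y - q| + |q| := by simpa using abs_add_le (y - q) q
    nlinarith
  rw [hpq, heatD, show x * y - p * q = (x - p) * y + p * (y - q) by ring]
  refine (abs_add_le _ _).trans ?_
  rw [abs_mul, abs_mul]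
  have e1 : |x - p| * |y| ≤ (C * Real.exp (-t)) * (C + 1) := by gcongr
  have e2 : |p| * |y - q| ≤ 1 * (C * Real.exp (-t)) := by gcongr
  linarith

lemma hasDerivAt_heatD (a b : ℕ) {t : ℝ} (ht : 0 < t) (v d : Fin 2 → ℝ) (s : ℝ) :
    HasDerivAt (fun s : ℝ => heatD a b t (v + s • d))
      (d 0 * heatD (a + 1) b t (v + s • d) + d 1 * heatD a (b + 1) t (v + s • d)) s := by
  have h0 : HasDerivAt (fun s : ℝ => v 0 + s * d 0) (d 0) s := by
    simpa using ((hasDerivAt_id s).mul_const (d 0)).const_add (v 0)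
  have h1 : HasDerivAt (fun s : ℝ => v 1 + s * d 1) (d 1) s := by
    simpa using ((hasDerivAt_id s).mul_const (d 1)).const_add (v 1)
  have := ((hasDerivAt_theta a ht (v 0 + s * d 0)).comp s h0).mul
    ((hasDerivAt_theta b ht (v 1 + s * d 1)).comp s h1)
  simp only [heatD, Pi.add_apply, Pi.smul_apply, smul_eq_mul]
  refine this.congr_deriv ?_
  simp only [Function.comp]
  ring

lemma continuousOn_heatD_time {a b : ℕ} (ha : a ≤ 1) (hb : b ≤ 1) (v : Fin 2 → ℝ) :
    ContinuousOn (fun t => heatD a b t v) (Set.Ioi 0) := by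
  have h : ∀ a ≤ 1, ∀ u, ContinuousOn (fun t => theta a t u) (Set.Ioi 0) := fun a ha u => by
    interval_cases a
    · exact continuousOn_theta_zero_time u
    · exact continuousOn_theta_one_time u
  exact (h a ha _).mul (h b hb _)

/-! ### Fourier series of the heat kernel -/

lemma hasSum_fin_two {f g : ℤ → ℂ} {A B : ℂ} (hf : HasSum f A) (hg : HasSum g B) :
    HasSum (fun k : Fin 2 → ℤ => f (k 0) * g (k 1)) (A * B) := by
  have h : HasSum (fun x : ℤ × ℤ => f x.1 * g x.2) (A * B) :=
    hf.mul hg (summable_mul_of_summable_norm hf.summable.norm hg.summable.norm)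
  rw [← (finTwoArrowEquiv ℤ).hasSum_iff] at h
  exact h

/-- The Fourier weight `exp(-4π²|k|²t)`. -/
def heatWeight (t : ℝ) (k : Fin 2 → ℤ) : ℝ := Real.exp (-(4 * Real.pi ^ 2 * freqSq k * t))

lemma mFourier_toTorus (k : Fin 2 → ℤ) (v : Fin 2 → ℝ) :
    UnitAddTorus.mFourier k (toTorus v) =
      Complex.exp (2 * Real.pi * Complex.I * (k 0 * v 0 + k 1 * v 1)) := by
  have : UnitAddTorus.mFourier k (toTorus v) = ∏ i, fourier (k i) (toTorus v i) := rfl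
  rw [this, Fin.prod_univ_two]
  simp only [toTorus]
  rw [fourier_coe_apply, fourier_coe_apply, ← Complex.exp_add]
  congr 1
  push_cast
  ring

lemma heatWeight_mul_mFourier (t : ℝ) (k : Fin 2 → ℤ) (v : Fin 2 → ℝ) :
    (heatWeight t k : ℂ) * UnitAddTorus.mFourier k (toTorus v) =
      Complex.exp (2 * Real.pi * Complex.I * k 0 * v 0 - 4 * Real.pi ^ 2 * k 0 ^ 2 * t) *
      Complex.exp (2 * Real.pi * Complex.I * k 1 * v 1 - 4 * Real.pi ^ 2 * k 1 ^ 2 * t) := by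
  rw [mFourier_toTorus, heatWeight, Complex.ofReal_exp, ← Complex.exp_add, ← Complex.exp_add,
    freqSq, Fin.sum_univ_two]
  congr 1
  push_cast
  ring

lemma hasSum_heatD_zero {t : ℝ} (ht : 0 < t) (v : Fin 2 → ℝ) :
    HasSum (fun k : Fin 2 → ℤ => heatWeight t k * (UnitAddTorus.mFourier k (toTorus v)).re)
      (heatD 0 0 t v) := by
  have h := Complex.hasSum_re (hasSum_fin_two (hasSum_thetaC ht (v 0)) (hasSum_thetaC ht (v 1)))
  rw [thetaC_ofReal, thetaC_ofReal, ← Complex.ofReal_mul, Complex.ofReal_re] at h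
  refine (congrArg (fun f => HasSum f _) (funext fun k => ?_)).mp h
  rw [← heatWeight_mul_mFourier, Complex.re_ofReal_mul]

lemma heatKernel_toTorus {t : ℝ} (ht : 0 < t) (v : Fin 2 → ℝ) :
    heatKernel t (toTorus v) = heatD 0 0 t v :=
  (hasSum_heatD_zero ht v).tsum_eq

/-- The first derivatives of the heat kernel. -/
def heatGrad (i : Fin 2) (t : ℝ) (v : Fin 2 → ℝ) : ℝ :=
  heatD (if i = 0 then 1 else 0) (if i = 0 then 0 else 1) t v

lemma hasSum_heatGrad (i : Fin 2) {t : ℝ} (ht : 0 < t) (v : Fin 2 → ℝ) :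
    HasSum (fun k : Fin 2 → ℤ =>
      -(2 * Real.pi * k i) * heatWeight t k * (UnitAddTorus.mFourier k (toTorus v)).im)
      (heatGrad i t v) := by
  have e : ∀ (k : Fin 2 → ℤ) (w : ℂ), w = (heatWeight t k : ℂ) * UnitAddTorus.mFourier k (toTorus v) →
      (2 * Real.pi * Complex.I * k i * w).re =
      -(2 * Real.pi * k i) * heatWeight t k * (UnitAddTorus.mFourier k (toTorus v)).im := by
    rintro k w rfl
    have : 2 * Real.pi * Complex.I * k i * ((heatWeight t k : ℂ) * UnitAddTorus.mFourier k (toTorus v))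
      = ((2 * Real.pi * k i * heatWeight t k : ℝ) : ℂ) *
        (Complex.I * UnitAddTorus.mFourier k (toTorus v)) := by
      push_cast; ring
    rw [this, Complex.re_ofReal_mul, Complex.I_mul_re]
    ring
  have hre : ∀ u : ℝ, (deriv (thetaC t) u).re = theta 1 t u := fun u => by
    rw [theta, iteratedDeriv_one]
  fin_cases i
  · have h := Complex.hasSum_re (hasSum_fin_two (hasSum_theta_one ht (v 0)) (hasSum_thetaC ht (v 1)))
    rw [thetaC_ofReal, Complex.re_mul_ofReal, hre] at h
    refine (congrArg (fun f => HasSum f _) (funext fun k => ?_)).mp h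
    rw [← e k _ rfl, heatWeight_mul_mFourier]
    congr 1
    simp only [Fin.zero_eta]
    ring
  · have h := Complex.hasSum_re (hasSum_fin_two (hasSum_thetaC ht (v 0)) (hasSum_theta_one ht (v 1)))
    rw [thetaC_ofReal, Complex.re_ofReal_mul, hre] at h
    refine (congrArg (fun f => HasSum f _) (funext fun k => ?_)).mp h
    rw [← e k _ rfl, heatWeight_mul_mFourier]
    congr 1
    simp only [Fin.mk_one]
    ring

/-! ### The Green function and the Biot-Savart kernel on the universal cover -/

/-- The heat kernel minus its mean, and its gradient, are bounded by `C t^{-3/2}` and by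
`C ‖x‖^{-3}`. -/
lemma abs_heat_le : ∃ C : ℝ, 0 < C ∧ ∀ t : ℝ, 0 < t → ∀ v,
    (|heatD 0 0 t v - 1| ≤ C * t ^ (-(3 / 2) : ℝ) ∧
      |heatD 0 0 t v - 1| * ‖toTorus v‖ ^ 3 ≤ C ∧
    ∀ i, |heatGrad i t v| ≤ C * t ^ (-(3 / 2) : ℝ) ∧ |heatGrad i t v| * ‖toTorus v‖ ^ 3 ≤ C) := by
  obtain ⟨A, hA, h1⟩ := abs_heatD_small
  obtain ⟨B, hB, h2⟩ := abs_heatD_large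
  refine ⟨A + 2 * B + 1, by positivity, fun t ht v => ?_⟩
  have hb : ‖toTorus v‖ ≤ 1 / 2 := norm_torus_le_half _
  have hb0 := norm_nonneg (toTorus v)
  have hrp : t ^ (-(3 / 2) : ℝ) = (Real.sqrt t ^ 3)⁻¹ := by
    rw [Real.rpow_neg ht.le, Real.sqrt_eq_rpow, ← Real.rpow_natCast, ← Real.rpow_mul ht.le]
    norm_num
  have hs : 0 < Real.sqrt t := Real.sqrt_pos.2 ht
  have hb3 : ‖toTorus v‖ ^ 3 ≤ 1 := pow_le_one₀ hb0 (by linarith)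
  rw [hrp]
  rcases le_total t 1 with ht1 | ht1
  · have hs1 : Real.sqrt t ≤ 1 := by
      rw [← Real.sqrt_one]; exact Real.sqrt_le_sqrt ht1
    have g : ∀ i, |heatGrad i t v| ≤ (A + 2 * B + 1) * (Real.sqrt t ^ 3)⁻¹ ∧
        |heatGrad i t v| * ‖toTorus v‖ ^ 3 ≤ A + 2 * B + 1 := fun i => by
      have := h1 (if i = 0 then 1 else 0) (if i = 0 then 0 else 1) (by split_ifs <;> norm_num) t ht
        ht1 v
      have e : 2 + (if i = 0 then 1 else 0) + (if i = 0 then 0 else 1) = 3 := by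
        split_ifs <;> norm_num
      rw [e] at this
      refine ⟨?_, this.2.trans (by linarith)⟩
      rw [← div_eq_mul_inv, le_div_iff₀ (by positivity)]
      exact this.1.trans (by linarith)
    have h0 := h1 0 0 (by norm_num) t ht ht1 v
    refine ⟨?_, ?_, g⟩
    · rw [← div_eq_mul_inv, le_div_iff₀ (by positivity)]
      have h3 : Real.sqrt t ^ 3 ≤ 1 := pow_le_one₀ hs.le hs1
      calc |heatD 0 0 t v - 1| * Real.sqrt t ^ 3 ≤ (|heatD 0 0 t v| + 1) * Real.sqrt t ^ 3 := by
            gcongr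
            simpa using abs_sub (heatD 0 0 t v) 1
        _ = |heatD 0 0 t v| * Real.sqrt t ^ 2 * Real.sqrt t + Real.sqrt t ^ 3 := by ring
        _ ≤ A * 1 + 1 := by gcongr; exact h0.1
        _ ≤ _ := by linarith
    · calc |heatD 0 0 t v - 1| * ‖toTorus v‖ ^ 3 ≤ (|heatD 0 0 t v| + 1) * ‖toTorus v‖ ^ 3 := by
            gcongr
            simpa using abs_sub (heatD 0 0 t v) 1
        _ = |heatD 0 0 t v| * ‖toTorus v‖ ^ 2 * ‖toTorus v‖ + ‖toTorus v‖ ^ 3 := by ring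
        _ ≤ A * 1 + 1 := by gcongr; exact h0.2; linarith
        _ ≤ _ := by linarith
  · have hexp : Real.exp (-t) * Real.sqrt t ^ 3 ≤ 2 := by
      have : Real.sqrt t ^ 3 ≤ t ^ 2 := by
        have h1 : 1 ≤ Real.sqrt t := Real.one_le_sqrt.2 ht1
        have h2 : t ^ 2 = Real.sqrt t ^ 4 := by
          rw [show Real.sqrt t ^ 4 = (Real.sqrt t ^ 2) ^ 2 by ring, Real.sq_sqrt ht.le]
        rw [h2]
        exact pow_le_pow_right₀ h1 (by norm_num)
      have h3 := Real.quadratic_le_exp_of_nonneg ht.le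
      rw [Real.exp_neg, inv_mul_le_iff₀ (Real.exp_pos _)]
      nlinarith
    have he1 : Real.exp (-t) ≤ 1 := Real.exp_le_one_iff.2 (by linarith)
    have main : ∀ y : ℝ, |y| ≤ B * Real.exp (-t) → |y| ≤ (A + 2 * B + 1) * (Real.sqrt t ^ 3)⁻¹ ∧
        |y| * ‖toTorus v‖ ^ 3 ≤ A + 2 * B + 1 := fun y hy => by
      constructor
      · rw [← div_eq_mul_inv, le_div_iff₀ (by positivity)]
        calc |y| * Real.sqrt t ^ 3 ≤ B * Real.exp (-t) * Real.sqrt t ^ 3 := by gcongr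
          _ = B * (Real.exp (-t) * Real.sqrt t ^ 3) := by ring
          _ ≤ B * 2 := by gcongr
          _ ≤ _ := by linarith
      · calc |y| * ‖toTorus v‖ ^ 3 ≤ (B * 1) * 1 := by
              gcongr
              exact hy.trans (by gcongr)
          _ ≤ _ := by linarith
    refine ⟨(main _ (by simpa using h2 0 0 (by norm_num) t ht1 v)).1,
      (main _ (by simpa using h2 0 0 (by norm_num) t ht1 v)).2, fun i => main _ ?_⟩
    have := h2 (if i = 0 then 1 else 0) (if i = 0 then 0 else 1) (by split_ifs <;> norm_num) t
        ht1 v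
    have e : (if i = 0 then 1 else 0) + (if i = 0 then 0 else 1) ≠ 0 := by
      split_ifs <;> norm_num
    rw [if_neg e, sub_zero] at this
    exact this

lemma integrableOn_Ioi_of_abs_le {f : ℝ → ℝ} (hf : ContinuousOn f (Set.Ioi 0)) {C b : ℝ}
    (h1 : ∀ t, 0 < t → |f t| ≤ C * t ^ (-(3 / 2) : ℝ)) (hb : ∀ t, 0 < t → |f t| ≤ b) :
    IntegrableOn f (Set.Ioi 0) := by
  have hm : ∀ s ⊆ Set.Ioi (0 : ℝ), MeasurableSet s → AEStronglyMeasurable f (volume.restrict s) :=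
    fun s hs hs' => (hf.mono hs).aestronglyMeasurable hs'
  rw [← Set.Ioc_union_Ioi_eq_Ioi zero_le_one]
  refine IntegrableOn.union ?_ ?_
  · refine Integrable.mono' (integrableOn_const (C := b) (by simp))
      (hm _ Set.Ioc_subset_Ioi_self measurableSet_Ioc) ?_
    · filter_upwards [self_mem_ae_restrict measurableSet_Ioc] with t ht using hb t ht.1
  · refine Integrable.mono' ((integrableOn_Ioi_rpow_of_lt (by norm_num : (-(3 / 2) : ℝ) < -1)
      one_pos).const_mul C) (hm _ (Set.Ioi_subset_Ioi zero_le_one) measurableSet_Ioi) ?_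
    filter_upwards [self_mem_ae_restrict measurableSet_Ioi] with t ht
      using h1 t (zero_lt_one.trans ht)

/-- The time integral is split at the parabolic scale t = b²: below it C/b³ over a length b², above
it the tail of t^(-3/2), which is 2/b. -/
lemma abs_integral_Ioi_le {f : ℝ → ℝ} (hf : ContinuousOn f (Set.Ioi 0)) {C b : ℝ} (hb0 : 0 < b)
    (h1 : ∀ t, 0 < t → |f t| ≤ C * t ^ (-(3 / 2) : ℝ)) (hb : ∀ t, 0 < t → |f t| * b ^ 3 ≤ C)
    {ε : ℝ} (hε : 0 ≤ ε) :
    |∫ t in Set.Ioi ε, f t| ≤ 3 * C / b := by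
  have hC : 0 ≤ C := (by positivity : 0 ≤ |f 1| * b ^ 3).trans (hb 1 one_pos)
  have hb' : ∀ t, 0 < t → |f t| ≤ C / b ^ 3 := fun t ht => by
    rw [le_div_iff₀ (by positivity)]; exact hb t ht
  have hi := integrableOn_Ioi_of_abs_le hf h1 hb'
  have hia : IntegrableOn (fun t => |f t|) (Set.Ioi 0) := hi.abs
  have h2 : |∫ t in Set.Ioi ε, f t| ≤ ∫ t in Set.Ioi (0 : ℝ), |f t| := by
    refine (abs_integral_le_integral_abs).trans ?_
    exact setIntegral_mono_set hia (ae_of_all _ fun _ => abs_nonneg _)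
      (Set.Ioi_subset_Ioi hε).eventuallyLE
  refine h2.trans ?_
  have hb2 : 0 < b ^ 2 := by positivity
  rw [← Set.Ioc_union_Ioi_eq_Ioi hb2.le, setIntegral_union (Set.Ioc_disjoint_Ioi le_rfl)
    measurableSet_Ioi (hia.mono_set Set.Ioc_subset_Ioi_self)
    (hia.mono_set (Set.Ioi_subset_Ioi hb2.le))]
  have e1 : ∫ t in Set.Ioc 0 (b ^ 2), |f t| ≤ C / b := by
    have := setIntegral_mono_on (g := fun _ => C / b ^ 3) (hia.mono_set Set.Ioc_subset_Ioi_self)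
      (by simp) measurableSet_Ioc fun t (ht : t ∈ Set.Ioc 0 (b ^ 2)) => hb' t ht.1
    refine this.trans (le_of_eq ?_)
    simp [hb2.le]
    field_simp
  have e2 : ∫ t in Set.Ioi (b ^ 2), |f t| ≤ 2 * C / b := by
    have := setIntegral_mono_on (hia.mono_set (Set.Ioi_subset_Ioi hb2.le))
      ((integrableOn_Ioi_rpow_of_lt (by norm_num : (-(3 / 2) : ℝ) < -1) hb2).const_mul C)
      measurableSet_Ioi fun t (ht : t ∈ Set.Ioi (b ^ 2)) => h1 t (hb2.trans ht)
    refine this.trans (le_of_eq ?_)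
    rw [integral_const_mul, integral_Ioi_rpow_of_lt (by norm_num) hb2, ← Real.rpow_natCast,
      ← Real.rpow_mul hb0.le]
    norm_num
    rw [Real.rpow_neg_one]
    field_simp
  calc _ ≤ C / b + 2 * C / b := add_le_add e1 e2
    _ = _ := by ring

/-- The Green function regularised at time `ε`, on the universal cover. -/
def greenReg (ε : ℝ) (v : Fin 2 → ℝ) : ℝ := -∫ t in Set.Ioi ε, (heatD 0 0 t v - 1)

/-- The gradient of the regularised Green function. -/
def gradReg (ε : ℝ) (i : Fin 2) (v : Fin 2 → ℝ) : ℝ := -∫ t in Set.Ioi ε, heatGrad i t v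

lemma continuousOn_heatGrad_time (i : Fin 2) (v : Fin 2 → ℝ) :
    ContinuousOn (fun t => heatGrad i t v) (Set.Ioi 0) :=
  continuousOn_heatD_time (by split_ifs <;> norm_num) (by split_ifs <;> norm_num) v

lemma continuousOn_heat_time (v : Fin 2 → ℝ) :
    ContinuousOn (fun t => heatD 0 0 t v - 1) (Set.Ioi 0) :=
  (continuousOn_heatD_time (by norm_num) (by norm_num) v).sub continuousOn_const

lemma green_eq (x y : Torus) (v : Fin 2 → ℝ) (h : toTorus v = x - y) : green x y = greenReg 0 v := by
  rw [green, greenReg, ← h]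
  congr 1
  exact setIntegral_congr_fun measurableSet_Ioi fun t ht => by
    simp only [heatKernel_toTorus ht]

/-- The point is the uniformity in ε. For the potential the true size is logarithmic, but 1/‖x‖ is
integrable in dimension two and is all that is needed. -/
lemma abs_greenReg_le : ∃ C : ℝ, 0 < C ∧ ∀ ε, 0 ≤ ε → ∀ v, toTorus v ≠ 0 →
    |greenReg ε v| ≤ C / ‖toTorus v‖ ∧ ∀ i, |gradReg ε i v| ≤ C / ‖toTorus v‖ := by
  obtain ⟨C, hC, h⟩ := abs_heat_le
  refine ⟨3 * C, by positivity, fun ε hε v hv => ⟨?_, fun i => ?_⟩⟩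
  · rw [greenReg, abs_neg]
    exact abs_integral_Ioi_le (continuousOn_heat_time v) (norm_pos_iff.2 hv)
      (fun t ht => (h t ht v).1) (fun t ht => (h t ht v).2.1) hε
  · rw [gradReg, abs_neg]
    exact abs_integral_Ioi_le (continuousOn_heatGrad_time i v) (norm_pos_iff.2 hv)
      (fun t ht => ((h t ht v).2.2 i).1) (fun t ht => ((h t ht v).2.2 i).2) hε

lemma integrableOn_heat {v : Fin 2 → ℝ} (hv : toTorus v ≠ 0) :
    IntegrableOn (fun t => heatD 0 0 t v - 1) (Set.Ioi 0) ∧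
    ∀ i, IntegrableOn (fun t => heatGrad i t v) (Set.Ioi 0) := by
  obtain ⟨C, hC, h⟩ := abs_heat_le
  have hb : 0 < ‖toTorus v‖ := norm_pos_iff.2 hv
  refine ⟨integrableOn_Ioi_of_abs_le (b := C / ‖toTorus v‖ ^ 3) (continuousOn_heat_time v)
    (fun t ht => (h t ht v).1) fun t ht => ?_,
    fun i => integrableOn_Ioi_of_abs_le (b := C / ‖toTorus v‖ ^ 3) (continuousOn_heatGrad_time i v)
    (fun t ht => ((h t ht v).2.2 i).1) fun t ht => ?_⟩
  · rw [le_div_iff₀ (by positivity)]; exact (h t ht v).2.1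
  · rw [le_div_iff₀ (by positivity)]; exact ((h t ht v).2.2 i).2

/-- Only the times in (0, ε] are missing, and there the gradient of the heat kernel is at most
C/‖x‖³. -/
lemma abs_gradReg_sub_le : ∃ C : ℝ, 0 < C ∧ ∀ ε, 0 ≤ ε → ∀ v, toTorus v ≠ 0 → ∀ i,
    |gradReg ε i v - gradReg 0 i v| ≤ C * ε / ‖toTorus v‖ ^ 3 := by
  obtain ⟨C, hC, h⟩ := abs_heat_le
  refine ⟨C, hC, fun ε hε v hv i => ?_⟩
  have hb : 0 < ‖toTorus v‖ := norm_pos_iff.2 hv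
  have hi := (integrableOn_heat hv).2 i
  have e : gradReg ε i v - gradReg 0 i v = ∫ t in Set.Ioc 0 ε, heatGrad i t v := by
    rw [gradReg, gradReg, ← Set.Ioc_union_Ioi_eq_Ioi hε,
      setIntegral_union (Set.Ioc_disjoint_Ioi le_rfl)
      measurableSet_Ioi (hi.mono_set Set.Ioc_subset_Ioi_self)
      (hi.mono_set (Set.Ioi_subset_Ioi hε))]
    ring
  rw [e, ← Real.norm_eq_abs]
  have := norm_setIntegral_le_of_norm_le_const (C := C / ‖toTorus v‖ ^ 3) (μ := volume)
    (s := Set.Ioc 0 ε) (f := fun t => heatGrad i t v) (by simp) fun t ht => by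
      rw [Real.norm_eq_abs, le_div_iff₀ (by positivity)]; exact ((h t ht.1 v).2.2 i).2
  refine this.trans (le_of_eq ?_)
  simp [Measure.real, hε]
  ring

/-- Points at distance at most half the norm. -/
lemma half_norm_le_of_norm_le {v d : Fin 2 → ℝ} (hd : ‖d‖ ≤ ‖toTorus v‖ / 2) :
    ‖toTorus v‖ / 2 ≤ ‖toTorus (v + d)‖ := by
  rw [toTorus_add]
  have h1 := norm_sub_le (toTorus v + toTorus d) (toTorus d)
  rw [add_sub_cancel_right] at h1
  have := norm_toTorus_le d
  linarith

lemma hasDerivAt_greenReg {v : Fin 2 → ℝ} (hv : toTorus v ≠ 0) (i : Fin 2) :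
    HasDerivAt (fun h : ℝ => greenReg 0 (v + Pi.single i h)) (gradReg 0 i v) 0 := by
  obtain ⟨C, hC, h⟩ := abs_heat_le
  have hb : 0 < ‖toTorus v‖ := norm_pos_iff.2 hv
  -- Within half the norm the point stays away from the lattice, so the gradient is bounded for
  -- small times and decays like t^(-3/2) for large ones; this dominates the derivatives under the
  -- integral.
  set bound : ℝ → ℝ := fun t => if t ≤ 1 then C / (‖toTorus v‖ / 2) ^ 3 else C * t ^ (-(3 / 2) : ℝ)
    with hbd
  have hnorm : ∀ s : ℝ, s ∈ Metric.ball (0 : ℝ) (‖toTorus v‖ / 2) →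
      ‖toTorus v‖ / 2 ≤ ‖toTorus (v + Pi.single i s)‖ := fun s hs => by
    refine half_norm_le_of_norm_le ?_
    rw [Pi.norm_single]
    exact (by simpa using hs : |s| < _).le
  have h1 : ∀ᶠ s in nhds (0 : ℝ), AEStronglyMeasurable
      (fun t => heatD 0 0 t (v + Pi.single i s) - 1) (volume.restrict (Set.Ioi 0)) :=
    Filter.Eventually.of_forall fun s =>
      (continuousOn_heat_time _).aestronglyMeasurable measurableSet_Ioi
  have h2 : Integrable (fun t => heatD 0 0 t (v + Pi.single i 0) - 1)
      (volume.restrict (Set.Ioi 0)) := by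
    rw [Pi.single_zero, add_zero]
    exact (integrableOn_heat hv).1
  have h3 : AEStronglyMeasurable (fun t => heatGrad i t (v + Pi.single i 0))
      (volume.restrict (Set.Ioi 0)) :=
    (continuousOn_heatGrad_time i _).aestronglyMeasurable measurableSet_Ioi
  have h4 : ∀ᵐ t ∂(volume.restrict (Set.Ioi (0 : ℝ))), ∀ s ∈ Metric.ball (0 : ℝ) (‖toTorus v‖ / 2),
      ‖heatGrad i t (v + Pi.single i s)‖ ≤ bound t := by
    filter_upwards [self_mem_ae_restrict measurableSet_Ioi] with t ht s hs
    simp only [hbd]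
    split_ifs
    · rw [Real.norm_eq_abs, le_div_iff₀ (by positivity)]
      refine le_trans ?_ ((h t ht (v + Pi.single i s)).2.2 i).2
      gcongr
      exact hnorm s hs
    · exact ((h t ht (v + Pi.single i s)).2.2 i).1
  have h5 : Integrable bound (volume.restrict (Set.Ioi 0)) := by
    show IntegrableOn bound (Set.Ioi 0)
    rw [← Set.Ioc_union_Ioi_eq_Ioi zero_le_one]
    refine IntegrableOn.union ?_ ?_
    · refine (integrableOn_const (C := C / (‖toTorus v‖ / 2) ^ 3) (by simp)).congr_fun
        (fun t ht => ?_) measurableSet_Ioc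
      simp [hbd, ht.2]
    · refine IntegrableOn.congr_fun (f := fun t => C * t ^ (-(3 / 2) : ℝ))
        ((integrableOn_Ioi_rpow_of_lt (by norm_num : (-(3 / 2) : ℝ) < -1)
        one_pos).const_mul C) (fun t ht => ?_) measurableSet_Ioi
      simp only [hbd]
      rw [if_neg (not_le.2 ht)]
  have h6 : ∀ᵐ t ∂(volume.restrict (Set.Ioi (0 : ℝ))), ∀ s ∈ Metric.ball (0 : ℝ) (‖toTorus v‖ / 2),
      HasDerivAt (fun s => heatD 0 0 t (v + Pi.single i s) - 1)
        (heatGrad i t (v + Pi.single i s)) s := by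
    filter_upwards [self_mem_ae_restrict measurableSet_Ioi] with t ht s hs
    have := hasDerivAt_heatD 0 0 ht v (Pi.single i 1) s
    have e : ∀ s : ℝ, v + s • (Pi.single i 1 : Fin 2 → ℝ) = v + Pi.single i s := fun s => by
      rw [← Pi.single_smul]; simp
    simp only [e] at this
    refine (this.sub_const 1).congr_deriv ?_
    fin_cases i <;> simp [heatGrad]
  have key := hasDerivAt_integral_of_dominated_loc_of_deriv_le (Metric.ball_mem_nhds 0
    (by positivity)) h1 h2 h3 h4 h5 h6
  have := key.2.neg
  simp only [Pi.single_zero, add_zero] at this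
  exact this

lemma greenDeriv_eq (i : Fin 2) (x y : Torus) (v : Fin 2 → ℝ) (h : toTorus v = x - y)
    (hv : x ≠ y) : greenDeriv i x y = gradReg 0 i v := by
  rw [greenDeriv]
  have hv' : toTorus v ≠ 0 := by rw [h]; exact sub_ne_zero.2 hv
  refine HasDerivAt.deriv ((hasDerivAt_greenReg hv' i).congr_of_eventuallyEq ?_)
  refine Filter.Eventually.of_forall fun s => ?_
  refine green_eq _ _ _ ?_
  rw [toTorus_add, h]; abel

/-! ### Lipschitz estimates away from the singularity -/

lemma abs_heatGrad_sub_le : ∃ C : ℝ, 0 < C ∧ ∀ v d : Fin 2 → ℝ, toTorus v ≠ 0 →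
    ‖d‖ ≤ ‖toTorus v‖ / 2 → ∀ i, ∀ t : ℝ, 0 < t →
    |heatGrad i t (v + d) - heatGrad i t v| ≤
      (if t ≤ 1 then C / ‖toTorus v‖ ^ 4 else C * Real.exp (-t)) * ‖d‖ := by
  obtain ⟨A, hA, h1⟩ := abs_heatD_small
  obtain ⟨B, hB, h2⟩ := abs_heatD_large
  refine ⟨2 * (16 * A + B), by positivity, fun v d hv hd i t ht => ?_⟩
  have hb : 0 < ‖toTorus v‖ := norm_pos_iff.2 hv
  set M : ℝ := if t ≤ 1 then (16 * A + B) / ‖toTorus v‖ ^ 4 else (16 * A + B) * Real.exp (-t) with hM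
  have hM' : (if t ≤ 1 then 2 * (16 * A + B) / ‖toTorus v‖ ^ 4
      else 2 * (16 * A + B) * Real.exp (-t)) = 2 * M := by
    rw [hM]; split_ifs <;> ring
  rw [hM']
  have hsec : ∀ a b : ℕ, a + b = 2 → ∀ s ∈ Set.Icc (0 : ℝ) 1, |heatD a b t (v + s • d)| ≤ M := by
    intro a b hab s hs
    have hn : ‖toTorus v‖ / 2 ≤ ‖toTorus (v + s • d)‖ := by
      -- The whole segment keeps at least half the norm; this is where 16 = 2⁴ comes from.
      refine half_norm_le_of_norm_le ?_
      rw [norm_smul, Real.norm_of_nonneg hs.1]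
      exact (mul_le_of_le_one_left (norm_nonneg _) hs.2).trans hd
    rw [hM]
    split_ifs with ht1
    · have := (h1 a b hab.le t ht ht1 (v + s • d)).2
      rw [show 2 + a + b = 4 by omega] at this
      rw [le_div_iff₀ (by positivity)]
      have h3 : ‖toTorus v‖ ^ 4 ≤ 16 * ‖toTorus (v + s • d)‖ ^ 4 := by
        have := pow_le_pow_left₀ (by positivity) hn 4
        rw [div_pow] at this
        linarith
      calc |heatD a b t (v + s • d)| * ‖toTorus v‖ ^ 4
          ≤ |heatD a b t (v + s • d)| * (16 * ‖toTorus (v + s • d)‖ ^ 4) := by gcongr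
        _ = 16 * (|heatD a b t (v + s • d)| * ‖toTorus (v + s • d)‖ ^ 4) := by ring
        _ ≤ 16 * A := by gcongr
        _ ≤ _ := by linarith
    · have := h2 a b hab.le t (not_le.1 ht1).le (v + s • d)
      rw [if_neg (by omega), sub_zero] at this
      refine this.trans ?_
      gcongr
      linarith
  have := norm_image_sub_le_of_norm_deriv_le_segment_01' (C := 2 * M * ‖d‖)
    (fun s hs => (hasDerivAt_heatD (if i = 0 then 1 else 0) (if i = 0 then 0 else 1) ht v d
      s).hasDerivWithinAt) fun s hs => by
    have hs' := Set.Ico_subset_Icc_self hs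
    refine (norm_add_le _ _).trans ?_
    rw [norm_mul, norm_mul, Real.norm_eq_abs (heatD _ _ _ _), Real.norm_eq_abs (heatD _ _ _ _)]
    have e1 := hsec ((if i = 0 then 1 else 0) + 1) (if i = 0 then 0 else 1)
      (by split_ifs <;> norm_num) s hs'
    have e2 := hsec (if i = 0 then 1 else 0) ((if i = 0 then 0 else 1) + 1)
      (by split_ifs <;> norm_num) s hs'
    have d0 := norm_le_pi_norm d 0
    have d1 := norm_le_pi_norm d 1
    have hM0 : 0 ≤ M := (abs_nonneg _).trans e1
    calc _ ≤ ‖d‖ * M + ‖d‖ * M := by gcongr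
      _ = _ := by ring
  simpa [heatGrad] using this

/-- The power 4 is cruder than the true order 2, but the bound is only used at a fixed separation.
-/
lemma abs_gradReg_add_sub_le : ∃ C : ℝ, 0 < C ∧ ∀ v d : Fin 2 → ℝ, toTorus v ≠ 0 →
    ‖d‖ ≤ ‖toTorus v‖ / 2 → ∀ i,
    |gradReg 0 i (v + d) - gradReg 0 i v| ≤ C / ‖toTorus v‖ ^ 4 * ‖d‖ := by
  obtain ⟨C, hC, h⟩ := abs_heatGrad_sub_le
  refine ⟨2 * C, by positivity, fun v d hv hd i => ?_⟩
  have hb : 0 < ‖toTorus v‖ := norm_pos_iff.2 hv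
  have hb1 : ‖toTorus v‖ ≤ 1 / 2 := norm_torus_le_half _
  have hv2 : toTorus (v + d) ≠ 0 := by
    have := half_norm_le_of_norm_le hd
    exact norm_pos_iff.1 (by linarith)
  have hi1 := (integrableOn_heat hv).2 i
  have hi2 := (integrableOn_heat hv2).2 i
  have hi : IntegrableOn (fun t => heatGrad i t (v + d) - heatGrad i t v) (Set.Ioi 0) := hi2.sub hi1
  have e : gradReg 0 i (v + d) - gradReg 0 i v =
      -∫ t in Set.Ioi 0, (heatGrad i t (v + d) - heatGrad i t v) := by
    rw [integral_sub hi2 hi1, gradReg, gradReg]; ring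
  rw [e, abs_neg, ← Set.Ioc_union_Ioi_eq_Ioi zero_le_one,
    setIntegral_union (Set.Ioc_disjoint_Ioi le_rfl) measurableSet_Ioi
    (hi.mono_set Set.Ioc_subset_Ioi_self) (hi.mono_set (Set.Ioi_subset_Ioi zero_le_one))]
  refine (abs_add_le _ _).trans ?_
  have e1 : |∫ t in Set.Ioc 0 1, (heatGrad i t (v + d) - heatGrad i t v)| ≤
      C / ‖toTorus v‖ ^ 4 * ‖d‖ := by
    have := norm_setIntegral_le_of_norm_le_const (C := C / ‖toTorus v‖ ^ 4 * ‖d‖) (μ := volume)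
      (s := Set.Ioc 0 1) (f := fun t => heatGrad i t (v + d) - heatGrad i t v) (by simp)
      fun t ht => by
        have := h v d hv hd i t ht.1
        rwa [if_pos ht.2] at this
    simpa using this
  have e2 : |∫ t in Set.Ioi 1, (heatGrad i t (v + d) - heatGrad i t v)| ≤
      C / ‖toTorus v‖ ^ 4 * ‖d‖ := by
    have := norm_integral_le_of_norm_le (μ := volume.restrict (Set.Ioi 1))
      (f := fun t => heatGrad i t (v + d) - heatGrad i t v)
      (g := fun t => C * ‖d‖ * Real.exp (-t)) ((integrableOn_exp_neg_Ioi 1).const_mul _) (by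
        filter_upwards [self_mem_ae_restrict measurableSet_Ioi] with t ht
        have := h v d hv hd i t (zero_lt_one.trans ht)
        rw [if_neg (not_le.2 ht)] at this
        refine this.trans (le_of_eq (by ring)))
    rw [integral_const_mul, integral_exp_neg_Ioi] at this
    refine this.trans ?_
    have h1 : Real.exp (-1) ≤ 1 := Real.exp_le_one_iff.2 (by norm_num)
    have h4 : ‖toTorus v‖ ^ 4 ≤ 1 := pow_le_one₀ hb.le (by linarith)
    calc C * ‖d‖ * Real.exp (-1) ≤ C * ‖d‖ * 1 := by gcongr
      _ = C / 1 * ‖d‖ := by ring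
      _ ≤ _ := by gcongr
  calc _ ≤ _ := add_le_add e1 e2
    _ = _ := by ring

/-! ### Logarithmic blow-up of the Green function on the diagonal -/

lemma integrableOn_heat_Ioi {ε : ℝ} (hε : 0 < ε) (v : Fin 2 → ℝ) :
    IntegrableOn (fun t => heatD 0 0 t v - 1) (Set.Ioi ε) := by
  obtain ⟨C, hC, h⟩ := abs_heat_le
  refine Integrable.mono' ((integrableOn_Ioi_rpow_of_lt (by norm_num : (-(3 / 2) : ℝ) < -1)
    hε).const_mul C) (((continuousOn_heat_time v).mono (Set.Ioi_subset_Ioi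
      hε.le)).aestronglyMeasurable measurableSet_Ioi) ?_
  filter_upwards [self_mem_ae_restrict measurableSet_Ioi] with t ht
    using (h t (hε.trans ht) v).1

lemma heatD_zero_nonneg {t : ℝ} (ht : 0 < t) (v : Fin 2 → ℝ) : 0 ≤ heatD 0 0 t v :=
  mul_nonneg (theta_zero_nonneg ht _) (theta_zero_nonneg ht _)

lemma heatD_zero_ge {t η : ℝ} (hη : 0 < η) (ht : η ^ 2 ≤ t) {v : Fin 2 → ℝ} (hv : ∀ i, |v i| ≤ η) :
    Real.exp (-(1 / 2)) / (4 * Real.pi) * t⁻¹ ≤ heatD 0 0 t v := by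
  have ht0 : 0 < t := lt_of_lt_of_le (by positivity) ht
  have h : ∀ i, (Real.sqrt (4 * Real.pi * t))⁻¹ * Real.exp (-(1 / 4)) ≤ theta 0 t (v i) := fun i => by
    refine le_trans ?_ (theta_zero_ge ht0 (v i))
    gcongr
    rw [neg_div, neg_le_neg_iff, div_le_div_iff₀ (by positivity) (by norm_num)]
    have := sq_le_sq' (by linarith [abs_nonneg (v i)]) (hv i)
    rw [sq_abs] at this
    linarith
  have := mul_le_mul (h 0) (h 1) (by positivity) (theta_zero_nonneg ht0 _)
  refine le_trans (le_of_eq ?_) this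
  rw [show ∀ a b : ℝ, a * b * (a * b) = (a * a) * (b * b) by intros; ring, ← mul_inv,
    Real.mul_self_sqrt (by positivity), ← Real.exp_add]
  norm_num
  ring

/-- Positivity of the heat kernel bounds -G below. Within distance η of the origin the heat kernel
is at least a constant times 1/t for η² ≤ t ≤ 1, and integration gives -2 log η. This turns
closeness of two vortices into a large potential. -/
lemma neg_greenReg_ge : ∃ C c : ℝ, 0 < C ∧ 0 < c ∧ ∀ ε, 0 < ε → ε ≤ 1 → ∀ v,
    -C ≤ -greenReg ε v ∧
    ∀ η, 0 < η → η ≤ 1 → ε ≤ η ^ 2 → (∀ i, |v i| ≤ η) → -(c * Real.log η) - C ≤ -greenReg ε v := by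
  obtain ⟨B, hB, h⟩ := abs_heatD_large
  refine ⟨B + 1, 2 * (Real.exp (-(1 / 2)) / (4 * Real.pi)), by positivity, by positivity,
    fun ε hε hε1 v => ?_⟩
  have hi := integrableOn_heat_Ioi hε v
  have hsplit : -greenReg ε v = (∫ t in Set.Ioc ε 1, heatD 0 0 t v) - (1 - ε) +
      ∫ t in Set.Ioi 1, (heatD 0 0 t v - 1) := by
    have h1 : IntegrableOn (fun t => heatD 0 0 t v) (Set.Ioc ε 1) := by
      have := (hi.mono_set (Set.Ioc_subset_Ioi_self : Set.Ioc ε 1 ⊆ Set.Ioi ε)).add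
        (integrableOn_const (C := (1 : ℝ)) (by simp))
      exact this.congr_fun (fun t _ => by simp) measurableSet_Ioc
    rw [greenReg, neg_neg, ← Set.Ioc_union_Ioi_eq_Ioi hε1, setIntegral_union
      (Set.Ioc_disjoint_Ioi le_rfl) measurableSet_Ioi (hi.mono_set Set.Ioc_subset_Ioi_self)
      (hi.mono_set (Set.Ioi_subset_Ioi hε1)), integral_sub h1 (integrableOn_const (by simp))]
    simp [hε1]
  have htail : -B ≤ ∫ t in Set.Ioi 1, (heatD 0 0 t v - 1) := by
    have := norm_integral_le_of_norm_le (μ := volume.restrict (Set.Ioi 1))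
      (f := fun t => heatD 0 0 t v - 1)
      (g := fun t => B * Real.exp (-t)) ((integrableOn_exp_neg_Ioi 1).const_mul _) (by
        filter_upwards [self_mem_ae_restrict measurableSet_Ioi] with t ht
        simpa using h 0 0 (by norm_num) t ht.le v)
    rw [integral_const_mul, integral_exp_neg_Ioi] at this
    have h1 : Real.exp (-1) ≤ 1 := Real.exp_le_one_iff.2 (by norm_num)
    have h2 := (abs_le.1 this).1
    nlinarith
  constructor
  · have : 0 ≤ ∫ t in Set.Ioc ε 1, heatD 0 0 t v :=
      setIntegral_nonneg measurableSet_Ioc fun t ht => heatD_zero_nonneg (hε.trans ht.1) v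
    rw [hsplit]; linarith
  · intro η hη hη1 hεη hv
    have hη2 : 0 < η ^ 2 := by positivity
    have hη21 : η ^ 2 ≤ 1 := pow_le_one₀ hη.le hη1
    have hI : IntegrableOn (fun t => heatD 0 0 t v) (Set.Ioc ε 1) := by
      have := (hi.mono_set (Set.Ioc_subset_Ioi_self : Set.Ioc ε 1 ⊆ Set.Ioi ε)).add
        (integrableOn_const (C := (1 : ℝ)) (by simp))
      exact this.congr_fun (fun t _ => by simp) measurableSet_Ioc
    have h1 : ∫ t in Set.Ioc (η ^ 2) 1, heatD 0 0 t v ≤ ∫ t in Set.Ioc ε 1, heatD 0 0 t v := by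
      refine setIntegral_mono_set hI ?_ (Set.Ioc_subset_Ioc_left hεη).eventuallyLE
      filter_upwards [self_mem_ae_restrict measurableSet_Ioc] with t ht
        using heatD_zero_nonneg (hε.trans ht.1) v
    have h2 : ∫ t in Set.Ioc (η ^ 2) 1, Real.exp (-(1 / 2)) / (4 * Real.pi) * t⁻¹ ≤
        ∫ t in Set.Ioc (η ^ 2) 1, heatD 0 0 t v := by
      refine setIntegral_mono_on ?_ (hI.mono_set (Set.Ioc_subset_Ioc_left hεη)) measurableSet_Ioc
        fun t ht => heatD_zero_ge hη ht.1.le hv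
      refine Integrable.const_mul ?_ _
      have : IntervalIntegrable (fun t : ℝ => t⁻¹) volume (η ^ 2) 1 :=
        intervalIntegral.intervalIntegrable_inv (fun t ht => by
          rw [Set.uIcc_of_le hη21] at ht
          exact (hη2.trans_le ht.1).ne') continuousOn_id
      exact (intervalIntegrable_iff_integrableOn_Ioc_of_le hη21).1 this
    rw [integral_const_mul, ← intervalIntegral.integral_of_le hη21,
      integral_inv_of_pos hη2 one_pos, one_div (η ^ 2), Real.log_inv, Real.log_pow] at h2
    rw [hsplit]
    push_cast at h2
    linarith

/-! ### Fourier series of the regularised Green function -/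

lemma freqSq_nonneg (k : Fin 2 → ℤ) : 0 ≤ freqSq k := Finset.sum_nonneg fun _ _ => sq_nonneg _

lemma sq_le_freqSq (k : Fin 2 → ℤ) (i : Fin 2) : (k i : ℝ) ^ 2 ≤ freqSq k :=
  Finset.single_le_sum (f := fun i => (k i : ℝ) ^ 2) (fun _ _ => sq_nonneg _) (Finset.mem_univ i)

lemma abs_le_freqSq (k : Fin 2 → ℤ) (i : Fin 2) : |(k i : ℝ)| ≤ freqSq k := by
  refine le_trans ?_ (sq_le_freqSq k i)
  have : |k i| ≤ (k i) ^ 2 := by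
    rw [← sq_abs]
    rcases eq_or_ne (k i) 0 with h | h
    · simp [h]
    · have := Int.one_le_abs h
      nlinarith
  exact_mod_cast this

lemma one_le_freqSq {k : Fin 2 → ℤ} (hk : k ≠ 0) : 1 ≤ freqSq k := by
  obtain ⟨i, hi⟩ := Function.ne_iff.1 hk
  refine le_trans ?_ (abs_le_freqSq k i)
  exact_mod_cast Int.one_le_abs hi

lemma summable_heatWeight {t : ℝ} (ht : 0 < t) : Summable (heatWeight t) := by
  have h := hasSum_heatD_zero ht 0
  refine h.summable.congr fun k => ?_
  have : UnitAddTorus.mFourier k (toTorus 0) = 1 := by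
    rw [mFourier_toTorus]; simp
  rw [this]; simp

lemma heatWeight_pos (t : ℝ) (k : Fin 2 → ℤ) : 0 < heatWeight t k := Real.exp_pos _

/-- The Fourier coefficients of the regularised Green function. -/
def greenCoeff (ε : ℝ) (k : Fin 2 → ℤ) : ℝ :=
  if k = 0 then 0 else -(heatWeight ε k / (4 * Real.pi ^ 2 * freqSq k))

lemma abs_greenCoeff_mul_le (ε : ℝ) (k : Fin 2 → ℤ) (i : Fin 2) :
    |greenCoeff ε k| ≤ heatWeight ε k ∧ |2 * Real.pi * k i * greenCoeff ε k| ≤ heatWeight ε k := by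
  rw [greenCoeff]
  split_ifs with h
  · simp [(heatWeight_pos ε k).le]
  · have h1 := one_le_freqSq h
    have h2 := abs_le_freqSq k i
    have hp := Real.pi_gt_three
    have hw := heatWeight_pos ε k
    have hpos : 0 < 4 * Real.pi ^ 2 * freqSq k := by positivity
    constructor
    · rw [abs_neg, abs_of_pos (by positivity), div_le_iff₀ hpos]
      have : 1 ≤ 4 * Real.pi ^ 2 * freqSq k := by nlinarith [sq_nonneg Real.pi]
      nlinarith
    · rw [abs_mul, abs_mul, abs_neg, abs_of_pos (by positivity : 0 < 2 * Real.pi),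
        abs_of_pos (by positivity : 0 < heatWeight ε k / (4 * Real.pi ^ 2 * freqSq k)),
        ← mul_div_assoc, div_le_iff₀ hpos, mul_comm]
      have h3 : 2 * Real.pi ≤ 4 * Real.pi ^ 2 := by nlinarith
      exact mul_le_mul_of_nonneg_left (mul_le_mul h3 h2 (abs_nonneg _) (by positivity)) hw.le

lemma integral_heatWeight {ε : ℝ} {k : Fin 2 → ℤ} (hk : k ≠ 0) :
    IntegrableOn (fun t => heatWeight t k) (Set.Ioi ε) ∧
    ∫ t in Set.Ioi ε, heatWeight t k = -greenCoeff ε k := by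
  have h1 := one_le_freqSq hk
  have hneg : -(4 * Real.pi ^ 2 * freqSq k) < 0 := by
    have : 0 < 4 * Real.pi ^ 2 * freqSq k := by positivity
    linarith
  have e : (fun t => heatWeight t k) = fun t => Real.exp (-(4 * Real.pi ^ 2 * freqSq k) * t) := by
    funext t; rw [heatWeight]; congr 1; ring
  rw [e]
  refine ⟨integrableOn_exp_mul_Ioi hneg ε, ?_⟩
  rw [integral_exp_mul_Ioi hneg, greenCoeff, if_neg hk, heatWeight, neg_neg, div_neg, neg_div,
    neg_neg]
  congr 2; ring

/-- Integration of a heat series term by term in time. The condition `c 0 = 0` removes the constant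
mode, whose integral would diverge. -/
lemma hasSum_integral_heatWeight {ε : ℝ} (hε : 0 < ε) {c : (Fin 2 → ℤ) → ℝ} {f : ℝ → ℝ}
    (hc : ∀ k, |c k * greenCoeff ε k| ≤ heatWeight ε k) (hc0 : c 0 = 0)
    (hf : ∀ t, 0 < t → HasSum (fun k => c k * heatWeight t k) (f t)) :
    HasSum (fun k => c k * greenCoeff ε k) (-∫ t in Set.Ioi ε, f t) := by
  have hint : ∀ k, Integrable (fun t => c k * heatWeight t k) (volume.restrict (Set.Ioi ε)) := by
    intro k
    by_cases hk : k = 0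
    · simp [hk, hc0]
    · exact (integral_heatWeight hk).1.const_mul _
  have hnorm : ∀ k, ∫ t in Set.Ioi ε, ‖c k * heatWeight t k‖ = |c k * greenCoeff ε k| := by
    intro k
    by_cases hk : k = 0
    · simp [hk, hc0]
    · simp_rw [norm_mul, Real.norm_of_nonneg (heatWeight_pos _ _).le]
      rw [integral_const_mul, (integral_heatWeight hk).2, Real.norm_eq_abs, abs_mul]
      congr 1
      rw [greenCoeff, if_neg hk, abs_neg, neg_neg, abs_of_nonneg]
      have := freqSq_nonneg k
      have := heatWeight_pos ε k
      positivity
  have h := hasSum_integral_of_summable_integral_norm hint (by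
    simp_rw [hnorm]
    exact Summable.of_nonneg_of_le (fun _ => abs_nonneg _) hc (summable_heatWeight hε))
  have e1 : ∀ k, ∫ t in Set.Ioi ε, c k * heatWeight t k = -(c k * greenCoeff ε k) := by
    intro k
    by_cases hk : k = 0
    · simp [hk, hc0]
    · rw [integral_const_mul, (integral_heatWeight hk).2]; ring
  simp_rw [e1] at h
  have e2 : ∫ t in Set.Ioi ε, ∑' k, c k * heatWeight t k = ∫ t in Set.Ioi ε, f t :=
    setIntegral_congr_fun measurableSet_Ioi fun t ht => (hf t (hε.trans ht)).tsum_eq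
  rw [e2] at h
  simpa using h.neg

lemma abs_re_mFourier_le (k : Fin 2 → ℤ) (z : Torus) : |(UnitAddTorus.mFourier k z).re| ≤ 1 := by
  have h1 := Complex.abs_re_le_norm (UnitAddTorus.mFourier k z)
  have h2 := (UnitAddTorus.mFourier k).norm_coe_le_norm z
  rw [UnitAddTorus.mFourier_norm] at h2
  linarith

lemma abs_im_mFourier_le (k : Fin 2 → ℤ) (z : Torus) : |(UnitAddTorus.mFourier k z).im| ≤ 1 := by
  have h1 := Complex.abs_im_le_norm (UnitAddTorus.mFourier k z)
  have h2 := (UnitAddTorus.mFourier k).norm_coe_le_norm z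
  rw [UnitAddTorus.mFourier_norm] at h2
  linarith

lemma hasSum_greenReg {ε : ℝ} (hε : 0 < ε) (v : Fin 2 → ℝ) :
    HasSum (fun k => greenCoeff ε k * (UnitAddTorus.mFourier k (toTorus v)).re) (greenReg ε v) := by
  have h := hasSum_integral_heatWeight hε
    (c := fun k => if k = 0 then 0 else (UnitAddTorus.mFourier k (toTorus v)).re)
    (f := fun t => heatD 0 0 t v - 1) (fun k => ?_) (by simp) fun t ht => ?_
  · refine (congrArg (fun f => HasSum f _) (funext fun k => ?_)).mp h
    by_cases hk : k = 0
    · simp [hk, greenCoeff]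
    · simp only [if_neg hk]; ring
  · rw [abs_mul]
    have h1 := (abs_greenCoeff_mul_le ε k 0).1
    have h2 : |if k = 0 then 0 else (UnitAddTorus.mFourier k (toTorus v)).re| ≤ 1 := by
      split_ifs
      · simp
      · exact abs_re_mFourier_le _ _
    nlinarith [abs_nonneg (greenCoeff ε k)]
  · have h := (hasSum_heatD_zero ht v).sub (hasSum_ite_eq (0 : Fin 2 → ℤ) (1 : ℝ))
    refine (congrArg (fun f => HasSum f _) (funext fun k => ?_)).mp h
    by_cases hk : k = 0
    · simp [hk, heatWeight, freqSq, UnitAddTorus.mFourier_zero]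
    · simp only [if_neg hk]; ring

lemma hasSum_gradReg {ε : ℝ} (hε : 0 < ε) (i : Fin 2) (v : Fin 2 → ℝ) :
    HasSum (fun k : Fin 2 → ℤ => -(2 * Real.pi * k i) * greenCoeff ε k *
      (UnitAddTorus.mFourier k (toTorus v)).im) (gradReg ε i v) := by
  have h := hasSum_integral_heatWeight hε
    (c := fun k : Fin 2 → ℤ => -(2 * Real.pi * k i) * (UnitAddTorus.mFourier k (toTorus v)).im)
    (f := fun t => heatGrad i t v) (fun k => ?_) (by simp) fun t ht => ?_
  · refine (congrArg (fun f => HasSum f _) (funext fun k => ?_)).mp h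
    ring
  · have h1 := (abs_greenCoeff_mul_le ε k i).2
    have h2 := abs_im_mFourier_le k (toTorus v)
    rw [show -(2 * Real.pi * k i) * (UnitAddTorus.mFourier k (toTorus v)).im * greenCoeff ε k =
      -((2 * Real.pi * k i * greenCoeff ε k) * (UnitAddTorus.mFourier k (toTorus v)).im) by ring,
      abs_neg, abs_mul]
    nlinarith [abs_nonneg (2 * Real.pi * k i * greenCoeff ε k)]
  · refine (congrArg (fun f => HasSum f _) (funext fun k => ?_)).mp (hasSum_heatGrad i ht v)
    ring

/-! ### The Biot-Savart kernel as a function on the torus -/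

lemma toTorus_surjective : Function.Surjective toTorus := fun z =>
  let ⟨v, hv, _⟩ := exists_toTorus_eq z
  ⟨v, hv⟩

/-- The Biot-Savart kernel as a function of the difference of its arguments. -/
def bsKernel (z : Torus) : Fin 2 → ℝ := biotSavart z 0

lemma green_eq_sub (x y : Torus) : green x y = green (x - y) 0 := by
  rw [green, green, sub_zero]

lemma biotSavart_eq (x y : Torus) : biotSavart x y = bsKernel (x - y) := by
  have h : ∀ i, greenDeriv i x y = greenDeriv i (x - y) 0 := fun i => by
    rw [greenDeriv, greenDeriv]
    congr 1
    funext h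
    rw [green_eq_sub, green_eq_sub (x - y + _)]
    congr 1
    abel
  rw [bsKernel, biotSavart, biotSavart, h, h]

lemma heatKernel_neg (t : ℝ) (z : Torus) : heatKernel t (-z) = heatKernel t z := by
  rw [heatKernel, heatKernel]
  refine tsum_congr fun k => ?_
  have : UnitAddTorus.mFourier k (-z) = UnitAddTorus.mFourier (-k) z := by
    simp [UnitAddTorus.mFourier]
  rw [this, UnitAddTorus.mFourier_neg, Complex.conj_re]

lemma green_neg (z : Torus) : green (-z) 0 = green z 0 := by
  simp only [green, sub_zero, heatKernel_neg]

lemma bsKernel_neg (z : Torus) : bsKernel (-z) = -bsKernel z := by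
  have h : ∀ i, greenDeriv i (-z) 0 = -greenDeriv i z 0 := fun i => by
    rw [greenDeriv, greenDeriv]
    have : (fun h : ℝ => green (-z + toTorus (Pi.single i h)) 0) =
        fun h => (fun h => green (z + toTorus (Pi.single i h)) 0) (-h) := by
      funext h
      simp only
      rw [← green_neg, Pi.single_neg, toTorus_neg]
      congr 1
      abel
    have h2 := deriv_comp_neg (fun h : ℝ => green (z + toTorus (Pi.single i h)) 0) 0
    rw [this]
    simpa using h2
  rw [bsKernel, bsKernel, biotSavart, biotSavart, h, h]
  ext i; fin_cases i <;> simp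

/-- Oddness decides the value on the diagonal, whatever `deriv` returns there. -/
lemma bsKernel_zero : bsKernel 0 = 0 := by
  have h := bsKernel_neg 0
  rw [neg_zero] at h
  exact self_eq_neg.1 h

lemma bsKernel_toTorus {v : Fin 2 → ℝ} (hv : toTorus v ≠ 0) :
    bsKernel (toTorus v) = ![gradReg 0 1 v, -gradReg 0 0 v] := by
  rw [bsKernel, biotSavart, greenDeriv_eq 1 _ _ v (by simp) hv, greenDeriv_eq 0 _ _ v (by simp) hv]

lemma norm_vec_two_le {a b c : ℝ} (ha : |a| ≤ c) (hb : |b| ≤ c) : ‖![a, b]‖ ≤ c := by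
  refine (pi_norm_le_iff_of_nonneg ((abs_nonneg _).trans ha)).2 fun i => ?_
  fin_cases i
  · exact ha
  · exact hb

/-- At z = 0 both sides are 0, by oddness and by the convention on division. -/
lemma norm_bsKernel_le : ∃ C : ℝ, 0 < C ∧ ∀ z, ‖bsKernel z‖ ≤ C / ‖z‖ := by
  obtain ⟨C, hC, h⟩ := abs_greenReg_le
  refine ⟨C, hC, fun z => ?_⟩
  obtain ⟨v, rfl⟩ := toTorus_surjective z
  by_cases hv : toTorus v = 0
  · rw [hv, bsKernel_zero]; simp
  · rw [bsKernel_toTorus hv]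
    exact norm_vec_two_le ((h 0 le_rfl v hv).2 1) (by rw [abs_neg]; exact (h 0 le_rfl v hv).2 0)

lemma norm_bsKernel_add_sub_le : ∃ C : ℝ, 0 < C ∧ ∀ (z : Torus) (d : Fin 2 → ℝ), z ≠ 0 →
    ‖d‖ ≤ ‖z‖ / 2 → ‖bsKernel (z + toTorus d) - bsKernel z‖ ≤ C / ‖z‖ ^ 4 * ‖d‖ := by
  obtain ⟨C, hC, h⟩ := abs_gradReg_add_sub_le
  refine ⟨C, hC, fun z d hz hd => ?_⟩
  obtain ⟨v, rfl⟩ := toTorus_surjective z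
  have hv2 : toTorus (v + d) ≠ 0 := by
    have := half_norm_le_of_norm_le hd
    have := norm_pos_iff.2 hz
    exact norm_pos_iff.1 (by linarith)
  rw [← toTorus_add, bsKernel_toTorus hz, bsKernel_toTorus hv2]
  have e : ![gradReg 0 1 (v + d), -gradReg 0 0 (v + d)] - ![gradReg 0 1 v, -gradReg 0 0 v] =
      ![gradReg 0 1 (v + d) - gradReg 0 1 v, -(gradReg 0 0 (v + d) - gradReg 0 0 v)] := by
    ext i; fin_cases i <;> simp; ring
  rw [e]
  exact norm_vec_two_le (h v d hz hd 1) (by rw [abs_neg]; exact h v d hz hd 0)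

/-- A trigonometric polynomial with frequencies in `s` and even coefficients. -/
def trigPot (s : Finset (Fin 2 → ℤ)) (g : (Fin 2 → ℤ) → ℝ) (z : Torus) : ℝ :=
  ∑ k ∈ s, g k * (UnitAddTorus.mFourier k z).re

/-- The partial derivatives of `trigPot`. -/
def trigGrad (s : Finset (Fin 2 → ℤ)) (g : (Fin 2 → ℤ) → ℝ) (i : Fin 2) (z : Torus) : ℝ :=
  ∑ k ∈ s, -(2 * Real.pi * k i) * g k * (UnitAddTorus.mFourier k z).im

/-- The velocity field with stream function `trigPot`. -/
def trigVel (s : Finset (Fin 2 → ℤ)) (g : (Fin 2 → ℤ) → ℝ) (z : Torus) : Fin 2 → ℝ :=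
  ![trigGrad s g 1 z, -trigGrad s g 0 z]

lemma abs_sub_sum_le_of_tail {w f : (Fin 2 → ℤ) → ℝ} {A κ : ℝ} {s : Finset (Fin 2 → ℤ)}
    (hw : Summable w) (hs : ∑' k : ↥{k | k ∉ s}, w k ≤ κ) (hf : HasSum f A) (hfw : ∀ k, |f k| ≤ w k) :
    |A - ∑ k ∈ s, f k| ≤ κ := by
  have h1 := hf.summable.sum_add_tsum_compl (s := s)
  rw [hf.tsum_eq] at h1
  have h2 : A - ∑ k ∈ s, f k = ∑' k : ↥((s : Set (Fin 2 → ℤ))ᶜ), f k := by linarith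
  rw [h2, ← Real.norm_eq_abs]
  refine (tsum_of_norm_bounded (hw.subtype _).hasSum fun k => hfw k).trans hs

/-- The Green function is regularised at heat time ε and its Fourier series is cut. That `C` and `c`
precede η and κ is essential: the collision estimate must not see the regularisation. The properties
serve, in order, for the three-vortex terms, the comparison with K, the positivity of the shifted
potential, its initial mean, and the detection of close pairs. -/
theorem exists_trig_approx : ∃ C c : ℝ, 0 < C ∧ 0 < c ∧ ∀ η, 0 < η → η ≤ 1 → ∀ κ, 0 < κ → κ ≤ 1 →
    ∃ (s : Finset (Fin 2 → ℤ)) (g : (Fin 2 → ℤ) → ℝ),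
      (∀ z, z ≠ 0 → ‖trigVel s g z‖ ≤ C / ‖z‖) ∧
      (∀ z, η ≤ ‖z‖ → ‖trigVel s g z - bsKernel z‖ ≤ κ) ∧
      (∀ z, -C ≤ -trigPot s g z) ∧
      (∀ z, z ≠ 0 → -trigPot s g z ≤ C / ‖z‖) ∧
      (∀ z, ‖z‖ ≤ η → -(c * Real.log η) - C ≤ -trigPot s g z) := by
  obtain ⟨C₁, hC₁, h1⟩ := abs_greenReg_le
  obtain ⟨C₂, hC₂, h2⟩ := abs_gradReg_sub_le
  obtain ⟨C₃, c, hC₃, hc, h3⟩ := neg_greenReg_ge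
  refine ⟨C₁ + C₃ + 1, c, by positivity, hc, fun η hη hη1 κ hκ hκ1 => ?_⟩
  -- The bound η² makes the logarithmic lower bound available at scale η; the other term makes the
  -- gradient error C₂ε/η³ at most κ/2, the second half of κ being left for the cut of the series.
  set ε : ℝ := min (η ^ 2) (κ * η ^ 3 / (2 * C₂)) with hεd
  have hε : 0 < ε := by positivity
  have hεη : ε ≤ η ^ 2 := min_le_left _ _
  have hε1 : ε ≤ 1 := hεη.trans (pow_le_one₀ hη.le hη1)
  have hεκ : C₂ * ε / η ^ 3 ≤ κ / 2 := by
    have := min_le_right (η ^ 2) (κ * η ^ 3 / (2 * C₂))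
    rw [← hεd, le_div_iff₀ (by positivity)] at this
    rw [div_le_div_iff₀ (by positivity) (by norm_num)]
    linarith
  have hsum := summable_heatWeight hε
  obtain ⟨s, hs⟩ : ∃ s : Finset (Fin 2 → ℤ), ∑' k : ↥{k | k ∉ s}, heatWeight ε k ≤ κ / 2 :=
    ((tendsto_tsum_compl_atTop_zero (heatWeight ε)).eventually_le_const
      (by positivity : (0 : ℝ) < κ / 2)).exists
  have hpot : ∀ v, |greenReg ε v - trigPot s (greenCoeff ε) (toTorus v)| ≤ κ / 2 := fun v =>
    abs_sub_sum_le_of_tail hsum hs (hasSum_greenReg hε v) fun k => by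
      rw [abs_mul]
      nlinarith [(abs_greenCoeff_mul_le ε k 0).1, abs_re_mFourier_le k (toTorus v),
        abs_nonneg (greenCoeff ε k)]
  have hgrad : ∀ i v, |gradReg ε i v - trigGrad s (greenCoeff ε) i (toTorus v)| ≤ κ / 2 := fun i v =>
    abs_sub_sum_le_of_tail hsum hs (hasSum_gradReg hε i v) fun k => by
      rw [abs_mul, show -(2 * Real.pi * k i) * greenCoeff ε k = -(2 * Real.pi * k i * greenCoeff ε k)
        by ring, abs_neg]
      nlinarith [(abs_greenCoeff_mul_le ε k i).2, abs_im_mFourier_le k (toTorus v),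
        abs_nonneg (2 * Real.pi * k i * greenCoeff ε k)]
  have hone : ∀ z : Torus, z ≠ 0 → 1 ≤ 1 / ‖z‖ := fun z hz => by
    rw [le_div_iff₀ (norm_pos_iff.2 hz)]
    have := norm_torus_le_half z
    linarith
  have hbd : ∀ z : Torus, z ≠ 0 → C₁ / ‖z‖ + κ / 2 ≤ (C₁ + C₃ + 1) / ‖z‖ := fun z hz => by
    have h5 : C₃ * (1 / ‖z‖) ≥ 0 := by positivity
    have := hone z hz
    calc C₁ / ‖z‖ + κ / 2 ≤ C₁ / ‖z‖ + C₃ * (1 / ‖z‖) + 1 / ‖z‖ := by linarith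
      _ = _ := by ring
  refine ⟨s, greenCoeff ε, fun z hz => ?_, fun z hz => ?_, fun z => ?_, fun z hz => ?_,
    fun z hz => ?_⟩
  · obtain ⟨v, rfl⟩ := toTorus_surjective z
    have key : ∀ i, |trigGrad s (greenCoeff ε) i (toTorus v)| ≤ (C₁ + C₃ + 1) / ‖toTorus v‖ :=
      fun i => by
        have e1 := (h1 ε hε.le v hz).2 i
        have e2 := hgrad i v
        have e3 := hbd _ hz
        rw [abs_le] at *
        constructor <;> linarith
    exact norm_vec_two_le (key 1) (by rw [abs_neg]; exact key 0)
  · obtain ⟨v, rfl⟩ := toTorus_surjective z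
    have hz0 : toTorus v ≠ 0 := norm_pos_iff.1 (hη.trans_le hz)
    have key : ∀ i, |trigGrad s (greenCoeff ε) i (toTorus v) - gradReg 0 i v| ≤ κ := fun i => by
      have e1 := h2 ε hε.le v hz0 i
      have e2 := hgrad i v
      have e3 : C₂ * ε / ‖toTorus v‖ ^ 3 ≤ C₂ * ε / η ^ 3 := by gcongr
      rw [abs_le] at *
      constructor <;> linarith
    rw [bsKernel_toTorus hz0, trigVel]
    have e : ![trigGrad s (greenCoeff ε) 1 (toTorus v), -trigGrad s (greenCoeff ε) 0 (toTorus v)] -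
        ![gradReg 0 1 v, -gradReg 0 0 v] =
      ![trigGrad s (greenCoeff ε) 1 (toTorus v) - gradReg 0 1 v,
        -(trigGrad s (greenCoeff ε) 0 (toTorus v) - gradReg 0 0 v)] := by
      ext i; fin_cases i <;> simp; ring
    rw [e]
    exact norm_vec_two_le (key 1) (by rw [abs_neg]; exact key 0)
  · obtain ⟨v, rfl⟩ := toTorus_surjective z
    have e1 := (h3 ε hε hε1 v).1
    have e2 := hpot v
    rw [abs_le] at e2
    linarith
  · obtain ⟨v, rfl⟩ := toTorus_surjective z
    have e1 := (h1 ε hε.le v hz).1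
    have e2 := hpot v
    have e3 := hbd _ hz
    rw [abs_le] at *
    linarith
  · obtain ⟨v, rfl, hv⟩ := exists_toTorus_eq z
    have e1 := (h3 ε hε hε1 v).2 η hη hη1 hεη fun i =>
      (hv i).le.trans ((norm_le_pi_norm (toTorus v) i).trans hz)
    have e2 := hpot v
    rw [abs_le] at e2
    linarith

lemma continuousAt_bsKernel {z : Torus} (hz : z ≠ 0) : ContinuousAt bsKernel z := by
  obtain ⟨C, hC, h⟩ := norm_bsKernel_add_sub_le
  have hz' : 0 < ‖z‖ := norm_pos_iff.2 hz
  rw [Metric.continuousAt_iff]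
  intro ε hε
  refine ⟨min (‖z‖ / 2) (ε / (C / ‖z‖ ^ 4 + 1)), by positivity, fun y hy => ?_⟩
  obtain ⟨d, hd, hd'⟩ := exists_toTorus_eq (y - z)
  have hdn : ‖d‖ ≤ dist y z := by
    rw [dist_eq_norm]
    exact (pi_norm_le_iff_of_nonneg (norm_nonneg _)).2 fun i => (hd' i).le.trans (norm_le_pi_norm _ i)
  have hy1 : ‖d‖ ≤ ‖z‖ / 2 := hdn.trans (hy.le.trans (min_le_left _ _))
  have hy2 : ‖d‖ < ε / (C / ‖z‖ ^ 4 + 1) := hdn.trans_lt (hy.trans_le (min_le_right _ _))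
  have e : y = z + toTorus d := by rw [hd]; abel
  rw [lt_div_iff₀ (by positivity)] at hy2
  rw [e, dist_eq_norm]
  refine (h z d hz hy1).trans_lt ?_
  nlinarith [norm_nonneg d]

lemma measurable_bsKernel : Measurable bsKernel := by
  have hc : ContinuousOn bsKernel {0}ᶜ := fun z hz => (continuousAt_bsKernel hz).continuousWithinAt
  exact measurable_of_measurable_on_compl_singleton 0
    (continuousOn_iff_continuous_domRestrict.1 hc).measurable

/-! ### Measure preserving shears -/

/-- A shear moves points along the orbits of γ by an amount that is constant on orbits. Translating
x by γ u replaces s x by u + s x; averaging over u and using the invariance of ν for fixed x removes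
s x, and what remains is a translation. -/
lemma measurePreserving_add_hom_of_invariant {G H : Type*} [AddCommGroup G] [MeasurableSpace G]
    [MeasurableAdd₂ G] [AddCommGroup H] [MeasurableSpace H] [MeasurableAdd₂ H]
    (μ : Measure G) [SFinite μ] [μ.IsAddLeftInvariant]
    (ν : Measure H) [IsProbabilityMeasure ν] [ν.IsAddLeftInvariant]
    {γ : H →+ G} (hγ : Measurable γ) {s : G → H} (hs : Measurable s)
    (hinv : ∀ x u, s (x + γ u) = s x) :
    MeasurePreserving (fun x => x + γ (s x)) μ μ := by
  have hm : Measurable fun x => x + γ (s x) := measurable_id.add (hγ.comp hs)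
  refine ⟨hm, Measure.ext fun A hA => ?_⟩
  rw [Measure.map_apply hm hA]
  set f : G → ℝ≥0∞ := A.indicator 1 with hf
  have hfm : Measurable f := measurable_one.indicator hA
  have h1 : μ ((fun x => x + γ (s x)) ⁻¹' A) = ∫⁻ x, f (x + γ (s x)) ∂μ := by
    rw [← lintegral_indicator_one (hm hA)]
    rfl
  have h2 : μ A = ∫⁻ x, f x ∂μ := (lintegral_indicator_one hA).symm
  have h3 : ∀ u, ∫⁻ x, f (x + γ (s x)) ∂μ = ∫⁻ x, f (x + γ (u + s x)) ∂μ := fun u => by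
    rw [← lintegral_add_right_eq_self _ (γ u)]
    simp_rw [hinv, map_add, add_assoc]
  have h4 : ∀ u, ∫⁻ x, f x ∂μ = ∫⁻ x, f (x + γ u) ∂μ := fun u =>
    (lintegral_add_right_eq_self _ (γ u)).symm
  calc μ ((fun x => x + γ (s x)) ⁻¹' A) = ∫⁻ u, ∫⁻ x, f (x + γ (u + s x)) ∂μ ∂ν := by
        rw [h1]
        simp_rw [← h3]
        simp
    _ = ∫⁻ x, ∫⁻ u, f (x + γ (u + s x)) ∂ν ∂μ := by
        refine lintegral_lintegral_swap (Measurable.aemeasurable ?_)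
        exact hfm.comp (measurable_snd.add (hγ.comp (measurable_fst.add (hs.comp measurable_snd))))
    _ = ∫⁻ x, ∫⁻ u, f (x + γ u) ∂ν ∂μ := by
        refine lintegral_congr fun x => ?_
        exact lintegral_add_right_eq_self (fun u => f (x + γ u)) (s x)
    _ = ∫⁻ u, ∫⁻ x, f (x + γ u) ∂μ ∂ν := by
        refine lintegral_lintegral_swap (Measurable.aemeasurable ?_)
        exact hfm.comp (measurable_fst.add (hγ.comp measurable_snd))
    _ = μ A := by
        simp_rw [← h4]
        simp [h2]

instance : IsProbabilityMeasure (volume : Measure UnitAddCircle) := ⟨UnitAddCircle.measure_univ⟩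

instance : IsProbabilityMeasure (volume : Measure Torus) :=
  Measure.pi.instIsProbabilityMeasure (fun _ : Fin 2 => (volume : Measure UnitAddCircle))

section Instances

variable {ι : Type*} [Fintype ι]

instance : BorelSpace (ι → Torus) := Pi.borelSpace (X := fun _ : ι => Torus)

instance : Measure.IsAddLeftInvariant (volume : Measure (ι → Torus)) :=
  Measure.pi.isAddLeftInvariant (fun _ : ι => (volume : Measure Torus))

instance : IsProbabilityMeasure (volume : Measure (ι → Torus)) :=
  Measure.pi.instIsProbabilityMeasure (fun _ : ι => (volume : Measure Torus))

end Instances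

/-- The projection of displacements to configurations. -/
def toConfig {ι : Type*} (D : ι → Fin 2 → ℝ) : ι → Torus := fun v => toTorus (D v)

lemma toConfig_add {ι : Type*} (D D' : ι → Fin 2 → ℝ) :
    toConfig (D + D') = toConfig D + toConfig D' := funext fun _ => toTorus_add _ _

@[simp] lemma toConfig_zero {ι : Type*} : toConfig (0 : ι → Fin 2 → ℝ) = 0 :=
  funext fun _ => toTorus_zero

lemma continuous_toConfig {ι : Type*} : Continuous (toConfig (ι := ι)) :=
  continuous_pi fun v => continuous_toTorus.comp (continuous_apply v)

/-- The direction of the shear of frequency `k`. -/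
def perp (k : Fin 2 → ℤ) : Fin 2 → ℝ := ![k 1, -k 0]

lemma mFourier_add_apply (k : Fin 2 → ℤ) (x y : Torus) :
    UnitAddTorus.mFourier k (x + y) = UnitAddTorus.mFourier k x * UnitAddTorus.mFourier k y := by
  simp only [UnitAddTorus.mFourier, ContinuousMap.coe_mk, Pi.add_apply, ← Finset.prod_mul_distrib]
  refine Finset.prod_congr rfl fun i _ => ?_
  rw [fourier_apply, fourier_apply, fourier_apply, smul_add, AddCircle.toCircle_add, Circle.coe_mul]

/-- The direction `perp k` is orthogonal to k, so the character is constant along it: a single mode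
generates a shear. -/
lemma mFourier_perp (k : Fin 2 → ℤ) (β : ℝ) : UnitAddTorus.mFourier k (toTorus (β • perp k)) = 1 := by
  rw [mFourier_toTorus]
  simp [perp]
  ring_nf
  simp

set_option linter.unusedSectionVars false

section Shears

variable {ι : Type*} [Fintype ι] [DecidableEq ι]

/-- The field of the shear `(v, w, k)`. -/
def shearField (c : (Fin 2 → ℤ) → ℝ) (j : ι × ι × (Fin 2 → ℤ)) (X : ι → Torus) : ι → Fin 2 → ℝ :=
  Pi.single j.1 ((c j.2.2 * (UnitAddTorus.mFourier j.2.2 (X j.1 - X j.2.1)).im) • perp j.2.2)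

lemma continuous_shearField (c : (Fin 2 → ℤ) → ℝ) (j : ι × ι × (Fin 2 → ℤ)) :
    Continuous (shearField c j) := by
  have : Continuous fun X : ι → Torus =>
      (c j.2.2 * (UnitAddTorus.mFourier j.2.2 (X j.1 - X j.2.1)).im) • perp j.2.2 := by
    have h1 : Continuous fun X : ι → Torus => X j.1 - X j.2.1 :=
      (continuous_apply _).sub (continuous_apply _)
    exact (continuous_const.mul (Complex.continuous_im.comp
      ((UnitAddTorus.mFourier j.2.2).continuous.comp h1))).smul continuous_const
  exact (continuous_single j.1).comp this

/-- The vortex v moves along `perp k` by an amount that depends only on e_k(X_v - X_w), which the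
motion leaves unchanged. Since `perp k` is an integer vector, its line closes up on the torus, and
displacements along it form the image γ of a circle, whose invariant probability measure can be
averaged over. -/
lemma measurePreserving_shear (c : (Fin 2 → ℤ) → ℝ) {j : ι × ι × (Fin 2 → ℤ)} (hj : j.1 ≠ j.2.1)
    (α : ℝ) : MeasurePreserving (fun X => X + toConfig (α • shearField c j X))
      (volume : Measure (ι → Torus)) volume := by
  obtain ⟨v, w, k⟩ := j
  simp only at hj
  let γ : UnitAddCircle →+ (ι → Torus) :=
    { toFun := fun u => Pi.single v ![k 1 • u, -(k 0 • u)]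
      map_zero' := by
        rw [Pi.single_eq_zero_iff]
        ext i; fin_cases i <;> simp
      map_add' := fun a b => by
        rw [← Pi.single_add]
        congr 1
        ext i; fin_cases i
        · simp
        · simp; abel }
  have hγc : Continuous γ := by
    refine (continuous_single v).comp (continuous_pi fun i => ?_)
    fin_cases i
    · exact continuous_zsmul _
    · exact (continuous_zsmul _).neg
  have hγ : ∀ β : ℝ, γ (β : UnitAddCircle) = toConfig (Pi.single v (β • perp k)) := fun β => by
    funext u
    by_cases hu : u = v
    · subst hu
      show (Pi.single u _ : ι → Torus) u = toTorus ((Pi.single u _ : ι → Fin 2 → ℝ) u)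
      rw [Pi.single_eq_same, Pi.single_eq_same]
      ext i; fin_cases i
      · show k 1 • (β : UnitAddCircle) = ((β * (k 1 : ℝ) : ℝ) : UnitAddCircle)
        rw [← AddCircle.coe_zsmul, zsmul_eq_mul, mul_comm]
      · show -(k 0 • (β : UnitAddCircle)) = ((β * (-(k 0 : ℝ)) : ℝ) : UnitAddCircle)
        rw [← AddCircle.coe_zsmul, zsmul_eq_mul, mul_neg, AddCircle.coe_neg, mul_comm]
    · show (Pi.single v _ : ι → Torus) u = toTorus ((Pi.single v _ : ι → Fin 2 → ℝ) u)
      rw [Pi.single_eq_of_ne hu, Pi.single_eq_of_ne hu, toTorus_zero]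
  let s : (ι → Torus) → UnitAddCircle := fun X =>
    ((α * (c k * (UnitAddTorus.mFourier k (X v - X w)).im) : ℝ) : UnitAddCircle)
  have hs : Measurable s := by
    have h1 : Continuous fun X : ι → Torus => X v - X w :=
      (continuous_apply _).sub (continuous_apply _)
    exact ((AddCircle.continuous_mk' (1 : ℝ)).comp (continuous_const.mul (continuous_const.mul
      (Complex.continuous_im.comp ((UnitAddTorus.mFourier k).continuous.comp h1))))).measurable
  have hinv : ∀ x u, s (x + γ u) = s x := fun x u => by
    obtain ⟨β, rfl⟩ := QuotientAddGroup.mk_surjective u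
    have e : (x + γ (β : UnitAddCircle)) v - (x + γ (β : UnitAddCircle)) w =
        (x v - x w) + toTorus (β • perp k) := by
      rw [hγ]
      simp only [Pi.add_apply, toConfig, Pi.single_eq_same, Pi.single_eq_of_ne hj.symm, toTorus_zero]
      abel
    simp only [s]
    rw [show (QuotientAddGroup.mk β : UnitAddCircle) = (β : UnitAddCircle) from rfl, e,
      mFourier_add_apply, mFourier_perp, mul_one]
  have key := measurePreserving_add_hom_of_invariant (volume : Measure (ι → Torus))
    (volume : Measure UnitAddCircle) hγc.measurable hs hinv
  refine (congrArg (fun f => MeasurePreserving f _ _) (funext fun X => ?_)).mp key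
  simp only [s, hγ, shearField, ← Pi.single_smul, smul_smul]

/-- The displacement produced by the composition of a list of shears with amplitudes `α`. -/
def shearDisp (c : (Fin 2 → ℤ) → ℝ) (α : ι × ι × (Fin 2 → ℤ) → ℝ) :
    List (ι × ι × (Fin 2 → ℤ)) → (ι → Torus) → ι → Fin 2 → ℝ
  | [], _ => 0
  | j :: l, X => α j • shearField c j X + shearDisp c α l (X + toConfig (α j • shearField c j X))

lemma measurePreserving_shearDisp (c : (Fin 2 → ℤ) → ℝ) (α : ι × ι × (Fin 2 → ℤ) → ℝ) :
    ∀ l : List (ι × ι × (Fin 2 → ℤ)), (∀ j ∈ l, j.1 ≠ j.2.1) →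
    MeasurePreserving (fun X => X + toConfig (shearDisp c α l X))
      (volume : Measure (ι → Torus)) volume
  | [], _ => by
    simp only [shearDisp, toConfig_zero, add_zero]
    exact MeasurePreserving.id (volume : Measure (ι → Torus))
  | j :: l, h => by
    have h1 := measurePreserving_shear c (h j List.mem_cons_self) (α j)
    have h2 := measurePreserving_shearDisp c α l fun j' hj' => h j' (List.mem_cons_of_mem _ hj')
    refine (congrArg (fun f => MeasurePreserving f _ _) (funext fun X => ?_)).mp (h2.comp h1)
    simp only [Function.comp, shearDisp, toConfig_add]
    abel

lemma measurable_shearDisp {𝓔 : Type*} [MeasurableSpace 𝓔] (c : (Fin 2 → ℤ) → ℝ)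
    {α : 𝓔 → ι × ι × (Fin 2 → ℤ) → ℝ} (hα : ∀ j, Measurable fun e => α e j) :
    ∀ l : List (ι × ι × (Fin 2 → ℤ)), Measurable fun p : 𝓔 × (ι → Torus) => shearDisp c (α p.1) l p.2
  | [] => measurable_const
  | j :: l => by
    have h1 : Measurable fun p : 𝓔 × (ι → Torus) => α p.1 j • shearField c j p.2 :=
      ((hα j).comp measurable_fst).smul ((continuous_shearField c j).measurable.comp measurable_snd)
    have h2 : Measurable fun p : 𝓔 × (ι → Torus) =>
        (p.1, p.2 + toConfig (α p.1 j • shearField c j p.2)) :=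
      measurable_fst.prodMk (measurable_snd.add (continuous_toConfig.measurable.comp h1))
    exact h1.add ((measurable_shearDisp c hα l).comp h2)

/-- Composing the shears differs from adding their fields only to second order in the amplitude:
each shear sees a configuration that the previous ones have moved by O(a). -/
lemma norm_shearDisp_sub_le {c : (Fin 2 → ℤ) → ℝ} {α : ι × ι × (Fin 2 → ℤ) → ℝ} {a B : ℝ}
    (hα : ∀ j, |α j| ≤ a) :
    ∀ l : List (ι × ι × (Fin 2 → ℤ)), (∀ j ∈ l, ∀ X, ‖shearField c j X‖ ≤ B) →
    (∀ j ∈ l, ∀ X D, ‖shearField c j (X + toConfig D) - shearField c j X‖ ≤ B * ‖D‖) → ∀ X,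
    ‖shearDisp c α l X - (l.map fun j => α j • shearField c j X).sum‖ ≤ (l.length * B * a) ^ 2
  | [], _, _, X => by simp [shearDisp]
  | j :: l, hb, hL, X => by
    have ha : 0 ≤ a := (abs_nonneg _).trans (hα j)
    have hB : 0 ≤ B := (norm_nonneg _).trans (hb j List.mem_cons_self X)
    set δ := α j • shearField c j X with hδ
    have hδn : ‖δ‖ ≤ a * B := by
      rw [hδ, norm_smul]
      exact mul_le_mul (hα j) (hb j List.mem_cons_self X) (norm_nonneg _) ha
    have ih := norm_shearDisp_sub_le (c := c) hα l (fun j' hj' => hb j' (List.mem_cons_of_mem _ hj'))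
      (fun j' hj' => hL j' (List.mem_cons_of_mem _ hj')) (X + toConfig δ)
    have hsum : ∀ l' : List (ι × ι × (Fin 2 → ℤ)), (∀ j' ∈ l', j' ∈ l) →
        ‖(l'.map fun j => α j • shearField c j (X + toConfig δ)).sum -
        (l'.map fun j => α j • shearField c j X).sum‖ ≤ l'.length * (a * (B * (a * B))) := by
      intro l'
      induction l' with
      | nil => simp
      | cons i l' ihl =>
        intro h
        simp only [List.map_cons, List.sum_cons, List.length_cons]
        rw [add_sub_add_comm, ← smul_sub]
        refine (norm_add_le _ _).trans ?_
        have h1 := ihl fun j' hj' => h j' (List.mem_cons_of_mem _ hj')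
        have h2 : ‖α i • (shearField c i (X + toConfig δ) - shearField c i X)‖ ≤
            a * (B * (a * B)) := by
          rw [norm_smul]
          refine mul_le_mul (hα i) ?_ (norm_nonneg _) ha
          refine (hL i (List.mem_cons_of_mem _ (h i List.mem_cons_self)) X δ).trans ?_
          gcongr
        push_cast
        linarith
    have h3 := hsum l fun _ h => h
    simp only [shearDisp, List.map_cons, List.sum_cons, List.length_cons]
    rw [add_sub_add_left_eq_sub]
    have h4 := norm_add_le (shearDisp c α l (X + toConfig δ) -
      (l.map fun j => α j • shearField c j (X + toConfig δ)).sum)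
      ((l.map fun j => α j • shearField c j (X + toConfig δ)).sum -
        (l.map fun j => α j • shearField c j X).sum)
    rw [sub_add_sub_cancel] at h4
    refine h4.trans ((add_le_add ih h3).trans ?_)
    push_cast
    have : (0 : ℝ) ≤ l.length := Nat.cast_nonneg _
    nlinarith [mul_nonneg this (mul_nonneg (mul_nonneg ha hB) (mul_nonneg ha hB)),
      mul_nonneg (mul_nonneg ha hB) (mul_nonneg ha hB)]

end Shears

/-! ### Discrete schemes that preserve the uniform measure -/

lemma norm_mFourier_apply (k : Fin 2 → ℤ) (z : Torus) : ‖UnitAddTorus.mFourier k z‖ = 1 := by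
  obtain ⟨v, rfl⟩ := toTorus_surjective z
  rw [mFourier_toTorus, Complex.norm_exp]
  simp

/-- The phase `2π k·d`. -/
def phase (k : Fin 2 → ℤ) (d : Fin 2 → ℝ) : ℝ := 2 * Real.pi * (k 0 * d 0 + k 1 * d 1)

/-- A Lipschitz constant of the character of frequency `k`. -/
def freqLip (k : Fin 2 → ℤ) : ℝ := 2 * Real.pi * (|(k 0 : ℝ)| + |(k 1 : ℝ)|)

lemma freqLip_nonneg (k : Fin 2 → ℤ) : 0 ≤ freqLip k := by unfold freqLip; positivity

lemma abs_phase_le (k : Fin 2 → ℤ) (d : Fin 2 → ℝ) : |phase k d| ≤ freqLip k * ‖d‖ := by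
  rw [phase, freqLip, abs_mul, abs_of_pos Real.two_pi_pos, mul_assoc (2 * Real.pi) _ ‖d‖]
  refine mul_le_mul_of_nonneg_left ?_ Real.two_pi_pos.le
  refine (abs_add_le _ _).trans ?_
  rw [abs_mul, abs_mul, add_mul]
  gcongr
  · exact norm_le_pi_norm d 0
  · exact norm_le_pi_norm d 1

lemma mFourier_toTorus_eq_exp_phase (k : Fin 2 → ℤ) (d : Fin 2 → ℝ) :
    UnitAddTorus.mFourier k (toTorus d) = Complex.exp (Complex.I * phase k d) := by
  rw [mFourier_toTorus, phase]
  congr 1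
  push_cast
  ring

lemma norm_mFourier_add_sub_le (k : Fin 2 → ℤ) (z : Torus) (d : Fin 2 → ℝ) :
    ‖UnitAddTorus.mFourier k (z + toTorus d) - UnitAddTorus.mFourier k z‖ ≤ freqLip k * ‖d‖ := by
  rw [mFourier_add_apply, mFourier_toTorus_eq_exp_phase, ← mul_sub_one, norm_mul,
    norm_mFourier_apply, one_mul]
  exact Real.norm_exp_I_mul_ofReal_sub_one_le.trans (abs_phase_le k d)

lemma norm_exp_I_mul_sub_le (x : ℝ) :
    ‖Complex.exp (Complex.I * x) - 1 - Complex.I * x‖ ≤ 3 * x ^ 2 := by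
  have hn : ‖Complex.I * (x : ℂ)‖ = |x| := by simp
  rcases le_or_gt |x| 1 with h | h
  · refine (Complex.norm_exp_sub_one_sub_id_le (hn.trans_le h)).trans ?_
    rw [hn, sq_abs]
    nlinarith [sq_nonneg x]
  · refine (norm_sub_le _ _).trans ?_
    have h1 := Real.norm_exp_I_mul_ofReal_sub_one_le (x := x)
    rw [Real.norm_eq_abs] at h1
    rw [hn, ← sq_abs]
    nlinarith

lemma norm_mFourier_add_sub_sub_le (k : Fin 2 → ℤ) (z : Torus) (d : Fin 2 → ℝ) :
    ‖UnitAddTorus.mFourier k (z + toTorus d) - UnitAddTorus.mFourier k z -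
      Complex.I * phase k d * UnitAddTorus.mFourier k z‖ ≤ 3 * (freqLip k * ‖d‖) ^ 2 := by
  rw [mFourier_add_apply, mFourier_toTorus_eq_exp_phase, show ∀ a b c : ℂ,
    a * b - a - c * a = a * (b - 1 - c) from fun a b c => by ring, norm_mul,
    norm_mFourier_apply, one_mul]
  refine (norm_exp_I_mul_sub_le _).trans ?_
  have := abs_phase_le k d
  rw [← sq_abs]
  gcongr

lemma exists_trigPot_taylor (s : Finset (Fin 2 → ℤ)) (g : (Fin 2 → ℤ) → ℝ) :
    ∃ E : ℝ, 0 ≤ E ∧ ∀ z d, |trigPot s g (z + toTorus d) - trigPot s g z -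
      ∑ i, trigGrad s g i z * d i| ≤ E * ‖d‖ ^ 2 := by
  refine ⟨∑ k ∈ s, |g k| * (3 * freqLip k ^ 2), by positivity, fun z d => ?_⟩
  have e : trigPot s g (z + toTorus d) - trigPot s g z - ∑ i, trigGrad s g i z * d i =
      ∑ k ∈ s, g k * (UnitAddTorus.mFourier k (z + toTorus d) - UnitAddTorus.mFourier k z -
      Complex.I * phase k d * UnitAddTorus.mFourier k z).re := by
    rw [Fin.sum_univ_two, trigPot, trigPot, trigGrad, trigGrad, Finset.sum_mul, Finset.sum_mul,
      ← Finset.sum_add_distrib, ← Finset.sum_sub_distrib, ← Finset.sum_sub_distrib]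
    refine Finset.sum_congr rfl fun k _ => ?_
    have : (Complex.I * phase k d * UnitAddTorus.mFourier k z).re =
        -(phase k d * (UnitAddTorus.mFourier k z).im) := by
      rw [mul_assoc, Complex.I_mul_re, Complex.im_ofReal_mul]
    rw [Complex.sub_re, Complex.sub_re, this, phase]
    ring
  rw [e, Finset.sum_mul]
  refine (Finset.abs_sum_le_sum_abs _ _).trans (Finset.sum_le_sum fun k _ => ?_)
  rw [abs_mul, mul_assoc |g k|]
  refine mul_le_mul_of_nonneg_left ?_ (abs_nonneg _)
  refine (Complex.abs_re_le_norm _).trans ((norm_mFourier_add_sub_sub_le k z d).trans (le_of_eq ?_))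
  ring

lemma trigVel_eq_sum (s : Finset (Fin 2 → ℤ)) (g : (Fin 2 → ℤ) → ℝ) (z : Torus) :
    trigVel s g z = ∑ k ∈ s, ((-(2 * Real.pi) * g k) * (UnitAddTorus.mFourier k z).im) • perp k := by
  ext i
  rw [Finset.sum_apply]
  fin_cases i
  · simp only [trigVel, trigGrad, perp, Fin.zero_eta, Matrix.cons_val_zero, Pi.smul_apply, smul_eq_mul]
    refine Finset.sum_congr rfl fun k _ => ?_
    ring
  · simp only [trigVel, trigGrad, perp, Fin.mk_one, Matrix.cons_val_one, Matrix.cons_val_fin_one,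
      Pi.smul_apply, smul_eq_mul, ← Finset.sum_neg_distrib]
    refine Finset.sum_congr rfl fun k _ => ?_
    ring

section Scheme

variable {ι : Type*} [Fintype ι] [DecidableEq ι]

/-- The shears whose fields add up to the velocity field of the frequencies in `s`. -/
def shearList (ι : Type*) [Fintype ι] [DecidableEq ι] (s : Finset (Fin 2 → ℤ)) :
    List (ι × ι × (Fin 2 → ℤ)) :=
  ((Finset.univ ×ˢ Finset.univ ×ˢ s).filter fun j : ι × ι × (Fin 2 → ℤ) => j.1 ≠ j.2.1).toList

lemma sum_shearList_apply (s : Finset (Fin 2 → ℤ)) (g : (Fin 2 → ℤ) → ℝ) (A : ι → ι → ℝ)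
    (X : ι → Torus) (v : ι) :
    ((shearList ι s).map fun j => A j.1 j.2.1 •
      shearField (fun k => -(2 * Real.pi) * g k) j X).sum v =
    ∑ w ∈ Finset.univ.erase v, A v w • trigVel s g (X v - X w) := by
  rw [shearList, Finset.sum_map_toList, Finset.sum_filter, Finset.sum_product, Finset.sum_apply,
    Finset.sum_eq_single v]
  · rw [Finset.sum_product, Finset.sum_apply, ← Finset.filter_ne', Finset.sum_filter]
    refine Finset.sum_congr rfl fun w _ => ?_
    rw [Finset.sum_apply]
    by_cases h : w = v
    · simp [h]
    · simp only [ne_eq, Ne.symm h, not_false_eq_true, if_true, h, Pi.smul_apply, shearField,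
        Pi.single_eq_same, trigVel_eq_sum, Finset.smul_sum]
  · intro u _ hu
    rw [Finset.sum_apply]
    refine Finset.sum_eq_zero fun w _ => ?_
    split_ifs
    · simp [shearField, Pi.single_eq_of_ne hu.symm]
    · rfl
  · simp

lemma exists_shearField_bound (s : Finset (Fin 2 → ℤ)) (c : (Fin 2 → ℤ) → ℝ) :
    ∃ B : ℝ, 0 ≤ B ∧ ∀ j ∈ shearList ι s, (∀ X, ‖shearField c j X‖ ≤ B) ∧
      ∀ X D, ‖shearField c j (X + toConfig D) - shearField c j X‖ ≤ B * ‖D‖ := by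
  refine ⟨∑ k ∈ s, |c k| * ‖perp k‖ * (1 + 2 * freqLip k), ?_, ?_⟩
  · refine Finset.sum_nonneg fun k _ => ?_
    have := freqLip_nonneg k
    positivity
  rintro ⟨v, w, k⟩ hj
  have hk : k ∈ s := by
    simp only [shearList, Finset.mem_toList, Finset.mem_filter, Finset.mem_product,
      Finset.mem_univ, true_and] at hj
    exact hj.1
  have hle : |c k| * ‖perp k‖ * (1 + 2 * freqLip k) ≤
      ∑ k ∈ s, |c k| * ‖perp k‖ * (1 + 2 * freqLip k) :=
    Finset.single_le_sum (f := fun k => |c k| * ‖perp k‖ * (1 + 2 * freqLip k))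
      (fun k _ => by have := freqLip_nonneg k; positivity) hk
  have hL := freqLip_nonneg k
  refine ⟨fun X => le_trans ?_ hle, fun X D => ?_⟩
  · rw [shearField, Pi.norm_single, norm_smul, Real.norm_eq_abs, abs_mul]
    have h1 := abs_im_mFourier_le k (X v - X w)
    have h2 : |c k| * |(UnitAddTorus.mFourier k (X v - X w)).im| * ‖perp k‖ ≤
      |c k| * 1 * ‖perp k‖ := by gcongr
    have h3 : 0 ≤ |c k| * ‖perp k‖ * freqLip k := by positivity
    simp only
    nlinarith
  · refine le_trans ?_ (mul_le_mul_of_nonneg_right hle (norm_nonneg _))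
    rw [shearField, shearField, ← Pi.single_sub, Pi.norm_single, ← sub_smul, ← mul_sub, norm_smul,
      Real.norm_eq_abs, abs_mul]
    simp only
    have e : (X + toConfig D) v - (X + toConfig D) w = X v - X w + toTorus (D v - D w) := by
      rw [sub_eq_add_neg (D v), toTorus_add, toTorus_neg]
      simp only [Pi.add_apply, toConfig]
      abel
    have h1 : |(UnitAddTorus.mFourier k ((X + toConfig D) v - (X + toConfig D) w)).im -
        (UnitAddTorus.mFourier k (X v - X w)).im| ≤ freqLip k * (2 * ‖D‖) := by
      rw [e, ← Complex.sub_im]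
      refine (Complex.abs_im_le_norm _).trans ((norm_mFourier_add_sub_le k _ _).trans ?_)
      refine mul_le_mul_of_nonneg_left ?_ hL
      have := norm_le_pi_norm D v
      have := norm_le_pi_norm D w
      linarith [norm_sub_le (D v) (D w)]
    have h2 : 0 ≤ |c k| * ‖perp k‖ * ‖D‖ := by positivity
    have h3 : 0 ≤ |c k| * ‖perp k‖ := by positivity
    nlinarith [mul_le_mul_of_nonneg_left h1 h3]

/-- Explicit one-step maps composed of shears approximate the flow of the vortices interacting
through a trigonometric kernel, up to a quadratic error, and preserve the uniform measure. -/
theorem exists_scheme (s : Finset (Fin 2 → ℤ)) (g : (Fin 2 → ℤ) → ℝ) :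
    ∃ E : ℝ, 0 ≤ E ∧ ∀ (𝓔 : Type*) [MeasurableSpace 𝓔] (A : ℕ → 𝓔 → ι → ι → ℝ) (a : ℝ),
      (∀ i v w, Measurable fun e => A i e v w) → (∀ i e v w, |A i e v w| ≤ a) →
      ∃ D : ℕ → 𝓔 × (ι → Torus) → ι → Fin 2 → ℝ, (∀ i, Measurable (D i)) ∧ (∀ p, D 0 p = 0) ∧
        (∀ i e, MeasurePreserving (fun Y => Y + toConfig (D i (e, Y)))
          (volume : Measure (ι → Torus)) volume) ∧
        ∀ i p v, ‖D (i + 1) p v - D i p v - ∑ w ∈ Finset.univ.erase v,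
          A i p.1 v w • trigVel s g ((p.2 + toConfig (D i p)) v - (p.2 + toConfig (D i p)) w)‖ ≤
            E * a ^ 2 := by
  set c : (Fin 2 → ℤ) → ℝ := fun k => -(2 * Real.pi) * g k with hc
  obtain ⟨B, hB, hBl⟩ := exists_shearField_bound (ι := ι) s c
  refine ⟨((shearList ι s).length * B) ^ 2, by positivity, fun 𝓔 _ A a hA hAa => ?_⟩
  set α : ℕ → 𝓔 → ι × ι × (Fin 2 → ℤ) → ℝ := fun i e j => A i e j.1 j.2.1 with hα
  -- Displacements in ℝ² are recorded, not positions on the torus, so that they can be compared with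
  -- integrals of the velocity.
  let D : ℕ → 𝓔 × (ι → Torus) → ι → Fin 2 → ℝ := fun i => Nat.rec (fun _ => 0)
    (fun i Di p => Di p + shearDisp c (α i p.1) (shearList ι s) (p.2 + toConfig (Di p))) i
  have hD : ∀ i p, D (i + 1) p =
      D i p + shearDisp c (α i p.1) (shearList ι s) (p.2 + toConfig (D i p)) := fun i p => rfl
  have hne : ∀ j ∈ shearList ι s, j.1 ≠ j.2.1 := fun j hj => by
    simp only [shearList, Finset.mem_toList, Finset.mem_filter] at hj
    exact hj.2
  have hDm : ∀ i, Measurable (D i) := by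
    intro i
    induction i with
    | zero => exact measurable_const
    | succ i ih =>
      have h1 := measurable_shearDisp c (α := α i) (fun j => hA i j.1 j.2.1) (shearList ι s)
      have h2 : Measurable fun p : 𝓔 × (ι → Torus) => (p.1, p.2 + toConfig (D i p)) :=
        measurable_fst.prodMk (measurable_snd.add (continuous_toConfig.measurable.comp ih))
      exact ih.add (h1.comp h2)
  refine ⟨D, hDm, fun p => rfl, fun i e => ?_, fun i p v => ?_⟩
  · induction i with
    | zero =>
      have : (fun Y => Y + toConfig (D 0 (e, Y))) = id := by
        funext Y
        show Y + toConfig 0 = Y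
        rw [toConfig_zero, add_zero]
      rw [this]
      exact MeasurePreserving.id _
    | succ i ih =>
      have h := (measurePreserving_shearDisp c (α i e) (shearList ι s) hne).comp ih
      refine (congrArg (fun f => MeasurePreserving f _ _) (funext fun X => ?_)).mp h
      simp only [Function.comp, hD, toConfig_add]
      abel
  · have h := norm_shearDisp_sub_le (α := α i p.1) (fun j => hAa i p.1 j.1 j.2.1) (shearList ι s)
      (fun j hj => (hBl j hj).1) (fun j hj => (hBl j hj).2) (p.2 + toConfig (D i p))
    rw [← mul_pow]
    refine le_trans (le_trans (le_of_eq ?_) (norm_le_pi_norm _ v)) h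
    rw [hD, Pi.sub_apply, sum_shearList_apply, Pi.add_apply, add_sub_cancel_left]

end Scheme

/-! ### Singular integrals over configurations -/

lemma lintegral_circle_lt_top : ∫⁻ u : UnitAddCircle, ‖u‖ₑ ^ (-(1 / 2) : ℝ) < ⊤ := by
  rw [← UnitAddCircle.lintegral_preimage 0, zero_add]
  have hle : ∀ a ∈ Set.Ioo (0 : ℝ) 1, ‖(a : UnitAddCircle)‖ₑ ^ (-(1 / 2) : ℝ) ≤
      ENNReal.ofReal (a ^ (-(1 / 2) : ℝ)) + ENNReal.ofReal ((1 - a) ^ (-(1 / 2) : ℝ)) := by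
    intro a ha
    have h : ‖(a : UnitAddCircle)‖ = a ∨ ‖(a : UnitAddCircle)‖ = 1 - a := by
      rw [UnitAddCircle.norm_eq]
      have h1 := abs_sub_round a
      rw [abs_le] at h1
      have h2 : round a < 2 := by
        have : (round a : ℝ) < 2 := by linarith [ha.2]
        exact_mod_cast this
      have h3 : -1 < round a := by
        have : (-1 : ℝ) < round a := by linarith [ha.1]
        exact_mod_cast this
      have h4 : round a = 0 ∨ round a = 1 := by omega
      rcases h4 with h4 | h4 <;> rw [h4]
      · left; simp [ha.1.le]
      · right; rw [abs_of_nonpos] <;> simp [ha.2.le]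
    rw [← ofReal_norm]
    rcases h with h | h <;> rw [h, ENNReal.ofReal_rpow_of_pos (by linarith [ha.1, ha.2])]
    · exact le_self_add
    · exact le_add_self
  have hi1 : IntervalIntegrable (fun a : ℝ => a ^ (-(1 / 2) : ℝ)) volume 0 1 :=
    intervalIntegral.intervalIntegrable_rpow' (by norm_num)
  have hi2 : IntervalIntegrable (fun a : ℝ => (1 - a) ^ (-(1 / 2) : ℝ)) volume 0 1 := by
    have := hi1.comp_sub_left 1
    simp only [sub_zero, sub_self] at this
    exact this.symm
  have hh : ∀ f : ℝ → ℝ, IntervalIntegrable f volume 0 1 →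
      ∫⁻ a in Set.Ioo (0 : ℝ) 1, ENNReal.ofReal (f a) < ⊤ := fun f hf => by
    rw [intervalIntegrable_iff_integrableOn_Ioo_of_le zero_le_one] at hf
    refine lt_of_le_of_lt (lintegral_mono fun a => ?_) hf.2
    rw [← ofReal_norm]
    exact ENNReal.ofReal_le_ofReal (le_abs_self _)
  rw [← Measure.restrict_congr_set (Ioo_ae_eq_Ioc (μ := volume) (a := (0 : ℝ)) (b := 1))]
  refine (setLIntegral_mono' measurableSet_Ioo hle).trans_lt ?_
  rw [lintegral_add_left (by fun_prop)]
  exact ENNReal.add_lt_top.2 ⟨hh _ hi1, hh _ hi2⟩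

/-- For the sup norm, ‖z‖⁻¹ is at most the product of the powers -1/2 of the two coordinates, and
each of these is integrable on the circle. -/
lemma lintegral_inv_enorm_lt_top : ∫⁻ z : Torus, ‖z‖ₑ⁻¹ < ⊤ := by
  have hm : Measurable fun u : UnitAddCircle => ‖u‖ₑ ^ (-(1 / 2) : ℝ) := by fun_prop
  have hle : ∀ z : Torus, ‖z‖ₑ⁻¹ ≤ ‖z 0‖ₑ ^ (-(1 / 2) : ℝ) * ‖z 1‖ₑ ^ (-(1 / 2) : ℝ) := by
    intro z
    have h1 : ∀ i, ‖z‖ₑ ^ (-(1 / 2) : ℝ) ≤ ‖z i‖ₑ ^ (-(1 / 2) : ℝ) := fun i => by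
      rw [ENNReal.rpow_neg, ENNReal.rpow_neg, ENNReal.inv_le_inv]
      refine ENNReal.rpow_le_rpow ?_ (by norm_num)
      rw [enorm_le_iff_norm_le]
      exact norm_le_pi_norm z i
    refine le_trans ?_ (mul_le_mul' (h1 0) (h1 1))
    rw [ENNReal.rpow_neg, ← ENNReal.mul_inv (by simp) (by simp), ← ENNReal.rpow_add_of_nonneg _ _ (by norm_num) (by norm_num)]
    norm_num
  refine (lintegral_mono hle).trans_lt ?_
  have h2 := (volume_preserving_finTwoArrow UnitAddCircle).lintegral_comp
    (f := fun p => ‖p.1‖ₑ ^ (-(1 / 2) : ℝ) * ‖p.2‖ₑ ^ (-(1 / 2) : ℝ)) (by fun_prop)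
  refine (le_of_eq h2).trans_lt ?_
  rw [Measure.volume_eq_prod, lintegral_prod_mul hm.aemeasurable hm.aemeasurable]
  exact ENNReal.mul_lt_top lintegral_circle_lt_top lintegral_circle_lt_top

section Energy

variable {ι : Type*} [Fintype ι] [DecidableEq ι]
-- The coordinate X_u is uniform and independent of the others: translate it by a and average over
-- a.
lemma lintegral_sub_mul {p : Torus → ℝ≥0∞} (hp : Measurable p) {F : (ι → Torus) → ℝ≥0∞}
    (hF : Measurable F) {u v : ι} (huv : u ≠ v)
    (hinv : ∀ X a, F (X + Pi.single u a) = F X) :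
    ∫⁻ X : ι → Torus, p (X v - X u) * F X = (∫⁻ z, p z) * ∫⁻ X, F X := by
  have hm1 : Measurable fun X : ι → Torus => p (X v - X u) :=
    hp.comp ((measurable_pi_apply v).sub (measurable_pi_apply u))
  have h1 : ∀ a : Torus, ∫⁻ X : ι → Torus, p (X v - X u) * F X =
      ∫⁻ X : ι → Torus, p (X v - X u + a) * F X := fun a => by
    rw [← lintegral_add_right_eq_self _ (Pi.single u (-a) : ι → Torus)]
    refine lintegral_congr fun X => ?_
    rw [hinv]
    simp [huv.symm, sub_add_eq_sub_sub]
  calc ∫⁻ X : ι → Torus, p (X v - X u) * F X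
      = ∫⁻ _ : Torus, ∫⁻ X : ι → Torus, p (X v - X u) * F X := by simp
    _ = ∫⁻ a : Torus, ∫⁻ X : ι → Torus, p (X v - X u + a) * F X := lintegral_congr h1
    _ = ∫⁻ X : ι → Torus, ∫⁻ a : Torus, p (X v - X u + a) * F X := by
        refine lintegral_lintegral_swap (Measurable.aemeasurable ?_)
        have h2 : Measurable fun q : Torus × (ι → Torus) => q.2 v - q.2 u + q.1 :=
          (((measurable_pi_apply v).comp measurable_snd).sub
            ((measurable_pi_apply u).comp measurable_snd)).add measurable_fst
        exact (hp.comp h2).mul (hF.comp measurable_snd)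
    _ = ∫⁻ X : ι → Torus, (∫⁻ z, p z) * F X := by
        refine lintegral_congr fun X => ?_
        have h2 : Measurable fun a : Torus => p (X v - X u + a) :=
          hp.comp (measurable_const.add measurable_id)
        rw [lintegral_mul_const _ h2, lintegral_add_left_eq_self p]
    _ = _ := lintegral_const_mul _ hF

/-! ### Trigonometric velocities and the change of a pair potential in one step -/

lemma continuous_trigGrad (s : Finset (Fin 2 → ℤ)) (g : (Fin 2 → ℤ) → ℝ) (i : Fin 2) :
    Continuous (trigGrad s g i) :=
  continuous_finsetSum _ fun k _ => continuous_const.mul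
    (Complex.continuous_im.comp (UnitAddTorus.mFourier k).continuous)

lemma continuous_trigPot (s : Finset (Fin 2 → ℤ)) (g : (Fin 2 → ℤ) → ℝ) :
    Continuous (trigPot s g) :=
  continuous_finsetSum _ fun k _ => continuous_const.mul
    (Complex.continuous_re.comp (UnitAddTorus.mFourier k).continuous)

lemma continuous_trigVel (s : Finset (Fin 2 → ℤ)) (g : (Fin 2 → ℤ) → ℝ) :
    Continuous (trigVel s g) := by
  refine continuous_pi fun i => ?_
  fin_cases i
  · exact continuous_trigGrad s g 1
  · exact (continuous_trigGrad s g 0).neg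

lemma exists_norm_trigVel_le (s : Finset (Fin 2 → ℤ)) (g : (Fin 2 → ℤ) → ℝ) :
    ∃ V : ℝ, 0 ≤ V ∧ ∀ z, ‖trigVel s g z‖ ≤ V := by
  obtain ⟨V, hV⟩ := isCompact_univ.exists_bound_of_continuousOn (continuous_trigVel s g).continuousOn
  exact ⟨V, (norm_nonneg _).trans (hV 0 trivial), fun z => hV z trivial⟩

lemma trigVel_neg (s : Finset (Fin 2 → ℤ)) (g : (Fin 2 → ℤ) → ℝ) (z : Torus) :
    trigVel s g (-z) = -trigVel s g z := by
  have h : ∀ k, (UnitAddTorus.mFourier k (-z)).im = -(UnitAddTorus.mFourier k z).im := fun k => by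
    obtain ⟨v, rfl⟩ := toTorus_surjective z
    rw [← toTorus_neg, mFourier_toTorus_eq_exp_phase, mFourier_toTorus_eq_exp_phase,
      show phase k (-v) = -phase k v by simp [phase]; ring, mul_comm, mul_comm Complex.I,
      Complex.exp_ofReal_mul_I_im, Complex.exp_ofReal_mul_I_im, Real.sin_neg]
  rw [trigVel_eq_sum, trigVel_eq_sum, ← Finset.sum_neg_distrib]
  refine Finset.sum_congr rfl fun k _ => ?_
  rw [h, mul_neg, neg_smul]

/-- The derivative of `trigPot` in the direction `y`. -/
def trigDir (s : Finset (Fin 2 → ℤ)) (g : (Fin 2 → ℤ) → ℝ) (z : Torus) : (Fin 2 → ℝ) →ₗ[ℝ] ℝ where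
  toFun y := ∑ i, trigGrad s g i z * y i
  map_add' y y' := by simp only [Pi.add_apply, mul_add, Finset.sum_add_distrib]
  map_smul' c y := by
    simp only [Pi.smul_apply, smul_eq_mul, RingHom.id_apply, Finset.mul_sum]
    exact Finset.sum_congr rfl fun i _ => by ring

/-- A gradient is orthogonal to its rotation, so to first order the mutual interaction of a pair
leaves its potential unchanged. -/
lemma trigDir_trigVel (s : Finset (Fin 2 → ℤ)) (g : (Fin 2 → ℤ) → ℝ) (z : Torus) :
    trigDir s g z (trigVel s g z) = 0 := by
  simp [trigDir, trigVel, Fin.sum_univ_two]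
  ring

lemma abs_trigDir_le (s : Finset (Fin 2 → ℤ)) (g : (Fin 2 → ℤ) → ℝ) (z : Torus) (y : Fin 2 → ℝ) :
    |trigDir s g z y| ≤ 2 * ‖trigVel s g z‖ * ‖y‖ := by
  have h0 := norm_le_pi_norm (trigVel s g z) 0
  have h1 := norm_le_pi_norm (trigVel s g z) 1
  have hy := norm_le_pi_norm y
  simp only [trigVel, Real.norm_eq_abs, Matrix.cons_val_zero, Matrix.cons_val_one, abs_neg,
    Matrix.cons_val_fin_one] at h0 h1 hy
  simp only [trigDir, LinearMap.coe_mk, AddHom.coe_mk, Fin.sum_univ_two]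
  refine (abs_add_le _ _).trans ?_
  rw [abs_mul, abs_mul]
  have e0 := mul_le_mul h1 (hy 0) (abs_nonneg _) (norm_nonneg _)
  have e1 := mul_le_mul h0 (hy 1) (abs_nonneg _) (norm_nonneg _)
  simp only [trigVel]
  linarith

/-- The rate at which a pair is brought together by the other vortices. -/
def pairRate (s : Finset (Fin 2 → ℤ)) (g : (Fin 2 → ℤ) → ℝ) (v w : ι) (X : ι → Torus) : ℝ :=
  ∑ u ∈ (Finset.univ.erase v).erase w, ‖trigVel s g (X v - X w)‖ *
    (‖trigVel s g (X v - X u)‖ + ‖trigVel s g (X w - X u)‖)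

lemma pairRate_nonneg (s : Finset (Fin 2 → ℤ)) (g : (Fin 2 → ℤ) → ℝ) (v w : ι) (X : ι → Torus) :
    0 ≤ pairRate s g v w X :=
  Finset.sum_nonneg fun _ _ => by positivity

lemma continuous_pairRate (s : Finset (Fin 2 → ℤ)) (g : (Fin 2 → ℤ) → ℝ) (v w : ι) :
    Continuous (pairRate s g v w) := by
  have h : ∀ v w : ι, Continuous fun X : ι → Torus => ‖trigVel s g (X v - X w)‖ := fun v w =>
    ((continuous_trigVel s g).comp ((continuous_apply v).sub (continuous_apply w))).norm
  exact continuous_finsetSum _ fun u _ => (h v w).mul ((h v u).add (h w u))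

/-- The pair potential changes slowly along one step of the scheme: the pair does not act on its
own potential. -/
lemma exists_trigPot_step (ι : Type*) [Fintype ι] [DecidableEq ι] (s : Finset (Fin 2 → ℤ))
    (g : (Fin 2 → ℤ) → ℝ) (E : ℝ) (hE : 0 ≤ E) :
    ∃ E' : ℝ, 0 ≤ E' ∧ ∀ (A : ι → ι → ℝ) (a : ℝ) (X : ι → Torus) (d : ι → Fin 2 → ℝ), a ≤ 1 →
      (∀ v w, |A v w| ≤ a) →
      (∀ v, ‖d v - ∑ w ∈ Finset.univ.erase v, A v w • trigVel s g (X v - X w)‖ ≤ E * a ^ 2) →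
      ∀ v w, v ≠ w → |trigPot s g ((X + toConfig d) v - (X + toConfig d) w) -
        trigPot s g (X v - X w)| ≤ 2 * a * pairRate s g v w X + E' * a ^ 2 := by
  obtain ⟨V, hV, hVb⟩ := exists_norm_trigVel_le s g
  obtain ⟨E₁, hE₁, hT⟩ := exists_trigPot_taylor s g
  set m : ℝ := ((Fintype.card ι : ℕ) : ℝ) with hm
  have hm0 : 0 ≤ m := Nat.cast_nonneg _
  refine ⟨2 * V * (2 * E) + E₁ * (2 * (m * V + E)) ^ 2, by positivity,
    fun A a X d ha1 hA hd v w hvw => ?_⟩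
  have ha : 0 ≤ a := (abs_nonneg _).trans (hA v w)
  set z := X v - X w with hz
  have hdn : ∀ v, ‖d v‖ ≤ a * (m * V + E) := fun v => by
    have h1 : ‖∑ w ∈ Finset.univ.erase v, A v w • trigVel s g (X v - X w)‖ ≤ m * (a * V) := by
      refine (norm_sum_le_of_le (n := fun _ => a * V) _ fun w _ => ?_).trans ?_
      · rw [norm_smul]
        exact mul_le_mul (hA v w) (hVb _) (norm_nonneg _) ha
      · rw [Finset.sum_const, nsmul_eq_mul]
        refine mul_le_mul_of_nonneg_right ?_ (by positivity)
        rw [hm]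
        exact_mod_cast Finset.card_le_univ _
    have h2 := norm_add_le (d v - ∑ w ∈ Finset.univ.erase v, A v w • trigVel s g (X v - X w))
      (∑ w ∈ Finset.univ.erase v, A v w • trigVel s g (X v - X w))
    rw [sub_add_cancel] at h2
    have h3 : E * a ^ 2 ≤ E * a := by
      refine mul_le_mul_of_nonneg_left ?_ hE
      nlinarith
    have := hd v
    nlinarith
  have e : (X + toConfig d) v - (X + toConfig d) w = z + toTorus (d v - d w) := by
    rw [sub_eq_add_neg (d v), toTorus_add, toTorus_neg]
    simp only [Pi.add_apply, toConfig, hz]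
    abel
  have h1 := hT z (d v - d w)
  rw [show ∑ i, trigGrad s g i z * (d v - d w) i = trigDir s g z (d v - d w) from rfl] at h1
  have hdd : ‖d v - d w‖ ≤ 2 * (a * (m * V + E)) := by
    linarith [norm_sub_le (d v) (d w), hdn v, hdn w]
  set U := (Finset.univ.erase v).erase w with hU
  have hU' : (Finset.univ.erase w).erase v = U := Finset.erase_right_comm
  have hsv : ∑ u ∈ Finset.univ.erase v, A v u • trigVel s g (X v - X u) =
      A v w • trigVel s g z + ∑ u ∈ U, A v u • trigVel s g (X v - X u) :=
    (Finset.add_sum_erase _ _ (Finset.mem_erase.2 ⟨hvw.symm, Finset.mem_univ _⟩)).symm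
  have hsw : ∑ u ∈ Finset.univ.erase w, A w u • trigVel s g (X w - X u) =
      -A w v • trigVel s g z + ∑ u ∈ U, A w u • trigVel s g (X w - X u) := by
    rw [← hU', ← Finset.add_sum_erase _ _ (Finset.mem_erase.2 ⟨hvw, Finset.mem_univ v⟩),
      show X w - X v = -z by rw [hz]; abel, trigVel_neg, smul_neg, neg_smul]
  -- Both mutual terms are multiples of the velocity at z, by oddness, and `trigDir` annihilates
  -- them even if A v w and A w v differ. Only third vortices and the error of the scheme remain.
  have hdec : trigDir s g z (d v - d w) = trigDir s g z
      ((∑ u ∈ U, (A v u • trigVel s g (X v - X u) - A w u • trigVel s g (X w - X u))) +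
        ((d v - ∑ u ∈ Finset.univ.erase v, A v u • trigVel s g (X v - X u)) -
         (d w - ∑ u ∈ Finset.univ.erase w, A w u • trigVel s g (X w - X u)))) := by
    rw [hsv, hsw, Finset.sum_sub_distrib]
    simp only [map_add, map_sub, map_smul, trigDir_trigVel, smul_zero]
    ring
  have h2 : |trigDir s g z (d v - d w)| ≤ 2 * a * pairRate s g v w X + 2 * V * (2 * E) * a ^ 2 := by
    rw [hdec, map_add]
    refine (abs_add_le _ _).trans (add_le_add ?_ ?_)
    · refine (abs_trigDir_le _ _ _ _).trans ?_
      have h3 : ‖∑ u ∈ U, (A v u • trigVel s g (X v - X u) - A w u • trigVel s g (X w - X u))‖ ≤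
          ∑ u ∈ U, a * (‖trigVel s g (X v - X u)‖ + ‖trigVel s g (X w - X u)‖) := by
        refine norm_sum_le_of_le _ fun u _ => (norm_sub_le _ _).trans ?_
        rw [norm_smul, norm_smul, mul_add]
        exact add_le_add (mul_le_mul_of_nonneg_right (hA _ _) (norm_nonneg _))
          (mul_le_mul_of_nonneg_right (hA _ _) (norm_nonneg _))
      refine (mul_le_mul_of_nonneg_left h3 (by positivity)).trans (le_of_eq ?_)
      rw [pairRate, ← Finset.mul_sum, ← Finset.mul_sum]
      ring
    · refine (abs_trigDir_le _ _ _ _).trans ?_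
      have h3 := (norm_sub_le (d v - ∑ u ∈ Finset.univ.erase v, A v u • trigVel s g (X v - X u))
        (d w - ∑ u ∈ Finset.univ.erase w, A w u • trigVel s g (X w - X u))).trans
          (add_le_add (hd v) (hd w))
      calc _ ≤ 2 * V * (E * a ^ 2 + E * a ^ 2) := by
            gcongr
            exact hVb z
        _ = _ := by ring
  have h4 : E₁ * ‖d v - d w‖ ^ 2 ≤ E₁ * (2 * (a * (m * V + E))) ^ 2 := by gcongr
  rw [e]
  rw [abs_le] at h1 h2 ⊢
  constructor <;> nlinarith

end Energy

/-! ### Collisions are unlikely along the scheme -/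

lemma ofReal_div_norm_le {C : ℝ} (hC : 0 < C) {r : ℝ} (z : Torus) (h : z ≠ 0 → r ≤ C / ‖z‖) :
    ENNReal.ofReal r ≤ ENNReal.ofReal C * ‖z‖ₑ⁻¹ := by
  by_cases hz : z = 0
  · rw [hz, enorm_zero, ENNReal.inv_zero, ENNReal.mul_top (by simpa using hC)]
    exact le_top
  · refine (ENNReal.ofReal_le_ofReal (h hz)).trans ?_
    rw [ENNReal.ofReal_div_of_pos (norm_pos_iff.2 hz), ofReal_norm, div_eq_mul_inv]

section Collision

variable {ι : Type*} [Fintype ι] [DecidableEq ι]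

lemma lintegral_sub_eq {p : Torus → ℝ≥0∞} (hp : Measurable p) {u v : ι} (huv : u ≠ v) :
    ∫⁻ X : ι → Torus, p (X v - X u) = ∫⁻ z, p z := by
  have := lintegral_sub_mul hp (F := fun _ : ι → Torus => 1) measurable_const huv fun _ _ => rfl
  simpa using this

lemma lintegral_sub_mul_sub {p q : Torus → ℝ≥0∞} (hp : Measurable p) (hq : Measurable q)
    {u v w x : ι} (huv : u ≠ v) (huw : u ≠ w) (hux : u ≠ x) (hwx : w ≠ x) :
    ∫⁻ X : ι → Torus, q (X w - X x) * p (X v - X u) = (∫⁻ z, q z) * ∫⁻ z, p z := by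
  have hF : Measurable fun X : ι → Torus => q (X w - X x) :=
    hq.comp ((measurable_pi_apply w).sub (measurable_pi_apply x))
  have := lintegral_sub_mul hp hF huv fun X a => by
    simp [Pi.single_eq_of_ne huw.symm, Pi.single_eq_of_ne hux.symm]
  rw [lintegral_sub_eq hq hwx.symm] at this
  rw [mul_comm (∫⁻ z, q z), ← this]
  exact lintegral_congr fun X => mul_comm _ _

/-- This makes the mean of any function of the configuration the same at each step of the scheme. -/
lemma lintegral_comp_of_slices {𝓔 : Type*} [MeasurableSpace 𝓔] (ν : Measure 𝓔)
    [IsProbabilityMeasure ν] {X : 𝓔 × (ι → Torus) → ι → Torus} (hX : Measurable X)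
    (h : ∀ e, MeasurePreserving (fun Y => X (e, Y)) (volume : Measure (ι → Torus)) volume)
    {f : (ι → Torus) → ℝ≥0∞} (hf : Measurable f) :
    ∫⁻ p, f (X p) ∂(ν.prod volume) = ∫⁻ Y, f Y := by
  have hfX : Measurable fun p => f (X p) := hf.comp hX
  rw [lintegral_prod _ hfX.aemeasurable]
  simp_rw [(h _).lintegral_comp hf]
  simp

/-- With a third vortex u, the difference of the pair and a difference with u are independent and
uniform. The product of two singularities 1/‖z‖ therefore has a finite mean, with a bound that
involves only `C` and the number of vortices. -/
lemma lintegral_pairRate_le {C : ℝ} (hC : 0 < C) {s : Finset (Fin 2 → ℤ)} {g : (Fin 2 → ℤ) → ℝ}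
    (hV : ∀ z, z ≠ 0 → ‖trigVel s g z‖ ≤ C / ‖z‖) {v w : ι} (hvw : v ≠ w) :
    ∫⁻ X : ι → Torus, ENNReal.ofReal (pairRate s g v w X) ≤
      Fintype.card ι * (2 * (ENNReal.ofReal C * ∫⁻ z : Torus, ‖z‖ₑ⁻¹) ^ 2) := by
  set I := ENNReal.ofReal C * ∫⁻ z : Torus, ‖z‖ₑ⁻¹ with hI
  have hp : Measurable fun z => ENNReal.ofReal ‖trigVel s g z‖ :=
    (continuous_trigVel s g).norm.measurable.ennreal_ofReal
  have hpI : ∫⁻ z, ENNReal.ofReal ‖trigVel s g z‖ ≤ I := by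
    rw [hI, ← lintegral_const_mul _ (by fun_prop)]
    exact lintegral_mono fun z => ofReal_div_norm_le hC z (hV z)
  have hm : ∀ v w : ι, Measurable fun X : ι → Torus => ENNReal.ofReal ‖trigVel s g (X v - X w)‖ :=
    fun v w => hp.comp ((measurable_pi_apply v).sub (measurable_pi_apply w))
  have e : ∀ X : ι → Torus, ENNReal.ofReal (pairRate s g v w X) =
      ∑ u ∈ (Finset.univ.erase v).erase w,
        (ENNReal.ofReal ‖trigVel s g (X v - X w)‖ * ENNReal.ofReal ‖trigVel s g (X v - X u)‖ +
        ENNReal.ofReal ‖trigVel s g (X v - X w)‖ * ENNReal.ofReal ‖trigVel s g (X w - X u)‖) := by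
    intro X
    rw [pairRate, ENNReal.ofReal_sum_of_nonneg fun _ _ => by positivity]
    refine Finset.sum_congr rfl fun u _ => ?_
    rw [ENNReal.ofReal_mul (norm_nonneg _), ENNReal.ofReal_add (norm_nonneg _) (norm_nonneg _),
      mul_add]
  simp_rw [e]
  rw [lintegral_finsetSum _ fun u _ => ((hm v w).fun_mul (hm v u)).fun_add ((hm v w).fun_mul (hm w u))]
  calc _ ≤ ∑ u ∈ (Finset.univ.erase v).erase w, 2 * I ^ 2 := by
        refine Finset.sum_le_sum fun u hu => ?_
        simp only [Finset.mem_erase, Finset.mem_univ, and_true] at hu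
        rw [lintegral_add_left ((hm v w).fun_mul (hm v u)), two_mul, sq]
        refine add_le_add ?_ ?_
        · rw [lintegral_sub_mul_sub hp hp hu.2 hu.2 hu.1 hvw]
          exact mul_le_mul' hpI hpI
        · rw [lintegral_sub_mul_sub hp hp hu.1 hu.2 hu.1 hvw]
          exact mul_le_mul' hpI hpI
    _ ≤ _ := by
        rw [Finset.sum_const, nsmul_eq_mul]
        gcongr
        exact Finset.card_le_univ _

/-- The shifted potential of a pair is nonnegative, and at each step up to J it is at most its
initial value plus the sum of all the increments' bounds. The means of these are those of the
uniform law, and Markov's inequality applies to a single function that dominates all pairs and all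
steps. `C₀` is independent of `s` and `g`; the constant `E'` that depends on them is multiplied by J
a², which vanishes as the step shrinks. -/
theorem exists_collision_bound (ι : Type*) [Fintype ι] [DecidableEq ι] {C : ℝ} (hC : 0 < C) :
    ∃ C₀ : ℝ, 0 ≤ C₀ ∧ ∀ (s : Finset (Fin 2 → ℤ)) (g : (Fin 2 → ℤ) → ℝ),
      (∀ z, z ≠ 0 → ‖trigVel s g z‖ ≤ C / ‖z‖) → (∀ z, -C ≤ -trigPot s g z) →
      (∀ z, z ≠ 0 → -trigPot s g z ≤ C / ‖z‖) → ∀ E, 0 ≤ E → ∃ E' : ℝ, 0 ≤ E' ∧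
      ∀ (𝓔 : Type*) [MeasurableSpace 𝓔] (ν : Measure 𝓔) [IsProbabilityMeasure ν]
        (A : ℕ → 𝓔 → ι → ι → ℝ) (a : ℝ) (D : ℕ → 𝓔 × (ι → Torus) → ι → Fin 2 → ℝ),
        0 ≤ a → a ≤ 1 → (∀ i e v w, |A i e v w| ≤ a) → (∀ i, Measurable (D i)) →
        (∀ p, D 0 p = 0) → (∀ i e, MeasurePreserving (fun Y => Y + toConfig (D i (e, Y)))
          (volume : Measure (ι → Torus)) volume) →
        (∀ i p v, ‖D (i + 1) p v - D i p v - ∑ w ∈ Finset.univ.erase v,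
          A i p.1 v w • trigVel s g ((p.2 + toConfig (D i p)) v - (p.2 + toConfig (D i p)) w)‖ ≤
            E * a ^ 2) →
        ∀ (J : ℕ) (R : ℝ), 0 < R → (ν.prod volume) {p | ∃ i ≤ J, ∃ v w, v ≠ w ∧
          R ≤ C - trigPot s g ((p.2 + toConfig (D i p)) v - (p.2 + toConfig (D i p)) w)} ≤
          ENNReal.ofReal ((C₀ * (1 + J * a) + E' * (J * a ^ 2)) / R) := by
  set I := ∫⁻ z : Torus, ‖z‖ₑ⁻¹ with hI
  have hIt : I ≠ ⊤ := lintegral_inv_enorm_lt_top.ne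
  set K := (Finset.univ : Finset ι).offDiag with hK
  set n : ℝ := ((Fintype.card ι : ℕ) : ℝ) with hn
  set k : ℝ := ((K.card : ℕ) : ℝ) with hk
  have hn0 : 0 ≤ n := Nat.cast_nonneg _
  have hk0 : 0 ≤ k := Nat.cast_nonneg _
  have hI0 : 0 ≤ I.toReal := ENNReal.toReal_nonneg
  set c₁ : ℝ := C + C * I.toReal with hc₁
  set c₂ : ℝ := n * (2 * (C * I.toReal) ^ 2) with hc₂
  refine ⟨k * c₁ + 2 * (k * c₂), by positivity, fun s g hV hlow hup E hE => ?_⟩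
  obtain ⟨E', hE', hstep⟩ := exists_trigPot_step ι s g E hE
  refine ⟨E', hE', fun 𝓔 _ ν _ A a D ha ha1 hA hDm hD0 hDp hD J R hR => ?_⟩
  set X : ℕ → 𝓔 × (ι → Torus) → ι → Torus := fun i p => p.2 + toConfig (D i p) with hX
  have hXm : ∀ i, Measurable (X i) := fun i =>
    measurable_snd.add (continuous_toConfig.measurable.comp (hDm i))
  set Φ : ι × ι → (ι → Torus) → ℝ := fun q Y => C - trigPot s g (Y q.1 - Y q.2) with hΦ
  have hΦ0 : ∀ q Y, 0 ≤ Φ q Y := fun q Y => by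
    have := hlow (Y q.1 - Y q.2)
    simp only [hΦ]
    linarith
  have hΦm : ∀ q, Measurable (Φ q) := fun q =>
    (continuous_const.sub ((continuous_trigPot s g).comp
      ((continuous_apply q.1).sub (continuous_apply q.2)))).measurable
  have hrm : ∀ v w : ι, Measurable (pairRate s g v w) := fun v w => (continuous_pairRate s g v w).measurable
  have hinc : ∀ p v w, v ≠ w → ∀ i, Φ (v, w) (X i p) ≤
      Φ (v, w) (X 0 p) + ∑ j ∈ Finset.range i, (2 * a * pairRate s g v w (X j p) + E' * a ^ 2) := by
    intro p v w hvw i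
    induction i with
    | zero => simp
    | succ i ih =>
      have h := hstep (fun v w => A i p.1 v w) a (X i p) (D (i + 1) p - D i p) ha1 (hA i p.1)
        (fun v => hD i p v) v w hvw
      have e : X i p + toConfig (D (i + 1) p - D i p) = X (i + 1) p := by
        simp only [hX]
        rw [add_assoc, ← toConfig_add, add_sub_cancel]
      rw [e, abs_le] at h
      rw [Finset.sum_range_succ]
      simp only [hΦ] at ih ⊢
      linarith [h.1]
  set H : 𝓔 × (ι → Torus) → ℝ≥0∞ := fun p =>
    (∑ q ∈ K, (ENNReal.ofReal (Φ q (X 0 p)) + ∑ j ∈ Finset.range J, ENNReal.ofReal (2 * a) *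
      ENNReal.ofReal (pairRate s g q.1 q.2 (X j p)))) + ENNReal.ofReal (E' * (J * a ^ 2)) with hH
  have hHm : Measurable H := by
    refine Measurable.add ?_ measurable_const
    refine Finset.measurable_fun_sum _ fun q _ => ?_
    refine ((hΦm q).comp (hXm 0)).ennreal_ofReal.add (Finset.measurable_fun_sum _ fun j _ => ?_)
    exact ((hrm q.1 q.2).comp (hXm j)).ennreal_ofReal.const_mul _
  have hsub : {p | ∃ i ≤ J, ∃ v w, v ≠ w ∧ R ≤ C - trigPot s g (X i p v - X i p w)} ⊆
      {p | ENNReal.ofReal R ≤ H p} := by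
    rintro p ⟨i, hi, v, w, hvw, hRi⟩
    have h1 := hRi.trans (hinc p v w hvw i)
    have h2 : Φ (v, w) (X 0 p) + ∑ j ∈ Finset.range i,
        (2 * a * pairRate s g v w (X j p) + E' * a ^ 2) ≤ Φ (v, w) (X 0 p) +
        ∑ j ∈ Finset.range J, 2 * a * pairRate s g v w (X j p) + E' * (J * a ^ 2) := by
      have h3 : ∑ j ∈ Finset.range i, (2 * a * pairRate s g v w (X j p) + E' * a ^ 2) ≤
          ∑ j ∈ Finset.range J, (2 * a * pairRate s g v w (X j p) + E' * a ^ 2) := by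
        refine Finset.sum_le_sum_of_subset_of_nonneg (Finset.range_mono hi) fun j _ _ => ?_
        have := pairRate_nonneg s g v w (X j p)
        positivity
      rw [Finset.sum_add_distrib (s := Finset.range J), Finset.sum_const, Finset.card_range,
        nsmul_eq_mul] at h3
      linarith
    have h4 := ENNReal.ofReal_le_ofReal (h1.trans h2)
    refine h4.trans (ENNReal.ofReal_add_le.trans ?_)
    refine add_le_add (ENNReal.ofReal_add_le.trans ?_) le_rfl
    have h5 : ENNReal.ofReal (∑ j ∈ Finset.range J, 2 * a * pairRate s g v w (X j p)) =
        ∑ j ∈ Finset.range J, ENNReal.ofReal (2 * a) *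
          ENNReal.ofReal (pairRate s g v w (X j p)) := by
      rw [ENNReal.ofReal_sum_of_nonneg]
      · exact Finset.sum_congr rfl fun j _ => ENNReal.ofReal_mul (by positivity)
      · intro j _
        have := pairRate_nonneg s g v w (X j p)
        positivity
    rw [h5]
    exact Finset.single_le_sum (f := fun q : ι × ι => ENNReal.ofReal (Φ q (X 0 p)) +
      ∑ j ∈ Finset.range J, ENNReal.ofReal (2 * a) * ENNReal.ofReal (pairRate s g q.1 q.2 (X j p)))
      (fun _ _ => zero_le) (Finset.mem_offDiag.2 ⟨Finset.mem_univ v, Finset.mem_univ w, hvw⟩)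
  have hint : ∫⁻ p, H p ∂(ν.prod volume) ≤
      ENNReal.ofReal ((k * c₁ + 2 * (k * c₂)) * (1 + J * a) + E' * (J * a ^ 2)) := by
    have hCI : ENNReal.ofReal C * I = ENNReal.ofReal (C * I.toReal) := by
      rw [ENNReal.ofReal_mul hC.le, ENNReal.ofReal_toReal hIt]
    have hq1 : ∀ q ∈ K, ∫⁻ p, ENNReal.ofReal (Φ q (X 0 p)) ∂(ν.prod volume) ≤
        ENNReal.ofReal c₁ := by
      intro q hq
      rw [lintegral_comp_of_slices ν (hXm 0) (hDp 0) (hΦm q).ennreal_ofReal,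
        lintegral_sub_eq (p := fun z => ENNReal.ofReal (C - trigPot s g z))
        (continuous_const.sub (continuous_trigPot s g)).measurable.ennreal_ofReal
        (Finset.mem_offDiag.1 hq).2.2.symm, hc₁, ENNReal.ofReal_add hC.le (by positivity), ← hCI]
      calc _ ≤ ∫⁻ z, (ENNReal.ofReal C + ENNReal.ofReal C * ‖z‖ₑ⁻¹) := by
            refine lintegral_mono fun z => ?_
            rw [sub_eq_add_neg]
            exact ENNReal.ofReal_add_le.trans
              (add_le_add le_rfl (ofReal_div_norm_le hC z (hup z)))
        _ = _ := by
            rw [lintegral_add_left measurable_const, lintegral_const_mul _ (by fun_prop)]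
            simp [hI]
    have hq2 : ∀ q ∈ K, ∀ j, ∫⁻ p, ENNReal.ofReal (pairRate s g q.1 q.2 (X j p)) ∂(ν.prod volume) ≤
        ENNReal.ofReal c₂ := by
      intro q hq j
      rw [lintegral_comp_of_slices ν (hXm j) (hDp j) (hrm q.1 q.2).ennreal_ofReal]
      refine (lintegral_pairRate_le hC hV (Finset.mem_offDiag.1 hq).2.2).trans (le_of_eq ?_)
      rw [hCI, hc₂, ENNReal.ofReal_mul hn0, ENNReal.ofReal_mul zero_le_two,
        ENNReal.ofReal_pow (by positivity), hn, ENNReal.ofReal_natCast, ENNReal.ofReal_ofNat]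
    have hm1 : ∀ q, Measurable fun p => ENNReal.ofReal (Φ q (X 0 p)) := fun q =>
      ((hΦm q).comp (hXm 0)).ennreal_ofReal
    have hm2 : ∀ q : ι × ι, ∀ j, Measurable fun p =>
        ENNReal.ofReal (pairRate s g q.1 q.2 (X j p)) := fun q j =>
      ((hrm q.1 q.2).comp (hXm j)).ennreal_ofReal
    have hm3 : ∀ q : ι × ι, Measurable fun p => ∑ j ∈ Finset.range J, ENNReal.ofReal (2 * a) *
        ENNReal.ofReal (pairRate s g q.1 q.2 (X j p)) := fun q =>
      Finset.measurable_fun_sum _ fun j _ => (hm2 q j).const_mul _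
    rw [hH, lintegral_add_right _ measurable_const,
      lintegral_finsetSum _ fun q _ => (hm1 q).fun_add (hm3 q)]
    have hsum : ∑ q ∈ K, ∫⁻ p, (ENNReal.ofReal (Φ q (X 0 p)) + ∑ j ∈ Finset.range J,
        ENNReal.ofReal (2 * a) * ENNReal.ofReal (pairRate s g q.1 q.2 (X j p))) ∂(ν.prod volume) ≤
        ∑ q ∈ K, ENNReal.ofReal (c₁ + J * (2 * a * c₂)) := by
      refine Finset.sum_le_sum fun q hq => ?_
      rw [lintegral_add_left (hm1 q), lintegral_finsetSum _ fun j _ => (hm2 q j).const_mul _,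
        ENNReal.ofReal_add (by positivity) (by positivity)]
      refine add_le_add (hq1 q hq) ?_
      refine (Finset.sum_le_sum (g := fun _ => ENNReal.ofReal (2 * a * c₂)) fun j _ => ?_).trans ?_
      · rw [lintegral_const_mul _ (hm2 q j), ENNReal.ofReal_mul (p := 2 * a) (by positivity)]
        exact mul_le_mul' le_rfl (hq2 q hq j)
      · rw [Finset.sum_const, Finset.card_range, nsmul_eq_mul,
          ENNReal.ofReal_mul (Nat.cast_nonneg J), ENNReal.ofReal_natCast]
    refine (add_le_add hsum (le_refl _)).trans ?_
    rw [lintegral_const, measure_univ, mul_one, Finset.sum_const, nsmul_eq_mul,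
      ← ENNReal.ofReal_natCast, ← hk, ← ENNReal.ofReal_mul hk0,
      ← ENNReal.ofReal_add (by positivity) (by positivity)]
    -- The initial means give k c₁, and the rates of J steps give 2 k c₂ J a; both are absorbed in
    -- one constant times 1 + J a.
    refine ENNReal.ofReal_le_ofReal (add_le_add ?_ le_rfl)
    have p1 : 0 ≤ k * c₁ * (J * a) := by positivity
    have p2 : 0 ≤ k * c₂ := by positivity
    nlinarith
  refine (measure_mono hsub).trans ((meas_ge_le_lintegral_div hHm.aemeasurable
    (by simpa using hR) ENNReal.ofReal_ne_top).trans ?_)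
  rw [ENNReal.ofReal_div_of_pos hR]
  exact ENNReal.div_le_div_right hint _

end Collision

/-! ### Comparison of the vortex dynamics with the scheme -/

/-- A continuity argument: the set where f reaches ρ is compact, and at its least element the
hypothesis applies. -/
lemma lt_of_forall_lt_of_continuousOn {f : ℝ → ℝ} {a b ρ : ℝ} (hf : ContinuousOn f (Set.Icc a b))
    (h : ∀ r ∈ Set.Icc a b, (∀ u ∈ Set.Ico a r, f u < ρ) → f r < ρ) :
    ∀ r ∈ Set.Icc a b, f r < ρ := by
  by_contra! hne
  obtain ⟨r, hr, hfr⟩ := hne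
  set S : Set ℝ := Set.Icc a b ∩ f ⁻¹' Set.Ici ρ with hS
  have hSc : IsClosed S := hf.preimage_isClosed_of_isClosed isClosed_Icc isClosed_Ici
  have hSk : IsCompact S := isCompact_Icc.of_isClosed_subset hSc Set.inter_subset_left
  obtain ⟨m, hm⟩ := hSk.exists_isLeast ⟨r, hr, hfr⟩
  refine absurd (h m hm.1.1 fun u hu => ?_) (not_lt.2 hm.1.2)
  by_contra hlt
  exact absurd (hm.2 ⟨⟨hu.1, hu.2.le.trans hm.1.1.2⟩, not_lt.1 hlt⟩) (not_le.2 hu.2)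

section Comparison

variable {ι : Type*} [Fintype ι] [DecidableEq ι]

lemma add_toConfig_sub (Y : ι → Torus) (d D : ι → Fin 2 → ℝ) (v w : ι) :
    (Y + toConfig d) v - (Y + toConfig d) w = ((Y + toConfig D) v - (Y + toConfig D) w) +
      toTorus ((d v - D v) - (d w - D w)) := by
  simp only [Pi.add_apply, toConfig]
  rw [sub_eq_add_neg (d v - D v), sub_eq_add_neg (d v), sub_eq_add_neg (d w), toTorus_add,
    toTorus_add, toTorus_neg, toTorus_neg, toTorus_add, toTorus_neg]
  abel

lemma norm_sub_sub_sub_le (d D : ι → Fin 2 → ℝ) (v w : ι) :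
    ‖(d v - D v) - (d w - D w)‖ ≤ 2 * ‖d - D‖ := by
  have h1 := norm_le_pi_norm (d - D) v
  have h2 := norm_le_pi_norm (d - D) w
  simp only [Pi.sub_apply] at h1 h2
  linarith [norm_sub_le (d v - D v) (d w - D w)]

/-- As long as the solution has moved by less than η/16, its pairs stay at distance at least η/2, so
its speed is at most `S`; the condition on S(t₁ - t₀) closes the continuity argument. The velocity
is then replaced by the trigonometric one at the scheme position, with a Lipschitz error for a
displacement of at most e + S(t₁ - t₀) and a kernel error κ. -/
lemma comparison_step {C L : ℝ} (hC : 0 < C) (hL : 0 < L) (hK : ∀ z, ‖bsKernel z‖ ≤ C / ‖z‖)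
    (hKL : ∀ (z : Torus) (d : Fin 2 → ℝ), z ≠ 0 → ‖d‖ ≤ ‖z‖ / 2 →
      ‖bsKernel (z + toTorus d) - bsKernel z‖ ≤ L / ‖z‖ ^ 4 * ‖d‖)
    {η κ : ℝ} (hη : 0 < η) (hκ : 0 ≤ κ) {s : Finset (Fin 2 → ℤ)} {g : (Fin 2 → ℤ) → ℝ}
    (hV : ∀ z, η ≤ ‖z‖ → ‖trigVel s g z - bsKernel z‖ ≤ κ)
    {B : ℝ} (hB : 0 ≤ B) {b : ι → ι → ℝ → ℝ} (hb : ∀ v w u, |b v w u| ≤ B)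
    {t₀ t₁ : ℝ} (ht : t₀ ≤ t₁) (hbi : ∀ v w, IntervalIntegrable (b v w) volume t₀ t₁)
    {Y : ι → Torus} {d : ℝ → ι → Fin 2 → ℝ} (hdc : ContinuousOn d (Set.Icc t₀ t₁))
    (hi : ∀ v, IntervalIntegrable (fun u => ∑ w ∈ Finset.univ.erase v, b v w u •
      bsKernel ((Y + toConfig (d u)) v - (Y + toConfig (d u)) w)) volume t₀ t₁)
    (hd : ∀ r ∈ Set.Icc t₀ t₁, ∀ v, d r v - d t₀ v = ∫ u in t₀..r, ∑ w ∈ Finset.univ.erase v,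
      b v w u • bsKernel ((Y + toConfig (d u)) v - (Y + toConfig (d u)) w))
    {D : ι → Fin 2 → ℝ} {e : ℝ} (he : ‖d t₀ - D‖ ≤ e) (heη : e ≤ η / 8)
    (hsep : ∀ v w, v ≠ w → η ≤ ‖(Y + toConfig D) v - (Y + toConfig D) w‖)
    {S : ℝ} (hS : S = Fintype.card ι * (B * (2 * C / η))) (hSh : S * (t₁ - t₀) < η / 16) (v : ι) :
    ‖d t₁ v - d t₀ v - ∑ w ∈ Finset.univ.erase v, (∫ u in t₀..t₁, b v w u) •
      trigVel s g ((Y + toConfig D) v - (Y + toConfig D) w)‖ ≤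
      Fintype.card ι * (B * (L / η ^ 4 * (2 * (e + S * (t₁ - t₀))) + κ)) * (t₁ - t₀) := by
  have hm0 : (0 : ℝ) ≤ Fintype.card ι := Nat.cast_nonneg _
  have hS0 : 0 ≤ S := by rw [hS]; positivity
  -- separation of the true configuration while it has not moved much
  have hclose : ∀ u, ‖d u - d t₀‖ < η / 16 → ∀ v w, v ≠ w →
      ‖bsKernel ((Y + toConfig (d u)) v - (Y + toConfig (d u)) w)‖ ≤ 2 * C / η := by
    intro u hu v w hvw
    refine (hK _).trans ?_
    have h1 : ‖d u - D‖ ≤ η / 16 + η / 8 := by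
      have := norm_add_le (d u - d t₀) (d t₀ - D)
      rw [sub_add_sub_cancel] at this
      linarith
    have h2 := norm_toTorus_le ((d u v - D v) - (d u w - D w))
    have h3 := norm_sub_sub_sub_le (d u) D v w
    have h4 := hsep v w hvw
    have h5 : η / 2 ≤ ‖(Y + toConfig (d u)) v - (Y + toConfig (d u)) w‖ := by
      rw [add_toConfig_sub Y (d u) D]
      have := norm_sub_le_norm_add ((Y + toConfig D) v - (Y + toConfig D) w)
        (toTorus ((d u v - D v) - (d u w - D w)))
      linarith
    rw [div_le_div_iff₀ (by linarith) hη]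
    nlinarith
  have hsum : ∀ f : ι → Fin 2 → ℝ, ∀ c, 0 ≤ c → (∀ w, w ≠ v → ‖f w‖ ≤ c) →
      ‖∑ w ∈ Finset.univ.erase v, f w‖ ≤ Fintype.card ι * c := by
    intro f c hc hf
    refine (norm_sum_le_of_le _ fun w hw => hf w (Finset.ne_of_mem_erase hw)).trans ?_
    rw [Finset.sum_const, nsmul_eq_mul]
    refine mul_le_mul_of_nonneg_right ?_ hc
    exact_mod_cast Finset.card_le_univ _
  have hmove : ∀ r ∈ Set.Icc t₀ t₁, (∀ u ∈ Set.Ico t₀ r, ‖d u - d t₀‖ < η / 16) →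
      ‖d r - d t₀‖ ≤ S * (r - t₀) := by
    intro r hr hu
    refine (pi_norm_le_iff_of_nonneg (mul_nonneg hS0 (sub_nonneg.2 hr.1))).2 fun v' => ?_
    rw [Pi.sub_apply, hd r hr v', ← abs_of_nonneg (sub_nonneg.2 hr.1)]
    refine intervalIntegral.norm_integral_le_of_norm_le_const_ae ?_
    -- Smallness is known only strictly before r; the endpoint is negligible in the integral.
    have hne : ∀ᵐ u : ℝ, u ≠ r := by simp [ae_iff]
    filter_upwards [hne] with u hur hmem
    rw [Set.uIoc_of_le hr.1] at hmem
    rw [hS]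
    refine (norm_sum_le_of_le (n := fun _ => B * (2 * C / η)) _ fun w hw => ?_).trans ?_
    · rw [norm_smul]
      refine mul_le_mul (hb _ _ _) (hclose u (hu u ⟨hmem.1.le, lt_of_le_of_ne hmem.2 hur⟩) _ _
        (Finset.ne_of_mem_erase hw).symm) (norm_nonneg _) hB
    · rw [Finset.sum_const, nsmul_eq_mul]
      refine mul_le_mul_of_nonneg_right ?_ (by positivity)
      exact_mod_cast Finset.card_le_univ _
  have hsmall : ∀ r ∈ Set.Icc t₀ t₁, ‖d r - d t₀‖ < η / 16 := by
    refine lt_of_forall_lt_of_continuousOn (f := fun r => ‖d r - d t₀‖)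
      (hdc.sub continuousOn_const).norm fun r hr hu => ?_
    refine (hmove r hr hu).trans_lt (lt_of_le_of_lt ?_ hSh)
    exact mul_le_mul_of_nonneg_left (sub_le_sub_right hr.2 _) hS0
  have hmove' : ∀ r ∈ Set.Icc t₀ t₁, ‖d r - d t₀‖ ≤ S * (t₁ - t₀) := fun r hr =>
    (hmove r hr fun u hu => hsmall u ⟨hu.1, hu.2.le.trans hr.2⟩).trans
      (mul_le_mul_of_nonneg_left (sub_le_sub_right hr.2 _) hS0)
  have hsm : ∀ w ∈ Finset.univ.erase v, IntervalIntegrable (fun u => b v w u •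
        trigVel s g ((Y + toConfig D) v - (Y + toConfig D) w)) volume t₀ t₁ := fun w _ =>
      ⟨(hbi v w).1.smul_const _, (hbi v w).2.smul_const _⟩
  have hint : ∑ w ∈ Finset.univ.erase v, (∫ u in t₀..t₁, b v w u) •
      trigVel s g ((Y + toConfig D) v - (Y + toConfig D) w) =
      ∫ u in t₀..t₁, ∑ w ∈ Finset.univ.erase v, b v w u •
        trigVel s g ((Y + toConfig D) v - (Y + toConfig D) w) := by
    rw [intervalIntegral.integral_finsetSum hsm]
    exact Finset.sum_congr rfl fun w _ => (intervalIntegral.integral_smul_const _ _).symm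
  have hi2 : IntervalIntegrable (fun u => ∑ w ∈ Finset.univ.erase v, b v w u •
        trigVel s g ((Y + toConfig D) v - (Y + toConfig D) w)) volume t₀ t₁ := by
    have := IntervalIntegrable.sum _ hsm
    simpa only [Finset.sum_fn] using this
  rw [hint, hd t₁ ⟨ht, le_rfl⟩ v, ← intervalIntegral.integral_sub (hi v) hi2,
    ← abs_of_nonneg (sub_nonneg.2 ht)]
  refine intervalIntegral.norm_integral_le_of_norm_le_const fun u hu => ?_
  rw [Set.uIoc_of_le ht] at hu
  have hu' : u ∈ Set.Icc t₀ t₁ := ⟨hu.1.le, hu.2⟩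
  rw [← Finset.sum_sub_distrib, abs_of_nonneg (sub_nonneg.2 ht)]
  have he0 : 0 ≤ e := (norm_nonneg _).trans he
  have hSt : 0 ≤ S * (t₁ - t₀) := mul_nonneg hS0 (sub_nonneg.2 ht)
  refine hsum _ _ (by positivity) fun w hw => ?_
  rw [← smul_sub, norm_smul]
  refine mul_le_mul (hb _ _ _) ?_ (norm_nonneg _) hB
  set z := (Y + toConfig D) v - (Y + toConfig D) w with hz
  have hzη : η ≤ ‖z‖ := hsep v w hw.symm
  have h1 : ‖d u - D‖ ≤ S * (t₁ - t₀) + e := by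
    have := norm_add_le (d u - d t₀) (d t₀ - D)
    rw [sub_add_sub_cancel] at this
    linarith [hmove' u hu']
  have h3 := norm_sub_sub_sub_le (d u) D v w
  rw [add_toConfig_sub Y (d u) D, ← hz]
  have h4 := hKL z ((d u v - D v) - (d u w - D w)) (norm_pos_iff.1 (hη.trans_le hzη)) (by linarith)
  have h5 := hV z hzη
  rw [norm_sub_rev] at h5
  have h6 := norm_add_le (bsKernel (z + toTorus ((d u v - D v) - (d u w - D w))) - bsKernel z)
    (bsKernel z - trigVel s g z)
  rw [sub_add_sub_cancel] at h6
  have h7 : L / ‖z‖ ^ 4 * ‖(d u v - D v) - (d u w - D w)‖ ≤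
      L / η ^ 4 * (2 * (e + S * (t₁ - t₀))) := by
    gcongr
    linarith
  linarith

/-- Discrete Gronwall: the error satisfies e_{i+1} ≤ e_i (1 + p h) + q. The assumption `hqη` keeps
it below η/8 so that the next step can be compared. Separation is required only of the scheme, whose
law is known, never of the solution. -/
lemma scheme_close {C L : ℝ} (hC : 0 < C) (hL : 0 < L) (hK : ∀ z, ‖bsKernel z‖ ≤ C / ‖z‖)
    (hKL : ∀ (z : Torus) (d : Fin 2 → ℝ), z ≠ 0 → ‖d‖ ≤ ‖z‖ / 2 →
      ‖bsKernel (z + toTorus d) - bsKernel z‖ ≤ L / ‖z‖ ^ 4 * ‖d‖)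
    {η κ : ℝ} (hη : 0 < η) (hκ : 0 ≤ κ) {s : Finset (Fin 2 → ℤ)} {g : (Fin 2 → ℤ) → ℝ}
    (hV : ∀ z, η ≤ ‖z‖ → ‖trigVel s g z - bsKernel z‖ ≤ κ)
    {B : ℝ} (hB : 0 ≤ B) {b : ι → ι → ℝ → ℝ} (hb : ∀ v w u, |b v w u| ≤ B)
    {h : ℝ} (hh : 0 ≤ h) {J : ℕ} (hbi : ∀ v w, IntervalIntegrable (b v w) volume 0 (J * h))
    {Y : ι → Torus} {d : ℝ → ι → Fin 2 → ℝ}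
    (hi : ∀ v, IntervalIntegrable (fun u => ∑ w ∈ Finset.univ.erase v, b v w u •
      bsKernel ((Y + toConfig (d u)) v - (Y + toConfig (d u)) w)) volume 0 (J * h))
    (hd : ∀ r ∈ Set.Icc 0 (J * h), ∀ v, d r v = ∫ u in (0 : ℝ)..r, ∑ w ∈ Finset.univ.erase v,
      b v w u • bsKernel ((Y + toConfig (d u)) v - (Y + toConfig (d u)) w))
    {D : ℕ → ι → Fin 2 → ℝ} (hD0 : D 0 = 0) {E : ℝ} (hE : 0 ≤ E)
    (hD : ∀ i v, ‖D (i + 1) v - D i v - ∑ w ∈ Finset.univ.erase v,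
      (∫ u in (i * h)..((i + 1 : ℕ) * h), b v w u) •
        trigVel s g ((Y + toConfig (D i)) v - (Y + toConfig (D i)) w)‖ ≤ E * (B * h) ^ 2)
    (hsep : ∀ i < J, ∀ v w, v ≠ w → η ≤ ‖(Y + toConfig (D i)) v - (Y + toConfig (D i)) w‖)
    {S p q : ℝ} (hS : S = Fintype.card ι * (B * (2 * C / η))) (hSh : S * h < η / 16)
    (hp : p = Fintype.card ι * (B * (L / η ^ 4 * 2)))
    (hq : q = Fintype.card ι * (B * (L / η ^ 4 * (2 * (S * h)) + κ)) * h + E * (B * h) ^ 2)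
    (hqη : J * q * Real.exp (p * (J * h)) ≤ η / 8) :
    ‖d (J * h) - D J‖ ≤ J * q * Real.exp (p * (J * h)) := by
  have hm0 : (0 : ℝ) ≤ Fintype.card ι := Nat.cast_nonneg _
  have hS0 : 0 ≤ S := by rw [hS]; positivity
  have hp0 : 0 ≤ p := by rw [hp]; positivity
  have hq0 : 0 ≤ q := by rw [hq]; positivity
  have hJh : ∀ i : ℕ, i ≤ J → (i : ℝ) * h ≤ J * h := fun i hi =>
    mul_le_mul_of_nonneg_right (by exact_mod_cast hi) hh
  have hih : ∀ i : ℕ, 0 ≤ (i : ℝ) * h := fun i => by positivity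
  have hJ0 := hih J
  have hsubI : ∀ {F : Type} [NormedAddCommGroup F] {f : ℝ → F} {a c : ℝ},
      IntervalIntegrable f volume 0 (J * h) → 0 ≤ a → a ≤ J * h → 0 ≤ c → c ≤ J * h →
      IntervalIntegrable f volume a c := fun hf ha1 ha2 hc1 hc2 =>
    hf.mono_set (Set.uIcc_subset_uIcc (by rw [Set.uIcc_of_le hJ0]; exact ⟨ha1, ha2⟩)
      (by rw [Set.uIcc_of_le hJ0]; exact ⟨hc1, hc2⟩))
  have hdc : ContinuousOn d (Set.Icc 0 (J * h)) := by
    refine continuousOn_pi.2 fun v => ?_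
    refine ContinuousOn.congr ?_ fun r hr => hd r hr v
    have := intervalIntegral.continuousOn_primitive_interval' (hi v) Set.left_mem_uIcc
    rwa [Set.uIcc_of_le hJ0] at this
  have key : ∀ i ≤ J, ‖d (i * h) - D i‖ ≤ i * q * Real.exp (p * (i * h)) := by
    intro i
    induction i with
    | zero =>
      intro _
      have : d 0 = 0 := funext fun v => by rw [hd 0 ⟨le_rfl, hJ0⟩ v]; simp
      simp [hD0, this]
    | succ i ih =>
      intro hiJ
      have hiJ' : i ≤ J := (Nat.le_succ i).trans hiJ
      have hle : (i : ℝ) * h ≤ ((i + 1 : ℕ) : ℝ) * h :=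
        mul_le_mul_of_nonneg_right (by exact_mod_cast Nat.le_succ i) hh
      have hdiff : ((i + 1 : ℕ) : ℝ) * h - i * h = h := by push_cast; ring
      set e := i * q * Real.exp (p * (i * h)) with he
      have he8 : e ≤ η / 8 := by
        refine le_trans ?_ hqη
        rw [he]
        have h1 := hJh i hiJ'
        have h2 : (i : ℝ) ≤ J := by exact_mod_cast hiJ'
        gcongr
      have he0 : 0 ≤ e := by positivity
      refine (pi_norm_le_iff_of_nonneg (by positivity)).2 fun v => ?_
      have h1 := comparison_step hC hL hK hKL hη hκ hV hB hb hle
        (fun v w => hsubI (hbi v w) (hih i) (hJh i hiJ') (hih _) (hJh _ hiJ)) (Y := Y) (d := d)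
        (hdc.mono (Set.Icc_subset_Icc (hih i) (hJh _ hiJ)))
        (fun v => hsubI (hi v) (hih i) (hJh i hiJ') (hih _) (hJh _ hiJ))
        (fun r hr v => by
          rw [hd r ⟨(hih i).trans hr.1, hr.2.trans (hJh _ hiJ)⟩ v, hd _ ⟨hih i, hJh i hiJ'⟩ v]
          exact intervalIntegral.integral_interval_sub_left
            (hsubI (hi v) le_rfl hJ0 ((hih i).trans hr.1) (hr.2.trans (hJh _ hiJ)))
            (hsubI (hi v) le_rfl hJ0 (hih i) (hJh i hiJ')))
        (ih hiJ') he8 (hsep i hiJ) hS (by rwa [hdiff]) v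
      rw [hdiff] at h1
      have h2 := hD i v
      rw [norm_sub_rev] at h2
      have h3 := norm_le_pi_norm (d (i * h) - D i) v
      have h4 := ih hiJ'
      have h5 : (d (((i + 1 : ℕ) : ℝ) * h) - D (i + 1)) v =
          (d (((i + 1 : ℕ) : ℝ) * h) v - d (i * h) v - ∑ w ∈ Finset.univ.erase v,
            (∫ u in (i * h)..((i + 1 : ℕ) * h), b v w u) •
              trigVel s g ((Y + toConfig (D i)) v - (Y + toConfig (D i)) w)) +
          ((∑ w ∈ Finset.univ.erase v, (∫ u in (i * h)..((i + 1 : ℕ) * h), b v w u) •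
              trigVel s g ((Y + toConfig (D i)) v - (Y + toConfig (D i)) w)) -
            (D (i + 1) v - D i v)) + (d (i * h) - D i) v := by
        simp only [Pi.sub_apply]
        abel
      rw [h5]
      have h6 := norm_add₃_le (a := (d (((i + 1 : ℕ) : ℝ) * h) v - d (i * h) v -
          ∑ w ∈ Finset.univ.erase v, (∫ u in (i * h)..((i + 1 : ℕ) * h), b v w u) •
              trigVel s g ((Y + toConfig (D i)) v - (Y + toConfig (D i)) w)))
        (b := ((∑ w ∈ Finset.univ.erase v, (∫ u in (i * h)..((i + 1 : ℕ) * h), b v w u) •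
              trigVel s g ((Y + toConfig (D i)) v - (Y + toConfig (D i)) w)) -
            (D (i + 1) v - D i v))) (c := (d (i * h) - D i) v)
      have h7 : e * (1 + p * h) + q ≤ ((i + 1 : ℕ) : ℝ) * q * Real.exp (p * ((i + 1 : ℕ) * h)) := by
        have h8 : 1 + p * h ≤ Real.exp (p * h) := by linarith [Real.add_one_le_exp (p * h)]
        have h9 : Real.exp (p * ((i + 1 : ℕ) * h)) = Real.exp (p * (i * h)) * Real.exp (p * h) := by
          rw [← Real.exp_add]
          congr 1
          push_cast
          ring
        have h10 : 1 ≤ Real.exp (p * ((i + 1 : ℕ) * h)) := Real.one_le_exp (by positivity)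
        calc e * (1 + p * h) + q ≤ e * Real.exp (p * h) + q * Real.exp (p * ((i + 1 : ℕ) * h)) := by
              refine add_le_add (mul_le_mul_of_nonneg_left h8 he0) ?_
              exact le_mul_of_one_le_right hq0 h10
          _ = _ := by
              rw [he, h9]
              push_cast
              ring
      refine le_trans ?_ h7
      have h8 : e * (p * h) = Fintype.card ι * (B * (L / η ^ 4 * 2)) * (e * h) := by rw [hp]; ring
      have h9 : Fintype.card ι * (B * (L / η ^ 4 * (2 * (e + S * h)) + κ)) * h =
        Fintype.card ι * (B * (L / η ^ 4 * 2)) * (e * h) +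
          Fintype.card ι * (B * (L / η ^ 4 * (2 * (S * h)) + κ)) * h := by ring
      linarith
  exact key J le_rfl

end Comparison

/-! ### The uniform measure is invariant under the vortex dynamics -/

section Transfer

variable {ι : Type*} [Fintype ι] [DecidableEq ι] {Ω : Type*} [MeasurableSpace Ω]

lemma measurable_intervalIntegral_param {𝓔 : Type*} [MeasurableSpace 𝓔] {b : 𝓔 → ℝ → ℝ}
    (hb : Measurable fun p : 𝓔 × ℝ => b p.1 p.2) {t₀ t₁ : ℝ} (h : t₀ ≤ t₁) :
    Measurable fun e => ∫ u in t₀..t₁, b e u := by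
  simp_rw [intervalIntegral.integral_of_le h]
  exact (hb.stronglyMeasurable.integral_prod_right
    (ν := volume.restrict (Set.Ioc t₀ t₁))).measurable

/-- The vortex dynamics is approximated in probability by measure preserving maps. -/
lemma exists_measurePreserving_approx {P : Measure Ω} [IsProbabilityMeasure P] {𝓔 : Type*}
    [MeasurableSpace 𝓔] {ν : Measure 𝓔} [IsProbabilityMeasure ν] {S : Ω → 𝓔}
    {Y : Ω → ι → Torus} {b : ι → ι → 𝓔 → ℝ → ℝ}
    (hbm : ∀ v w, Measurable fun p : 𝓔 × ℝ => b v w p.1 p.2) {B : ℝ} (hB : 0 ≤ B)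
    (hb : ∀ v w e u, |b v w e u| ≤ B) {t : ℝ} (ht : 0 ≤ t) {d : Ω → ℝ → ι → Fin 2 → ℝ}
    (hi : ∀ᵐ ω ∂P, ∀ v, IntervalIntegrable (fun u => ∑ w ∈ Finset.univ.erase v, b v w (S ω) u •
      bsKernel ((Y ω + toConfig (d ω u)) v - (Y ω + toConfig (d ω u)) w)) volume 0 t)
    (hd : ∀ᵐ ω ∂P, ∀ r ∈ Set.Icc 0 t, ∀ v, d ω r v = ∫ u in (0 : ℝ)..r,
      ∑ w ∈ Finset.univ.erase v, b v w (S ω) u •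
        bsKernel ((Y ω + toConfig (d ω u)) v - (Y ω + toConfig (d ω u)) w))
    {ε : ℝ} (hε : 0 < ε) :
    ∃ D : 𝓔 × (ι → Torus) → ι → Fin 2 → ℝ, Measurable D ∧
      (∀ e, MeasurePreserving (fun Y => Y + toConfig (D (e, Y)))
        (volume : Measure (ι → Torus)) volume) ∧
      ∃ s : Set (𝓔 × (ι → Torus)), MeasurableSet s ∧ (ν.prod volume) s ≤ ENNReal.ofReal ε ∧
        ∀ᵐ ω ∂P, (S ω, Y ω) ∉ s → ‖d ω t - D (S ω, Y ω)‖ ≤ ε := by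
  obtain ⟨C₁, hC₁, hK⟩ := norm_bsKernel_le
  obtain ⟨L, hL, hKL⟩ := norm_bsKernel_add_sub_le
  obtain ⟨C, c, hC, hc, happ⟩ := exists_trig_approx
  obtain ⟨C₀, hC₀, hcol⟩ := exists_collision_bound ι hC
  set m : ℝ := ((Fintype.card ι : ℕ) : ℝ) with hm
  have hm0 : 0 ≤ m := Nat.cast_nonneg _
  -- With this threshold the collision probability is at most ε; the summand 1 leaves room for the
  -- `E'` term. The scale η below is the one at which the logarithm forces the potential above `R`.
  set R : ℝ := (C₀ * (1 + B * t) + 1) / ε with hR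
  have hR0 : 0 < R := by positivity
  set η : ℝ := Real.exp (-(R / c)) with hηd
  have hη : 0 < η := Real.exp_pos _
  have hη1 : η ≤ 1 := Real.exp_le_one_iff.2 (by simp only [Left.neg_nonpos_iff]; positivity)
  have hlog : -(c * Real.log η) = R := by
    rw [hηd, Real.log_exp]
    field_simp
  set V : ℝ := m * (B * (2 * C₁ / η)) with hV
  set p : ℝ := m * (B * (L / η ^ 4 * 2)) with hp
  set ε' : ℝ := min ε (η / 8) with hε'
  have hε'0 : 0 < ε' := by positivity
  set W : ℝ := t * (m * B) * Real.exp (p * t) with hW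
  have hW0 : 0 ≤ W := by positivity
  -- The kernel error, amplified by the Gronwall factor `W`, stays strictly below the tolerance; the
  -- gap is left for the terms that vanish with the step.
  set κ : ℝ := min 1 (ε' / (2 * (W + 1))) with hκd
  have hκ : 0 < κ := by positivity
  have hWκ : W * κ < ε' := by
    have h1 : κ ≤ ε' / (2 * (W + 1)) := min_le_right _ _
    rw [le_div_iff₀ (by positivity)] at h1
    nlinarith
  obtain ⟨s, g, hs1, hs2, hs3, hs4, hs5⟩ := happ η hη hη1 κ hκ (min_le_left _ _)
  obtain ⟨E, hE, hsch⟩ := exists_scheme (ι := ι) s g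
  obtain ⟨E', hE', hcolE⟩ := hcol s g hs1 hs3 hs4 E hE
  have hlim : Filter.Tendsto (fun J : ℕ => t / J) Filter.atTop (nhds 0) :=
    tendsto_const_div_atTop_nhds_zero_nat t
  have hev : ∀ {F : ℝ → ℝ} {x : ℝ}, Continuous F → F 0 < x → ∀ᶠ J : ℕ in Filter.atTop,
      F (t / J) < x := fun hF hx => hlim.eventually ((hF.tendsto 0).eventually (gt_mem_nhds hx))
  have e1 := hev (F := fun h => B * h) (x := 1) (by fun_prop) (by simp)
  have e2 := hev (F := fun h => E' * (B * t * (B * h))) (x := 1) (by fun_prop) (by simp)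
  have e3 := hev (F := fun h => V * h) (x := η / 16) (by fun_prop) (by simpa using hη)
  have e4 := hev (F := fun h => t * (m * (B * (L / η ^ 4 * (2 * (V * h)) + κ)) + E * B ^ 2 * h) *
    Real.exp (p * t)) (x := ε') (by fun_prop) (by
      refine lt_of_eq_of_lt ?_ hWκ
      rw [hW]
      ring)
  -- The number of steps comes last, after `R`, η, κ, the polynomial and its constants `E`, `E'`: it
  -- may depend on all of them.
  obtain ⟨J, hJ1, hJ2, hJ3, hJ4, hJ0⟩ :=
    (e1.and (e2.and (e3.and (e4.and (Filter.eventually_gt_atTop 0))))).exists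
  set h : ℝ := t / J with hh
  have hJ' : (0 : ℝ) < J := by exact_mod_cast hJ0
  have hh0 : 0 ≤ h := by positivity
  have hJh : (J : ℝ) * h = t := mul_div_cancel₀ t hJ'.ne'
  have hle : ∀ i : ℕ, (i : ℝ) * h ≤ ((i + 1 : ℕ) : ℝ) * h := fun i =>
    mul_le_mul_of_nonneg_right (by exact_mod_cast Nat.le_succ i) hh0
  set A : ℕ → 𝓔 → ι → ι → ℝ := fun i e v w => ∫ u in (i * h)..((i + 1 : ℕ) * h), b v w e u with hA
  have hAb : ∀ i e v w, |A i e v w| ≤ B * h := fun i e v w => by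
    have := intervalIntegral.norm_integral_le_of_norm_le_const (a := i * h)
      (b := ((i + 1 : ℕ) : ℝ) * h) fun u _ => (Real.norm_eq_abs _).le.trans (hb v w e u)
    rw [Real.norm_eq_abs, show ((i + 1 : ℕ) : ℝ) * h - i * h = h by push_cast; ring,
      abs_of_nonneg hh0] at this
    exact this
  obtain ⟨D, hDm, hD0, hDp, hDs⟩ := hsch 𝓔 A (B * h)
    (fun i v w => measurable_intervalIntegral_param (hbm v w) (hle i)) hAb
  have hbad := hcolE 𝓔 ν A (B * h) D (by positivity) hJ1.le hAb hDm hD0 hDp hDs J R hR0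
  set bad : Set (𝓔 × (ι → Torus)) := {p | ∃ i ≤ J, ∃ v w, v ≠ w ∧
    R ≤ C - trigPot s g ((p.2 + toConfig (D i p)) v - (p.2 + toConfig (D i p)) w)} with hbadd
  refine ⟨D J, hDm J, hDp J, toMeasurable (ν.prod volume) bad, measurableSet_toMeasurable _ _, ?_, ?_⟩
  · rw [measure_toMeasurable]
    refine hbad.trans (ENNReal.ofReal_le_ofReal ?_)
    rw [div_le_iff₀ hR0, hR, mul_div_cancel₀ _ hε.ne']
    have h1 : (J : ℝ) * (B * h) = B * t := by rw [← hJh]; ring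
    have h2 : (J : ℝ) * (B * h) ^ 2 = B * t * (B * h) := by rw [← hJh]; ring
    rw [h1, h2]
    linarith
  · filter_upwards [hi, hd] with ω hiω hdω hω
    have hω' : (S ω, Y ω) ∉ bad := fun hmem => hω (subset_toMeasurable _ _ hmem)
    set q : ℝ := m * (B * (L / η ^ 4 * (2 * (V * h)) + κ)) * h + E * (B * h) ^ 2 with hq
    have hJq : J * q * Real.exp (p * (J * h)) =
        t * (m * (B * (L / η ^ 4 * (2 * (V * h)) + κ)) + E * B ^ 2 * h) * Real.exp (p * t) := by
      rw [hJh, hq, ← hJh]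
      ring
    have hsep : ∀ i < J, ∀ v w, v ≠ w → η ≤ ‖(Y ω + toConfig (D i (S ω, Y ω))) v -
        (Y ω + toConfig (D i (S ω, Y ω))) w‖ := by
      intro i hiJ v w hvw
      by_contra hlt
      refine hω' ⟨i, hiJ.le, v, w, hvw, ?_⟩
      have := hs5 _ (not_le.1 hlt).le
      rw [hlog] at this
      linarith
    have hbi : ∀ v w, IntervalIntegrable (b v w (S ω)) volume 0 (J * h) := fun v w => by
      have hmeas : Measurable (b v w (S ω)) := (hbm v w).comp measurable_prodMk_left
      refine (intervalIntegrable_const (c := B)).mono_fun hmeas.aestronglyMeasurable ?_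
      exact Filter.Eventually.of_forall fun u => by
        show |b v w (S ω) u| ≤ |B|
        rw [abs_of_nonneg hB]
        exact hb v w _ u
    have hfin := scheme_close hC₁ hL hK hKL hη hκ.le hs2 hB (b := fun v w => b v w (S ω))
      (fun v w u => hb v w (S ω) u) hh0 (J := J) hbi (Y := Y ω) (d := d ω)
      (by rw [hJh]; exact hiω) (by rw [hJh]; exact hdω) (D := fun i => D i (S ω, Y ω)) (hD0 _) hE
      (fun i v => hDs i (S ω, Y ω) v) hsep hV hJ3 hp hq
      (by rw [hJq]; exact hJ4.le.trans (min_le_right _ _))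
    rw [hJq, hJh] at hfin
    exact hfin.trans (hJ4.le.trans (min_le_left _ _))

lemma dist_add_toConfig_le (Y : ι → Torus) (d D : ι → Fin 2 → ℝ) :
    dist (Y + toConfig d) (Y + toConfig D) ≤ ‖d - D‖ := by
  refine (dist_pi_le_iff (norm_nonneg _)).2 fun v => ?_
  have e : (Y + toConfig d) v - (Y + toConfig D) v = toTorus (d v - D v) := by
    simp only [Pi.add_apply, toConfig]
    rw [sub_eq_add_neg (d v), toTorus_add, toTorus_neg]
    abel
  rw [dist_eq_norm, e]
  exact (norm_toTorus_le _).trans (norm_le_pi_norm (d - D) v)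

/-- If the initial positions are independent and uniform, and independent of the data `S` that
determine the intensities, then so are the positions at a later time. -/
theorem map_prodMk_eq_of_dynamics {P : Measure Ω} [IsProbabilityMeasure P] {𝓔 : Type*}
    [MeasurableSpace 𝓔] {ν : Measure 𝓔} [IsProbabilityMeasure ν] {S : Ω → 𝓔} (hS : Measurable S)
    {Y : Ω → ι → Torus} (hY : Measurable Y)
    (hlaw : P.map (fun ω => (S ω, Y ω)) = ν.prod volume) {b : ι → ι → 𝓔 → ℝ → ℝ}
    (hbm : ∀ v w, Measurable fun p : 𝓔 × ℝ => b v w p.1 p.2) {B : ℝ}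
    (hb : ∀ v w e u, |b v w e u| ≤ B) {t : ℝ} (ht : 0 ≤ t) {d : Ω → ℝ → ι → Fin 2 → ℝ}
    (hi : ∀ᵐ ω ∂P, ∀ v, IntervalIntegrable (fun u => ∑ w ∈ Finset.univ.erase v, b v w (S ω) u •
      bsKernel ((Y ω + toConfig (d ω u)) v - (Y ω + toConfig (d ω u)) w)) volume 0 t)
    (hd : ∀ᵐ ω ∂P, ∀ r ∈ Set.Icc 0 t, ∀ v, d ω r v = ∫ u in (0 : ℝ)..r,
      ∑ w ∈ Finset.univ.erase v, b v w (S ω) u •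
        bsKernel ((Y ω + toConfig (d ω u)) v - (Y ω + toConfig (d ω u)) w))
    {X : Ω → ι → Torus} (hX : Measurable X) (hXd : ∀ᵐ ω ∂P, X ω = Y ω + toConfig (d ω t)) :
    P.map (fun ω => (S ω, X ω)) = ν.prod volume := by
  have hB' : ∀ v w e u, |b v w e u| ≤ max B 0 := fun v w e u => (hb v w e u).trans (le_max_left _ _)
  -- Conditioning on the data: on each event {S ∈ A} the law of X is tested against continuous
  -- functions.
  have key : ∀ A : Set 𝓔, MeasurableSet A → (P.restrict (S ⁻¹' A)).map X = ν A • volume := by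
    intro A hA
    have : IsFiniteMeasure ((P.restrict (S ⁻¹' A)).map X) := inferInstance
    refine ext_of_forall_lintegral_eq_of_IsFiniteMeasure fun f => ?_
    have hfm : Measurable fun Z => (f Z : ℝ≥0∞) := f.continuous.measurable.coe_nnreal_ennreal
    rw [lintegral_map hfm hX, lintegral_smul_measure]
    obtain ⟨M, hM⟩ : ∃ M : ℝ≥0, ∀ Z, f Z ≤ M := by
      obtain ⟨M, hM⟩ := isCompact_univ.exists_bound_of_continuousOn
        (f := fun Z => ((f Z : ℝ≥0) : ℝ)) (NNReal.continuous_coe.comp f.continuous).continuousOn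
      refine ⟨M.toNNReal, fun Z => ?_⟩
      exact NNReal.le_toNNReal_of_coe_le ((le_abs_self _).trans (hM Z trivial))
    have huc := CompactSpace.uniformContinuous_of_continuous f.continuous
    -- Z is the configuration produced by the scheme. Its integral over {S ∈ A} is exact because
    -- every slice preserves the uniform measure, and X is close to Z off a small event.
    have happrox : ∀ r : ℝ≥0, 0 < r → ∃ Z : Ω → ι → Torus, Measurable Z ∧
        ∫⁻ ω in S ⁻¹' A, (f (Z ω) : ℝ≥0∞) ∂P = ν A * ∫⁻ Y, (f Y : ℝ≥0∞) ∧
        ∃ s : Set Ω, MeasurableSet s ∧ M * P s ≤ r ∧ ∀ᵐ ω ∂P, ω ∉ s → dist (f (X ω)) (f (Z ω)) ≤ r := by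
      intro r hr
      obtain ⟨δ, hδ, hfδ⟩ := Metric.uniformContinuous_iff.1 huc r (by exact_mod_cast hr)
      obtain ⟨D, hDm, hDp, s, hs, hsP, hsD⟩ := exists_measurePreserving_approx (ν := ν) (S := S)
        (Y := Y) hbm (le_max_right _ _) hB' ht hi hd
        (ε := min (δ / 2) (r / (M + 1))) (by positivity)
      have hpm : Measurable fun ω => (S ω, Y ω) := hS.prodMk hY
      have hDm' : Measurable fun p : 𝓔 × (ι → Torus) => p.2 + toConfig (D p) :=
        measurable_snd.add (continuous_toConfig.measurable.comp hDm)
      refine ⟨fun ω => Y ω + toConfig (D (S ω, Y ω)), hDm'.comp hpm, ?_,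
        (fun ω => (S ω, Y ω)) ⁻¹' s, hpm hs, ?_, ?_⟩
      · have h2 : Measurable fun p : 𝓔 × (ι → Torus) => (Prod.fst ⁻¹' A).indicator
            (fun p => (f (p.2 + toConfig (D p)) : ℝ≥0∞)) p :=
          (hfm.comp hDm').indicator (measurable_fst hA)
        have h1 : ∫⁻ ω in S ⁻¹' A, (f (Y ω + toConfig (D (S ω, Y ω))) : ℝ≥0∞) ∂P =
            ∫⁻ p, (Prod.fst ⁻¹' A).indicator (fun p => (f (p.2 + toConfig (D p)) : ℝ≥0∞)) p
              ∂(ν.prod volume) := by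
          rw [← hlaw, lintegral_map h2 hpm, ← lintegral_indicator (hS hA)]
          rfl
        rw [h1, lintegral_prod _ h2.aemeasurable]
        have h3 : ∀ e, ∫⁻ Y, (Prod.fst ⁻¹' A).indicator
            (fun p : 𝓔 × (ι → Torus) => (f (p.2 + toConfig (D p)) : ℝ≥0∞)) (e, Y) =
            A.indicator (fun _ => ∫⁻ Y, (f Y : ℝ≥0∞)) e := by
          intro e
          by_cases he : e ∈ A
          · simp only [Set.indicator, Set.mem_preimage, he, if_true]
            exact (hDp e).lintegral_comp hfm
          · simp [Set.indicator, he]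
        simp_rw [h3]
        rw [lintegral_indicator hA, lintegral_const, Measure.restrict_apply_univ, mul_comm]
      · have h1 : P ((fun ω => (S ω, Y ω)) ⁻¹' s) ≤ ENNReal.ofReal (r / (M + 1)) := by
          rw [← Measure.map_apply hpm hs, hlaw]
          exact hsP.trans (ENNReal.ofReal_le_ofReal (min_le_right _ _))
        refine (mul_le_mul_right h1 (M : ℝ≥0∞)).trans ?_
        rw [← ENNReal.ofReal_coe_nnreal (p := M), ← ENNReal.ofReal_mul (NNReal.coe_nonneg M),
          ← ENNReal.ofReal_coe_nnreal (p := r)]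
        refine ENNReal.ofReal_le_ofReal ?_
        rw [mul_div_assoc', div_le_iff₀ (by positivity)]
        have hr0 := NNReal.coe_nonneg r
        nlinarith
      · filter_upwards [hsD, hXd] with ω h1 h2 h3
        have h4 := h1 h3
        refine (hfδ ?_).le
        rw [h2]
        refine (dist_add_toConfig_le _ _ _).trans_lt (h4.trans_lt ((min_le_left _ _).trans_lt ?_))
        linarith
    -- Stated for two arbitrary maps, to be used once in each direction.
    have hone : ∀ (r : ℝ≥0) (Z Z' : Ω → ι → Torus), Measurable Z → ∀ s : Set Ω, MeasurableSet s →
        M * P s ≤ r → (∀ᵐ ω ∂P, ω ∉ s → dist (f (Z' ω)) (f (Z ω)) ≤ r) →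
        ∫⁻ ω in S ⁻¹' A, (f (Z' ω) : ℝ≥0∞) ∂P ≤
          ∫⁻ ω in S ⁻¹' A, (f (Z ω) : ℝ≥0∞) ∂P + (r + r : ℝ≥0) := by
      intro r Z Z' hZ s hs hMs hclose
      calc ∫⁻ ω in S ⁻¹' A, (f (Z' ω) : ℝ≥0∞) ∂P ≤
          ∫⁻ ω in S ⁻¹' A, ((f (Z ω) : ℝ≥0∞) + (r + s.indicator (fun _ => (M : ℝ≥0∞)) ω)) ∂P := by
            refine lintegral_mono_ae ?_
            filter_upwards [ae_restrict_of_ae hclose] with ω h1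
            by_cases hω : ω ∈ s
            · simp only [Set.indicator_of_mem hω]
              exact (ENNReal.coe_le_coe.2 (hM _)).trans (le_add_self.trans le_add_self)
            · rw [Set.indicator_of_notMem hω, add_zero, ← ENNReal.coe_add, ENNReal.coe_le_coe]
              have h2 := h1 hω
              rw [NNReal.dist_eq, abs_le] at h2
              have : ((f (Z' ω) : ℝ≥0) : ℝ) ≤ f (Z ω) + r := by linarith [h2.2]
              exact_mod_cast this
        _ ≤ _ := by
            have hfZ : Measurable fun ω => (f (Z ω) : ℝ≥0∞) := hfm.comp hZ
            rw [lintegral_add_left hfZ]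
            refine add_le_add le_rfl ?_
            rw [lintegral_add_left measurable_const, lintegral_const,
              lintegral_indicator hs, lintegral_const, ENNReal.coe_add]
            refine add_le_add ?_ ?_
            · refine mul_le_of_le_one_right' ?_
              rw [Measure.restrict_apply_univ]
              exact prob_le_one
            · refine le_trans (mul_le_mul_right ?_ _) hMs
              rw [Measure.restrict_apply_univ]
              exact Measure.restrict_le_self _
    refine le_antisymm ?_ ?_
    · refine ENNReal.le_of_forall_pos_le_add fun r hr _ => ?_
      obtain ⟨Z, hZ, hZi, s, hs, hMs, hcl⟩ := happrox (r / 2) (by positivity)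
      have := hone (r / 2) Z X hZ s hs hMs hcl
      rwa [hZi, add_halves] at this
    · refine ENNReal.le_of_forall_pos_le_add fun r hr _ => ?_
      obtain ⟨Z, hZ, hZi, s, hs, hMs, hcl⟩ := happrox (r / 2) (by positivity)
      have := hone (r / 2) X Z hX s hs hMs (by simpa only [dist_comm] using hcl)
      rwa [hZi, add_halves] at this
  refine (Measure.prod_eq fun A B hA hB => ?_).symm
  rw [Measure.map_apply (hS.prodMk hX) (hA.prod hB)]
  have h1 : (fun ω => (S ω, X ω)) ⁻¹' (A ×ˢ B) = X ⁻¹' B ∩ S ⁻¹' A := by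
    ext ω
    simp [and_comm]
  have h2 := congrArg (fun μ => μ B) (key A hA)
  simp only [Measure.map_apply hX hB, Measure.restrict_apply (hX hB), Measure.smul_apply,
    smul_eq_mul] at h2
  rw [h1, h2]

end Transfer

/-! ### Random signs -/

instance : IsProbabilityMeasure signMeasure := ⟨by
  simp only [signMeasure, Measure.add_apply, Measure.smul_apply, measure_univ, smul_eq_mul, mul_one]
  exact ENNReal.inv_two_add_inv_two⟩

lemma ae_signMeasure : ∀ᵐ x ∂signMeasure, x = 1 ∨ x = -1 := by
  rw [signMeasure, ae_add_measure_iff]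
  constructor
  · refine Measure.ae_smul_measure ?_ _
    rw [ae_dirac_eq]
    simp
  · refine Measure.ae_smul_measure ?_ _
    rw [ae_dirac_eq]
    simp

lemma measurePreserving_neg_sign : MeasurePreserving (fun x : ℝ => -x) signMeasure signMeasure := by
  refine ⟨measurable_neg, ?_⟩
  rw [signMeasure, Measure.map_add _ _ measurable_neg, Measure.map_smul, Measure.map_smul,
    Measure.map_dirac' measurable_neg, Measure.map_dirac' measurable_neg, neg_neg, add_comm]

section Rademacher

variable {ι : Type*} [Fintype ι] [DecidableEq ι]

/-- The law of independent random signs. -/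
def signPi (ι : Type*) [Fintype ι] : Measure (ι → ℝ) := Measure.pi fun _ => signMeasure

instance : IsProbabilityMeasure (signPi ι) :=
  inferInstanceAs (IsProbabilityMeasure (Measure.pi fun _ : ι => signMeasure))

lemma ae_signPi : ∀ᵐ e ∂(signPi ι), ∀ v, e v = 1 ∨ e v = -1 :=
  ae_all_iff.2 fun v => (Measure.tendsto_eval_ae_ae (μ := fun _ : ι => signMeasure)
    (i := v)).eventually ae_signMeasure

lemma ae_signPi_sq : ∀ᵐ e ∂(signPi ι), ∀ v, e v * e v = 1 := by
  filter_upwards [ae_signPi] with e he v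
  rcases he v with h | h <;> rw [h] <;> norm_num

lemma measurePreserving_flip (v : ι) : MeasurePreserving
    (fun e : ι → ℝ => fun i => if i = v then -e i else e i) (signPi ι) (signPi ι) := by
  refine measurePreserving_pi (fun _ : ι => signMeasure) (fun _ => signMeasure)
    (f := fun i x => if i = v then -x else x) fun i => ?_
  by_cases h : i = v
  · simpa [h] using measurePreserving_neg_sign
  · simp only [h, if_false]
    exact MeasurePreserving.id signMeasure

/-- Flipping one sign preserves the law. -/
lemma integral_signPi_eq_zero {f : (ι → ℝ) → ℝ} (v : ι)
    (h : ∀ e, f (fun i => if i = v then -e i else e i) = -f e) : ∫ e, f e ∂(signPi ι) = 0 := by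
  have hinv : Function.Involutive fun e : ι → ℝ => fun i => if i = v then -e i else e i := by
    intro e
    funext i
    by_cases hi : i = v <;> simp [hi]
  have hemb : MeasurableEmbedding fun e : ι → ℝ => fun i => if i = v then -e i else e i :=
    (MeasurableEquiv.mk hinv.toPerm (measurePreserving_flip v).measurable
      (measurePreserving_flip v).measurable).measurableEmbedding
  have h1 := (measurePreserving_flip v).integral_comp hemb f
  simp_rw [h, integral_neg] at h1
  linarith

lemma integral_sign_mul (v w : ι) : ∫ e, e v * e w ∂(signPi ι) = if v = w then 1 else 0 := by
  split_ifs with h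
  · subst h
    rw [integral_congr_ae (ae_signPi_sq.mono fun e he => he v)]
    simp
  · exact integral_signPi_eq_zero v fun e => by simp [Ne.symm h]

lemma integrable_signPi {f : (ι → ℝ) → ℝ} (hf : Measurable f) {C : ℝ}
    (h : ∀ e : ι → ℝ, (∀ v, e v = 1 ∨ e v = -1) → |f e| ≤ C) : Integrable f (signPi ι) :=
  Integrable.of_bound hf.aestronglyMeasurable C (ae_signPi.mono fun e he => h e he)

lemma integral_sign_mul_four {v w u x : ι} (hvw : v ≠ w) (hux : u ≠ x) :
    ∫ e, (e v * e w) * (e u * e x) ∂(signPi ι) =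
      (if v = u ∧ w = x then 1 else 0) + (if v = x ∧ w = u then 1 else 0) := by
  by_cases h1 : v = u
  · subst h1
    have : ∫ e, (e v * e w) * (e v * e x) ∂(signPi ι) = ∫ e, e w * e x ∂(signPi ι) := by
      refine integral_congr_ae (ae_signPi_sq.mono fun e he => ?_)
      show (e v * e w) * (e v * e x) = e w * e x
      rw [mul_mul_mul_comm, he v, one_mul]
    rw [this, integral_sign_mul]
    simp [hux]
  · by_cases h2 : v = x
    · subst h2
      have : ∫ e, (e v * e w) * (e u * e v) ∂(signPi ι) = ∫ e, e w * e u ∂(signPi ι) := by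
        refine integral_congr_ae (ae_signPi_sq.mono fun e he => ?_)
        show (e v * e w) * (e u * e v) = e w * e u
        rw [mul_comm (e u), mul_mul_mul_comm, he v, one_mul]
      rw [this, integral_sign_mul]
      simp [h1]
    · simp only [h1, h2, false_and, if_false, add_zero]
      exact integral_signPi_eq_zero v fun e => by
        simp [Ne.symm h1, Ne.symm h2, hvw.symm]

lemma abs_sign_le {e : ι → ℝ} (he : ∀ v, e v = 1 ∨ e v = -1) (v : ι) : |e v| ≤ 1 := by
  rcases he v with h | h <;> simp [h]

lemma integral_sum_sign_sq (a : ι → ℝ) :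
    ∫ e, (∑ v, a v * e v) ^ 2 ∂(signPi ι) = ∑ v, a v ^ 2 := by
  have hi : ∀ v w : ι, Integrable (fun e : ι → ℝ => a v * a w * (e v * e w)) (signPi ι) := fun v w =>
    (integrable_signPi (C := 1) (by fun_prop) fun e he => by
      rw [abs_mul]
      exact mul_le_one₀ (abs_sign_le he v) (abs_nonneg _) (abs_sign_le he w)).const_mul _
  have e1 : ∀ e : ι → ℝ, (∑ v, a v * e v) ^ 2 = ∑ v, ∑ w, a v * a w * (e v * e w) := fun e => by
    rw [sq, Finset.sum_mul_sum]
    exact Finset.sum_congr rfl fun v _ => Finset.sum_congr rfl fun w _ => by ring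
  simp_rw [e1]
  rw [integral_finsetSum _ fun v _ => integrable_finsetSum _ fun w _ => hi v w]
  refine Finset.sum_congr rfl fun v _ => ?_
  rw [integral_finsetSum _ fun w _ => hi v w]
  simp_rw [integral_const_mul, integral_sign_mul]
  simp [sq]

/-- In the expanded square only equal and transposed pairs survive; the transposed ones are bounded
by 2xy ≤ x² + y², whence the factor 2. -/
lemma integral_offDiag_sign_sq_le (a : ι → ι → ℝ) :
    ∫ e, (∑ p ∈ Finset.univ.offDiag, a p.1 p.2 * (e p.1 * e p.2)) ^ 2 ∂(signPi ι) ≤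
      2 * ∑ p ∈ Finset.univ.offDiag, a p.1 p.2 ^ 2 := by
  set K := (Finset.univ : Finset ι).offDiag with hK
  have hi : ∀ p q : ι × ι, Integrable (fun e : ι → ℝ => a p.1 p.2 * a q.1 q.2 *
      ((e p.1 * e p.2) * (e q.1 * e q.2))) (signPi ι) := fun p q =>
    (integrable_signPi (C := 1) (by fun_prop) fun e he => by
      have := abs_sign_le he
      rw [abs_mul, abs_mul, abs_mul]
      exact mul_le_one₀ (mul_le_one₀ (this _) (abs_nonneg _) (this _)) (by positivity)
        (mul_le_one₀ (this _) (abs_nonneg _) (this _))).const_mul _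
  have e1 : ∀ e : ι → ℝ, (∑ p ∈ K, a p.1 p.2 * (e p.1 * e p.2)) ^ 2 =
      ∑ p ∈ K, ∑ q ∈ K, a p.1 p.2 * a q.1 q.2 * ((e p.1 * e p.2) * (e q.1 * e q.2)) := fun e => by
    rw [sq, Finset.sum_mul_sum]
    exact Finset.sum_congr rfl fun v _ => Finset.sum_congr rfl fun w _ => by ring
  simp_rw [e1]
  rw [integral_finsetSum _ fun v _ => integrable_finsetSum _ fun w _ => hi v w, Finset.mul_sum]
  have e2 : ∀ p ∈ K, ∫ e, ∑ q ∈ K, a p.1 p.2 * a q.1 q.2 * ((e p.1 * e p.2) * (e q.1 * e q.2))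
      ∂(signPi ι) = a p.1 p.2 ^ 2 + a p.1 p.2 * a p.2 p.1 := by
    intro p hp
    have hp' := (Finset.mem_offDiag.1 hp).2.2
    rw [integral_finsetSum _ fun w _ => hi p w]
    simp_rw [integral_const_mul]
    rw [Finset.sum_congr rfl fun q hq => by
      rw [integral_sign_mul_four hp' (Finset.mem_offDiag.1 hq).2.2, mul_add, mul_ite, mul_ite,
        mul_one, mul_zero]]
    rw [Finset.sum_add_distrib]
    congr 1
    · rw [Finset.sum_eq_single p]
      · simp [sq]
      · intro q _ hq
        rw [if_neg]
        rintro ⟨h1, h2⟩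
        exact hq (Prod.ext h1.symm h2.symm)
      · exact fun h => absurd hp h
    · rw [Finset.sum_eq_single p.swap]
      · simp
      · intro q _ hq
        rw [if_neg]
        rintro ⟨h1, h2⟩
        exact hq (Prod.ext h2.symm h1.symm)
      · intro h
        exact absurd (Finset.mem_offDiag.2 ⟨Finset.mem_univ _, Finset.mem_univ _, hp'.symm⟩) h
  rw [Finset.sum_congr rfl e2, Finset.sum_add_distrib]
  have e3 : ∑ p ∈ K, a p.1 p.2 * a p.2 p.1 ≤ ∑ p ∈ K, (a p.1 p.2 ^ 2 + a p.2 p.1 ^ 2) / 2 :=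
    Finset.sum_le_sum fun p _ => by nlinarith [sq_nonneg (a p.1 p.2 - a p.2 p.1)]
  have e4 : ∑ p ∈ K, a p.2 p.1 ^ 2 = ∑ p ∈ K, a p.1 p.2 ^ 2 := by
    refine Finset.sum_nbij' Prod.swap Prod.swap ?_ ?_ ?_ ?_ ?_ <;> simp [hK, eq_comm]
  rw [← Finset.sum_div, Finset.sum_add_distrib, e4] at e3
  rw [← Finset.mul_sum]
  linarith

/-- The second moment of a complex Rademacher sum. -/
lemma lintegral_sum_sign_sq_le (a : ι → ℂ) :
    ∫⁻ e, ENNReal.ofReal (‖∑ v, (e v : ℂ) * a v‖ ^ 2) ∂(signPi ι) ≤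
      ENNReal.ofReal (∑ v, ‖a v‖ ^ 2) := by
  have e1 : ∀ e : ι → ℝ, ‖∑ v, (e v : ℂ) * a v‖ ^ 2 =
      (∑ v, (a v).re * e v) ^ 2 + (∑ v, (a v).im * e v) ^ 2 := fun e => by
    rw [← Complex.normSq_eq_norm_sq, Complex.normSq_apply, Complex.re_sum, Complex.im_sum, sq, sq]
    simp [mul_comm]
  have hb : ∀ b : ι → ℝ, Integrable (fun e : ι → ℝ => (∑ v, b v * e v) ^ 2) (signPi ι) := fun b =>
    integrable_signPi (C := (∑ v, |b v|) ^ 2) (by fun_prop) fun e he => by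
      rw [abs_pow]
      refine pow_le_pow_left₀ (abs_nonneg _) ((Finset.abs_sum_le_sum_abs _ _).trans ?_) 2
      refine Finset.sum_le_sum fun v _ => ?_
      rw [abs_mul]
      exact mul_le_of_le_one_right (abs_nonneg _) (abs_sign_le he v)
  simp_rw [e1]
  rw [← ofReal_integral_eq_lintegral_ofReal ((hb _).fun_add (hb _))
    (Filter.Eventually.of_forall fun e => by simp only [Pi.zero_apply]; positivity)]
  refine ENNReal.ofReal_le_ofReal (le_of_eq ?_)
  rw [integral_add (hb _) (hb _), integral_sum_sign_sq, integral_sum_sign_sq,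
    ← Finset.sum_add_distrib]
  refine Finset.sum_congr rfl fun v _ => ?_
  rw [← Complex.normSq_eq_norm_sq, Complex.normSq_apply, sq, sq]

/-- The second moment of a complex Rademacher chaos of order two. -/
lemma lintegral_offDiag_sign_sq_le (a : ι → ι → ℂ) :
    ∫⁻ e, ENNReal.ofReal (‖∑ p ∈ Finset.univ.offDiag, ((e p.1 * e p.2 : ℝ) : ℂ) * a p.1 p.2‖ ^ 2)
      ∂(signPi ι) ≤ ENNReal.ofReal (2 * ∑ p ∈ Finset.univ.offDiag, ‖a p.1 p.2‖ ^ 2) := by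
  set K := (Finset.univ : Finset ι).offDiag with hK
  have e1 : ∀ e : ι → ℝ, ‖∑ p ∈ K, ((e p.1 * e p.2 : ℝ) : ℂ) * a p.1 p.2‖ ^ 2 =
      (∑ p ∈ K, (a p.1 p.2).re * (e p.1 * e p.2)) ^ 2 +
      (∑ p ∈ K, (a p.1 p.2).im * (e p.1 * e p.2)) ^ 2 := fun e => by
    rw [← Complex.normSq_eq_norm_sq, Complex.normSq_apply, Complex.re_sum, Complex.im_sum, sq, sq]
    simp only [Complex.re_ofReal_mul, Complex.im_ofReal_mul]
    simp only [mul_comm]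
  have hb : ∀ b : ι → ι → ℝ, Integrable (fun e : ι → ℝ => (∑ p ∈ K, b p.1 p.2 * (e p.1 * e p.2)) ^ 2)
      (signPi ι) := fun b =>
    integrable_signPi (C := (∑ p ∈ K, |b p.1 p.2|) ^ 2) (by fun_prop) fun e he => by
      rw [abs_pow]
      refine pow_le_pow_left₀ (abs_nonneg _) ((Finset.abs_sum_le_sum_abs _ _).trans ?_) 2
      refine Finset.sum_le_sum fun v _ => ?_
      rw [abs_mul, abs_mul]
      exact mul_le_of_le_one_right (abs_nonneg _)
        (mul_le_one₀ (abs_sign_le he _) (abs_nonneg _) (abs_sign_le he _))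
  simp_rw [e1]
  rw [← ofReal_integral_eq_lintegral_ofReal ((hb fun v w => (a v w).re).fun_add
    (hb fun v w => (a v w).im))
    (Filter.Eventually.of_forall fun e => by simp only [Pi.zero_apply]; positivity)]
  refine ENNReal.ofReal_le_ofReal ?_
  rw [integral_add (hb fun v w => (a v w).re) (hb fun v w => (a v w).im)]
  refine (add_le_add (integral_offDiag_sign_sq_le fun v w => (a v w).re)
    (integral_offDiag_sign_sq_le fun v w => (a v w).im)).trans
    (le_of_eq ?_)
  rw [← mul_add, ← Finset.sum_add_distrib]
  congr 1
  refine Finset.sum_congr rfl fun v _ => ?_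
  rw [← Complex.normSq_eq_norm_sq, Complex.normSq_apply, sq, sq]

end Rademacher

/-! ### The exponential of an indefinite integral -/

lemma absolutelyContinuousOnInterval_of_dist_le {X : Type*} [PseudoMetricSpace X] {f : ℝ → X}
    {g : ℝ → ℝ} {a b K : ℝ} (hK : 0 ≤ K) (hg : AbsolutelyContinuousOnInterval g a b)
    (h : ∀ s ∈ Set.uIcc a b, ∀ t ∈ Set.uIcc a b, dist (f s) (f t) ≤ K * dist (g s) (g t)) :
    AbsolutelyContinuousOnInterval f a b := by
  rw [absolutelyContinuousOnInterval_iff] at hg ⊢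
  intro ε hε
  obtain ⟨δ, hδ, hgδ⟩ := hg (ε / (K + 1)) (by positivity)
  refine ⟨δ, hδ, fun E hE hlt => ?_⟩
  have h1 := hgδ E hE hlt
  calc _ ≤ ∑ i ∈ Finset.range E.1, K * dist (g (E.2 i).1) (g (E.2 i).2) :=
        Finset.sum_le_sum fun i hi => h _ (hE.1 i hi).1 _ (hE.1 i hi).2
    _ = K * ∑ i ∈ Finset.range E.1, dist (g (E.2 i).1) (g (E.2 i).2) := by rw [Finset.mul_sum]
    _ ≤ (K + 1) * ∑ i ∈ Finset.range E.1, dist (g (E.2 i).1) (g (E.2 i).2) :=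
        mul_le_mul_of_nonneg_right (by linarith) (Finset.sum_nonneg fun _ _ => dist_nonneg)
    _ < (K + 1) * (ε / (K + 1)) := mul_lt_mul_of_pos_left h1 (by positivity)
    _ = ε := mul_div_cancel₀ _ (by positivity)

lemma absolutelyContinuousOnInterval_integral {w : ℝ → ℂ} {a b : ℝ}
    (hw : IntervalIntegrable w volume a b) :
    AbsolutelyContinuousOnInterval (fun x => ∫ u in a..x, w u) a b := by
  refine absolutelyContinuousOnInterval_of_dist_le zero_le_one
    (hw.norm.absolutelyContinuousOnInterval_intervalIntegral Set.left_mem_uIcc)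
    fun s hs t ht => ?_
  have hi : ∀ {F : Type} [NormedAddCommGroup F] {f : ℝ → F}, IntervalIntegrable f volume a b →
      ∀ x ∈ Set.uIcc a b, ∀ y ∈ Set.uIcc a b, IntervalIntegrable f volume x y :=
    fun hf x hx y hy => hf.mono_set (Set.uIcc_subset_uIcc hx hy)
  rw [one_mul, dist_eq_norm, dist_eq_norm,
    intervalIntegral.integral_interval_sub_left (hi hw _ Set.left_mem_uIcc _ hs)
      (hi hw _ Set.left_mem_uIcc _ ht),
    intervalIntegral.integral_interval_sub_left (hi hw.norm _ Set.left_mem_uIcc _ hs)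
      (hi hw.norm _ Set.left_mem_uIcc _ ht), Real.norm_eq_abs]
  exact intervalIntegral.norm_integral_le_abs_integral_norm

/-- The integrand is merely integrable, so the chain rule holds only almost everywhere. The
exponential is Lipschitz on the bounded range of the primitive, hence both sides are absolutely
continuous, and their difference has zero derivative almost everywhere. -/
theorem exp_intervalIntegral_eq {w : ℝ → ℂ} {a b : ℝ} (hw : IntervalIntegrable w volume a b) :
    Complex.exp (∫ u in a..b, w u) = 1 + ∫ u in a..b, w u * Complex.exp (∫ s in a..u, w s) := by
  set W : ℝ → ℂ := fun x => ∫ u in a..x, w u with hW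
  have hWac : AbsolutelyContinuousOnInterval W a b := absolutelyContinuousOnInterval_integral hw
  have hWc : ContinuousOn W (Set.uIcc a b) := hWac.continuousOn
  have hw' : IntervalIntegrable (fun u => w u * Complex.exp (W u)) volume a b :=
    hw.mul_continuousOn (Complex.continuous_exp.comp_continuousOn hWc)
  obtain ⟨R, hR⟩ := hWac.exists_bound
  have hLip : ∀ x y : ℂ, ‖x‖ ≤ R → ‖y‖ ≤ R →
      ‖Complex.exp y - Complex.exp x‖ ≤ Real.exp R * ‖y - x‖ := by
    intro x y hx hy
    refine (convex_closedBall (0 : ℂ) R).norm_image_sub_le_of_norm_hasDerivWithin_le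
      (f := Complex.exp) (f' := Complex.exp)
      (fun z _ => (Complex.hasDerivAt_exp z).hasDerivWithinAt) (fun z hz => ?_)
      (by simpa using hx) (by simpa using hy)
    rw [Complex.norm_exp]
    exact Real.exp_le_exp.2 ((Complex.re_le_norm z).trans (by simpa using hz))
  have hexp : AbsolutelyContinuousOnInterval (fun x => Complex.exp (W x)) a b := by
    refine absolutelyContinuousOnInterval_of_dist_le (K := Real.exp R) (Real.exp_pos _).le
      (hw.norm.absolutelyContinuousOnInterval_intervalIntegral Set.left_mem_uIcc)
      fun s hs t ht => ?_
    rw [dist_eq_norm, dist_eq_norm]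
    refine (hLip _ _ (hR t ht) (hR s hs)).trans ?_
    refine mul_le_mul_of_nonneg_left ?_ (Real.exp_pos _).le
    have hi : ∀ {F : Type} [NormedAddCommGroup F] {f : ℝ → F}, IntervalIntegrable f volume a b →
        ∀ x ∈ Set.uIcc a b, ∀ y ∈ Set.uIcc a b, IntervalIntegrable f volume x y :=
      fun hf x hx y hy => hf.mono_set (Set.uIcc_subset_uIcc hx hy)
    rw [hW]
    simp only
    rw [intervalIntegral.integral_interval_sub_left (hi hw _ Set.left_mem_uIcc _ hs)
      (hi hw _ Set.left_mem_uIcc _ ht),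
      intervalIntegral.integral_interval_sub_left (hi hw.norm _ Set.left_mem_uIcc _ hs)
      (hi hw.norm _ Set.left_mem_uIcc _ ht), Real.norm_eq_abs]
    exact intervalIntegral.norm_integral_le_abs_integral_norm
  have hF := absolutelyContinuousOnInterval_integral hw'
  obtain ⟨c, hc⟩ := (hexp.sub hF).const_of_ae_hasDerivAt_zero (by
    filter_upwards [hw.ae_hasDerivAt_integral, hw'.ae_hasDerivAt_integral] with x h1 h2 hx
    have := ((h1 hx a Set.left_mem_uIcc).cexp).sub (h2 hx a Set.left_mem_uIcc)
    rw [mul_comm, sub_self] at this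
    exact this)
  have ha := hc a Set.left_mem_uIcc
  have hb := hc b Set.right_mem_uIcc
  simp only [Pi.sub_apply, hW, intervalIntegral.integral_same, Complex.exp_zero, sub_zero] at ha hb
  rw [← ha] at hb
  rw [← hb]
  ring

/-! ### Fourier coefficients along the vortex dynamics -/

/-- The symmetrised interaction kernel in the equation of a Fourier coefficient. -/
def symKernel (k : Fin 2 → ℤ) (x y : Torus) : ℂ :=
  (1 / 2 : ℝ) * (Complex.I * phase k (bsKernel (x - y))) *
    (UnitAddTorus.mFourier k x - UnitAddTorus.mFourier k y)

lemma freqLip_sq_le (k : Fin 2 → ℤ) : freqLip k ^ 2 ≤ (2 * Real.pi) ^ 2 * 2 * freqSq k := by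
  rw [freqLip, freqSq, Fin.sum_univ_two, mul_pow, mul_assoc ((2 * Real.pi) ^ 2)]
  refine mul_le_mul_of_nonneg_left ?_ (by positivity)
  rw [← sq_abs (k 0 : ℝ), ← sq_abs (k 1 : ℝ)]
  nlinarith [sq_nonneg (|(k 0 : ℝ)| - |(k 1 : ℝ)|)]

/-- The difference of the characters vanishes on the diagonal at the rate |k|‖x-y‖, which cancels
the 1/‖x-y‖ of the Biot-Savart kernel; the other factor |k| comes from the phase. -/
lemma exists_norm_symKernel_le : ∃ C : ℝ, 0 < C ∧ ∀ k x y, ‖symKernel k x y‖ ≤ C * freqSq k := by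
  obtain ⟨C, hC, hK⟩ := norm_bsKernel_le
  refine ⟨1 / 2 * C * ((2 * Real.pi) ^ 2 * 2), by positivity, fun k x y => ?_⟩
  obtain ⟨d, hd, hdn⟩ := exists_toTorus_eq (x - y)
  have hdz : ‖d‖ ≤ ‖x - y‖ := (pi_norm_le_iff_of_nonneg (norm_nonneg _)).2 fun i => by
    rw [Real.norm_eq_abs, hdn]
    exact norm_le_pi_norm (x - y) i
  have h1 : ‖UnitAddTorus.mFourier k x - UnitAddTorus.mFourier k y‖ ≤ freqLip k * ‖x - y‖ := by
    have := norm_mFourier_add_sub_le k y d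
    rw [hd, add_sub_cancel] at this
    exact this.trans (mul_le_mul_of_nonneg_left hdz (freqLip_nonneg k))
  have h2 : |phase k (bsKernel (x - y))| ≤ freqLip k * (C / ‖x - y‖) :=
    (abs_phase_le _ _).trans (mul_le_mul_of_nonneg_left (hK _) (freqLip_nonneg k))
  have hF := freqLip_nonneg k
  have hF0 := freqSq_nonneg k
  rw [symKernel, norm_mul, norm_mul, norm_mul, Complex.norm_I, one_mul, Complex.norm_real,
    Complex.norm_real, Real.norm_eq_abs, Real.norm_eq_abs, abs_of_pos (by norm_num : (0 : ℝ) < 1 / 2)]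
  calc _ ≤ 1 / 2 * (freqLip k * (C / ‖x - y‖)) * (freqLip k * ‖x - y‖) := by gcongr
    _ = 1 / 2 * C * freqLip k ^ 2 * (‖x - y‖ / ‖x - y‖) := by ring
    _ ≤ 1 / 2 * C * freqLip k ^ 2 * 1 :=
        mul_le_mul_of_nonneg_left (div_self_le_one _) (by positivity)
    _ ≤ 1 / 2 * C * ((2 * Real.pi) ^ 2 * 2 * freqSq k) := by
        rw [mul_one]
        exact mul_le_mul_of_nonneg_left (freqLip_sq_le k) (by positivity)
    _ = _ := by ring

lemma measurable_phase (k : Fin 2 → ℤ) : Measurable (phase k) := by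
  unfold phase
  fun_prop

lemma measurable_symKernel (k : Fin 2 → ℤ) : Measurable fun p : Torus × Torus =>
    symKernel k p.1 p.2 := by
  have h1 : Measurable fun p : Torus × Torus => phase k (bsKernel (p.1 - p.2)) :=
    (measurable_phase k).comp (measurable_bsKernel.comp (measurable_fst.sub measurable_snd))
  have h2 : Measurable fun z : Torus => UnitAddTorus.mFourier k z :=
    (UnitAddTorus.mFourier k).continuous.measurable
  exact ((measurable_const.mul (Complex.measurable_ofReal.comp h1)).const_mul _).mul
    ((h2.comp measurable_fst).sub (h2.comp measurable_snd))

/-- `phase` as a continuous linear map. -/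
def phaseL (k : Fin 2 → ℤ) : (Fin 2 → ℝ) →L[ℝ] ℝ :=
  (2 * Real.pi) • ((k 0 : ℝ) • ContinuousLinearMap.proj 0 + (k 1 : ℝ) • ContinuousLinearMap.proj 1)

lemma phaseL_apply (k : Fin 2 → ℤ) (d : Fin 2 → ℝ) : phaseL k d = phase k d := by
  simp [phaseL, phase]
  ring

lemma phase_sum_smul {ι : Type*} (k : Fin 2 → ℤ) (s : Finset ι) (a : ι → ℝ) (f : ι → Fin 2 → ℝ) :
    phase k (∑ w ∈ s, a w • f w) = ∑ w ∈ s, a w * phase k (f w) := by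
  rw [← phaseL_apply, map_sum]
  simp [phaseL_apply]

/-- The equation of the contribution of a single vortex to a Fourier coefficient. -/
lemma exp_mul_mFourier_eq (k : Fin 2 → ℤ) (θ : ℝ) {b t : ℝ} {V : ℝ → Fin 2 → ℝ}
    (hV : IntervalIntegrable V volume b t) (p : Torus) :
    IntervalIntegrable (fun u => (Real.exp (-(θ * (u - b))) : ℂ) * (-θ + Complex.I * phase k (V u)) *
      UnitAddTorus.mFourier k (p + toTorus (∫ s in b..u, V s))) volume b t ∧
    (Real.exp (-(θ * (t - b))) : ℂ) * UnitAddTorus.mFourier k (p + toTorus (∫ s in b..t, V s)) =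
      UnitAddTorus.mFourier k p + ∫ u in b..t, (Real.exp (-(θ * (u - b))) : ℂ) *
        (-θ + Complex.I * phase k (V u)) * UnitAddTorus.mFourier k (p + toTorus (∫ s in b..u, V s)) := by
  set w : ℝ → ℂ := fun u => -θ + Complex.I * phase k (V u) with hw
  have hph : IntervalIntegrable (fun u => ((phase k (V u) : ℝ) : ℂ)) volume b t := by
    have h1 : ∀ u, ((phase k (V u) : ℝ) : ℂ) = (Complex.ofRealCLM.comp (phaseL k)) (V u) := fun u => by
      simp [phaseL_apply]
    simp_rw [h1]
    exact ⟨(Complex.ofRealCLM.comp (phaseL k)).integrable_comp hV.1,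
      (Complex.ofRealCLM.comp (phaseL k)).integrable_comp hV.2⟩
  have hwi : IntervalIntegrable w volume b t := intervalIntegrable_const.add (hph.const_mul _)
  have hWu : ∀ u ∈ Set.uIcc b t, Complex.exp (∫ s in b..u, w s) =
      (Real.exp (-(θ * (u - b))) : ℂ) *
        Complex.exp (Complex.I * phase k (∫ s in b..u, V s)) := by
    intro u hu
    have hsub : ∀ {F : Type} [NormedAddCommGroup F] {f : ℝ → F}, IntervalIntegrable f volume b t →
        IntervalIntegrable f volume b u := fun hf =>
      hf.mono_set (Set.uIcc_subset_uIcc Set.left_mem_uIcc hu)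
    rw [hw, intervalIntegral.integral_add intervalIntegrable_const ((hsub hph).const_mul _),
      intervalIntegral.integral_const, intervalIntegral.integral_const_mul,
      intervalIntegral.integral_ofReal, Complex.exp_add]
    have e1 : ∫ s in b..u, phase k (V s) = phase k (∫ s in b..u, V s) := by
      simp_rw [← phaseL_apply]
      exact (phaseL k).intervalIntegral_comp_comm (hsub hV)
    rw [e1, Complex.ofReal_exp]
    congr 2
    push_cast
    rw [Complex.real_smul]
    push_cast
    ring
  have hφ : ∀ u ∈ Set.uIcc b t, (Real.exp (-(θ * (u - b))) : ℂ) *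
      UnitAddTorus.mFourier k (p + toTorus (∫ s in b..u, V s)) =
      UnitAddTorus.mFourier k p * Complex.exp (∫ s in b..u, w s) := fun u hu => by
    rw [hWu u hu, mFourier_add_apply, mFourier_toTorus_eq_exp_phase]
    ring
  have hpt : ∀ u ∈ Set.uIcc b t, (Real.exp (-(θ * (u - b))) : ℂ) * (-θ + Complex.I * phase k (V u)) *
      UnitAddTorus.mFourier k (p + toTorus (∫ s in b..u, V s)) =
      UnitAddTorus.mFourier k p * (w u * Complex.exp (∫ s in b..u, w s)) := fun u hu => by
    rw [mul_right_comm, hφ u hu]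
    ring
  have hcont : ContinuousOn (fun u => Complex.exp (∫ s in b..u, w s)) (Set.uIcc b t) :=
    Complex.continuous_exp.comp_continuousOn
      (intervalIntegral.continuousOn_primitive_interval' hwi Set.left_mem_uIcc)
  constructor
  · refine ((hwi.mul_continuousOn hcont).const_mul (UnitAddTorus.mFourier k p)).congr ?_
    intro u hu
    exact (hpt u (Set.uIoc_subset_uIcc hu)).symm
  · rw [hφ t Set.right_mem_uIcc, intervalIntegral.integral_congr hpt,
      intervalIntegral.integral_const_mul, exp_intervalIntegral_eq hwi]
    ring

/-- Lets all vortices be integrated from time 0: those not yet born contribute a zero integrand. -/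
lemma intervalIntegral_cut {F : Type*} [NormedAddCommGroup F] [NormedSpace ℝ F] {f : ℝ → F}
    {b t : ℝ} (hb : 0 ≤ b) (ht : 0 ≤ t) (hf : b ≤ t → IntervalIntegrable f volume b t) :
    IntervalIntegrable (fun u => if b ≤ u then f u else 0) volume 0 t ∧
    ∫ u in (0 : ℝ)..t, (if b ≤ u then f u else 0) = if b ≤ t then ∫ u in b..t, f u else 0 := by
  have h0 : ∀ c, 0 ≤ c → c ≤ b → IntervalIntegrable (fun u => if b ≤ u then f u else 0) volume 0 c ∧
      ∫ u in (0 : ℝ)..c, (if b ≤ u then f u else 0) = 0 := by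
    intro c hc hcb
    have hae : ∀ᵐ u : ℝ, u ∈ Set.uIoc 0 c → (if b ≤ u then f u else 0) = 0 := by
      have hne : ∀ᵐ u : ℝ, u ≠ b := by simp [ae_iff]
      filter_upwards [hne] with u hu hmem
      rw [Set.uIoc_of_le hc] at hmem
      rw [if_neg]
      exact fun h => hu (le_antisymm (hmem.2.trans hcb) h)
    constructor
    · refine (intervalIntegrable_const (c := (0 : F)) (μ := volume) (a := 0) (b := c)).congr_ae ?_
      rw [Filter.EventuallyEq, ae_restrict_iff' measurableSet_uIoc]
      exact hae.mono fun u h hu => (h hu).symm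
    · rw [intervalIntegral.integral_congr_ae hae]
      simp
  split_ifs with h
  · have h1 : IntervalIntegrable (fun u => if b ≤ u then f u else 0) volume b t := by
      refine (hf h).congr fun u hu => ?_
      rw [Set.uIoc_of_le h] at hu
      simp [hu.1.le]
    refine ⟨(h0 b hb le_rfl).1.trans h1, ?_⟩
    rw [← intervalIntegral.integral_add_adjacent_intervals (h0 b hb le_rfl).1 h1,
      (h0 b hb le_rfl).2, zero_add]
    refine intervalIntegral.integral_congr fun u hu => ?_
    rw [Set.uIcc_of_le h] at hu
    simp [hu.1]
  · exact h0 t ht (not_le.1 h).le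

section FiniteSystem

variable {ι : Type*} [Fintype ι] [DecidableEq ι]

/-- Exchange v and w in the double sum, average the two forms and use that K is odd; the weight a_v
a_w is symmetric. -/
lemma sum_phase_eq_sum_symKernel (k : Fin 2 → ℤ) (a : ι → ℝ) (x : ι → Torus) :
    ∑ v, (a v : ℂ) * (Complex.I * phase k (∑ w ∈ Finset.univ.erase v, a w • bsKernel (x v - x w))) *
      UnitAddTorus.mFourier k (x v) =
    ∑ p ∈ Finset.univ.offDiag, ((a p.1 * a p.2 : ℝ) : ℂ) * symKernel k (x p.1) (x p.2) := by
  set K := (Finset.univ : Finset ι).offDiag with hK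
  set h : ι × ι → ℂ := fun p => ((a p.1 * a p.2 : ℝ) : ℂ) *
    (Complex.I * phase k (bsKernel (x p.1 - x p.2))) * UnitAddTorus.mFourier k (x p.1) with hh
  have e1 : ∑ v, (a v : ℂ) *
      (Complex.I * phase k (∑ w ∈ Finset.univ.erase v, a w • bsKernel (x v - x w))) *
      UnitAddTorus.mFourier k (x v) = ∑ p ∈ K, h p := by
    rw [hK, Finset.sum_finset_product _ Finset.univ (fun v => Finset.univ.erase v)
      (by simp [eq_comm])]
    refine Finset.sum_congr rfl fun v _ => ?_
    rw [phase_sum_smul, Complex.ofReal_sum, Finset.mul_sum, Finset.mul_sum, Finset.sum_mul]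
    refine Finset.sum_congr rfl fun w _ => ?_
    simp only [hh]
    push_cast
    ring
  have e2 : ∑ p ∈ K, h p = ∑ p ∈ K, h p.swap := by
    refine Finset.sum_nbij' Prod.swap Prod.swap ?_ ?_ ?_ ?_ ?_ <;> simp [hK, eq_comm]
  have e3 : ∀ p, ((a p.1 * a p.2 : ℝ) : ℂ) * symKernel k (x p.1) (x p.2) =
      (1 / 2 : ℝ) * (h p + h p.swap) := by
    intro p
    have : phase k (bsKernel (x p.2 - x p.1)) = -phase k (bsKernel (x p.1 - x p.2)) := by
      rw [← neg_sub (x p.1), bsKernel_neg]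
      simp [phase]
      ring
    simp only [hh, symKernel, Prod.fst_swap, Prod.snd_swap, this]
    push_cast
    ring
  simp_rw [e3]
  rw [e1, ← Finset.mul_sum, Finset.sum_add_distrib, ← e2]
  push_cast
  ring

/-- The drift of the `k`-th Fourier coefficient of a system of damped vortices. -/
def coeffDrift (k : Fin 2 → ℤ) (θ : ℝ) (a : ι → ℝ) (x : ι → Torus) : ℂ :=
  -θ * ∑ v, (a v : ℂ) * UnitAddTorus.mFourier k (x v) +
    ∑ p ∈ Finset.univ.offDiag, ((a p.1 * a p.2 : ℝ) : ℂ) * symKernel k (x p.1) (x p.2)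

/-- The evolution of a Fourier coefficient of a finite system of damped vortices with creation. -/
theorem coeff_eq (k : Fin 2 → ℤ) (θ : ℝ) {t : ℝ} (ht : 0 ≤ t) {b ξ : ι → ℝ} (hb : ∀ v, 0 ≤ b v)
    {act : ι → Prop} [∀ v, Decidable (act v)] {a : ι → ℝ → ℝ}
    (ha : ∀ v u, a v u = if act v ∧ b v ≤ u then ξ v * Real.exp (-(θ * (u - b v))) else 0)
    {p : ι → Torus} {x : ι → ℝ → Torus}
    (hi : ∀ v, act v → b v ≤ t → IntervalIntegrable (fun u => ∑ w ∈ Finset.univ.erase v,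
      a w u • bsKernel (x v u - x w u)) volume (b v) t)
    (hx : ∀ v, act v → ∀ r, b v ≤ r → r ≤ t → x v r = p v + toTorus (∫ u in (b v)..r,
      ∑ w ∈ Finset.univ.erase v, a w u • bsKernel (x v u - x w u))) :
    IntervalIntegrable (fun u => coeffDrift k θ (fun v => a v u) (fun v => x v u)) volume 0 t ∧
    ∑ v, (a v t : ℂ) * UnitAddTorus.mFourier k (x v t) =
      ∑ v, (if act v ∧ b v ≤ t then (ξ v : ℂ) * UnitAddTorus.mFourier k (p v) else 0) +
      ∫ u in (0 : ℝ)..t, coeffDrift k θ (fun v => a v u) (fun v => x v u) := by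
  set V : ι → ℝ → Fin 2 → ℝ := fun v u => ∑ w ∈ Finset.univ.erase v,
    a w u • bsKernel (x v u - x w u) with hV
  set f : ι → ℝ → ℂ := fun v u => (a v u : ℂ) * (-θ + Complex.I * phase k (V v u)) *
    UnitAddTorus.mFourier k (x v u) with hf
  have hD : ∀ u, coeffDrift k θ (fun v => a v u) (fun v => x v u) = ∑ v, f v u := by
    intro u
    rw [coeffDrift, ← sum_phase_eq_sum_symKernel k (fun v => a v u) (fun v => x v u), Finset.mul_sum, ← Finset.sum_add_distrib]
    refine Finset.sum_congr rfl fun v _ => ?_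
    simp only [hf, hV]
    ring
  have key : ∀ v, IntervalIntegrable (f v) volume 0 t ∧ (a v t : ℂ) * UnitAddTorus.mFourier k (x v t) =
      (if act v ∧ b v ≤ t then (ξ v : ℂ) * UnitAddTorus.mFourier k (p v) else 0) +
        ∫ u in (0 : ℝ)..t, f v u := by
    intro v
    by_cases hv : act v
    swap
    · have h0 : f v = fun _ => 0 := funext fun u => by simp [hf, ha, hv]
      rw [h0]
      refine ⟨intervalIntegrable_const, ?_⟩
      simp [ha, hv]
    set g : ℝ → ℂ := fun u => (ξ v : ℂ) * ((Real.exp (-(θ * (u - b v))) : ℂ) *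
      (-θ + Complex.I * phase k (V v u)) *
        UnitAddTorus.mFourier k (p v + toTorus (∫ s in (b v)..u, V v s))) with hg
    -- The weight `a v u` vanishes before birth, so the integrand is the cut of the single-vortex
    -- one.
    have hfg : ∀ u ∈ Set.Icc 0 t, f v u = if b v ≤ u then g u else 0 := by
      intro u hu
      by_cases hbu : b v ≤ u
      · simp only [hf, hg, hbu, if_true, ha, hv, true_and]
        rw [hx v hv u hbu hu.2]
        push_cast
        ring
      · simp [hf, ha, hbu]
    have hcut := intervalIntegral_cut (f := g) (hb v) ht fun hbt =>
      (exp_mul_mFourier_eq k θ (hi v hv hbt) (p v)).1.const_mul _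
    have hint : ∫ u in (0 : ℝ)..t, f v u = ∫ u in (0 : ℝ)..t, (if b v ≤ u then g u else 0) :=
      intervalIntegral.integral_congr fun u hu => hfg u (by rwa [Set.uIcc_of_le ht] at hu)
    refine ⟨hcut.1.congr fun u hu => (hfg u ?_).symm, ?_⟩
    · rw [Set.uIoc_of_le ht] at hu
      exact ⟨hu.1.le, hu.2⟩
    rw [hint, hcut.2]
    by_cases hbt : b v ≤ t
    · simp only [ha, hv, hbt, true_and, if_true]
      rw [hx v hv t hbt le_rfl, hg, intervalIntegral.integral_const_mul, ← mul_add,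
        ← (exp_mul_mFourier_eq k θ (hi v hv hbt) (p v)).2]
      push_cast
      ring
    · simp [ha, hbt]
  simp_rw [hD]
  constructor
  · have := IntervalIntegrable.sum Finset.univ fun v (_ : v ∈ Finset.univ) => (key v).1
    simpa only [Finset.sum_fn] using this
  · rw [intervalIntegral.integral_finsetSum fun v _ => (key v).1, ← Finset.sum_add_distrib]
    exact Finset.sum_congr rfl fun v _ => (key v).2

end FiniteSystem

/-! ### The joint law of times, signs and positions -/

section Independence

variable {Ω : Type*} [MeasurableSpace Ω] {P : Measure Ω} [IsProbabilityMeasure P]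
  {α β γ δ : Type*} [MeasurableSpace α] [MeasurableSpace β] [MeasurableSpace γ] [MeasurableSpace δ]

lemma indepFun_prodMk_left {X : Ω → α} {Y : Ω → β} {Z : Ω → γ} (hX : Measurable X)
    (hY : Measurable Y) (hZ : Measurable Z) (h : IndepFun X (fun ω => (Y ω, Z ω)) P)
    (h' : IndepFun Y Z P) : IndepFun (fun ω => (X ω, Y ω)) Z P := by
  have hXY : IndepFun X Y P := h.comp measurable_id measurable_fst
  have : IsProbabilityMeasure (P.map X) := Measure.isProbabilityMeasure_map hX.aemeasurable
  have : IsProbabilityMeasure (P.map Y) := Measure.isProbabilityMeasure_map hY.aemeasurable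
  have : IsProbabilityMeasure (P.map Z) := Measure.isProbabilityMeasure_map hZ.aemeasurable
  rw [indepFun_iff_map_prod_eq_prod_map_map hX.aemeasurable (hY.prodMk hZ).aemeasurable,
    (indepFun_iff_map_prod_eq_prod_map_map hY.aemeasurable hZ.aemeasurable).1 h'] at h
  rw [indepFun_iff_map_prod_eq_prod_map_map (hX.prodMk hY).aemeasurable hZ.aemeasurable,
    (indepFun_iff_map_prod_eq_prod_map_map hX.aemeasurable hY.aemeasurable).1 hXY]
  rw [← ((measurePreserving_prodAssoc (P.map X) (P.map Y) (P.map Z)).symm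
    (MeasurableEquiv.prodAssoc)).map_eq, ← h,
    Measure.map_map (MeasurableEquiv.measurable _) (hX.prodMk (hY.prodMk hZ))]
  rfl

lemma indepFun_prodMk_right {X : Ω → α} {Y : Ω → β} {Z : Ω → γ} (hX : Measurable X)
    (hY : Measurable Y) (hZ : Measurable Z) (h : IndepFun (fun ω => (X ω, Y ω)) Z P)
    (h' : IndepFun X Y P) : IndepFun X (fun ω => (Y ω, Z ω)) P := by
  have h1 : IndepFun Z (fun ω => (Y ω, X ω)) P :=
    (h.comp (measurable_snd.prodMk measurable_fst) measurable_id).symm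
  have h2 := indepFun_prodMk_left hZ hY hX h1 h'.symm
  exact (h2.comp (measurable_snd.prodMk measurable_fst) measurable_id).symm

/-- Regrouping of four variables: from the two processes being independent, each with times
independent of marks, to all times being independent of all marks. -/
lemma indepFun_prodMk_prodMk {A : Ω → α} {B : Ω → β} {C : Ω → γ} {D : Ω → δ} (hA : Measurable A)
    (hB : Measurable B) (hC : Measurable C) (hD : Measurable D)
    (h : IndepFun (fun ω => (A ω, B ω)) (fun ω => (C ω, D ω)) P) (hAB : IndepFun A B P)
    (hCD : IndepFun C D P) : IndepFun (fun ω => (A ω, C ω)) (fun ω => (B ω, D ω)) P := by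
  have h1 : IndepFun (fun ω => ((A ω, B ω), C ω)) D P :=
    indepFun_prodMk_left (hA.prodMk hB) hC hD h hCD
  have h2 : IndepFun (fun ω => ((A ω, C ω), B ω)) D P :=
    h1.comp (((measurable_fst.comp measurable_fst).prodMk measurable_snd).prodMk
      (measurable_snd.comp measurable_fst)) measurable_id
  have h3 : IndepFun (fun ω => (B ω, A ω)) C P :=
    h.comp (measurable_snd.prodMk measurable_fst) measurable_fst
  exact indepFun_prodMk_right (hA.prodMk hC) hB hD h2
    (indepFun_prodMk_right hB hA hC h3 hAB.symm).symm

end Independence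

/-- The vortices among the first `m` initial ones and the first `m` created ones. -/
def lab (m : ℕ) : Fin m ⊕ Fin m → Label := Sum.map Fin.val Fin.val

lemma lab_injective (m : ℕ) : Function.Injective (lab m) :=
  Function.Injective.sumMap Fin.val_injective Fin.val_injective

section Labels

variable {Ω : Type*} [MeasurableSpace Ω] (init noise : MarkedPoints Ω)

/-- The time of the point that gives the vortex `v`. -/
def labTime : Label → Ω → ℝ
  | .inl i => init.time i
  | .inr j => noise.time j

/-- The mark of the point that gives the vortex `v`. -/
def labMark : Label → Ω → ℝ × Torus
  | .inl i => init.mark i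
  | .inr j => noise.mark j

lemma measurable_labTime (v : Label) : Measurable (labTime init noise v) := by
  rcases v with i | j
  · exact init.measurable_time i
  · exact noise.measurable_time j

lemma measurable_labMark (v : Label) : Measurable (labMark init noise v) := by
  rcases v with i | j
  · exact init.measurable_mark i
  · exact noise.measurable_mark j

/-- The times of all the points, and the signs of the points that give the first vortices. -/
def timesSigns (m : ℕ) (ω : Ω) : (Label → ℝ) × (Fin m ⊕ Fin m → ℝ) :=
  (fun v => labTime init noise v ω, fun v => (labMark init noise (lab m v) ω).1)

lemma measurable_timesSigns (m : ℕ) : Measurable (timesSigns init noise m) :=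
  (measurable_pi_lambda _ fun v => measurable_labTime init noise v).prodMk
    (measurable_pi_lambda _ fun _ => measurable_fst.comp (measurable_labMark init noise _))

lemma measurable_startPos (v : Label) : Measurable (startPos init noise v) := by
  rcases v with i | j
  · exact measurable_snd.comp (init.measurable_mark i)
  · exact measurable_snd.comp (noise.measurable_mark j)

variable {init noise}

/-- The times, the signs and the positions at birth are independent. -/
lemma map_timesSigns_startPos {P : Measure Ω} [IsProbabilityMeasure P] {r r' : ℝ≥0}
    (hI : init.IsPoisson r P) (hN : noise.IsPoisson r' P)
    (hIN : IndepFun (fun ω i => (init.time i ω, init.mark i ω))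
      (fun ω i => (noise.time i ω, noise.mark i ω)) P) (m : ℕ) :
    P.map (fun ω => (timesSigns init noise m ω, fun v => startPos init noise (lab m v) ω)) =
      ((P.map fun ω v => labTime init noise v ω).prod (signPi (Fin m ⊕ Fin m))).prod volume := by
  have mtI : Measurable fun ω i => init.time i ω := measurable_pi_lambda _ init.measurable_time
  have mtN : Measurable fun ω i => noise.time i ω := measurable_pi_lambda _ noise.measurable_time
  have mmI : Measurable fun ω i => init.mark i ω := measurable_pi_lambda _ init.measurable_mark
  have mmN : Measurable fun ω i => noise.mark i ω := measurable_pi_lambda _ noise.measurable_mark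
  have hsplit : Measurable fun f : ℕ → ℝ × ℝ × Torus => (fun i => (f i).1, fun i => (f i).2) :=
    (measurable_pi_lambda _ fun i => measurable_fst.comp (measurable_pi_apply i)).prodMk
      (measurable_pi_lambda _ fun i => measurable_snd.comp (measurable_pi_apply i))
  have h4 : IndepFun (fun ω => (fun i => init.time i ω, fun i => noise.time i ω))
      (fun ω => (fun i => init.mark i ω, fun i => noise.mark i ω)) P :=
    indepFun_prodMk_prodMk mtI mmI mtN mmN (hIN.comp hsplit hsplit) hI.indep_time_mark
      hN.indep_time_mark
  have hmm : IndepFun (fun ω i => init.mark i ω) (fun ω i => noise.mark i ω) P :=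
    hIN.comp (measurable_snd.comp hsplit) (measurable_snd.comp hsplit)
  set tm : Ω → Label → ℝ := fun ω v => labTime init noise v ω with htm
  set mk : Ω → Fin m ⊕ Fin m → ℝ × Torus := fun ω v => labMark init noise (lab m v) ω with hmk
  have mtm : Measurable tm := measurable_pi_lambda _ fun v => measurable_labTime init noise v
  have mmk : Measurable mk := measurable_pi_lambda _ fun v => measurable_labMark init noise _
  have hind : IndepFun tm mk P := by
    let φ : (ℕ → ℝ) × (ℕ → ℝ) → Label → ℝ := fun p v => Sum.elim p.1 p.2 v
    let ψ : (ℕ → ℝ × Torus) × (ℕ → ℝ × Torus) → Fin m ⊕ Fin m → ℝ × Torus :=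
      fun p v => Sum.elim p.1 p.2 (lab m v)
    have hφ : Measurable φ := measurable_pi_lambda _ fun v => by
      rcases v with i | j
      · exact (measurable_pi_apply i).comp measurable_fst
      · exact (measurable_pi_apply j).comp measurable_snd
    have hψ : Measurable ψ := measurable_pi_lambda _ fun v => by
      rcases v with i | j
      · exact (measurable_pi_apply _).comp measurable_fst
      · exact (measurable_pi_apply _).comp measurable_snd
    have h5 := h4.comp hφ hψ
    have e1 : φ ∘ (fun ω => (fun i => init.time i ω, fun i => noise.time i ω)) = tm := by
      funext ω v
      rcases v with i | j <;> rfl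
    have e2 : ψ ∘ (fun ω => (fun i => init.mark i ω, fun i => noise.mark i ω)) = mk := by
      funext ω v
      rcases v with i | j <;> rfl
    rwa [e1, e2] at h5
  have hlaw1 : ∀ (q : MarkedPoints Ω) (ρ : ℝ≥0), q.IsPoisson ρ P →
      P.map (fun ω (i : Fin m) => q.mark i ω) =
        Measure.pi fun _ : Fin m => signMeasure.prod (volume : Measure Torus) := by
    intro q ρ hq
    have h6 : iIndepFun (fun i : Fin m => q.mark i) P := hq.indep_marks.precomp Fin.val_injective
    rw [(iIndepFun_iff_map_fun_eq_pi_map fun i : Fin m =>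
      (q.measurable_mark (i : ℕ)).aemeasurable).1 h6]
    congr 1
    funext i
    exact (hq.law_marks i).map_eq
  have hmarks : P.map mk =
      Measure.pi fun _ : Fin m ⊕ Fin m => signMeasure.prod (volume : Measure Torus) := by
    have mI' : Measurable fun ω (i : Fin m) => init.mark i ω :=
      measurable_pi_lambda _ fun i => init.measurable_mark i
    have mN' : Measurable fun ω (i : Fin m) => noise.mark i ω :=
      measurable_pi_lambda _ fun i => noise.measurable_mark i
    have hres : Measurable fun (f : ℕ → ℝ × Torus) (i : Fin m) => f i :=
      measurable_pi_lambda _ fun i => measurable_pi_apply _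
    have h7 : IndepFun (fun ω (i : Fin m) => init.mark i ω) (fun ω (i : Fin m) => noise.mark i ω) P :=
      hmm.comp hres hres
    rw [indepFun_iff_map_prod_eq_prod_map_map mI'.aemeasurable mN'.aemeasurable, hlaw1 init r hI,
      hlaw1 noise r' hN] at h7
    have h8 := (measurePreserving_sumPiEquivProdPi_symm
      (fun _ : Fin m ⊕ Fin m => signMeasure.prod (volume : Measure Torus))).map_eq
    rw [← h7, Measure.map_map (MeasurableEquiv.measurable _) (mI'.prodMk mN')] at h8
    rw [← h8]
    congr 1
    funext ω v
    rcases v with i | j <;> rfl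
  have hsp : P.map (fun ω => ((fun v => (mk ω v).1 : Fin m ⊕ Fin m → ℝ),
      (fun v => (mk ω v).2 : Fin m ⊕ Fin m → Torus))) = (signPi (Fin m ⊕ Fin m)).prod volume := by
    have h9 := (measurePreserving_arrowProdEquivProdArrow ℝ Torus (Fin m ⊕ Fin m)
      (fun _ => signMeasure) (fun _ => volume)).map_eq
    rw [← hmarks, Measure.map_map (MeasurableEquiv.measurable _) mmk] at h9
    exact h9
  have m1 : Measurable fun ω => (fun v => (mk ω v).1 : Fin m ⊕ Fin m → ℝ) :=
    measurable_pi_lambda _ fun v => measurable_fst.comp ((measurable_pi_apply v).comp mmk)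
  have m2 : Measurable fun ω => (fun v => (mk ω v).2 : Fin m ⊕ Fin m → Torus) :=
    measurable_pi_lambda _ fun v => measurable_snd.comp ((measurable_pi_apply v).comp mmk)
  have hfin : P.map (fun ω => (tm ω, (fun v => (mk ω v).1, fun v => (mk ω v).2))) =
      (P.map tm).prod ((signPi (Fin m ⊕ Fin m)).prod volume) := by
    have hind2 : IndepFun tm (fun ω => ((fun v => (mk ω v).1 : Fin m ⊕ Fin m → ℝ),
        (fun v => (mk ω v).2 : Fin m ⊕ Fin m → Torus))) P := by
      have : Measurable fun f : Fin m ⊕ Fin m → ℝ × Torus =>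
          ((fun v => (f v).1 : Fin m ⊕ Fin m → ℝ), (fun v => (f v).2 : Fin m ⊕ Fin m → Torus)) :=
        (MeasurableEquiv.arrowProdEquivProdArrow ℝ Torus (Fin m ⊕ Fin m)).measurable
      exact hind.comp measurable_id this
    rw [← hsp]
    exact (indepFun_iff_map_prod_eq_prod_map_map mtm.aemeasurable (m1.prodMk m2).aemeasurable).1 hind2
  have : IsProbabilityMeasure (P.map tm) := Measure.isProbabilityMeasure_map mtm.aemeasurable
  rw [← ((measurePreserving_prodAssoc (P.map tm) (signPi (Fin m ⊕ Fin m)) volume).symm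
    (MeasurableEquiv.prodAssoc)).map_eq, ← hfin,
    Measure.map_map (MeasurableEquiv.measurable _) (mtm.prodMk (m1.prodMk m2))]
  congr 1
  funext ω
  refine Prod.ext rfl (funext fun v => ?_)
  rcases v with i | j <;> rfl

end Labels

/-! ### Finite systems of vortices up to a time horizon -/

/-- The modulus at time `u` of the intensity of the vortex `v`, up to the factor `1 / √N`, as a
function of the times of the points. -/
def amp (θ M : ℝ) (τ : Label → ℝ) : Label → ℝ → ℝ
  | .inl i, u => if 0 < τ (.inl i) ∧ τ (.inl i) ≤ M ∧ 0 ≤ u then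
      Real.exp (-(θ * (τ (.inl i) + u))) else 0
  | .inr j, u => if 0 < τ (.inr j) ∧ τ (.inr j) ≤ u then
      Real.exp (-(θ * (u - τ (.inr j)))) else 0

lemma amp_nonneg (θ M : ℝ) (τ : Label → ℝ) (v : Label) (u : ℝ) : 0 ≤ amp θ M τ v u := by
  rcases v with i | j <;> simp only [amp] <;> split_ifs <;> positivity

/-- The sign conditions on the times built into `amp` make this hold for every sequence of times,
not only for almost every outcome. -/
lemma amp_le_one {θ : ℝ} (hθ : 0 < θ) (M : ℝ) (τ : Label → ℝ) (v : Label) (u : ℝ) :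
    amp θ M τ v u ≤ 1 := by
  rcases v with i | j <;> simp only [amp] <;> split_ifs with h
  · exact Real.exp_le_one_iff.2 (neg_nonpos.2 (mul_nonneg hθ.le (by linarith [h.1, h.2.2])))
  · exact zero_le_one
  · exact Real.exp_le_one_iff.2 (neg_nonpos.2 (mul_nonneg hθ.le (by linarith [h.2])))
  · exact zero_le_one

lemma measurable_amp (θ M : ℝ) (v : Label) :
    Measurable fun p : (Label → ℝ) × ℝ => amp θ M p.1 v p.2 := by
  have h : ∀ w : Label, Measurable fun p : (Label → ℝ) × ℝ => p.1 w := fun w =>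
    (measurable_pi_apply w).comp measurable_fst
  rcases v with i | j <;> simp only [amp]
  · refine Measurable.ite ?_ (by fun_prop) measurable_const
    exact (measurableSet_lt measurable_const (h _)).inter
      ((measurableSet_le (h _) measurable_const).inter
        (measurableSet_le measurable_const measurable_snd))
  · refine Measurable.ite ?_ (by fun_prop) measurable_const
    exact (measurableSet_lt measurable_const (h _)).inter (measurableSet_le (h _) measurable_snd)

/-- The times for which the first vortices are the only ones that are active up to time `T`. -/
def truncSet (M T : ℝ) (m : ℕ) : Set (Label → ℝ) :=
  {τ | (∀ i, m ≤ i → M < τ (.inl i)) ∧ ∀ j, m ≤ j → T < τ (.inr j)}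

lemma measurableSet_truncSet (M T : ℝ) (m : ℕ) : MeasurableSet (truncSet M T m) := by
  have e : truncSet M T m = (⋂ i, ⋂ (_ : m ≤ i), {τ : Label → ℝ | M < τ (.inl i)}) ∩
      ⋂ j, ⋂ (_ : m ≤ j), {τ : Label → ℝ | T < τ (.inr j)} := by
    ext τ
    simp [truncSet]
  rw [e]
  refine MeasurableSet.inter ?_ ?_ <;>
  exact MeasurableSet.iInter fun i => MeasurableSet.iInter fun _ =>
    measurableSet_lt measurable_const (measurable_pi_apply _)

lemma finsum_cond_eq_sum {ι L E : Type*} [Fintype ι] [AddCommMonoid E] {e : ι → L}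
    (he : Function.Injective e) {p : L → Prop} [∀ w, Decidable (p w)] (hp : ∀ w, p w → w ∈ Set.range e)
    (f : L → E) : ∑ᶠ (w : L) (_ : p w), f w = ∑ v, if p (e v) then f (e v) else 0 := by
  classical
  have h1 : ∀ w, (∑ᶠ (_ : p w), f w) = if p w then f w else 0 := fun w => by
    split_ifs with h <;> simp [h]
  simp_rw [h1]
  rw [finsum_eq_sum_of_support_subset (s := Finset.univ.map ⟨e, he⟩)]
  · rw [Finset.sum_map]
    rfl
  · intro w hw
    rw [Function.mem_support] at hw
    have : p w := by
      by_contra h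
      exact hw (if_neg h)
    obtain ⟨v, rfl⟩ := hp w this
    simp

section Paths

variable {Ω : Type*} [MeasurableSpace Ω] (init noise : MarkedPoints Ω) (θ M : ℝ) (N : ℕ)
  (x : Label → ℝ → Ω → Torus)

/-- The outcomes for which the almost sure properties of the point vortices process hold. -/
structure GoodPath (ω : Ω) : Prop where
  init_pos : ∀ i, 0 < init.time i ω
  noise_pos : ∀ j, 0 < noise.time j ω
  init_lim : Filter.Tendsto (fun i => init.time i ω) Filter.atTop Filter.atTop
  noise_lim : Filter.Tendsto (fun i => noise.time i ω) Filter.atTop Filter.atTop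
  sign : ∀ v, (labMark init noise v ω).1 = 1 ∨ (labMark init noise v ω).1 = -1
  before : ∀ v, Present init M v ω → ∀ t, 0 ≤ t → t ≤ birth noise v ω →
    x v t ω = startPos init noise v ω
  integrable : ∀ v, Present init M v ω → ∀ t, birth noise v ω ≤ t →
    IntervalIntegrable (fun s => velocity init noise θ M N x v s ω) volume (birth noise v ω) t
  after : ∀ v, Present init M v ω → ∀ t, birth noise v ω ≤ t →
    x v t ω = startPos init noise v ω +
      toTorus (∫ s in (birth noise v ω)..t, velocity init noise θ M N x v s ω)

/-- The signed intensity of an active vortex, and `0` for the other ones. -/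
def wgt (v : Label) (u : ℝ) (ω : Ω) : ℝ :=
  (labMark init noise v ω).1 * amp θ M (fun w => labTime init noise w ω) v u / Real.sqrt N

lemma measurable_wgt (v : Label) : Measurable fun p : ℝ × Ω => wgt init noise θ M N v p.1 p.2 := by
  have h1 : Measurable fun p : ℝ × Ω => (fun w => labTime init noise w p.2, p.1) :=
    (measurable_pi_lambda _ fun w => (measurable_labTime init noise w).comp measurable_snd).prodMk
      measurable_fst
  exact (((measurable_fst.comp (measurable_labMark init noise v)).comp measurable_snd).mul
    ((measurable_amp θ M v).comp h1)).div_const _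

variable {init noise θ M N x} {ω : Ω}

lemma ae_goodPath {P : Measure Ω} {r r' : ℝ≥0} (hI : init.IsPoisson r P)
    (hN : noise.IsPoisson r' P) (hx : IsVortexDynamics init noise θ M N x P) :
    ∀ᵐ ω ∂P, GoodPath init noise θ M N x ω := by
  have hpos : ∀ (q : MarkedPoints Ω) (ρ : ℝ≥0), q.IsPoisson ρ P → ∀ᵐ ω ∂P, ∀ i, 0 < q.time i ω := by
    intro q ρ hq
    filter_upwards [hq.ordered] with ω h i
    exact h.1.trans_le (h.2.1.monotone (Nat.zero_le i))
  have hsign : ∀ (q : MarkedPoints Ω) (ρ : ℝ≥0), q.IsPoisson ρ P →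
      ∀ i, ∀ᵐ ω ∂P, (q.mark i ω).1 = 1 ∨ (q.mark i ω).1 = -1 := by
    intro q ρ hq i
    have h1 : ∀ᵐ z ∂(signMeasure.prod (volume : Measure Torus)), z.1 = 1 ∨ z.1 = -1 :=
      Measure.quasiMeasurePreserving_fst.ae ae_signMeasure
    rw [← (hq.law_marks i).map_eq] at h1
    exact ae_of_ae_map (q.measurable_mark i).aemeasurable h1
  have hs : ∀ᵐ ω ∂P, ∀ v, (labMark init noise v ω).1 = 1 ∨ (labMark init noise v ω).1 = -1 := by
    rw [ae_all_iff]
    intro v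
    rcases v with i | j
    · exact hsign init r hI i
    · exact hsign noise r' hN j
  filter_upwards [hpos init r hI, hpos noise r' hN, hI.ordered, hN.ordered, hs, hx.before_birth,
    hx.integrable, hx.after_birth] with ω h1 h2 h3 h4 h5 h6 h7 h8
  exact ⟨h1, h2, h3.2.2, h4.2.2, h5, h6, h7, h8⟩

namespace GoodPath

lemma birth_nonneg (h : GoodPath init noise θ M N x ω) (v : Label) : 0 ≤ birth noise v ω := by
  rcases v with i | j
  · exact le_rfl
  · exact (h.noise_pos j).le

lemma amp_eq (h : GoodPath init noise θ M N x ω) (v : Label) (u : ℝ)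
    [Decidable (Present init M v ω ∧ birth noise v ω ≤ u)] :
    wgt init noise θ M N v u ω = if Present init M v ω ∧ birth noise v ω ≤ u then
      startIntensity init noise θ N v ω * Real.exp (-(θ * (u - birth noise v ω))) else 0 := by
  rcases v with i | j
  · have hp := h.init_pos i
    by_cases hc : Present init M (.inl i) ω ∧ birth noise (.inl i) ω ≤ u
    · rw [if_pos hc]
      have hc' : 0 < labTime init noise (.inl i) ω ∧ labTime init noise (.inl i) ω ≤ M ∧ 0 ≤ u :=
        ⟨hp, hc.1, hc.2⟩
      rw [wgt, amp, if_pos hc']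
      simp only [startIntensity, labMark, labTime, birth]
      rw [mul_add, neg_add, Real.exp_add, sub_zero]
      ring
    · rw [if_neg hc]
      have hc' : ¬(0 < labTime init noise (.inl i) ω ∧ labTime init noise (.inl i) ω ≤ M ∧ 0 ≤ u) :=
        fun h' => hc ⟨h'.2.1, h'.2.2⟩
      rw [wgt, amp, if_neg hc', mul_zero, zero_div]
  · have hp := h.noise_pos j
    by_cases hc : Present init M (.inr j) ω ∧ birth noise (.inr j) ω ≤ u
    · rw [if_pos hc]
      have hc' : 0 < labTime init noise (.inr j) ω ∧ labTime init noise (.inr j) ω ≤ u := ⟨hp, hc.2⟩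
      rw [wgt, amp, if_pos hc']
      simp only [startIntensity, labMark, labTime, birth]
      ring
    · rw [if_neg hc]
      have hc' : ¬(0 < labTime init noise (.inr j) ω ∧ labTime init noise (.inr j) ω ≤ u) :=
        fun h' => hc ⟨trivial, h'.2⟩
      rw [wgt, amp, if_neg hc', mul_zero, zero_div]

lemma active_iff_amp_pos (h : GoodPath init noise θ M N x ω)
    (v : Label) (u : ℝ) : Present init M v ω ∧ birth noise v ω ≤ u ↔
    0 < amp θ M (fun w => labTime init noise w ω) v u := by
  rcases v with i | j
  · have hp := h.init_pos i
    constructor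
    · intro hc
      have hc' : 0 < labTime init noise (.inl i) ω ∧ labTime init noise (.inl i) ω ≤ M ∧ 0 ≤ u :=
        ⟨hp, hc.1, hc.2⟩
      simp only [amp, hc', and_self, if_true]
      exact Real.exp_pos _
    · intro hc
      simp only [amp] at hc
      split_ifs at hc with h'
      · exact ⟨h'.2.1, h'.2.2⟩
      · exact absurd hc (lt_irrefl _)
  · have hp := h.noise_pos j
    constructor
    · intro hc
      have hc' : 0 < labTime init noise (.inr j) ω ∧ labTime init noise (.inr j) ω ≤ u := ⟨hp, hc.2⟩
      simp only [amp, hc', and_self, if_true]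
      exact Real.exp_pos _
    · intro hc
      simp only [amp] at hc
      split_ifs at hc with h'
      · exact ⟨trivial, h'.2⟩
      · exact absurd hc (lt_irrefl _)

lemma intensity_eq (h : GoodPath init noise θ M N x ω) (v : Label)
    (u : ℝ) [Decidable (Active init noise M u v ω)] :
    (if Active init noise M u v ω then intensity init noise θ N v u ω else 0) =
      wgt init noise θ M N v u ω := by
  classical
  rw [h.amp_eq]
  by_cases hc : Active init noise M u v ω
  · rw [if_pos hc, if_pos (show Present init M v ω ∧ birth noise v ω ≤ u from hc), intensity,
      if_neg (not_lt.2 hc.2)]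
  · rw [if_neg hc, if_neg (show ¬(Present init M v ω ∧ birth noise v ω ≤ u) from hc)]

lemma mem_range_lab_of_active {T : ℝ} {m : ℕ}
    (hT : (fun w => labTime init noise w ω) ∈ truncSet M T m) {u : ℝ} (hu : u ≤ T) {v : Label}
    (hv : Active init noise M u v ω) : v ∈ Set.range (lab m) := by
  rcases v with i | j
  · by_cases hi : i < m
    · exact ⟨.inl ⟨i, hi⟩, rfl⟩
    · exact absurd hv.1 (not_le.2 (hT.1 i (not_lt.1 hi)))
  · by_cases hj : j < m
    · exact ⟨.inr ⟨j, hj⟩, rfl⟩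
    · exact absurd (hv.2.trans hu) (not_le.2 (hT.2 j (not_lt.1 hj)))

/-- On the truncation event all active vortices are among the first ones. Positions of absent
vortices may be arbitrary, since their weights are 0. -/
lemma velocity_eq (h : GoodPath init noise θ M N x ω)
    {T : ℝ} {m : ℕ}
    (hT : (fun w => labTime init noise w ω) ∈ truncSet M T m)
    {u : ℝ} (hu : u ≤ T) (v : Fin m ⊕ Fin m) {X : Fin m ⊕ Fin m → Torus}
    (hX : ∀ w, Present init M (lab m w) ω → X w = x (lab m w) u ω) (hv : X v = x (lab m v) u ω) :
    velocity init noise θ M N x (lab m v) u ω = ∑ w ∈ Finset.univ.erase v,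
      wgt init noise θ M N (lab m w) u ω • bsKernel (X v - X w) := by
  classical
  rw [velocity, finsum_cond_eq_sum (lab_injective m) fun w hw =>
    mem_range_lab_of_active hT hu hw.1, ← Finset.filter_ne', Finset.sum_filter]
  refine Finset.sum_congr rfl fun w _ => ?_
  rw [← h.intensity_eq (lab m w) u]
  by_cases hwv : w = v
  · simp [hwv]
  · have hne : lab m w ≠ lab m v := fun e => hwv (lab_injective m e)
    by_cases ha : Active init noise M u (lab m w) ω
    · simp only [ha, hne, hwv, ne_eq, not_false_eq_true, and_self, if_true]
      rw [biotSavart_eq, hv, hX w ha.1]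
    · simp [ha]

end GoodPath

end Paths

/-! ### Fourier coefficients of the vorticity and the truncated system -/

lemma vectorMeasure_integrable_mFourier_dirac (k : Fin 2 → ℤ) (x : Torus) (a : ℝ) :
    (VectorMeasure.dirac x a : SignedMeasure Torus).Integrable fun y => UnitAddTorus.mFourier k y :=
  Integrable.of_bound (UnitAddTorus.mFourier k).continuous.aestronglyMeasurable 1
    (Filter.Eventually.of_forall fun y => (norm_mFourier_apply k y).le)

lemma fourierCoeffMeasure_sum_dirac_sub {ι κ : Type*} [Fintype ι] [Fintype κ] (k : Fin 2 → ℤ)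
    (x : ι → Torus) (a : ι → ℝ) (y : κ → Torus) (b : κ → ℝ) :
    fourierCoeffMeasure (∑ v, VectorMeasure.dirac (x v) (a v) - ∑ w, VectorMeasure.dirac (y w) (b w)) k =
      ∑ v, (a v : ℂ) * UnitAddTorus.mFourier (-k) (x v) -
        ∑ w, (b w : ℂ) * UnitAddTorus.mFourier (-k) (y w) := by
  have hi := vectorMeasure_integrable_mFourier_dirac (-k)
  rw [fourierCoeffMeasure, VectorMeasure.integral_sub_vectorMeasure
    (VectorMeasure.Integrable.finsetSum_vectorMeasure fun v _ => hi _ _)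
    (VectorMeasure.Integrable.finsetSum_vectorMeasure fun v _ => hi _ _),
    VectorMeasure.integral_finsetSum_vectorMeasure fun v _ => hi _ _,
    VectorMeasure.integral_finsetSum_vectorMeasure fun v _ => hi _ _]
  simp [VectorMeasure.integral_dirac]

section Truncation

variable {Ω : Type*} [MeasurableSpace Ω] (init noise : MarkedPoints Ω) (M : ℝ)
  (x : Label → ℝ → Ω → Torus) (G : Set Ω) (T : ℝ) (m : ℕ)

/-- The outcomes of `G` for which only the first vortices are active up to time `T`. -/
def horizonSet : Set Ω := G ∩ {ω | (fun w => labTime init noise w ω) ∈ truncSet M T m}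

open scoped Classical in
/-- The trajectories of the first vortices, on `horizonSet`. -/
def cutPos (u : ℝ) (ω : Ω) (v : Fin m ⊕ Fin m) : Torus :=
  if ω ∈ horizonSet init noise M G T m ∧ Present init M (lab m v) ω then x (lab m v) (max u 0) ω
  else startPos init noise (lab m v) ω

variable {init noise M x G T m} {θ : ℝ} {N : ℕ}

lemma measurableSet_horizonSet (hG : MeasurableSet G) :
    MeasurableSet (horizonSet init noise M G T m) :=
  hG.inter ((measurable_pi_lambda _ fun w => measurable_labTime init noise w)
    (measurableSet_truncSet M T m))

lemma measurableSet_present (v : Label) : MeasurableSet {ω | Present init M v ω} := by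
  rcases v with i | j
  · exact measurableSet_le (init.measurable_time i) measurable_const
  · exact MeasurableSet.univ

lemma measurable_cutPos_apply (hG : MeasurableSet G) (hx : ∀ v t, 0 ≤ t → Measurable (x v t)) (u : ℝ) :
    Measurable (cutPos init noise M x G T m u) := by
  refine measurable_pi_lambda _ fun v => ?_
  exact Measurable.ite ((measurableSet_horizonSet hG).inter (measurableSet_present _))
    (hx _ _ (le_max_right _ _)) (measurable_startPos init noise _)

/-- Continuity in time, combined with measurability at each fixed time, gives joint measurability of
the trajectories. -/
lemma continuous_primitive_max {V : ℝ → Fin 2 → ℝ} {b : ℝ}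
    (hV : ∀ t, b ≤ t → IntervalIntegrable V volume b t) :
    Continuous fun u => ∫ s in b..max u b, V s := by
  have h1 : ∀ c, IntervalIntegrable ((Set.Ioi b).indicator V) volume b c := by
    intro c
    rcases le_total b c with hc | hc
    · refine (hV c hc).congr fun s hs => ?_
      rw [Set.uIoc_of_le hc] at hs
      exact (Set.indicator_of_mem (show s ∈ Set.Ioi b from hs.1) V).symm
    · refine (intervalIntegrable_const (c := (0 : Fin 2 → ℝ))).congr fun s hs => ?_
      rw [Set.uIoc_of_ge hc] at hs
      exact (Set.indicator_of_notMem (show s ∉ Set.Ioi b from not_lt.2 hs.2) V).symm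
  have h2 : Continuous fun c => ∫ s in b..c, (Set.Ioi b).indicator V s :=
    intervalIntegral.continuous_primitive (fun c d => (h1 c).symm.trans (h1 d)) b
  have h3 : (fun u => ∫ s in b..max u b, V s) =
      fun u => ∫ s in b..max u b, (Set.Ioi b).indicator V s := by
    funext u
    refine intervalIntegral.integral_congr_ae (Filter.Eventually.of_forall fun s hs => ?_)
    rw [Set.uIoc_of_le (le_max_right _ _)] at hs
    exact (Set.indicator_of_mem (show s ∈ Set.Ioi b from hs.1) V).symm
  rw [h3]
  exact h2.comp (continuous_id.max continuous_const)

lemma GoodPath.position_eq {ω : Ω} (h : GoodPath init noise θ M N x ω) {v : Label}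
    (hv : Present init M v ω) (u : ℝ) : x v (max u 0) ω = startPos init noise v ω +
      toTorus (∫ s in (birth noise v ω)..max u (birth noise v ω), velocity init noise θ M N x v s ω) := by
  have hb := h.birth_nonneg v
  rcases le_total u (birth noise v ω) with hu | hu
  · rw [max_eq_right hu, intervalIntegral.integral_same, toTorus_zero, add_zero]
    exact h.before v hv _ (le_max_right _ _) (max_le hu hb)
  · rw [max_eq_left hu, max_eq_left (hb.trans hu)]
    exact h.after v hv u hu

lemma continuous_cutPos (hgood : ∀ ω ∈ G, GoodPath init noise θ M N x ω) (ω : Ω) :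
    Continuous fun u => cutPos init noise M x G T m u ω := by
  refine continuous_pi fun v => ?_
  by_cases hc : ω ∈ horizonSet init noise M G T m ∧ Present init M (lab m v) ω
  · have h := hgood ω hc.1.1
    simp only [cutPos, if_pos hc, h.position_eq hc.2]
    exact continuous_const.add (continuous_toTorus.comp
      (continuous_primitive_max (h.integrable _ hc.2)))
  · simp only [cutPos, if_neg hc]
    exact continuous_const

lemma measurable_cutPos (hG : MeasurableSet G) (hgood : ∀ ω ∈ G, GoodPath init noise θ M N x ω)
    (hx : ∀ v t, 0 ≤ t → Measurable (x v t)) :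
    Measurable fun p : ℝ × Ω => cutPos init noise M x G T m p.1 p.2 :=
  measurable_uncurry_of_continuous_of_measurable (u := cutPos init noise M x G T m)
    (continuous_cutPos hgood) (measurable_cutPos_apply hG hx)

lemma velocity_eq_cutPos (hgood : ∀ ω ∈ G, GoodPath init noise θ M N x ω) {ω : Ω}
    (hω : ω ∈ horizonSet init noise M G T m) {u : ℝ} (hu0 : 0 ≤ u) (hu : u ≤ T) (v : Fin m ⊕ Fin m)
    (hv : Present init M (lab m v) ω) :
    velocity init noise θ M N x (lab m v) u ω = ∑ w ∈ Finset.univ.erase v,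
      wgt init noise θ M N (lab m w) u ω •
        bsKernel (cutPos init noise M x G T m u ω v - cutPos init noise M x G T m u ω w) := by
  have hc : ∀ w, Present init M (lab m w) ω →
      cutPos init noise M x G T m u ω w = x (lab m w) u ω := fun w hw => by
    rw [cutPos, if_pos ⟨hω, hw⟩, max_eq_left hu0]
  exact (hgood ω hω.1).velocity_eq hω.2 hu v hc (hc v hv)

/-- The trajectories of the truncated system solve the equations of the point vortices. -/
lemma cutPos_eq (hgood : ∀ ω ∈ G, GoodPath init noise θ M N x ω) {ω : Ω}
    (hω : ω ∈ horizonSet init noise M G T m) {t : ℝ} (ht : t ≤ T) {v : Fin m ⊕ Fin m}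
    (hv : Present init M (lab m v) ω) (hb : birth noise (lab m v) ω ≤ t) :
    IntervalIntegrable (fun u => ∑ w ∈ Finset.univ.erase v, wgt init noise θ M N (lab m w) u ω •
      bsKernel (cutPos init noise M x G T m u ω v - cutPos init noise M x G T m u ω w)) volume
      (birth noise (lab m v) ω) t ∧
    cutPos init noise M x G T m t ω v = startPos init noise (lab m v) ω +
      toTorus (∫ u in (birth noise (lab m v) ω)..t, ∑ w ∈ Finset.univ.erase v,
        wgt init noise θ M N (lab m w) u ω •
        bsKernel (cutPos init noise M x G T m u ω v - cutPos init noise M x G T m u ω w)) := by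
  have h := hgood ω hω.1
  have hb0 := h.birth_nonneg (lab m v)
  have he : ∀ u, u ∈ Set.uIoc (birth noise (lab m v) ω) t →
      velocity init noise θ M N x (lab m v) u ω = ∑ w ∈ Finset.univ.erase v,
        wgt init noise θ M N (lab m w) u ω •
        bsKernel (cutPos init noise M x G T m u ω v - cutPos init noise M x G T m u ω w) := by
    intro u hu
    rw [Set.uIoc_of_le hb] at hu
    exact velocity_eq_cutPos hgood hω (hb0.trans hu.1.le) (hu.2.trans ht) v hv
  refine ⟨(h.integrable _ hv t hb).congr he, ?_⟩
  rw [← intervalIntegral.integral_congr_ae (Filter.Eventually.of_forall he), cutPos, if_pos ⟨hω, hv⟩,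
    h.position_eq hv, max_eq_left hb]

/-- The contribution of the created vortices to the Fourier coefficients. -/
def creation (noise : MarkedPoints Ω) (N m : ℕ) (k : Fin 2 → ℤ) (t : ℝ) (ω : Ω) : ℂ :=
  ∑ j : Fin m, if noise.time j ω ≤ t then
    (((noise.mark j ω).1 / Real.sqrt N : ℝ) : ℂ) * UnitAddTorus.mFourier k (noise.mark j ω).2 else 0

variable (init noise M x G T m θ N) in
/-- The Fourier coefficients of the vorticity of the truncated system. -/
def coeffPath (k : Fin 2 → ℤ) (t : ℝ) (ω : Ω) : ℂ :=
  ∑ v, (wgt init noise θ M N (lab m v) t ω : ℂ) *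
    UnitAddTorus.mFourier k (cutPos init noise M x G T m t ω v)

variable (init noise M x G T m θ N) in
/-- The drift of the Fourier coefficients of the vorticity of the truncated system. -/
def driftPath (k : Fin 2 → ℤ) (t : ℝ) (ω : Ω) : ℂ :=
  coeffDrift k θ (fun v => wgt init noise θ M N (lab m v) t ω)
    (cutPos init noise M x G T m t ω)

lemma fourierCoeffMeasure_vorticity_sub (hgood : ∀ ω ∈ G, GoodPath init noise θ M N x ω) {ω : Ω}
    (hω : ω ∈ horizonSet init noise M G T m) {s t : ℝ} (hs0 : 0 ≤ s) (hs : s ≤ T) (ht0 : 0 ≤ t)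
    (ht : t ≤ T) (k : Fin 2 → ℤ) :
    fourierCoeffMeasure (vorticity init noise θ M N x t ω - vorticity init noise θ M N x s ω) k =
      coeffPath init noise M x G T m θ N (-k) t ω - coeffPath init noise M x G T m θ N (-k) s ω := by
  classical
  have h := hgood ω hω.1
  have e : ∀ u, 0 ≤ u → u ≤ T → vorticity init noise θ M N x u ω =
      ∑ v, VectorMeasure.dirac (cutPos init noise M x G T m u ω v)
        (wgt init noise θ M N (lab m v) u ω) := by
    intro u hu0 hu
    rw [vorticity, finsum_cond_eq_sum (lab_injective m) fun w hw => GoodPath.mem_range_lab_of_active hω.2 hu hw]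
    refine Finset.sum_congr rfl fun v _ => ?_
    rw [← h.intensity_eq (lab m v) u]
    split_ifs with ha
    · rw [cutPos, if_pos ⟨hω, ha.1⟩, max_eq_left hu0]
    · rw [VectorMeasure.dirac_zero]
  rw [e t ht0 ht, e s hs0 hs, fourierCoeffMeasure_sum_dirac_sub]
  rfl

/-- The evolution of the Fourier coefficients of the vorticity. -/
lemma coeffPath_sub (hgood : ∀ ω ∈ G, GoodPath init noise θ M N x ω) {ω : Ω}
    (hω : ω ∈ horizonSet init noise M G T m) {s t : ℝ} (hs0 : 0 ≤ s) (hst : s ≤ t)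
    (ht : t ≤ T) (k : Fin 2 → ℤ) :
    IntervalIntegrable (fun u => driftPath init noise M x G T m θ N k u ω) volume 0 t ∧
    coeffPath init noise M x G T m θ N k t ω - coeffPath init noise M x G T m θ N k s ω =
      creation noise N m k t ω - creation noise N m k s ω +
        ∫ u in s..t, driftPath init noise M x G T m θ N k u ω := by
  classical
  have h := hgood ω hω.1
  have key := fun (r : ℝ) (hr0 : 0 ≤ r) (hr : r ≤ T) => coeff_eq k θ hr0
    (b := fun v => birth noise (lab m v) ω) (ξ := fun v => startIntensity init noise θ N (lab m v) ω)
    (fun v => h.birth_nonneg _) (act := fun v => Present init M (lab m v) ω)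
    (a := fun v u => wgt init noise θ M N (lab m v) u ω) (fun v u => h.amp_eq (lab m v) u)
    (p := fun v => startPos init noise (lab m v) ω)
    (x := fun v u => cutPos init noise M x G T m u ω v)
    (fun v hv hb => (cutPos_eq hgood hω hr hv hb).1)
    (fun v hv q hb hq => (cutPos_eq hgood hω (hq.trans hr) hv hb).2)
  -- The starting terms of the initial vortices are the same at every time and cancel in the
  -- difference.
  have hinit : ∀ r, 0 ≤ r → (∑ v, (if Present init M (lab m v) ω ∧ birth noise (lab m v) ω ≤ r then
      (startIntensity init noise θ N (lab m v) ω : ℂ) *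
        UnitAddTorus.mFourier k (startPos init noise (lab m v) ω) else 0)) =
      (∑ i : Fin m, if init.time i ω ≤ M then
        (startIntensity init noise θ N (.inl i) ω : ℂ) *
        UnitAddTorus.mFourier k (startPos init noise (.inl i) ω) else 0) + creation noise N m k r ω := by
    intro r hr
    rw [Fintype.sum_sum_type]
    congr 1
    · refine Finset.sum_congr rfl fun i _ => ?_
      have : (Present init M (lab m (.inl i)) ω ∧ birth noise (lab m (.inl i)) ω ≤ r) ↔
          init.time i ω ≤ M := ⟨fun h' => h'.1, fun h' => ⟨h', hr⟩⟩
      simp only [this]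
      rfl
    · refine Finset.sum_congr rfl fun j _ => ?_
      have : (Present init M (lab m (.inr j)) ω ∧ birth noise (lab m (.inr j)) ω ≤ r) ↔
          noise.time j ω ≤ r := ⟨fun h' => h'.2, fun h' => ⟨trivial, h'⟩⟩
      simp only [this]
      rfl
  obtain ⟨i1, e1⟩ := key t (hs0.trans hst) ht
  obtain ⟨i2, e2⟩ := key s hs0 (hst.trans ht)
  refine ⟨i1, ?_⟩
  have e3 : coeffPath init noise M x G T m θ N k t ω = _ := e1
  have e4 : coeffPath init noise M x G T m θ N k s ω = _ := e2
  rw [e3, e4, hinit t (hs0.trans hst), hinit s hs0]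
  have e5 := intervalIntegral.integral_add_adjacent_intervals i2 (i2.symm.trans i1)
  rw [← e5]
  simp only [driftPath]
  ring

end Truncation

/-! ### The law of the truncated system at a fixed time -/

section Law

variable {Ω : Type*} [MeasurableSpace Ω] {init noise : MarkedPoints Ω} {M : ℝ}
  {x : Label → ℝ → Ω → Torus} {G : Set Ω} {T : ℝ} {m : ℕ} {θ : ℝ} {N : ℕ}

open scoped Classical in
/-- The intensities of the truncated system as functions of the times and of the signs: the vortex
`w` acts on the vortex `v` when both are active. -/
def cutIntensity (θ M T : ℝ) (N m : ℕ) (v w : Fin m ⊕ Fin m)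
    (e : (Label → ℝ) × (Fin m ⊕ Fin m → ℝ)) (u : ℝ) : ℝ :=
  if e.1 ∈ truncSet M T m ∧ 0 < amp θ M e.1 (lab m v) u then
    max (-1) (min (e.2 w) 1) * amp θ M e.1 (lab m w) u / Real.sqrt N else 0

lemma measurable_cutIntensity (v w : Fin m ⊕ Fin m) :
    Measurable fun p : ((Label → ℝ) × (Fin m ⊕ Fin m → ℝ)) × ℝ =>
      cutIntensity θ M T N m v w p.1 p.2 := by
  have h1 : ∀ z : Label, Measurable fun p : ((Label → ℝ) × (Fin m ⊕ Fin m → ℝ)) × ℝ =>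
      amp θ M p.1.1 z p.2 := fun z => (measurable_amp θ M z).comp
    ((measurable_fst.comp measurable_fst).prodMk measurable_snd)
  have h2 : Measurable fun p : ((Label → ℝ) × (Fin m ⊕ Fin m → ℝ)) × ℝ => p.1.2 w :=
    (measurable_pi_apply w).comp (measurable_snd.comp measurable_fst)
  refine Measurable.ite ?_ ?_ measurable_const
  · exact ((measurable_fst.comp measurable_fst) (measurableSet_truncSet M T m)).inter
      (measurableSet_lt measurable_const (h1 _))
  · exact ((measurable_const.max (h2.min measurable_const)).mul (h1 _)).div_const _

/-- The signs are clamped to [-1, 1] in `cutIntensity` so that the bound holds everywhere; on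
genuine signs the clamp does nothing. -/
lemma abs_cutIntensity_le (hθ : 0 < θ) (hN : 1 ≤ N) (v w : Fin m ⊕ Fin m)
    (e : (Label → ℝ) × (Fin m ⊕ Fin m → ℝ)) (u : ℝ) : |cutIntensity θ M T N m v w e u| ≤ 1 := by
  unfold cutIntensity
  split_ifs
  · have h1 : |max (-1) (min (e.2 w) 1)| ≤ 1 := abs_le.2
      ⟨le_max_left _ _, max_le (by norm_num) (min_le_right _ _)⟩
    have h2 : |amp θ M e.1 (lab m w) u| ≤ 1 := by
      rw [abs_of_nonneg (amp_nonneg _ _ _ _ _)]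
      exact amp_le_one hθ _ _ _ _
    have h3 : 1 ≤ Real.sqrt N := Real.one_le_sqrt.2 (by exact_mod_cast hN)
    rw [abs_div, abs_mul, abs_of_nonneg (Real.sqrt_nonneg _)]
    exact div_le_one_of_le₀ ((mul_le_one₀ h1 (abs_nonneg _) h2).trans h3) (Real.sqrt_nonneg _)
  · simp

/-- The trajectories of the truncated system in terms of the times and of the signs. -/
lemma cutPos_eq_cutIntensity (hgood : ∀ ω ∈ G, GoodPath init noise θ M N x ω) {ω : Ω} (hω : ω ∈ G)
    {t : ℝ} (ht0 : 0 ≤ t) (ht : t ≤ T) (v : Fin m ⊕ Fin m) :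
    IntervalIntegrable (fun u => ∑ w ∈ Finset.univ.erase v,
      cutIntensity θ M T N m v w (timesSigns init noise m ω) u •
      bsKernel (cutPos init noise M x G T m u ω v - cutPos init noise M x G T m u ω w)) volume 0 t ∧
    cutPos init noise M x G T m t ω v = startPos init noise (lab m v) ω +
      toTorus (∫ u in (0 : ℝ)..t, ∑ w ∈ Finset.univ.erase v,
        cutIntensity θ M T N m v w (timesSigns init noise m ω) u •
        bsKernel (cutPos init noise M x G T m u ω v - cutPos init noise M x G T m u ω w)) := by
  classical
  have h := hgood ω hω
  by_cases hc : ω ∈ horizonSet init noise M G T m ∧ Present init M (lab m v) ω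
  · obtain ⟨hH, hv⟩ := hc
    set f : ℝ → Fin 2 → ℝ := fun u => ∑ w ∈ Finset.univ.erase v, wgt init noise θ M N (lab m w) u ω •
      bsKernel (cutPos init noise M x G T m u ω v - cutPos init noise M x G T m u ω w) with hf
    have e : (fun u => ∑ w ∈ Finset.univ.erase v,
        cutIntensity θ M T N m v w (timesSigns init noise m ω) u •
        bsKernel (cutPos init noise M x G T m u ω v - cutPos init noise M x G T m u ω w)) =
        fun u => if birth noise (lab m v) ω ≤ u then f u else 0 := by
      funext u
      split_ifs with hb
      · have ha := (h.active_iff_amp_pos (lab m v) u).1 ⟨hv, hb⟩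
        refine Finset.sum_congr rfl fun w _ => ?_
        congr 1
        rw [cutIntensity, if_pos ⟨hH.2, ha⟩, wgt]
        have h1 : max (-1) (min ((timesSigns init noise m ω).2 w) 1) =
            (labMark init noise (lab m w) ω).1 := by
          show max (-1) (min ((labMark init noise (lab m w) ω).1) 1) = _
          rcases h.sign (lab m w) with h1 | h1 <;> rw [h1] <;> norm_num
        rw [h1]
        rfl
      · have ha : ¬0 < amp θ M (timesSigns init noise m ω).1 (lab m v) u := fun ha =>
          hb ((h.active_iff_amp_pos (lab m v) u).2 ha).2
        refine Finset.sum_eq_zero fun w _ => ?_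
        rw [cutIntensity, if_neg fun h' => ha h'.2, zero_smul]
    rw [e]
    obtain ⟨i1, e1⟩ := intervalIntegral_cut (f := f) (h.birth_nonneg (lab m v)) ht0 fun hb =>
      (cutPos_eq hgood hH ht hv hb).1
    refine ⟨i1, ?_⟩
    rw [e1]
    split_ifs with hb
    · exact (cutPos_eq hgood hH ht hv hb).2
    · rw [toTorus_zero, add_zero, cutPos, if_pos ⟨hH, hv⟩, h.position_eq hv,
        max_eq_right (not_le.1 hb).le, intervalIntegral.integral_same, toTorus_zero, add_zero]
  -- Off the truncation event, or for an absent vortex, all intensities acting on v vanish and the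
  -- position is frozen at its start. The system thus holds on all of G, and its coefficients depend
  -- only on times and signs.
  · have e : (fun u => ∑ w ∈ Finset.univ.erase v,
        cutIntensity θ M T N m v w (timesSigns init noise m ω) u •
        bsKernel (cutPos init noise M x G T m u ω v - cutPos init noise M x G T m u ω w)) =
        fun _ => 0 := by
      funext u
      refine Finset.sum_eq_zero fun w _ => ?_
      rw [cutIntensity, if_neg, zero_smul]
      exact fun h' => hc ⟨⟨hω, h'.1⟩, ((h.active_iff_amp_pos (lab m v) u).2 h'.2).1⟩
    rw [e]
    refine ⟨intervalIntegrable_const, ?_⟩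
    rw [intervalIntegral.integral_zero, toTorus_zero, add_zero, cutPos, if_neg hc]

/-- At a fixed time the times, the signs and the positions of the truncated system are independent,
and the positions are uniform. -/
theorem map_timesSigns_cutPos {P : Measure Ω} [IsProbabilityMeasure P] {r r' : ℝ≥0}
    (hI : init.IsPoisson r P) (hN : noise.IsPoisson r' P)
    (hIN : IndepFun (fun ω i => (init.time i ω, init.mark i ω))
      (fun ω i => (noise.time i ω, noise.mark i ω)) P) (hG : MeasurableSet G) (hG0 : ∀ᵐ ω ∂P, ω ∈ G)
    (hgood : ∀ ω ∈ G, GoodPath init noise θ M N x ω) (hx : ∀ v t, 0 ≤ t → Measurable (x v t))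
    (hθ : 0 < θ) (hN1 : 1 ≤ N) {t : ℝ} (ht0 : 0 ≤ t) (ht : t ≤ T) :
    P.map (fun ω => (timesSigns init noise m ω, cutPos init noise M x G T m t ω)) =
      ((P.map fun ω v => labTime init noise v ω).prod (signPi (Fin m ⊕ Fin m))).prod volume := by
  have : IsProbabilityMeasure (P.map fun ω v => labTime init noise v ω) :=
    Measure.isProbabilityMeasure_map (measurable_pi_lambda _ fun v =>
      measurable_labTime init noise v).aemeasurable
  -- The displacement lifted to ℝ², the form in which the invariance theorem takes the dynamics.
  set d : Ω → ℝ → Fin m ⊕ Fin m → Fin 2 → ℝ := fun ω r v => ∫ u in (0 : ℝ)..r,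
    ∑ w ∈ Finset.univ.erase v, cutIntensity θ M T N m v w (timesSigns init noise m ω) u •
    bsKernel (cutPos init noise M x G T m u ω v - cutPos init noise M x G T m u ω w) with hd
  have hpos : ∀ ω ∈ G, ∀ r, 0 ≤ r → r ≤ t → cutPos init noise M x G T m r ω =
      (fun v => startPos init noise (lab m v) ω) + toConfig (d ω r) := fun ω hω r hr0 hr =>
    funext fun v => (cutPos_eq_cutIntensity hgood hω hr0 (hr.trans ht) v).2
  have hcongr : ∀ ω ∈ G, ∀ v : Fin m ⊕ Fin m, ∀ u ∈ Set.Icc 0 t,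
      (∑ w ∈ Finset.univ.erase v, cutIntensity θ M T N m v w (timesSigns init noise m ω) u •
        bsKernel (cutPos init noise M x G T m u ω v - cutPos init noise M x G T m u ω w)) =
      ∑ w ∈ Finset.univ.erase v, cutIntensity θ M T N m v w (timesSigns init noise m ω) u •
        bsKernel (((fun v => startPos init noise (lab m v) ω) + toConfig (d ω u)) v -
          ((fun v => startPos init noise (lab m v) ω) + toConfig (d ω u)) w) := by
    intro ω hω v u hu
    rw [hpos ω hω u hu.1 hu.2]
  refine map_prodMk_eq_of_dynamics (measurable_timesSigns init noise m)
    (Y := fun ω v => startPos init noise (lab m v) ω)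
    (measurable_pi_lambda _ fun v => measurable_startPos init noise _)
    (map_timesSigns_startPos hI hN hIN m) (b := cutIntensity θ M T N m) measurable_cutIntensity
    (abs_cutIntensity_le hθ hN1) ht0 (d := d) ?_ ?_ (measurable_cutPos_apply hG hx t) ?_
  · filter_upwards [hG0] with ω hω v
    refine (cutPos_eq_cutIntensity hgood hω ht0 ht v).1.congr fun u hu => ?_
    rw [Set.uIoc_of_le ht0] at hu
    exact hcongr ω hω v u ⟨hu.1.le, hu.2⟩
  · filter_upwards [hG0] with ω hω r hr v
    refine intervalIntegral.integral_congr fun u hu => ?_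
    rw [Set.uIcc_of_le hr.1] at hu
    exact hcongr ω hω v u ⟨hu.1, hu.2.trans hr.2⟩
  · filter_upwards [hG0] with ω hω
    exact hpos ω hω t ht0 le_rfl

end Law

/-! ### Second moments of Poisson sums -/

lemma lintegral_poissonMeasure (r : ℝ≥0) (f : ℕ → ℝ≥0∞) : ∫⁻ n, f n ∂poissonMeasure r =
    ∑' n : ℕ, ENNReal.ofReal (Real.exp (-r) * r ^ n / n.factorial) * f n := by
  rw [poissonMeasure, lintegral_sum_measure]
  refine tsum_congr fun n => ?_
  rw [lintegral_smul_measure, lintegral_dirac, smul_eq_mul]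

/-- The factor n cancels in n!, which shifts the series by one; applied to 1 and n this yields the
first two moments. -/
lemma lintegral_poissonMeasure_mul (r : ℝ≥0) (f : ℕ → ℝ≥0∞) :
    ∫⁻ n, (n : ℝ≥0∞) * f n ∂poissonMeasure r = r * ∫⁻ n, f (n + 1) ∂poissonMeasure r := by
  rw [lintegral_poissonMeasure, lintegral_poissonMeasure, tsum_eq_zero_add' ENNReal.summable,
    ← ENNReal.tsum_mul_left]
  simp only [Nat.cast_zero, zero_mul, mul_zero, zero_add]
  refine tsum_congr fun n => ?_
  rw [← mul_assoc, ← mul_assoc]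
  congr 1
  rw [← ENNReal.ofReal_natCast, ← ENNReal.ofReal_coe_nnreal, ← ENNReal.ofReal_mul (by positivity),
    ← ENNReal.ofReal_mul (by positivity), Nat.factorial_succ]
  congr 1
  push_cast
  field_simp
  ring

lemma lintegral_poissonMeasure_id (r : ℝ≥0) : ∫⁻ n, (n : ℝ≥0∞) ∂poissonMeasure r = r := by
  have h := lintegral_poissonMeasure_mul r fun _ => 1
  simpa using h

lemma lintegral_poissonMeasure_sq (r : ℝ≥0) :
    ∫⁻ n, (n : ℝ≥0∞) ^ 2 ∂poissonMeasure r = r * (r + 1) := by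
  have h := lintegral_poissonMeasure_mul r fun n => n
  simp_rw [sq]
  rw [h]
  push_cast
  rw [lintegral_add_right _ measurable_const, lintegral_poissonMeasure_id]
  simp

lemma ennreal_mul_le_sq_add_sq (a b : ℝ≥0∞) : a * b ≤ a ^ 2 + b ^ 2 := by
  rcases le_total a b with h | h
  · exact (mul_le_mul' h le_rfl).trans (by rw [sq b]; exact le_add_self)
  · exact (mul_le_mul' le_rfl h).trans (by rw [sq a]; exact le_self_add)

/-- Cauchy-Schwarz with weights; the constant 2 comes from the bound xy ≤ x² + y², which holds in
[0,∞] without roots. -/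
lemma ennreal_tsum_mul_sq_le (w D : ℕ → ℝ≥0∞) :
    (∑' n, w n * D n) ^ 2 ≤ 2 * ((∑' n, w n) * ∑' n, w n * D n ^ 2) := by
  have h1 : (∑' n, w n * D n) ^ 2 = ∑' n, ∑' k, w n * D n * (w k * D k) := by
    rw [sq, ← ENNReal.tsum_mul_right]
    exact tsum_congr fun n => ENNReal.tsum_mul_left.symm
  have h2 : ∀ n k, w n * D n * (w k * D k) ≤ w k * (w n * D n ^ 2) + w n * (w k * D k ^ 2) := by
    intro n k
    calc w n * D n * (w k * D k) = w n * w k * (D n * D k) := by ring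
      _ ≤ w n * w k * (D n ^ 2 + D k ^ 2) := mul_le_mul' le_rfl (ennreal_mul_le_sq_add_sq _ _)
      _ = _ := by ring
  rw [h1]
  refine (ENNReal.tsum_le_tsum fun n => ENNReal.tsum_le_tsum fun k => h2 n k).trans ?_
  simp_rw [ENNReal.tsum_add, ENNReal.tsum_mul_left, ENNReal.tsum_mul_right]
  rw [ENNReal.tsum_mul_left, two_mul]

section PoissonSums

variable {Ω : Type*} [MeasurableSpace Ω] {q : MarkedPoints Ω} {ρ : ℝ≥0} {P : Measure Ω}

lemma lintegral_count_sub_sq (hq : q.IsPoisson ρ P) {s t : ℝ≥0} (h : s ≤ t) :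
    ∫⁻ ω, ((q.count t ω - q.count s ω : ℕ) : ℝ≥0∞) ^ 2 ∂P =
      ((ρ * (t - s) : ℝ≥0) : ℝ≥0∞) * ((ρ * (t - s) : ℝ≥0) + 1) := by
  have hl := hq.law_increments s t h
  rw [← lintegral_poissonMeasure_sq, ← hl.map_eq, lintegral_map' (by fun_prop) hl.aemeasurable]

lemma lintegral_count_sub (hq : q.IsPoisson ρ P) {s t : ℝ≥0} (h : s ≤ t) :
    ∫⁻ ω, ((q.count t ω - q.count s ω : ℕ) : ℝ≥0∞) ∂P = ((ρ * (t - s) : ℝ≥0) : ℝ≥0∞) := by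
  have hl := hq.law_increments s t h
  rw [← lintegral_poissonMeasure_id, ← hl.map_eq, lintegral_map' (by fun_prop) hl.aemeasurable]

lemma finite_time_le {ω : Ω} (h : Filter.Tendsto (fun i => q.time i ω) Filter.atTop Filter.atTop)
    (t : ℝ) : {i | q.time i ω ≤ t}.Finite := by
  obtain ⟨i, hi⟩ := Filter.eventually_atTop.1 (h.eventually_gt_atTop t)
  refine (Set.finite_lt_nat i).subset fun j hj => ?_
  by_contra hn
  exact absurd hj (not_le.2 (hi j (not_lt.1 hn)))

lemma card_filter_le_count_sub {ω : Ω}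
    (h : Filter.Tendsto (fun i => q.time i ω) Filter.atTop Filter.atTop) {s t : ℝ≥0} (hst : s ≤ t)
    (m : ℕ) : ((Finset.range m).filter fun i => (s : ℝ) < q.time i ω ∧ q.time i ω ≤ t).card ≤
      q.count t ω - q.count s ω := by
  have hsub : {i | q.time i ω ≤ s} ⊆ {i | q.time i ω ≤ t} := fun i hi =>
    le_trans hi (NNReal.coe_le_coe.2 hst)
  rw [MarkedPoints.count, MarkedPoints.count, ← Set.ncard_sdiff hsub (finite_time_le h s),
    ← Set.ncard_coe_finset]
  refine Set.ncard_le_ncard (fun i hi => ?_) ((finite_time_le h t).sdiff)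
  have := (Finset.mem_filter.1 hi).2
  exact ⟨this.2, not_le.2 this.1⟩

/-- The second moment of a sum over the points of a Poisson process, if the contribution of every
point is controlled by weights on short intervals. -/
lemma lintegral_sum_points_sq_le (hq : q.IsPoisson ρ P) {w : ℕ → ℝ≥0∞} {a b : ℕ → ℝ≥0}
    (hab : ∀ n, a n ≤ b n) (hba : ∀ n, b n ≤ a n + 1) {f : ℕ → Ω → ℝ≥0∞}
    (hf : ∀ᵐ ω ∂P, ∀ i, f i ω ≤
      ∑' n, if (a n : ℝ) < q.time i ω ∧ q.time i ω ≤ b n then w n else 0) (m : ℕ) :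
    ∫⁻ ω, (∑ i ∈ Finset.range m, f i ω) ^ 2 ∂P ≤ 2 * ((∑' n, w n) ^ 2 * (ρ * (ρ + 1))) := by
  have h1 : ∀ᵐ ω ∂P, (∑ i ∈ Finset.range m, f i ω) ^ 2 ≤ 2 * ((∑' n, w n) *
      ∑' n, w n * ((q.count (b n) ω - q.count (a n) ω : ℕ) : ℝ≥0∞) ^ 2) := by
    filter_upwards [hf, hq.ordered] with ω hω ho
    refine le_trans (pow_le_pow_left' ?_ 2) (ennreal_tsum_mul_sq_le _ _)
    refine (Finset.sum_le_sum fun i _ => hω i).trans ?_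
    rw [← Summable.tsum_finsetSum fun _ _ => ENNReal.summable]
    refine ENNReal.tsum_le_tsum fun n => ?_
    rw [← Finset.sum_filter, Finset.sum_const, nsmul_eq_mul, mul_comm]
    exact mul_le_mul' le_rfl (Nat.cast_le.2 (card_filter_le_count_sub ho.2.2 (hab n) m))
  refine (lintegral_mono_ae h1).trans ?_
  have hm : ∀ n, AEMeasurable (fun ω => ((q.count (b n) ω - q.count (a n) ω : ℕ) : ℝ≥0∞) ^ 2) P :=
    fun n => (measurable_from_nat (f := fun n => (n : ℝ≥0∞) ^ 2)).comp_aemeasurable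
      (hq.law_increments _ _ (hab n)).aemeasurable
  have hm' : AEMeasurable (fun ω => ∑' n, w n *
      ((q.count (b n) ω - q.count (a n) ω : ℕ) : ℝ≥0∞) ^ 2) P :=
    AEMeasurable.tsum fun n => (hm n).const_mul _
  rw [lintegral_const_mul'' _ (hm'.const_mul _), lintegral_const_mul'' _ hm',
    lintegral_tsum fun n => (hm n).const_mul _]
  refine mul_le_mul' le_rfl ?_
  rw [sq, mul_assoc]
  refine mul_le_mul' le_rfl ?_
  rw [← ENNReal.tsum_mul_right]
  refine ENNReal.tsum_le_tsum fun n => ?_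
  rw [lintegral_const_mul'' _ (hm n), lintegral_count_sub_sq hq (hab n)]
  refine mul_le_mul' le_rfl ?_
  -- Every interval has length at most 1, so all counts have the moments of one unit interval.
  have h2 : ((ρ * (b n - a n) : ℝ≥0) : ℝ≥0∞) ≤ ρ := by
    refine ENNReal.coe_le_coe.2 (mul_le_of_le_one_right (zero_le) ?_)
    rw [tsub_le_iff_left]
    exact hba n
  exact mul_le_mul' h2 (add_le_add_left h2 1)

end PoissonSums

/-! ### Second moments of the Fourier coefficients and of their drifts -/

/-- Points are sorted by unit intervals of their times: one in (n, n+1] has weight at most exp(-θn),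
whatever M and u are. -/
lemma ofReal_amp_inl_le {θ M : ℝ} (hθ : 0 < θ) (τ : Label → ℝ) (i : ℕ) (u : ℝ) :
    ENNReal.ofReal (amp θ M τ (.inl i) u) ≤ ∑' n : ℕ,
      if ((n : ℝ≥0) : ℝ) < τ (.inl i) ∧ τ (.inl i) ≤ ((n + 1 : ℝ≥0) : ℝ) then
        ENNReal.ofReal (Real.exp (-(θ * n))) else 0 := by
  rw [amp]
  split_ifs with h
  · obtain ⟨n, hn⟩ : ∃ n, ⌈τ (.inl i)⌉₊ = n + 1 :=
      Nat.exists_eq_succ_of_ne_zero (Nat.ceil_pos.2 h.1).ne'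
    have h1 : (n : ℝ) < τ (.inl i) := Nat.lt_ceil.1 (by omega)
    have h2 : τ (.inl i) ≤ n + 1 := by
      have := Nat.le_ceil (τ (.inl i))
      rw [hn] at this
      exact_mod_cast this
    refine le_trans ?_ (ENNReal.le_tsum n)
    rw [if_pos ⟨by exact_mod_cast h1, by push_cast; exact h2⟩]
    refine ENNReal.ofReal_le_ofReal (Real.exp_le_exp.2 (neg_le_neg ?_))
    exact mul_le_mul_of_nonneg_left (by linarith [h.2.2]) hθ.le
  · simp

/-- Points are sorted by integer age n = ⌊u - τ⌋. The window (u-n-1, u-n] is cut at 0, which loses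
nothing since active points have positive times. -/
lemma ofReal_amp_inr_le {θ M : ℝ} (hθ : 0 < θ) (τ : Label → ℝ) (j : ℕ) (u : ℝ) :
    ENNReal.ofReal (amp θ M τ (.inr j) u) ≤ ∑' n : ℕ,
      if ((u - (n + 1)).toNNReal : ℝ) < τ (.inr j) ∧ τ (.inr j) ≤ ((u - n).toNNReal : ℝ) then
        ENNReal.ofReal (Real.exp (-(θ * n))) else 0 := by
  rw [amp]
  split_ifs with h
  · set n := ⌊u - τ (.inr j)⌋₊ with hn
    have h1 : (n : ℝ) ≤ u - τ (.inr j) := Nat.floor_le (by linarith [h.2])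
    have h2 : u - τ (.inr j) < n + 1 := Nat.lt_floor_add_one _
    refine le_trans ?_ (ENNReal.le_tsum n)
    rw [if_pos]
    · refine ENNReal.ofReal_le_ofReal (Real.exp_le_exp.2 (neg_le_neg ?_))
      exact mul_le_mul_of_nonneg_left h1 hθ.le
    · constructor
      · rw [Real.coe_toNNReal']
        exact max_lt (by linarith) h.1
      · rw [Real.coe_toNNReal']
        exact le_max_of_le_left (by linarith)
  · simp

/-- The sum of the squares of the intensities of the first vortices. -/
def enstrophy (θ M : ℝ) (N m : ℕ) (τ : Label → ℝ) (u : ℝ) : ℝ :=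
  (∑ v, amp θ M τ (lab m v) u ^ 2) / N

lemma enstrophy_nonneg (θ M : ℝ) (N m : ℕ) (τ : Label → ℝ) (u : ℝ) : 0 ≤ enstrophy θ M N m τ u :=
  div_nonneg (Finset.sum_nonneg fun _ _ => sq_nonneg _) (Nat.cast_nonneg _)

lemma measurable_enstrophy (θ M : ℝ) (N m : ℕ) (u : ℝ) :
    Measurable fun τ => enstrophy θ M N m τ u := by
  refine (Finset.measurable_fun_sum _ fun v _ => ?_).div_const _
  exact ((measurable_amp θ M (lab m v)).comp (measurable_id.prodMk measurable_const)).pow_const 2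

/-- A bound for the second moment of the enstrophy. -/
def enstrophyBound (θ : ℝ) (lam : ℝ≥0) : ℝ≥0∞ :=
  12 * ((∑' n : ℕ, ENNReal.ofReal (Real.exp (-(θ * n)))) ^ 2 * (lam * (lam + 1)))

lemma enstrophyBound_ne_top {θ : ℝ} (hθ : 0 < θ) (lam : ℝ≥0) : enstrophyBound θ lam ≠ ⊤ := by
  have h : Summable fun n : ℕ => Real.exp (-(θ * n)) := by
    have : ∀ n : ℕ, Real.exp (-(θ * n)) = Real.exp (-θ) ^ n := fun n => by
      rw [← Real.exp_nat_mul]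
      ring_nf
    simp_rw [this]
    exact summable_geometric_of_lt_one (Real.exp_pos _).le (Real.exp_lt_one_iff.2 (by linarith))
  have h1 : ∑' n : ℕ, ENNReal.ofReal (Real.exp (-(θ * n))) ≠ ⊤ := by
    rw [← ENNReal.ofReal_tsum_of_nonneg (fun n => (Real.exp_pos _).le) h]
    exact ENNReal.ofReal_ne_top
  unfold enstrophyBound
  finiteness

section Moments

variable {Ω : Type*} [MeasurableSpace Ω] {init noise : MarkedPoints Ω} {M : ℝ}
  {x : Label → ℝ → Ω → Torus} {G : Set Ω} {T : ℝ} {m : ℕ} {θ : ℝ} {N : ℕ}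
  {P : Measure Ω} [IsProbabilityMeasure P] {lam : ℝ≥0}

/-- Intensity Nλ yields Nλ(Nλ + 1), and the two factors 1/N reduce this to λ(λ + 1/N), at most λ(λ +
1). The constant 12 is 3·(2 + 2): 3 from the square of the sum of initial and created parts, 2 from
each of them. -/
lemma lintegral_enstrophy_sq_le (hθ : 0 < θ) (hN1 : 1 ≤ N) (hI : init.IsPoisson (N * lam) P)
    (hN : noise.IsPoisson (N * lam) P) (u : ℝ) :
    ∫⁻ ω, ENNReal.ofReal (enstrophy θ M N m (fun v => labTime init noise v ω) u ^ 2) ∂P ≤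
      enstrophyBound θ lam := by
  set W : ℝ≥0∞ := ∑' n : ℕ, ENNReal.ofReal (Real.exp (-(θ * n))) with hW
  set f : ℕ → Ω → ℝ≥0∞ := fun i ω =>
    ENNReal.ofReal (amp θ M (fun v => labTime init noise v ω) (.inl i) u) with hf
  set g : ℕ → Ω → ℝ≥0∞ := fun j ω =>
    ENNReal.ofReal (amp θ M (fun v => labTime init noise v ω) (.inr j) u) with hg
  have h1 : ∫⁻ ω, (∑ i ∈ Finset.range m, f i ω) ^ 2 ∂P ≤
      2 * (W ^ 2 * ((N * lam : ℝ≥0) * ((N * lam : ℝ≥0) + 1))) :=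
    lintegral_sum_points_sq_le hI (a := fun n => (n : ℝ≥0)) (b := fun n => (n + 1 : ℝ≥0))
      (fun n => le_self_add) (fun n => le_rfl)
      (Filter.Eventually.of_forall fun ω i => ofReal_amp_inl_le hθ _ i u) m
  have h2 : ∫⁻ ω, (∑ i ∈ Finset.range m, g i ω) ^ 2 ∂P ≤
      2 * (W ^ 2 * ((N * lam : ℝ≥0) * ((N * lam : ℝ≥0) + 1))) :=
    lintegral_sum_points_sq_le hN (a := fun n => (u - (n + 1)).toNNReal)
      (b := fun n => (u - n).toNNReal) (fun n => Real.toNNReal_le_toNNReal (by linarith))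
      (fun n => by
        rw [← Real.toNNReal_one]
        refine le_trans (Real.toNNReal_le_toNNReal ?_) Real.toNNReal_add_le
        linarith)
      (Filter.Eventually.of_forall fun ω i => ofReal_amp_inr_le hθ _ i u) m
  have hm : ∀ v : Label, Measurable fun ω =>
      ENNReal.ofReal (amp θ M (fun v => labTime init noise v ω) v u) := fun v =>
    ((measurable_amp θ M v).comp ((measurable_pi_lambda _ fun v =>
      measurable_labTime init noise v).prodMk measurable_const)).ennreal_ofReal
  have h3 : ∀ ω, ENNReal.ofReal (enstrophy θ M N m (fun v => labTime init noise v ω) u ^ 2) ≤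
      ((N : ℝ≥0∞)⁻¹ * (N : ℝ≥0∞)⁻¹ * 3) *
        ((∑ i ∈ Finset.range m, f i ω) ^ 2 + (∑ i ∈ Finset.range m, g i ω) ^ 2) := by
    intro ω
    have h4 : ENNReal.ofReal (enstrophy θ M N m (fun v => labTime init noise v ω) u) ≤
        (N : ℝ≥0∞)⁻¹ * (∑ i ∈ Finset.range m, f i ω + ∑ i ∈ Finset.range m, g i ω) := by
      rw [enstrophy, ENNReal.ofReal_div_of_pos (by exact_mod_cast hN1), ENNReal.ofReal_natCast,
        mul_comm, ENNReal.div_eq_inv_mul, mul_comm]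
      refine mul_le_mul' ?_ le_rfl
      rw [ENNReal.ofReal_sum_of_nonneg fun _ _ => sq_nonneg _, Fintype.sum_sum_type,
        Finset.sum_range, Finset.sum_range]
      have h5 : ∀ v : Label, ENNReal.ofReal (amp θ M (fun v => labTime init noise v ω) v u ^ 2) ≤
          ENNReal.ofReal (amp θ M (fun v => labTime init noise v ω) v u) := fun v =>
        ENNReal.ofReal_le_ofReal (by
          rw [sq]
          exact mul_le_of_le_one_right (amp_nonneg _ _ _ _ _) (amp_le_one hθ _ _ _ _))
      exact add_le_add (Finset.sum_le_sum fun i _ => h5 _) (Finset.sum_le_sum fun i _ => h5 _)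
    rw [ENNReal.ofReal_pow (enstrophy_nonneg _ _ _ _ _ _)]
    refine (pow_le_pow_left' h4 2).trans ?_
    rw [mul_pow, sq (N : ℝ≥0∞)⁻¹, mul_assoc ((N : ℝ≥0∞)⁻¹ * (N : ℝ≥0∞)⁻¹)]
    refine mul_le_mul' le_rfl ?_
    set X := ∑ i ∈ Finset.range m, f i ω
    set Y := ∑ i ∈ Finset.range m, g i ω
    calc (X + Y) ^ 2 = X ^ 2 + Y ^ 2 + 2 * (X * Y) := by ring
      _ ≤ X ^ 2 + Y ^ 2 + 2 * (X ^ 2 + Y ^ 2) := by gcongr; exact ennreal_mul_le_sq_add_sq X Y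
      _ = 3 * (X ^ 2 + Y ^ 2) := by ring
  refine (lintegral_mono h3).trans ?_
  have hfm : Measurable fun ω => (∑ i ∈ Finset.range m, f i ω) ^ 2 :=
    (Finset.measurable_fun_sum _ fun i _ => hm _).pow_const 2
  have hgm : Measurable fun ω => (∑ i ∈ Finset.range m, g i ω) ^ 2 :=
    (Finset.measurable_fun_sum _ fun i _ => hm _).pow_const 2
  rw [lintegral_const_mul _ (hfm.fun_add hgm), lintegral_add_left hfm]
  refine (mul_le_mul' le_rfl (add_le_add h1 h2)).trans ?_
  have hN0 : (N : ℝ≥0∞) ≠ 0 := by exact_mod_cast (by omega : N ≠ 0)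
  have h6 : (N : ℝ≥0∞)⁻¹ * N = 1 := ENNReal.inv_mul_cancel hN0 (ENNReal.natCast_ne_top N)
  have h7 : (N : ℝ≥0∞)⁻¹ ≤ 1 := ENNReal.inv_le_one.2 (by exact_mod_cast hN1)
  rw [enstrophyBound, ← hW]
  push_cast
  calc (N : ℝ≥0∞)⁻¹ * (N : ℝ≥0∞)⁻¹ * 3 * (2 * (W ^ 2 * (N * lam * (N * lam + 1))) +
        2 * (W ^ 2 * (N * lam * (N * lam + 1))))
      = 12 * (W ^ 2 * (((N : ℝ≥0∞)⁻¹ * N) * lam * (((N : ℝ≥0∞)⁻¹ * N) * lam + (N : ℝ≥0∞)⁻¹))) := by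
        ring
    _ ≤ _ := by
        rw [h6, one_mul]
        gcongr

/-- The signs are integrated first, with times and positions fixed; a bound free of the positions
then leaves only the law of the times. -/
lemma lintegral_timesSigns_cutPos_le {X : Ω → Fin m ⊕ Fin m → Torus} (hX : Measurable X)
    (hlaw : P.map (fun ω => (timesSigns init noise m ω, X ω)) =
      ((P.map fun ω v => labTime init noise v ω).prod (signPi (Fin m ⊕ Fin m))).prod volume)
    {F : ((Label → ℝ) × (Fin m ⊕ Fin m → ℝ)) × (Fin m ⊕ Fin m → Torus) → ℝ≥0∞} (hF : Measurable F)
    {g : (Label → ℝ) → ℝ≥0∞} (hg : Measurable g)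
    (h : ∀ τ y, ∫⁻ e, F ((τ, e), y) ∂signPi (Fin m ⊕ Fin m) ≤ g τ) :
    ∫⁻ ω, F (timesSigns init noise m ω, X ω) ∂P ≤ ∫⁻ ω, g (fun v => labTime init noise v ω) ∂P := by
  have mtm : Measurable fun ω v => labTime init noise v ω :=
    measurable_pi_lambda _ fun v => measurable_labTime init noise v
  have : IsProbabilityMeasure (P.map fun ω v => labTime init noise v ω) :=
    Measure.isProbabilityMeasure_map mtm.aemeasurable
  rw [← lintegral_map (f := F) (g := fun ω => (timesSigns init noise m ω, X ω)) hF
    ((measurable_timesSigns init noise m).prodMk hX), hlaw, lintegral_prod_symm' _ hF]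
  calc _ ≤ ∫⁻ _ : Fin m ⊕ Fin m → Torus, ∫⁻ τ, g τ ∂(P.map fun ω v => labTime init noise v ω) := by
        refine lintegral_mono fun y => ?_
        refine (lintegral_prod (fun z => F (z, y))
          (hF.comp measurable_prodMk_right).aemeasurable).trans_le ?_
        exact lintegral_mono fun τ => h τ y
    _ = _ := by
        rw [lintegral_const, measure_univ, mul_one, lintegral_map hg mtm]

lemma measurable_sign_mul_amp (t : ℝ) (v : Fin m ⊕ Fin m) :
    Measurable fun z : ((Label → ℝ) × (Fin m ⊕ Fin m → ℝ)) × (Fin m ⊕ Fin m → Torus) =>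
      z.1.2 v * amp θ M z.1.1 (lab m v) t / Real.sqrt N :=
  (((measurable_pi_apply v).comp (measurable_snd.comp measurable_fst)).mul
    ((measurable_amp θ M (lab m v)).comp
      ((measurable_fst.comp measurable_fst).prodMk measurable_const))).div_const _

lemma lintegral_coeff_sign_sq_le (k : Fin 2 → ℤ) (t : ℝ) (τ : Label → ℝ)
    (y : Fin m ⊕ Fin m → Torus) :
    ∫⁻ e, ENNReal.ofReal (‖∑ v, ((e v * amp θ M τ (lab m v) t / Real.sqrt N : ℝ) : ℂ) *
      UnitAddTorus.mFourier k (y v)‖ ^ 2) ∂signPi (Fin m ⊕ Fin m) ≤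
      ENNReal.ofReal (enstrophy θ M N m τ t) := by
  refine le_trans (le_of_eq ?_) ((lintegral_sum_sign_sq_le fun v =>
    ((amp θ M τ (lab m v) t / Real.sqrt N : ℝ) : ℂ) * UnitAddTorus.mFourier k (y v)).trans
    (le_of_eq ?_))
  · refine lintegral_congr fun e => ?_
    congr 3
    refine Finset.sum_congr rfl fun v _ => ?_
    rw [mul_div_assoc, Complex.ofReal_mul, mul_assoc]
  · rw [enstrophy, Finset.sum_div]
    congr 1
    refine Finset.sum_congr rfl fun v _ => ?_
    rw [norm_mul, norm_mFourier_apply, mul_one, Complex.norm_real, Real.norm_eq_abs, sq_abs, div_pow,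
      Real.sq_sqrt (Nat.cast_nonneg _)]

lemma sum_offDiag_mul_sq_le {ι : Type*} [Fintype ι] [DecidableEq ι] (c : ι → ℝ) :
    ∑ p ∈ Finset.univ.offDiag, (c p.1 * c p.2) ^ 2 ≤ (∑ v, c v ^ 2) ^ 2 := by
  rw [sq (∑ v, c v ^ 2), Finset.sum_mul_sum, ← Finset.sum_product']
  simp_rw [mul_pow]
  exact Finset.sum_le_sum_of_subset_of_nonneg (Finset.subset_univ _) fun _ _ _ => by positivity

lemma lintegral_offDiag_sign_le {C : ℝ} (hC : ∀ k x y, ‖symKernel k x y‖ ≤ C * freqSq k)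
    (k : Fin 2 → ℤ) (t : ℝ) (τ : Label → ℝ) (y : Fin m ⊕ Fin m → Torus) :
    ∫⁻ e, ENNReal.ofReal (‖∑ p ∈ Finset.univ.offDiag,
      (((e p.1 * amp θ M τ (lab m p.1) t / Real.sqrt N) *
        (e p.2 * amp θ M τ (lab m p.2) t / Real.sqrt N) : ℝ) : ℂ) *
      symKernel k (y p.1) (y p.2)‖ ^ 2) ∂signPi (Fin m ⊕ Fin m) ≤
      ENNReal.ofReal (2 * ((C * freqSq k) ^ 2 * enstrophy θ M N m τ t ^ 2)) := by
  set c : Fin m ⊕ Fin m → ℝ := fun v => amp θ M τ (lab m v) t / Real.sqrt N with hc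
  have hens : enstrophy θ M N m τ t = ∑ v, c v ^ 2 := by
    rw [enstrophy, Finset.sum_div]
    refine Finset.sum_congr rfl fun v _ => ?_
    rw [hc, div_pow, Real.sq_sqrt (Nat.cast_nonneg _)]
  refine le_trans (le_of_eq ?_) ((lintegral_offDiag_sign_sq_le fun v w =>
    ((c v * c w : ℝ) : ℂ) * symKernel k (y v) (y w)).trans (ENNReal.ofReal_le_ofReal ?_))
  · refine lintegral_congr fun e => ?_
    congr 3
    refine Finset.sum_congr rfl fun p _ => ?_
    rw [← mul_assoc, ← Complex.ofReal_mul]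
    congr 2
    simp only [hc]
    ring
  · refine mul_le_mul_of_nonneg_left ?_ zero_le_two
    rw [hens]
    refine le_trans (Finset.sum_le_sum (g := fun p : (Fin m ⊕ Fin m) × (Fin m ⊕ Fin m) =>
      (C * freqSq k) ^ 2 * (c p.1 * c p.2) ^ 2) fun p _ => ?_) ?_
    · rw [norm_mul, mul_pow, Complex.norm_real, Real.norm_eq_abs, sq_abs, mul_comm]
      exact mul_le_mul_of_nonneg_right (pow_le_pow_left₀ (norm_nonneg _) (hC _ _ _) 2) (sq_nonneg _)
    · rw [← Finset.mul_sum]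
      exact mul_le_mul_of_nonneg_left (sum_offDiag_mul_sq_le c) (sq_nonneg _)

/-- The second moments of the Fourier coefficients of the truncated system. -/
theorem lintegral_coeffPath_sq_le (hθ : 0 < θ) (hN1 : 1 ≤ N) (hI : init.IsPoisson (N * lam) P)
    (hN : noise.IsPoisson (N * lam) P) (t : ℝ)
    (hX : Measurable (cutPos init noise M x G T m t))
    (hlaw : P.map (fun ω => (timesSigns init noise m ω, cutPos init noise M x G T m t ω)) =
      ((P.map fun ω v => labTime init noise v ω).prod (signPi (Fin m ⊕ Fin m))).prod volume)
    (k : Fin 2 → ℤ) :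
    ∫⁻ ω, ENNReal.ofReal (‖coeffPath init noise M x G T m θ N k t ω‖ ^ 2) ∂P ≤
      1 + enstrophyBound θ lam := by
  have hFm : Measurable fun y : Torus => UnitAddTorus.mFourier k y :=
    (UnitAddTorus.mFourier k).continuous.measurable
  refine (lintegral_timesSigns_cutPos_le hX hlaw (F := fun z => ENNReal.ofReal (‖∑ v,
    ((z.1.2 v * amp θ M z.1.1 (lab m v) t / Real.sqrt N : ℝ) : ℂ) *
      UnitAddTorus.mFourier k (z.2 v)‖ ^ 2)) ?_ (measurable_enstrophy θ M N m t).ennreal_ofReal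
    fun τ y => lintegral_coeff_sign_sq_le k t τ y).trans ?_
  · refine ((Finset.measurable_fun_sum _ fun v _ => ?_).norm.pow_const 2).ennreal_ofReal
    exact (Complex.measurable_ofReal.comp (measurable_sign_mul_amp t v)).mul
      (hFm.comp ((measurable_pi_apply v).comp measurable_snd))
  -- From a ≤ 1 + a², so that the second moment of the enstrophy is the only one ever needed.
  · refine le_trans (lintegral_mono (g := fun ω => 1 +
      ENNReal.ofReal (enstrophy θ M N m (fun v => labTime init noise v ω) t ^ 2)) fun ω => ?_) ?_
    · simp only
      rw [← ENNReal.ofReal_one, ← ENNReal.ofReal_add zero_le_one (sq_nonneg _)]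
      refine ENNReal.ofReal_le_ofReal ?_
      generalize enstrophy θ M N m (fun v => labTime init noise v ω) t = a
      nlinarith [sq_nonneg (a - 1)]
    · rw [lintegral_add_left measurable_const, lintegral_const, measure_univ, mul_one]
      exact add_le_add le_rfl (lintegral_enstrophy_sq_le hθ hN1 hI hN t)

/-- The second moments of the drifts of the truncated system. -/
theorem lintegral_driftPath_sq_le (hθ : 0 < θ) (hN1 : 1 ≤ N) (hI : init.IsPoisson (N * lam) P)
    (hN : noise.IsPoisson (N * lam) P) (t : ℝ)
    (hX : Measurable (cutPos init noise M x G T m t))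
    (hlaw : P.map (fun ω => (timesSigns init noise m ω, cutPos init noise M x G T m t ω)) =
      ((P.map fun ω v => labTime init noise v ω).prod (signPi (Fin m ⊕ Fin m))).prod volume)
    {C : ℝ} (hC : ∀ k x y, ‖symKernel k x y‖ ≤ C * freqSq k) (k : Fin 2 → ℤ) :
    ∫⁻ ω, ENNReal.ofReal (‖driftPath init noise M x G T m θ N k t ω‖ ^ 2) ∂P ≤
      ENNReal.ofReal ((2 * θ ^ 2 + 4 * C ^ 2) * (1 + freqSq k) ^ 2) *
        (1 + enstrophyBound θ lam) := by
  have hF0 := freqSq_nonneg k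
  have hdrift : Measurable fun z : ((Label → ℝ) × (Fin m ⊕ Fin m → ℝ)) × (Fin m ⊕ Fin m → Torus) =>
      ∑ p ∈ Finset.univ.offDiag, (((z.1.2 p.1 * amp θ M z.1.1 (lab m p.1) t / Real.sqrt N) *
        (z.1.2 p.2 * amp θ M z.1.1 (lab m p.2) t / Real.sqrt N) : ℝ) : ℂ) *
        symKernel k (z.2 p.1) (z.2 p.2) := by
    refine Finset.measurable_fun_sum _ fun p _ => ?_
    have e1 := (measurable_sign_mul_amp (M := M) (θ := θ) (N := N) t p.1).fun_mul
      (measurable_sign_mul_amp (M := M) (θ := θ) (N := N) t p.2)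
    have e2 : Measurable fun z : ((Label → ℝ) × (Fin m ⊕ Fin m → ℝ)) × (Fin m ⊕ Fin m → Torus) =>
        (z.2 p.1, z.2 p.2) := ((measurable_pi_apply p.1).comp measurable_snd).prodMk
          ((measurable_pi_apply p.2).comp measurable_snd)
    have e3 := (measurable_symKernel k).comp e2
    have e4 := Complex.measurable_ofReal.comp e1
    exact e4.fun_mul e3
  have h1 : ∫⁻ ω, ENNReal.ofReal (‖∑ p ∈ Finset.univ.offDiag,
      ((wgt init noise θ M N (lab m p.1) t ω * wgt init noise θ M N (lab m p.2) t ω : ℝ) : ℂ) *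
      symKernel k (cutPos init noise M x G T m t ω p.1) (cutPos init noise M x G T m t ω p.2)‖ ^ 2) ∂P ≤
      ENNReal.ofReal (2 * (C * freqSq k) ^ 2) * enstrophyBound θ lam := by
    refine (lintegral_timesSigns_cutPos_le hX hlaw (F := fun z => ENNReal.ofReal
      (‖∑ p ∈ Finset.univ.offDiag, (((z.1.2 p.1 * amp θ M z.1.1 (lab m p.1) t / Real.sqrt N) *
        (z.1.2 p.2 * amp θ M z.1.1 (lab m p.2) t / Real.sqrt N) : ℝ) : ℂ) *
        symKernel k (z.2 p.1) (z.2 p.2)‖ ^ 2))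
      (hdrift.norm.pow_const 2).ennreal_ofReal
      ((((measurable_enstrophy θ M N m t).pow_const 2).const_mul _).const_mul _).ennreal_ofReal
      fun τ y => lintegral_offDiag_sign_le hC k t τ y).trans ?_
    have h2 : ∀ ω, ENNReal.ofReal (2 * ((C * freqSq k) ^ 2 *
        enstrophy θ M N m (fun v => labTime init noise v ω) t ^ 2)) =
        ENNReal.ofReal (2 * (C * freqSq k) ^ 2) *
          ENNReal.ofReal (enstrophy θ M N m (fun v => labTime init noise v ω) t ^ 2) := fun ω => by
      rw [← ENNReal.ofReal_mul (by positivity), mul_assoc]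
    simp_rw [h2]
    rw [lintegral_const_mul' _ _ ENNReal.ofReal_ne_top]
    exact mul_le_mul' le_rfl (lintegral_enstrophy_sq_le hθ hN1 hI hN t)
  have h3 : ∀ ω, ENNReal.ofReal (‖driftPath init noise M x G T m θ N k t ω‖ ^ 2) ≤
      ENNReal.ofReal (2 * θ ^ 2) * ENNReal.ofReal (‖coeffPath init noise M x G T m θ N k t ω‖ ^ 2) +
      2 * ENNReal.ofReal (‖∑ p ∈ Finset.univ.offDiag,
      ((wgt init noise θ M N (lab m p.1) t ω * wgt init noise θ M N (lab m p.2) t ω : ℝ) : ℂ) *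
      symKernel k (cutPos init noise M x G T m t ω p.1)
        (cutPos init noise M x G T m t ω p.2)‖ ^ 2) := by
    intro ω
    have e2 : (2 : ℝ≥0∞) = ENNReal.ofReal 2 := by simp
    rw [e2, ← ENNReal.ofReal_mul (by positivity), ← ENNReal.ofReal_mul (by positivity),
      ← ENNReal.ofReal_add (by positivity) (by positivity)]
    refine ENNReal.ofReal_le_ofReal ?_
    rw [driftPath, coeffDrift]
    refine (pow_le_pow_left₀ (norm_nonneg _) (norm_add_le _ _) 2).trans ?_
    refine (add_sq_le).trans (le_of_eq ?_)
    have : ‖(-θ : ℂ)‖ = θ := by rw [norm_neg, Complex.norm_real, Real.norm_of_nonneg hθ.le]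
    rw [norm_mul, this]
    simp only [coeffPath]
    ring
  have hZm : Measurable fun ω => ENNReal.ofReal (‖coeffPath init noise M x G T m θ N k t ω‖ ^ 2) := by
    refine ((Finset.measurable_fun_sum _ fun v _ => ?_).norm.pow_const 2).ennreal_ofReal
    exact (Complex.measurable_ofReal.comp ((measurable_wgt init noise θ M N (lab m v)).comp
      (measurable_const.prodMk measurable_id))).mul
      ((UnitAddTorus.mFourier k).continuous.measurable.comp ((measurable_pi_apply v).comp hX))
  refine (lintegral_mono h3).trans ?_
  rw [lintegral_add_left (hZm.const_mul _), lintegral_const_mul' _ _ ENNReal.ofReal_ne_top,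
    lintegral_const_mul' _ _ (by simp)]
  have h4 := lintegral_coeffPath_sq_le hθ hN1 hI hN t hX hlaw k
  have e2 : (2 : ℝ≥0∞) = ENNReal.ofReal 2 := by simp
  calc _ ≤ ENNReal.ofReal (2 * θ ^ 2) * (1 + enstrophyBound θ lam) +
        2 * (ENNReal.ofReal (2 * (C * freqSq k) ^ 2) * (1 + enstrophyBound θ lam)) :=
        add_le_add (mul_le_mul' le_rfl h4) (mul_le_mul' le_rfl
          (h1.trans (mul_le_mul' le_rfl le_add_self)))
    _ = ENNReal.ofReal (2 * θ ^ 2 + 2 * (2 * (C * freqSq k) ^ 2)) * (1 + enstrophyBound θ lam) := by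
        rw [ENNReal.ofReal_add (by positivity) (by positivity), ENNReal.ofReal_mul zero_le_two (q := 2 * (C * freqSq k) ^ 2),
          ← e2, add_mul, mul_assoc 2]
    _ ≤ _ := by
        refine mul_le_mul' (ENNReal.ofReal_le_ofReal ?_) le_rfl
        have h5 : 1 ≤ (1 + freqSq k) ^ 2 := one_le_pow₀ (by linarith)
        have h6 : freqSq k ^ 2 ≤ (1 + freqSq k) ^ 2 := pow_le_pow_left₀ hF0 (by linarith) 2
        nlinarith [mul_le_mul_of_nonneg_left h5 (sq_nonneg θ),
          mul_le_mul_of_nonneg_left h6 (sq_nonneg C)]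

end Moments

/-! ### Independence of the increments of a Poisson process from its past -/

section Past

variable {Ω : Type*} [MeasurableSpace Ω] {P : Measure Ω} [IsProbabilityMeasure P]

open scoped Classical in
/-- The number of points in `(s, t]`. -/
def MarkedPoints.incr (q : MarkedPoints Ω) (s t : ℝ) (ω : Ω) : ℝ≥0∞ :=
  ∑' i, if s < q.time i ω ∧ q.time i ω ≤ t then 1 else 0

variable {q : MarkedPoints Ω} {ρ : ℝ≥0}

lemma measurable_incr (q : MarkedPoints Ω) (s t : ℝ) : Measurable (q.incr s t) :=
  Measurable.tsum fun i => Measurable.ite ((measurableSet_lt measurable_const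
    (q.measurable_time i)).inter (measurableSet_le (q.measurable_time i) measurable_const))
    measurable_const measurable_const

lemma incr_add {s t u : ℝ} (hst : s ≤ t) (htu : t ≤ u) (ω : Ω) :
    q.incr s u ω = q.incr s t ω + q.incr t u ω := by
  rw [MarkedPoints.incr, MarkedPoints.incr, MarkedPoints.incr, ← ENNReal.tsum_add]
  refine tsum_congr fun i => ?_
  by_cases h1 : q.time i ω ≤ s
  · simp [not_lt.2 h1, not_lt.2 (h1.trans hst)]
  · have h1' := not_le.1 h1
    by_cases h2 : q.time i ω ≤ t
    · simp [h1', h2, h2.trans htu, not_lt.2 h2]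
    · simp [h1', h2, not_le.1 h2]

lemma incr_eq_count_sub {ω : Ω}
    (h : Filter.Tendsto (fun i => q.time i ω) Filter.atTop Filter.atTop) {s t : ℝ≥0} (hst : s ≤ t) :
    q.incr s t ω = ((q.count t ω - q.count s ω : ℕ) : ℝ≥0∞) := by
  have hsub : {i | q.time i ω ≤ s} ⊆ {i | q.time i ω ≤ t} := fun i hi =>
    le_trans hi (NNReal.coe_le_coe.2 hst)
  have hfin : ({i | q.time i ω ≤ t} \ {i | q.time i ω ≤ s}).Finite := (finite_time_le h t).sdiff
  rw [MarkedPoints.count, MarkedPoints.count, ← Set.ncard_sdiff hsub (finite_time_le h s),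
    Set.ncard_eq_toFinset_card _ hfin, MarkedPoints.incr, tsum_eq_sum (s := hfin.toFinset)]
  · rw [Finset.sum_congr rfl (g := fun _ => 1)]
    · simp
    · intro i hi
      rw [Set.Finite.mem_toFinset] at hi
      rw [if_pos ⟨not_le.1 hi.2, hi.1⟩]
  · intro i hi
    rw [Set.Finite.mem_toFinset] at hi
    rw [if_neg]
    exact fun h' => hi ⟨h'.2, not_le.2 h'.1⟩

lemma incr_ae_eq (hq : q.IsPoisson ρ P) {s t : ℝ≥0} (hst : s ≤ t) :
    q.incr s t =ᵐ[P] fun ω => ((q.count t ω - q.count s ω : ℕ) : ℝ≥0∞) := by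
  filter_upwards [hq.ordered] with ω h
  exact incr_eq_count_sub h.2.2 hst

lemma iIndepFun_incr (hq : q.IsPoisson ρ P) {t : ℕ → ℝ≥0} (ht : Monotone t) :
    iIndepFun (fun i => q.incr (t i) (t (i + 1))) P := by
  have h := (hq.indep_increments.nat ht).comp (fun _ n => (n : ℝ≥0∞)) fun _ =>
    (measurable_from_nat : Measurable fun n : ℕ => (n : ℝ≥0∞))
  exact h.congr fun i => (incr_ae_eq hq (ht (Nat.le_succ i))).symm

/-- The numbers of points before the dyadic points of `[0, s]`. -/
def MarkedPoints.grid (q : MarkedPoints Ω) (s : ℝ≥0) (ω : Ω) (n j : ℕ) : ℝ≥0∞ :=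
  q.incr 0 (s * (min j (2 ^ n) : ℕ) / 2 ^ n) ω

/-- The counts at grid points are partial sums of increments before s, which are jointly independent
of the increment over (s, t]. -/
lemma indepFun_grid_level (hq : q.IsPoisson ρ P) {s t : ℝ≥0} (hst : s ≤ t) (n : ℕ) :
    IndepFun (fun ω j => q.grid s ω n j) (q.incr s t) P := by
  -- The grid of [0, s] continued by the constant t: its increment number 2^n is the one over (s,
  -- t].
  set u : ℕ → ℝ≥0 := fun i => if i ≤ 2 ^ n then s * i / 2 ^ n else t with hu
  have hle : ∀ i : ℕ, i ≤ 2 ^ n → s * i / 2 ^ n ≤ s := fun i hi => by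
    rw [mul_div_assoc]
    refine mul_le_of_le_one_right zero_le ((div_le_one (by positivity)).2 ?_)
    exact_mod_cast hi
  have hmono : Monotone u := by
    refine monotone_nat_of_le_succ fun i => ?_
    simp only [hu]
    split_ifs with h1 h2 h2
    · gcongr
      exact Nat.le_succ i
    · exact (hle i h1).trans hst
    · omega
    · exact le_rfl
  have hi := (iIndepFun_incr hq hmono).indepFun_finset (Finset.range (2 ^ n)) {2 ^ n}
    (by simp) fun i => measurable_incr q _ _
  have hj : ∀ j ω, j ≤ 2 ^ n → q.incr 0 (u j) ω =
      ∑ i ∈ Finset.range j, q.incr (u i) (u (i + 1)) ω := by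
    intro j ω hj
    induction j with
    | zero =>
      have : u 0 = 0 := by simp [hu]
      rw [this, Finset.range_zero, Finset.sum_empty, MarkedPoints.incr]
      refine ENNReal.tsum_eq_zero.2 fun i => if_neg fun h => ?_
      exact absurd (h.1.trans_le h.2) (by simp)
    | succ j ih =>
      rw [Finset.sum_range_succ, ← ih (by omega)]
      exact incr_add (by exact_mod_cast zero_le) (NNReal.coe_le_coe.2 (hmono (Nat.le_succ j))) ω
  let φ : (Finset.range (2 ^ n) → ℝ≥0∞) → ℕ → ℝ≥0∞ := fun f j =>
    ∑ i : Finset.range (2 ^ n), if (i : ℕ) < min j (2 ^ n) then f i else 0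
  have hφ : Measurable φ := by
    refine measurable_pi_lambda _ fun j => Finset.measurable_fun_sum _ fun i _ => ?_
    split_ifs
    · exact measurable_pi_apply i
    · exact measurable_const
  have key := hi.comp hφ (measurable_pi_apply (⟨2 ^ n, by simp⟩ : ({2 ^ n} : Finset ℕ)))
  have e1 : (φ ∘ fun ω (i : Finset.range (2 ^ n)) => q.incr (u i) (u (i + 1)) ω) =
      fun ω j => q.grid s ω n j := by
    funext ω j
    have h1 : (s * (min j (2 ^ n) : ℕ) / 2 ^ n : ℝ) = u (min j (2 ^ n)) := by
      simp only [hu, if_pos (min_le_right j (2 ^ n))]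
      push_cast
      rfl
    rw [MarkedPoints.grid, h1, hj _ _ (min_le_right _ _)]
    show (∑ i : Finset.range (2 ^ n), if (i : ℕ) < min j (2 ^ n) then
      q.incr (u i) (u (i + 1)) ω else 0) = _
    rw [Finset.sum_coe_sort (Finset.range (2 ^ n)) fun i => if i < min j (2 ^ n) then
      q.incr (u i) (u (i + 1)) ω else 0, ← Finset.sum_filter]
    refine Finset.sum_congr (Finset.ext fun i => ?_) fun _ _ => rfl
    simp only [Finset.mem_filter, Finset.mem_range]
    have := min_le_right j (2 ^ n)
    omega
  have e2 : ((fun f : ({2 ^ n} : Finset ℕ) → ℝ≥0∞ => f ⟨2 ^ n, by simp⟩) ∘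
      fun ω (i : ({2 ^ n} : Finset ℕ)) => q.incr (u i) (u (i + 1)) ω) = q.incr s t := by
    funext ω
    show q.incr (u (2 ^ n)) (u (2 ^ n + 1)) ω = _
    have h1 : u (2 ^ n) = s := by simp [hu]
    have h2 : u (2 ^ n + 1) = t := by simp [hu]
    rw [h1, h2]
  rw [e1] at key
  exact e2 ▸ key

/-- The grid of level n consists of the even points of level n + 1, so the σ-algebras increase and
independence passes to their supremum. -/
lemma indepFun_grid (hq : q.IsPoisson ρ P) {s t : ℝ≥0} (hst : s ≤ t) :
    IndepFun (q.grid s) (q.incr s t) P := by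
  set mn : ℕ → MeasurableSpace Ω := fun n =>
    MeasurableSpace.comap (fun ω j => q.grid s ω n j) inferInstance with hmn
  have hmono : Monotone mn := by
    refine monotone_nat_of_le_succ fun n => ?_
    have e : (fun ω j => q.grid s ω n j) =
        (fun f : ℕ → ℝ≥0∞ => fun j => f (2 * j)) ∘ fun ω j => q.grid s ω (n + 1) j := by
      funext ω j
      simp only [MarkedPoints.grid, Function.comp]
      have : min (2 * j) (2 ^ (n + 1)) = 2 * min j (2 ^ n) := by
        rw [pow_succ, mul_comm (2 ^ n) 2, Nat.mul_min_mul_left]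
      rw [this]
      congr 1
      push_cast
      rw [pow_succ]
      field_simp
    simp only [hmn]
    rw [e, ← MeasurableSpace.comap_comp]
    exact MeasurableSpace.comap_mono (Measurable.comap_le
      (measurable_pi_lambda _ fun j => measurable_pi_apply _))
  have h := indep_iSup_of_monotone (m := mn) (m1 := MeasurableSpace.comap (q.incr s t) inferInstance)
    (fun n => (IndepFun_iff_Indep _ _ _).1 (indepFun_grid_level hq hst n))
    (fun n => (measurable_pi_lambda _ fun j => measurable_incr q _ _).comap_le)
    (measurable_incr q s t).comap_le hmono
  rw [IndepFun_iff_Indep]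
  refine indep_of_indep_of_le_left h ?_
  rw [← measurable_iff_comap_le]
  refine @measurable_pi_lambda _ _ _ (⨆ n, mn n) _ _ fun n => ?_
  exact Measurable.mono (comap_measurable _) (le_iSup mn n) le_rfl

/-- With indices from 0, the time of index i has passed exactly when i + 1 points have been counted;
this recovers times from counts. -/
lemma succ_le_incr_iff {ω : Ω} (h0 : 0 < q.time 0 ω) (hm : StrictMono fun i => q.time i ω) (u : ℝ)
    (i : ℕ) : ((i + 1 : ℕ) : ℝ≥0∞) ≤ q.incr 0 u ω ↔ q.time i ω ≤ u := by
  have hpos : ∀ j, 0 < q.time j ω := fun j => h0.trans_le (hm.monotone (Nat.zero_le j))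
  constructor
  · intro h
    by_contra hu
    have hz : ∀ j ∉ Finset.range i, (if 0 < q.time j ω ∧ q.time j ω ≤ u then (1 : ℝ≥0∞) else 0) = 0 := by
      intro j hj
      refine if_neg fun h' => hu ?_
      exact (hm.monotone (not_lt.1 fun h'' => hj (Finset.mem_range.2 h''))).trans h'.2
    rw [MarkedPoints.incr, tsum_eq_sum hz] at h
    have h2 : ∑ j ∈ Finset.range i, (if 0 < q.time j ω ∧ q.time j ω ≤ u then (1 : ℝ≥0∞) else 0) ≤ i := by
      refine (Finset.sum_le_sum (g := fun _ => (1 : ℝ≥0∞)) fun j _ => ?_).trans (by simp)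
      split_ifs <;> simp
    have h3 := h.trans h2
    rw [Nat.cast_le] at h3
    omega
  · intro h
    refine le_trans ?_ (ENNReal.sum_le_tsum (Finset.range (i + 1)))
    rw [Finset.sum_congr rfl (g := fun _ => (1 : ℝ≥0∞))]
    · simp
    · intro j hj
      exact if_pos ⟨hpos j, (hm.monotone (Nat.lt_succ_iff.1 (Finset.mem_range.1 hj))).trans h⟩

open scoped Classical in
/-- The times up to `s`; later times are replaced by `s + 1`. -/
def MarkedPoints.stopTimes (q : MarkedPoints Ω) (s : ℝ) (ω : Ω) (i : ℕ) : ℝ :=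
  if q.time i ω ≤ s then q.time i ω else s + 1

lemma measurable_stopTimes (q : MarkedPoints Ω) (s : ℝ) : Measurable (q.stopTimes s) :=
  measurable_pi_lambda _ fun i => Measurable.ite
    (measurableSet_le (q.measurable_time i) measurable_const) (q.measurable_time i) measurable_const

open scoped Classical in
/-- The times up to `s` as functions of the numbers of points before the dyadic points. -/
def gridTimes (s : ℝ≥0) (f : ℕ → ℕ → ℝ≥0∞) (i : ℕ) : ℝ :=
  if ((i + 1 : ℕ) : ℝ≥0∞) ≤ f 0 1 then
    ⨅ p : ℕ × ℕ, if ((i + 1 : ℕ) : ℝ≥0∞) ≤ f p.1 p.2 then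
      (s * (min p.2 (2 ^ p.1) : ℕ) / 2 ^ p.1 : ℝ) else s
  else s + 1

lemma measurable_gridTimes (s : ℝ≥0) : Measurable (gridTimes s) := by
  have h : ∀ n j : ℕ, Measurable fun f : ℕ → ℕ → ℝ≥0∞ => f n j := fun n j =>
    (measurable_pi_apply j).comp (measurable_pi_apply n)
  refine measurable_pi_lambda _ fun i => Measurable.ite (measurableSet_le measurable_const (h 0 1))
    (Measurable.iInf fun p => Measurable.ite (measurableSet_le measurable_const (h _ _))
      measurable_const measurable_const) measurable_const

/-- A time up to s is the infimum of the dyadic points of [0, s] that it precedes. The default value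
s in the infimum is harmless, because it is itself above the time. -/
lemma gridTimes_grid {ω : Ω} (h0 : 0 < q.time 0 ω) (hm : StrictMono fun i => q.time i ω) (s : ℝ≥0) :
    gridTimes s (q.grid s ω) = q.stopTimes s ω := by
  funext i
  have hpos : 0 < q.time i ω := h0.trans_le (hm.monotone (Nat.zero_le i))
  have hiff : ∀ n j, ((i + 1 : ℕ) : ℝ≥0∞) ≤ q.grid s ω n j ↔
      q.time i ω ≤ s * (min j (2 ^ n) : ℕ) / 2 ^ n := fun n j => succ_le_incr_iff h0 hm _ i
  rw [gridTimes, MarkedPoints.stopTimes]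
  simp only [hiff]
  -- The entry (0, 1) of the grid is the count up to s.
  have e1 : (s * (min 1 (2 ^ 0) : ℕ) / 2 ^ 0 : ℝ) = s := by simp
  rw [e1]
  split_ifs with hs
  · have hlow : ∀ p : ℕ × ℕ, q.time i ω ≤ if q.time i ω ≤ s * (min p.2 (2 ^ p.1) : ℕ) / 2 ^ p.1 then
        (s * (min p.2 (2 ^ p.1) : ℕ) / 2 ^ p.1 : ℝ) else s := fun p => by
      split_ifs with h
      · exact h
      · exact hs
    refine le_antisymm (le_of_forall_pos_le_add fun ε hε => ?_) (le_ciInf hlow)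
    have hs0 : (0 : ℝ) < s := hpos.trans_le hs
    obtain ⟨n, hn⟩ := pow_unbounded_of_one_lt (s / ε : ℝ) one_lt_two
    have h2n : (0 : ℝ) < 2 ^ n := by positivity
    set j := ⌈q.time i ω * 2 ^ n / s⌉₊ with hj
    have hj1 : q.time i ω * 2 ^ n / s ≤ j := Nat.le_ceil _
    have hj2 : (j : ℝ) < q.time i ω * 2 ^ n / s + 1 := Nat.ceil_lt_add_one (by positivity)
    have hj3 : j ≤ 2 ^ n := by
      refine Nat.ceil_le.2 ?_
      push_cast
      rw [div_le_iff₀ hs0, mul_comm]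
      exact mul_le_mul_of_nonneg_left hs h2n.le
    refine (ciInf_le ⟨q.time i ω, by rintro _ ⟨p, rfl⟩; exact hlow p⟩ (n, j)).trans ?_
    simp only [min_eq_left hj3]
    rw [if_pos]
    · rw [div_le_iff₀ h2n]
      rw [div_lt_iff₀ hε] at hn
      have h3 : (s : ℝ) * j ≤ s * (q.time i ω * 2 ^ n / s + 1) :=
        mul_le_mul_of_nonneg_left hj2.le hs0.le
      have h4 : (s : ℝ) * (q.time i ω * 2 ^ n / s + 1) = q.time i ω * 2 ^ n + s := by
        field_simp
      nlinarith
    · rw [le_div_iff₀ h2n]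
      rw [div_le_iff₀ hs0] at hj1
      linarith
  · rfl

/-- The times up to `s` are independent of the number of points in `(s, t]`. -/
theorem indepFun_stopTimes_incr (hq : q.IsPoisson ρ P) {s t : ℝ≥0} (hst : s ≤ t) :
    IndepFun (q.stopTimes s) (q.incr s t) P := by
  refine ((indepFun_grid hq hst).comp (measurable_gridTimes s) measurable_id).congr ?_ .rfl
  filter_upwards [hq.ordered] with ω h
  exact gridTimes_grid h.1 h.2.1 s

end Past

/-! ### Past events and created vortices -/

section PastEvents

variable {Ω : Type*} [MeasurableSpace Ω] {P : Measure Ω}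
  {init noise : MarkedPoints Ω} {M : ℝ}

/-- The initial points, and the points of the noise up to time `s`. -/
def pastData (init noise : MarkedPoints Ω) (s : ℝ) (ω : Ω) :
    (ℕ → ℝ × ℝ × Torus) × (ℕ → ℝ × ℝ × Torus) :=
  (fun i => (init.time i ω, init.mark i ω), fun i => noise.observed s i ω)

lemma measurable_pastData (init noise : MarkedPoints Ω) (s : ℝ) : Measurable (pastData init noise s) :=
  (measurable_pi_lambda _ fun i => (init.measurable_time i).prodMk (init.measurable_mark i)).prodMk
    (measurable_pi_lambda _ fun i => noise.measurable_observed s i)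

/-- The events of the past are determined by the data of the past, up to null events. -/
lemma exists_pastData_preimage {s : ℝ≥0} {A : Set Ω}
    (hA : MeasurableSet[augmentedFiltration init noise M P s] A) :
    ∃ B, MeasurableSet B ∧ A =ᵐ[P] pastData init noise s ⁻¹' B := by
  classical
  have hmm : Measurable[MeasurableSpace.comap (pastData init noise s) inferInstance] (pastData init noise s) := comap_measurable _
  -- The data keep all initial points and not only those up to M; this is more information, but it
  -- is still independent of the noise.
  have h1 : init.sigma M ≤
      MeasurableSpace.comap (pastData init noise s) inferInstance := by
    refine iSup_le fun i => ?_
    rw [← measurable_iff_comap_le]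
    have hg : Measurable (fun z : (ℕ → ℝ × ℝ × Torus) × (ℕ → ℝ × ℝ × Torus) =>
        if (z.1 i).1 ≤ M then z.1 i else 0) :=
      Measurable.ite (measurableSet_le (measurable_fst.comp
        ((measurable_pi_apply i).comp measurable_fst)) measurable_const)
        ((measurable_pi_apply i).comp measurable_fst) measurable_const
    have e : init.observed M i = (fun z : (ℕ → ℝ × ℝ × Torus) × (ℕ → ℝ × ℝ × Torus) =>
        if (z.1 i).1 ≤ M then z.1 i else 0) ∘ pastData init noise s := by
      funext ω
      exact if_congr Iff.rfl rfl rfl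
    rw [e]
    exact hg.comp hmm
  have h2 : noise.sigma s ≤
      MeasurableSpace.comap (pastData init noise s) inferInstance := by
    refine iSup_le fun i => ?_
    rw [← measurable_iff_comap_le]
    exact ((measurable_pi_apply i).comp measurable_snd).comp hmm
  have h3 : MeasurableSpace.comap (pastData init noise s) inferInstance ≤
      eventuallyMeasurableSpace (MeasurableSpace.comap (pastData init noise s) inferInstance) (ae P) := fun D hD => ⟨D, hD, Filter.EventuallyEq.rfl⟩
  have h4 : nullSigma P ≤ eventuallyMeasurableSpace
      (MeasurableSpace.comap (pastData init noise s) inferInstance) (ae P) := by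
    refine MeasurableSpace.generateFrom_le fun D hD => ?_
    exact ⟨∅, @MeasurableSet.empty _ (_), (ae_eq_empty.2 hD.2)⟩
  have h5 : MeasurableSet[eventuallyMeasurableSpace
      (MeasurableSpace.comap (pastData init noise s) inferInstance) (ae P)] A :=
    (sup_le (sup_le (h1.trans h3) (h2.trans h3)) h4 :
      augmentedFiltration init noise M P s ≤ eventuallyMeasurableSpace
      (MeasurableSpace.comap (pastData init noise s) inferInstance) (ae P)) _ hA
  obtain ⟨A', ⟨B, hB, rfl⟩, hAB⟩ := h5
  exact ⟨B, hB, hAB⟩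

variable [IsProbabilityMeasure P] {r ρ : ℝ≥0}

lemma indepFun_init_times_marks (hN : noise.IsPoisson ρ P)
    (hIN : IndepFun (fun ω i => (init.time i ω, init.mark i ω))
      (fun ω i => (noise.time i ω, noise.mark i ω)) P) :
    IndepFun (fun ω => ((fun i => (init.time i ω, init.mark i ω)), fun i => noise.time i ω))
      (fun ω i => noise.mark i ω) P := by
  have hsplit : Measurable fun f : ℕ → ℝ × ℝ × Torus => (fun i => (f i).1, fun i => (f i).2) :=
    (measurable_pi_lambda _ fun i => measurable_fst.comp (measurable_pi_apply i)).prodMk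
      (measurable_pi_lambda _ fun i => measurable_snd.comp (measurable_pi_apply i))
  exact indepFun_prodMk_left
    (measurable_pi_lambda _ fun i => (init.measurable_time i).prodMk (init.measurable_mark i))
    (measurable_pi_lambda _ noise.measurable_time) (measurable_pi_lambda _ noise.measurable_mark)
    (hIN.comp measurable_id hsplit) hN.indep_time_mark

/-- The data of the past are independent of the number of points in `(s, t]`. -/
lemma indepFun_incr_pastData (hN : noise.IsPoisson ρ P)
    (hIN : IndepFun (fun ω i => (init.time i ω, init.mark i ω))
      (fun ω i => (noise.time i ω, noise.mark i ω)) P) {s t : ℝ≥0} (hst : s ≤ t) :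
    IndepFun (noise.incr s t) (pastData init noise s) P := by
  classical
  have mU : Measurable fun ω i => (init.time i ω, init.mark i ω) :=
    measurable_pi_lambda _ fun i => (init.measurable_time i).prodMk (init.measurable_mark i)
  have mt : Measurable fun ω i => noise.time i ω := measurable_pi_lambda _ noise.measurable_time
  have mm : Measurable fun ω i => noise.mark i ω := measurable_pi_lambda _ noise.measurable_mark
  have h1 := (indepFun_init_times_marks hN hIN).comp (measurable_snd.prodMk measurable_fst)
    measurable_id
  have hUt : IndepFun (fun ω i => noise.time i ω) (fun ω i => (init.time i ω, init.mark i ω)) P :=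
    (hIN.comp measurable_id (measurable_pi_lambda _ fun i =>
      measurable_fst.comp (measurable_pi_apply i))).symm
  have h2 : IndepFun (fun ω i => noise.time i ω)
      (fun ω => ((fun i => (init.time i ω, init.mark i ω)), fun i => noise.mark i ω)) P :=
    indepFun_prodMk_right mt mU mm h1 hUt
  let φ : (ℕ → ℝ) → ℝ≥0∞ × (ℕ → ℝ) := fun τ =>
    (∑' i, if (s : ℝ) < τ i ∧ τ i ≤ t then 1 else 0, fun i => if τ i ≤ s then τ i else s + 1)
  have hφ : Measurable φ := by
    refine Measurable.prodMk (Measurable.tsum fun i => Measurable.ite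
      ((measurableSet_lt measurable_const (measurable_pi_apply i)).inter
      (measurableSet_le (measurable_pi_apply i) measurable_const)) measurable_const
      measurable_const) (measurable_pi_lambda _ fun i => Measurable.ite
      (measurableSet_le (measurable_pi_apply i) measurable_const) (measurable_pi_apply i)
      measurable_const)
  have h3 : IndepFun (fun ω => (noise.incr s t ω, noise.stopTimes s ω))
      (fun ω => ((fun i => (init.time i ω, init.mark i ω)), fun i => noise.mark i ω)) P := by
    have e : (fun ω => (noise.incr s t ω, noise.stopTimes s ω)) = φ ∘ fun ω i => noise.time i ω := by
      funext ω
      exact Prod.ext (tsum_congr fun i => if_congr Iff.rfl rfl rfl)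
        (funext fun i => if_congr Iff.rfl rfl rfl)
    rw [e]
    exact h2.comp hφ measurable_id
  have h4 := indepFun_prodMk_right (measurable_incr noise s t) (measurable_stopTimes noise s)
    (mU.prodMk mm) h3 (indepFun_stopTimes_incr hN hst).symm
  let ψ : (ℕ → ℝ) × (ℕ → ℝ × ℝ × Torus) × (ℕ → ℝ × Torus) →
      (ℕ → ℝ × ℝ × Torus) × (ℕ → ℝ × ℝ × Torus) := fun z =>
    (z.2.1, fun i => if z.1 i ≤ s then (z.1 i, z.2.2 i) else 0)
  have hψ : Measurable ψ := by
    have a1 : ∀ i : ℕ, Measurable fun z : (ℕ → ℝ) × (ℕ → ℝ × ℝ × Torus) × (ℕ → ℝ × Torus) => z.1 i :=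
      fun i => (measurable_pi_apply i).comp measurable_fst
    have a2 : ∀ i : ℕ, Measurable fun z : (ℕ → ℝ) × (ℕ → ℝ × ℝ × Torus) × (ℕ → ℝ × Torus) =>
      z.2.2 i := fun i => (measurable_pi_apply i).comp (measurable_snd.comp measurable_snd)
    exact (measurable_fst.comp measurable_snd).prodMk (measurable_pi_lambda _ fun i =>
      Measurable.ite (measurableSet_le (a1 i) measurable_const) ((a1 i).prodMk (a2 i))
        measurable_const)
  have e : pastData init noise s = ψ ∘ fun ω => (noise.stopTimes s ω,
      ((fun i => (init.time i ω, init.mark i ω)), fun i => noise.mark i ω)) := by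
    funext ω
    refine Prod.ext rfl (funext fun i => ?_)
    simp only [pastData, MarkedPoints.observed, Function.comp, ψ, MarkedPoints.stopTimes]
    by_cases hi : noise.time i ω ≤ s
    · simp [hi]
    · simp [hi]
  rw [e]
  exact h4.comp measurable_id hψ

lemma setLIntegral_incr (hN : noise.IsPoisson ρ P)
    (hIN : IndepFun (fun ω i => (init.time i ω, init.mark i ω))
      (fun ω i => (noise.time i ω, noise.mark i ω)) P) {s t : ℝ≥0} (hst : s ≤ t)
    {B : Set ((ℕ → ℝ × ℝ × Torus) × (ℕ → ℝ × ℝ × Torus))} (hB : MeasurableSet B) :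
    ∫⁻ ω in pastData init noise s ⁻¹' B, noise.incr s t ω ∂P =
      P (pastData init noise s ⁻¹' B) * ((ρ * (t - s) : ℝ≥0) : ℝ≥0∞) := by
  have hm : MeasurableSet (pastData init noise s ⁻¹' B) := measurable_pastData init noise s hB
  have hind : IndepFun (fun ω => B.indicator (fun _ => (1 : ℝ≥0∞)) (pastData init noise s ω))
      (noise.incr s t) P :=
    (indepFun_incr_pastData hN hIN hst).symm.comp (measurable_const.indicator hB) measurable_id
  have h1 : ∫⁻ ω, B.indicator (fun _ => (1 : ℝ≥0∞)) (pastData init noise s ω) * noise.incr s t ω ∂P =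
      (∫⁻ ω, B.indicator (fun _ => (1 : ℝ≥0∞)) (pastData init noise s ω) ∂P) *
        ∫⁻ ω, noise.incr s t ω ∂P := lintegral_mul_eq_lintegral_mul_lintegral_of_indepFun''
    ((measurable_const.indicator hB).comp (measurable_pastData init noise s)).aemeasurable
    (measurable_incr noise s t).aemeasurable hind
  have h2 : ∫⁻ ω, noise.incr s t ω ∂P = ((ρ * (t - s) : ℝ≥0) : ℝ≥0∞) := by
    rw [lintegral_congr_ae (incr_ae_eq hN hst), lintegral_count_sub hN hst]
  have h3 : ∫⁻ ω, B.indicator (fun _ => (1 : ℝ≥0∞)) (pastData init noise s ω) ∂P =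
      P (pastData init noise s ⁻¹' B) := by
    rw [← lintegral_indicator_one hm]
    rfl
  rw [← h2, ← h3, ← h1, ← lintegral_indicator hm]
  refine lintegral_congr fun ω => ?_
  by_cases hω : pastData init noise s ω ∈ B
  · rw [Set.indicator_of_mem (show ω ∈ pastData init noise s ⁻¹' B from hω),
      Set.indicator_of_mem hω, one_mul]
  · rw [Set.indicator_of_notMem (show ω ∉ pastData init noise s ⁻¹' B from hω),
      Set.indicator_of_notMem hω, zero_mul]

/-- The entry l is overwritten by 0, so that the sequence of the other marks keeps the same index
set. -/
lemma indepFun_update_mark (hN : noise.IsPoisson ρ P) (l : ℕ) :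
    IndepFun (fun ω i => if i = l then 0 else noise.mark i ω) (noise.mark l) P := by
  have h := indep_iSup_of_disjoint (fun i => (noise.measurable_mark i).comap_le) hN.indep_marks
    (S := {l}ᶜ) (T := {l}) (Set.disjoint_compl_left_iff_subset.2 subset_rfl)
  rw [IndepFun_iff_Indep]
  refine indep_of_indep_of_le_left (indep_of_indep_of_le_right h ?_) ?_
  · exact le_iSup₂_of_le l rfl le_rfl
  · rw [← measurable_iff_comap_le]
    refine @measurable_pi_lambda _ _ _ (_) _ _ fun i => ?_
    by_cases hi : i = l
    · simp only [hi, if_true]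
      exact @measurable_const _ _ _ (_) _
    · simp only [hi, if_false]
      exact Measurable.mono (comap_measurable _)
        (le_iSup₂_of_le (f := fun i (_ : i ∈ ({l}ᶜ : Set ℕ)) =>
          MeasurableSpace.comap (noise.mark i) inferInstance) i hi le_rfl) le_rfl

open scoped Classical in
/-- The contribution of the `j`-th point to a sum over the points in `(s, t]`. -/
def MarkedPoints.jump (q : MarkedPoints Ω) (s t : ℝ) (h : Torus → ℝ) (j : ℕ) (ω : Ω) : ℝ :=
  if s < q.time j ω ∧ q.time j ω ≤ t then (q.mark j ω).1 * h (q.mark j ω).2 else 0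

lemma measurable_jump (q : MarkedPoints Ω) (s t : ℝ) {h : Torus → ℝ} (hh : Measurable h) (j : ℕ) :
    Measurable (q.jump s t h j) :=
  Measurable.ite ((measurableSet_lt measurable_const (q.measurable_time j)).inter
    (measurableSet_le (q.measurable_time j) measurable_const))
    ((measurable_fst.comp (q.measurable_mark j)).mul
      (hh.comp (measurable_snd.comp (q.measurable_mark j)))) measurable_const

lemma integral_signMeasure_id : ∫ x, x ∂signMeasure = 0 := by
  have := measurePreserving_neg_sign.integral_comp (MeasurableEquiv.neg ℝ).measurableEmbedding
    (fun x : ℝ => x)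
  rw [integral_neg] at this
  linarith

lemma integral_sign_mul_mark (hN : noise.IsPoisson ρ P) {h : Torus → ℝ} (hh : Measurable h) (l : ℕ) :
    ∫ ω, (noise.mark l ω).1 * h (noise.mark l ω).2 ∂P = 0 := by
  have hl := hN.law_marks l
  have h1 := integral_map (noise.measurable_mark l).aemeasurable (f := fun z : ℝ × Torus => z.1 * h z.2)
    (μ := P) (measurable_fst.mul (hh.comp measurable_snd)).aestronglyMeasurable
  rw [← h1, hl.map_eq, integral_prod_mul (fun x : ℝ => x) h, integral_signMeasure_id, zero_mul]

/-- Different points are orthogonal, given the past. -/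
lemma integral_past_jump_mul_jump (hN : noise.IsPoisson ρ P)
    (hIN : IndepFun (fun ω i => (init.time i ω, init.mark i ω))
      (fun ω i => (noise.time i ω, noise.mark i ω)) P) (s t : ℝ)
    {B : Set ((ℕ → ℝ × ℝ × Torus) × (ℕ → ℝ × ℝ × Torus))} (hB : MeasurableSet B) {h : Torus → ℝ}
    (hh : Measurable h) {j l : ℕ} (hjl : j ≠ l) :
    ∫ ω in pastData init noise s ⁻¹' B, noise.jump s t h j ω * noise.jump s t h l ω ∂P = 0 := by
  classical
  have hm : MeasurableSet (pastData init noise s ⁻¹' B) := measurable_pastData init noise s hB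
  have mU : Measurable fun ω i => (init.time i ω, init.mark i ω) :=
    measurable_pi_lambda _ fun i => (init.measurable_time i).prodMk (init.measurable_mark i)
  have mt : Measurable fun ω i => noise.time i ω := measurable_pi_lambda _ noise.measurable_time
  set ml : Ω → ℕ → ℝ × Torus := fun ω i => if i = l then 0 else noise.mark i ω with hml
  have mml : Measurable ml := measurable_pi_lambda _ fun i => by
    by_cases hi : i = l
    · simp only [hml, hi, if_true]
      exact measurable_const
    · simp only [hml, hi, if_false]
      exact noise.measurable_mark i
  have hg : Measurable fun f : ℕ → ℝ × Torus => ((fun i => if i = l then 0 else f i : ℕ → ℝ × Torus), f l) := by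
    refine (measurable_pi_lambda _ fun i => ?_).prodMk (measurable_pi_apply l)
    by_cases hi : i = l
    · simp only [hi, if_true]
      exact measurable_const
    · simp only [hi, if_false]
      exact measurable_pi_apply i
  have h1 : IndepFun (fun ω => (((fun i => (init.time i ω, init.mark i ω)), fun i => noise.time i ω),
      ml ω)) (noise.mark l) P :=
    indepFun_prodMk_left (mU.prodMk mt) mml (noise.measurable_mark l)
      ((indepFun_init_times_marks hN hIN).comp measurable_id hg) (indepFun_update_mark hN l)
  -- If the point l falls in (s, t], its mark is not observed by time s, so the past may be computed
  -- with that mark erased. Everything except the factor of mark l is then a function of variables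
  -- independent of it, and that factor has mean zero.
  let F : ((ℕ → ℝ × ℝ × Torus) × (ℕ → ℝ)) × (ℕ → ℝ × Torus) → ℝ := fun w =>
    if (w.1.1, fun i => if w.1.2 i ≤ s then (w.1.2 i, w.2 i) else 0) ∈ B ∧
      (s < w.1.2 l ∧ w.1.2 l ≤ t) ∧ (s < w.1.2 j ∧ w.1.2 j ≤ t) then
      (w.2 j).1 * h (w.2 j).2 else 0
  have hF : Measurable F := by
    have a1 : ∀ i : ℕ, Measurable fun w : ((ℕ → ℝ × ℝ × Torus) × (ℕ → ℝ)) × (ℕ → ℝ × Torus) =>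
      w.1.2 i := fun i => (measurable_pi_apply i).comp (measurable_snd.comp measurable_fst)
    have a2 : ∀ i : ℕ, Measurable fun w : ((ℕ → ℝ × ℝ × Torus) × (ℕ → ℝ)) × (ℕ → ℝ × Torus) =>
      w.2 i := fun i => (measurable_pi_apply i).comp measurable_snd
    refine Measurable.ite (MeasurableSet.inter ?_ (((measurableSet_lt measurable_const (a1 l)).inter
      (measurableSet_le (a1 l) measurable_const)).inter ((measurableSet_lt measurable_const (a1 j)).inter
      (measurableSet_le (a1 j) measurable_const)))) ((measurable_fst.comp (a2 j)).mul
      (hh.comp (measurable_snd.comp (a2 j)))) measurable_const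
    exact ((measurable_fst.comp measurable_fst).prodMk (measurable_pi_lambda _ fun i =>
      Measurable.ite (measurableSet_le (a1 i) measurable_const) ((a1 i).prodMk (a2 i))
        measurable_const)) hB
  have key := h1.integral_fun_comp_mul_comp ((mU.prodMk mt).prodMk mml).aemeasurable
    (noise.measurable_mark l).aemeasurable (f := F) (g := fun z => z.1 * h z.2)
    hF.aestronglyMeasurable (measurable_fst.mul (hh.comp measurable_snd)).aestronglyMeasurable
  rw [integral_sign_mul_mark hN hh l, mul_zero] at key
  rw [← integral_indicator hm, ← key]
  refine integral_congr_ae (Filter.Eventually.of_forall fun ω => ?_)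
  simp only [F]
  by_cases hl : s < noise.time l ω ∧ noise.time l ω ≤ t
  · have hobs : (fun i => if noise.time i ω ≤ s then (noise.time i ω, ml ω i) else 0) =
        fun i => noise.observed s i ω := by
      funext i
      rw [MarkedPoints.observed]
      by_cases hi : noise.time i ω ≤ s
      · have hil : i ≠ l := by
          rintro rfl
          exact absurd hl.1 (not_lt.2 hi)
        simp only [hi, if_true, hml, hil, if_false]
      · simp only [hi, if_false]
    rw [hobs]
    have hmj : ml ω j = noise.mark j ω := by simp only [hml, hjl, if_false]
    rw [hmj]
    by_cases hω : pastData init noise s ω ∈ B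
    · rw [Set.indicator_of_mem (show ω ∈ pastData init noise s ⁻¹' B from hω), MarkedPoints.jump,
        MarkedPoints.jump, if_pos hl]
      by_cases hj : s < noise.time j ω ∧ noise.time j ω ≤ t
      · rw [if_pos hj, if_pos ⟨hω, hl, hj⟩]
      · rw [if_neg hj, if_neg fun h' => hj h'.2.2, zero_mul]
    · rw [Set.indicator_of_notMem (show ω ∉ pastData init noise s ⁻¹' B from hω),
        if_neg fun h' => hω h'.1, zero_mul]
  · rw [if_neg fun h' => hl h'.2.1, zero_mul]
    refine Set.indicator_apply_eq_zero.2 fun _ => ?_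
    rw [MarkedPoints.jump, MarkedPoints.jump, if_neg hl, mul_zero]

lemma ae_abs_jump_le (hN : noise.IsPoisson ρ P) (s t : ℝ) {h : Torus → ℝ} (hb : ∀ z, |h z| ≤ 1) :
    ∀ᵐ ω ∂P, ∀ j, |noise.jump s t h j ω| ≤ 1 := by
  rw [ae_all_iff]
  intro j
  have h1 : ∀ᵐ z ∂(signMeasure.prod (volume : Measure Torus)), z.1 = 1 ∨ z.1 = -1 :=
    Measure.quasiMeasurePreserving_fst.ae ae_signMeasure
  rw [← (hN.law_marks j).map_eq] at h1
  filter_upwards [ae_of_ae_map (noise.measurable_mark j).aemeasurable h1] with ω hω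
  rw [MarkedPoints.jump]
  split_ifs
  · rcases hω with e | e <;> rw [e] <;> simpa using hb _
  · simp

/-- The second moment of a sum over the points in `(s, t]`, given the past. -/
lemma integral_past_sum_jump_sq (hN : noise.IsPoisson ρ P)
    (hIN : IndepFun (fun ω i => (init.time i ω, init.mark i ω))
      (fun ω i => (noise.time i ω, noise.mark i ω)) P) (s t : ℝ)
    {B : Set ((ℕ → ℝ × ℝ × Torus) × (ℕ → ℝ × ℝ × Torus))} (hB : MeasurableSet B) {h : Torus → ℝ}
    (hh : Measurable h) (hb : ∀ z, |h z| ≤ 1) (m : ℕ) :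
    ∫ ω in pastData init noise s ⁻¹' B, (∑ j ∈ Finset.range m, noise.jump s t h j ω) ^ 2 ∂P =
      ∑ j ∈ Finset.range m, ∫ ω in pastData init noise s ⁻¹' B, noise.jump s t h j ω ^ 2 ∂P := by
  have hi : ∀ j l, Integrable (fun ω => noise.jump s t h j ω * noise.jump s t h l ω)
      (P.restrict (pastData init noise s ⁻¹' B)) := by
    intro j l
    refine Integrable.of_bound ((measurable_jump noise s t hh j).mul
      (measurable_jump noise s t hh l)).aestronglyMeasurable 1 (ae_restrict_of_ae ?_)
    filter_upwards [ae_abs_jump_le hN s t hb] with ω hω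
    rw [Real.norm_eq_abs, abs_mul]
    exact mul_le_one₀ (hω j) (abs_nonneg _) (hω l)
  have e : ∀ ω, (∑ j ∈ Finset.range m, noise.jump s t h j ω) ^ 2 =
      ∑ j ∈ Finset.range m, ∑ l ∈ Finset.range m, noise.jump s t h j ω * noise.jump s t h l ω :=
    fun ω => by rw [sq, Finset.sum_mul_sum]
  simp_rw [e]
  rw [integral_finsetSum _ fun j _ => integrable_finsetSum _ fun l _ => hi j l]
  refine Finset.sum_congr rfl fun j hj => ?_
  rw [integral_finsetSum _ fun l _ => hi j l, Finset.sum_eq_single j]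
  · simp_rw [sq]
  · exact fun l _ hl => integral_past_jump_mul_jump hN hIN s t hB hh hl.symm
  · exact fun hj' => absurd hj hj'

end PastEvents

/-! ### The created vortices after a stopping time -/

section StoppingTime

variable {Ω : Type*} [MeasurableSpace Ω] {P : Measure Ω} [IsProbabilityMeasure P]
  {init noise : MarkedPoints Ω} {M : ℝ} {lam : ℝ≥0} {N : ℕ}

lemma norm_sq_creation_sub (noise : MarkedPoints Ω) (N m : ℕ) (k : Fin 2 → ℤ) {s t : ℝ} (hst : s ≤ t)
    (ω : Ω) : ‖creation noise N m k t ω - creation noise N m k s ω‖ ^ 2 =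
      (N : ℝ)⁻¹ * ((∑ j ∈ Finset.range m,
        noise.jump s t (fun z => (UnitAddTorus.mFourier k z).re) j ω) ^ 2 +
      (∑ j ∈ Finset.range m,
        noise.jump s t (fun z => (UnitAddTorus.mFourier k z).im) j ω) ^ 2) := by
  have e : creation noise N m k t ω - creation noise N m k s ω =
      ((Real.sqrt N)⁻¹ : ℝ) * (((∑ j ∈ Finset.range m,
        noise.jump s t (fun z => (UnitAddTorus.mFourier k z).re) j ω : ℝ) : ℂ) +
      ((∑ j ∈ Finset.range m,
        noise.jump s t (fun z => (UnitAddTorus.mFourier k z).im) j ω : ℝ) : ℂ) * Complex.I) := by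
    rw [creation, creation, ← Finset.sum_sub_distrib, Finset.sum_range, Finset.sum_range,
      Complex.ofReal_sum, Complex.ofReal_sum, Finset.sum_mul, ← Finset.sum_add_distrib,
      Finset.mul_sum]
    refine Finset.sum_congr rfl fun j _ => ?_
    rw [MarkedPoints.jump, MarkedPoints.jump]
    by_cases h1 : noise.time j ω ≤ s
    · simp [h1, h1.trans hst, not_lt.2 h1]
    · by_cases h2 : noise.time j ω ≤ t
      · rw [if_pos h2, if_neg h1, if_pos ⟨not_le.1 h1, h2⟩, if_pos ⟨not_le.1 h1, h2⟩, sub_zero]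
        conv_lhs => rw [← Complex.re_add_im (UnitAddTorus.mFourier k (noise.mark j ω).2)]
        push_cast
        ring
      · simp [h1, h2]
  rw [e, norm_mul, mul_pow, Complex.norm_real, Real.norm_eq_abs, sq_abs, inv_pow,
    Real.sq_sqrt (Nat.cast_nonneg _), ← Complex.normSq_eq_norm_sq, Complex.normSq_add_mul_I]

lemma measurable_creation (noise : MarkedPoints Ω) (N m : ℕ) (k : Fin 2 → ℤ) :
    Measurable fun p : ℝ × Ω => creation noise N m k p.1 p.2 := by
  refine Finset.measurable_fun_sum _ fun j _ => Measurable.ite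
    (measurableSet_le ((noise.measurable_time j).comp measurable_snd) measurable_fst) ?_
    measurable_const
  have h1 : Measurable fun p : ℝ × Ω => (noise.mark j p.2).1 / Real.sqrt N :=
    ((measurable_fst.comp (noise.measurable_mark j)).comp measurable_snd).div_const _
  have h2 : Measurable fun p : ℝ × Ω => UnitAddTorus.mFourier k (noise.mark j p.2).2 :=
    (UnitAddTorus.mFourier k).continuous.measurable.comp
      ((measurable_snd.comp (noise.measurable_mark j)).comp measurable_snd)
  exact (Complex.measurable_ofReal.comp h1).fun_mul h2

/-- The second moment of the contribution of the vortices created in `(s, t]`, given the past. -/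
lemma setLIntegral_creation_sub_sq_le (hN1 : 1 ≤ N) (hN : noise.IsPoisson (N * lam) P)
    (hIN : IndepFun (fun ω i => (init.time i ω, init.mark i ω))
      (fun ω i => (noise.time i ω, noise.mark i ω)) P) {s t : ℝ≥0} (hst : s ≤ t) {A : Set Ω}
    (hA : MeasurableSet[augmentedFiltration init noise M P s] A) (m : ℕ) (k : Fin 2 → ℤ) :
    ∫⁻ ω in A, ENNReal.ofReal (‖creation noise N m k t ω - creation noise N m k s ω‖ ^ 2) ∂P ≤
      P A * ((lam * (t - s) : ℝ≥0) : ℝ≥0∞) := by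
  obtain ⟨B, hB, hAB⟩ := exists_pastData_preimage hA
  rw [setLIntegral_congr hAB, measure_congr hAB]
  have hst' : (s : ℝ) ≤ t := NNReal.coe_le_coe.2 hst
  have hN0 : (0 : ℝ) < N := by exact_mod_cast hN1
  have hcre : Measurable fun z : Torus => (UnitAddTorus.mFourier k z).re :=
    Complex.measurable_re.comp (UnitAddTorus.mFourier k).continuous.measurable
  have hcim : Measurable fun z : Torus => (UnitAddTorus.mFourier k z).im :=
    Complex.measurable_im.comp (UnitAddTorus.mFourier k).continuous.measurable
  have hbre : ∀ z : Torus, |(UnitAddTorus.mFourier k z).re| ≤ 1 := fun z =>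
    (Complex.abs_re_le_norm _).trans (norm_mFourier_apply k z).le
  have hbim : ∀ z : Torus, |(UnitAddTorus.mFourier k z).im| ≤ 1 := fun z =>
    (Complex.abs_im_le_norm _).trans (norm_mFourier_apply k z).le
  set A' := pastData init noise s ⁻¹' B with hA'
  have hi : ∀ h : Torus → ℝ, Measurable h → (∀ z, |h z| ≤ 1) → Integrable (fun ω =>
      (∑ j ∈ Finset.range m, noise.jump s t h j ω) ^ 2) (P.restrict A') ∧
      ∀ j, Integrable (fun ω => noise.jump s t h j ω ^ 2) (P.restrict A') := by
    intro h hh hb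
    constructor
    · refine Integrable.of_bound ((Finset.measurable_fun_sum _ fun j _ =>
        measurable_jump noise s t hh j).pow_const 2).aestronglyMeasurable ((m : ℝ) ^ 2)
        (ae_restrict_of_ae ?_)
      filter_upwards [ae_abs_jump_le hN s t hb] with ω hω
      rw [Real.norm_eq_abs, abs_pow]
      refine pow_le_pow_left₀ (abs_nonneg _) ((Finset.abs_sum_le_sum_abs _ _).trans ?_) 2
      exact (Finset.sum_le_sum fun j _ => hω j).trans (by simp)
    · intro j
      refine Integrable.of_bound ((measurable_jump noise s t hh j).pow_const 2).aestronglyMeasurable 1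
        (ae_restrict_of_ae ?_)
      filter_upwards [ae_abs_jump_le hN s t hb] with ω hω
      rw [Real.norm_eq_abs, abs_pow]
      exact pow_le_one₀ (abs_nonneg _) (hω j)
  have h1 := hi _ hcre hbre
  have h2 := hi _ hcim hbim
  simp_rw [norm_sq_creation_sub noise N m k hst']
  rw [← ofReal_integral_eq_lintegral_ofReal ((h1.1.fun_add h2.1).const_mul _)
    (Filter.Eventually.of_forall fun ω => by positivity), integral_const_mul,
    integral_add h1.1 h2.1, integral_past_sum_jump_sq hN hIN s t hB hcre hbre,
    integral_past_sum_jump_sq hN hIN s t hB hcim hbim, ← Finset.sum_add_distrib]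
  rw [Finset.sum_congr rfl fun j _ => (integral_add (h1.2 j) (h2.2 j)).symm]
  rw [← integral_finsetSum _ fun j _ => (h1.2 j).fun_add (h2.2 j), ENNReal.ofReal_mul (by positivity),
    ofReal_integral_eq_lintegral_ofReal (integrable_finsetSum _ fun j _ => (h1.2 j).fun_add (h2.2 j))
      (Filter.Eventually.of_forall fun ω => Finset.sum_nonneg fun j _ => by positivity)]
  -- Signs and characters have modulus one, so each point in (s, t] counts exactly once.
  have h3 : ∀ᵐ ω ∂P, ENNReal.ofReal (∑ j ∈ Finset.range m,
      (noise.jump s t (fun z => (UnitAddTorus.mFourier k z).re) j ω ^ 2 +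
        noise.jump s t (fun z => (UnitAddTorus.mFourier k z).im) j ω ^ 2)) ≤ noise.incr s t ω := by
    have hs : ∀ᵐ ω ∂P, ∀ j, (noise.mark j ω).1 = 1 ∨ (noise.mark j ω).1 = -1 := by
      rw [ae_all_iff]
      intro j
      have h1 : ∀ᵐ z ∂(signMeasure.prod (volume : Measure Torus)), z.1 = 1 ∨ z.1 = -1 :=
        Measure.quasiMeasurePreserving_fst.ae ae_signMeasure
      rw [← (hN.law_marks j).map_eq] at h1
      exact ae_of_ae_map (noise.measurable_mark j).aemeasurable h1
    filter_upwards [hs] with ω hω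
    rw [ENNReal.ofReal_sum_of_nonneg fun j _ => by positivity]
    refine (Finset.sum_le_sum fun j _ => ?_).trans (ENNReal.sum_le_tsum (Finset.range m))
    rw [MarkedPoints.jump, MarkedPoints.jump]
    split_ifs with hj
    · have hz : (UnitAddTorus.mFourier k (noise.mark j ω).2).re ^ 2 +
          (UnitAddTorus.mFourier k (noise.mark j ω).2).im ^ 2 = 1 := by
        have := norm_mFourier_apply k (noise.mark j ω).2
        have h2 := Complex.normSq_eq_norm_sq (UnitAddTorus.mFourier k (noise.mark j ω).2)
        rw [this, Complex.normSq_apply] at h2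
        linarith
      have hsg : (noise.mark j ω).1 ^ 2 = 1 := by
        rcases hω j with e | e <;> rw [e] <;> norm_num
      rw [mul_pow, mul_pow, ← mul_add, hz, hsg]
      simp
    · simp
  refine (mul_le_mul' le_rfl ((lintegral_mono_ae (ae_restrict_of_ae h3)).trans
    (setLIntegral_incr hN hIN hst hB).le)).trans (le_of_eq ?_)
  rw [ENNReal.ofReal_inv_of_pos hN0, ENNReal.ofReal_natCast]
  push_cast
  have hNN : (N : ℝ≥0∞)⁻¹ * N = 1 := ENNReal.inv_mul_cancel (by exact_mod_cast (by omega : N ≠ 0))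
    (ENNReal.natCast_ne_top N)
  calc (N : ℝ≥0∞)⁻¹ * (P A' * (N * lam * (t - s)))
      = ((N : ℝ≥0∞)⁻¹ * N) * (P A' * (lam * (t - s))) := by ring
    _ = _ := by rw [hNN, one_mul]

/-- The event {τ < s} is a union of events {τ ≤ u} with u < s, and the right limit at u is contained
in the σ-algebra at s. Strict inequalities thus remove the right-continuous version. -/
lemma measurableSet_lt_of_isStoppingTime {τ : Ω → ℝ≥0}
    (hτ : IsStoppingTime (vortexFiltration init noise M P) fun ω => (τ ω : WithTop ℝ≥0)) (s : ℝ≥0) :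
    MeasurableSet[augmentedFiltration init noise M P s] {ω | τ ω < s} := by
  have e : {ω | τ ω < s} = ⋃ n : ℕ, {ω | τ ω + (n + 1 : ℝ≥0)⁻¹ ≤ s} := by
    ext ω
    simp only [Set.mem_ofPred_eq, Set.mem_iUnion]
    constructor
    · intro h
      obtain ⟨n, hn⟩ := exists_nat_one_div_lt (K := ℝ) (sub_pos.2 (NNReal.coe_lt_coe.2 h))
      refine ⟨n, ?_⟩
      rw [← NNReal.coe_le_coe]
      push_cast
      rw [one_div] at hn
      linarith
    · rintro ⟨n, hn⟩
      exact lt_of_lt_of_le (lt_add_of_pos_right _ (by positivity)) hn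
  rw [e]
  refine @MeasurableSet.iUnion _ _ (_) _ _ fun n => ?_
  by_cases hn : (n + 1 : ℝ≥0)⁻¹ ≤ s
  · set u : ℝ≥0 := s - (n + 1 : ℝ≥0)⁻¹ with hu
    have hus : u < s := tsub_lt_self (lt_of_lt_of_le (by positivity) hn) (by positivity)
    have h1 := hτ u
    have h2 : {ω | (τ ω : WithTop ℝ≥0) ≤ u} = {ω | τ ω + (n + 1 : ℝ≥0)⁻¹ ≤ s} := by
      ext ω
      simp only [Set.mem_ofPred_eq, WithTop.coe_le_coe, hu]
      exact le_tsub_iff_right hn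
    rw [h2, vortexFiltration, Filtration.rightCont_eq] at h1
    exact iInf₂_le (f := fun j (_ : j > u) => (augmentedFiltration init noise M P j : MeasurableSpace Ω))
      s hus _ h1
  · have : {ω | τ ω + (n + 1 : ℝ≥0)⁻¹ ≤ s} = ∅ := by
      ext ω
      simp only [Set.mem_ofPred_eq, Set.mem_empty_iff_false, iff_false]
      exact fun h => hn (le_add_self.trans h)
    rw [this]
    exact @MeasurableSet.empty _ (_)

lemma measurable_of_isStoppingTime {τ : Ω → ℝ≥0}
    (hτ : IsStoppingTime (vortexFiltration init noise M P) fun ω => (τ ω : WithTop ℝ≥0)) :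
    Measurable τ :=
  measurable_of_Iio fun s => (augmentedFiltration init noise M P).le s _
    (measurableSet_lt_of_isStoppingTime hτ s)

/-- τ is replaced by the first multiple of h strictly after it. Each of its values h(l+1) is taken
on an event of the past of that time, where the deterministic estimate applies; the events partition
the space. -/
lemma lintegral_creation_grid_sq_le (hN1 : 1 ≤ N) (hN : noise.IsPoisson (N * lam) P)
    (hIN : IndepFun (fun ω i => (init.time i ω, init.mark i ω))
      (fun ω i => (noise.time i ω, noise.mark i ω)) P) {τ : Ω → ℝ≥0}
    (hτ : IsStoppingTime (vortexFiltration init noise M P) fun ω => (τ ω : WithTop ℝ≥0))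
    (r : ℝ≥0) {h : ℝ≥0} (hh : 0 < h) (m : ℕ) (k : Fin 2 → ℤ) :
    ∫⁻ ω, ENNReal.ofReal (‖creation noise N m k ((h * (⌊τ ω / h⌋₊ + 1) : ℝ≥0) + r) ω -
      creation noise N m k (h * (⌊τ ω / h⌋₊ + 1) : ℝ≥0) ω‖ ^ 2) ∂P ≤ ((lam * r : ℝ≥0) : ℝ≥0∞) := by
  set A : ℕ → Set Ω := fun l => {ω | ⌊τ ω / h⌋₊ = l} with hA
  have hAm : ∀ l : ℕ, MeasurableSet[augmentedFiltration init noise M P (h * (l + 1))] (A l) := by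
    intro l
    have e : A l = {ω | τ ω < h * (l + 1)} \ {ω | τ ω < h * l} := by
      ext ω
      simp only [hA, Set.mem_ofPred_eq, Set.mem_sdiff, not_lt]
      rw [Nat.floor_eq_iff (by positivity), le_div_iff₀ hh, div_lt_iff₀ hh, mul_comm (l : ℝ≥0),
        mul_comm (l + 1 : ℝ≥0), and_comm]
    rw [e]
    refine @MeasurableSet.diff _ (_) _ _ (measurableSet_lt_of_isStoppingTime hτ _) ?_
    refine (augmentedFiltration init noise M P).mono (i := h * l) ?_ _
      (measurableSet_lt_of_isStoppingTime hτ _)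
    gcongr
    exact le_self_add
  have hAm' : ∀ l, MeasurableSet (A l) := fun l =>
    (augmentedFiltration init noise M P).le _ _ (hAm l)
  have hdisj : Pairwise (Function.onFun Disjoint A) := fun i j hij =>
    Set.disjoint_left.2 fun ω h1 h2 => hij (h1.symm.trans h2)
  have hun : ⋃ l, A l = Set.univ := Set.eq_univ_of_forall fun ω => Set.mem_iUnion.2 ⟨_, rfl⟩
  rw [← setLIntegral_univ, ← hun, lintegral_iUnion hAm' hdisj]
  have h1 : ∀ l, ∫⁻ ω in A l, ENNReal.ofReal (‖creation noise N m k ((h * (⌊τ ω / h⌋₊ + 1) : ℝ≥0) + r) ω -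
      creation noise N m k (h * (⌊τ ω / h⌋₊ + 1) : ℝ≥0) ω‖ ^ 2) ∂P ≤
      P (A l) * ((lam * r : ℝ≥0) : ℝ≥0∞) := by
    intro l
    have h2 := setLIntegral_creation_sub_sq_le hN1 hN hIN (s := h * (l + 1)) (t := h * (l + 1) + r)
      le_self_add (hAm l) m k
    rw [add_tsub_cancel_left] at h2
    refine le_trans (le_of_eq ?_) h2
    refine setLIntegral_congr_fun (hAm' l) fun ω hω => ?_
    have hω' : ⌊τ ω / h⌋₊ = l := hω
    simp only [hω', NNReal.coe_add]
  refine (ENNReal.tsum_le_tsum h1).trans ?_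
  rw [ENNReal.tsum_mul_right, ← measure_iUnion hdisj hAm', hun, measure_univ, one_mul]

/-- The second moment of the contribution of the vortices created after a stopping time. -/
theorem lintegral_creation_sub_sq_le (hN1 : 1 ≤ N) (hN : noise.IsPoisson (N * lam) P)
    (hIN : IndepFun (fun ω i => (init.time i ω, init.mark i ω))
      (fun ω i => (noise.time i ω, noise.mark i ω)) P) {τ : Ω → ℝ≥0}
    (hτ : IsStoppingTime (vortexFiltration init noise M P) fun ω => (τ ω : WithTop ℝ≥0))
    (r : ℝ≥0) (m : ℕ) (k : Fin 2 → ℤ) :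
    ∫⁻ ω, ENNReal.ofReal (‖creation noise N m k (τ ω + r) ω - creation noise N m k (τ ω) ω‖ ^ 2) ∂P ≤
      ((lam * r : ℝ≥0) : ℝ≥0∞) := by
  set h : ℕ → ℝ≥0 := fun n => (n + 1 : ℝ≥0)⁻¹ with hh
  have hpos : ∀ n, 0 < h n := fun n => by positivity
  set σ : ℕ → Ω → ℝ≥0 := fun n ω => h n * (⌊τ ω / h n⌋₊ + 1) with hσ
  have hτm := measurable_of_isStoppingTime hτ
  have hlt : ∀ n ω, τ ω < σ n ω := fun n ω => by
    have := Nat.lt_floor_add_one (τ ω / h n)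
    rw [div_lt_iff₀ (hpos n)] at this
    simpa [hσ, mul_comm] using this
  have hle : ∀ n ω, σ n ω ≤ τ ω + h n := fun n ω => by
    have := Nat.floor_le (zero_le : 0 ≤ τ ω / h n)
    rw [le_div_iff₀ (hpos n)] at this
    simp only [hσ, mul_add, mul_one]
    gcongr
    rwa [mul_comm]
  have hlim0 : Filter.Tendsto (fun n => ((h n : ℝ≥0) : ℝ)) Filter.atTop (nhds 0) := by
    have := tendsto_one_div_add_atTop_nhds_zero_nat (𝕜 := ℝ)
    simpa [hh] using this
  -- The grid times tend to τ from the right and the creation part is a right-continuous step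
  -- function, so it is eventually constant along them.
  have hright : ∀ (c : ℝ) ω, ∀ᶠ n in Filter.atTop,
      creation noise N m k ((σ n ω : ℝ) + c) ω = creation noise N m k (τ ω + c) ω := by
    intro c ω
    have h1 : ∀ j : Fin m, ∀ᶠ n in Filter.atTop,
        (noise.time j ω ≤ (σ n ω : ℝ) + c ↔ noise.time j ω ≤ τ ω + c) := by
      intro j
      by_cases hj : noise.time j ω ≤ τ ω + c
      · refine Filter.Eventually.of_forall fun n => ⟨fun _ => hj, fun _ => hj.trans ?_⟩
        have := NNReal.coe_lt_coe.2 (hlt n ω)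
        linarith
      · filter_upwards [hlim0.eventually_lt_const (sub_pos.2 (not_le.1 hj))] with n hn
        refine ⟨fun h' => absurd h' (not_le.2 ?_), fun h' => absurd h' hj⟩
        have := NNReal.coe_le_coe.2 (hle n ω)
        push_cast at this
        linarith
    filter_upwards [Filter.eventually_all.2 h1] with n hn
    rw [creation, creation]
    exact Finset.sum_congr rfl fun j _ => if_congr (hn j) rfl rfl
  have hmeas : ∀ n, Measurable fun ω => ENNReal.ofReal (‖creation noise N m k ((σ n ω : ℝ) + r) ω -
      creation noise N m k (σ n ω) ω‖ ^ 2) := by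
    intro n
    have hs : Measurable (σ n) := by
      have h1 : Measurable fun ω => ((⌊τ ω / h n⌋₊ : ℕ) : ℝ≥0) :=
        (measurable_from_nat (f := fun n => (n : ℝ≥0))).comp
          (Nat.measurable_floor.comp (hτm.div_const _))
      exact (h1.add_const _).const_mul _
    have hs' : Measurable fun ω => (σ n ω : ℝ) := measurable_coe_nnreal_real.comp hs
    refine ((Measurable.sub ?_ ?_).norm.pow_const 2).ennreal_ofReal
    · exact (measurable_creation noise N m k).comp ((hs'.add_const _).prodMk measurable_id)
    · exact (measurable_creation noise N m k).comp (hs'.prodMk measurable_id)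
  calc _ ≤ ∫⁻ ω, Filter.liminf (fun n => ENNReal.ofReal
        (‖creation noise N m k ((σ n ω : ℝ) + r) ω - creation noise N m k (σ n ω) ω‖ ^ 2))
        Filter.atTop ∂P := by
        refine lintegral_mono fun ω => ?_
        have h1 := hright r ω
        have h2 := hright 0 ω
        simp only [add_zero] at h2
        refine Filter.le_liminf_of_le (by isBoundedDefault) ?_
        filter_upwards [h1, h2] with n e1 e2
        rw [e1, e2]
    _ ≤ Filter.liminf (fun n => ∫⁻ ω, ENNReal.ofReal
        (‖creation noise N m k ((σ n ω : ℝ) + r) ω - creation noise N m k (σ n ω) ω‖ ^ 2) ∂P)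
        Filter.atTop := lintegral_liminf_le hmeas
    _ ≤ _ := by
        refine Filter.liminf_le_of_le (by isBoundedDefault) fun b hb => ?_
        obtain ⟨n, hn⟩ := hb.exists
        exact hn.trans (lintegral_creation_grid_sq_le hN1 hN hIN hτ r (hpos n) m k)

end StoppingTime

/-! ### Increments of the Fourier coefficients after a stopping time -/

lemma ofReal_norm_add_sq_le (z w : ℂ) : ENNReal.ofReal (‖z + w‖ ^ 2) ≤
    2 * (ENNReal.ofReal (‖z‖ ^ 2) + ENNReal.ofReal (‖w‖ ^ 2)) := by
  have e2 : (2 : ℝ≥0∞) = ENNReal.ofReal 2 := by simp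
  rw [e2, ← ENNReal.ofReal_add (by positivity) (by positivity), ← ENNReal.ofReal_mul zero_le_two]
  exact ENNReal.ofReal_le_ofReal
    ((pow_le_pow_left₀ (norm_nonneg _) (norm_add_le _ _) 2).trans add_sq_le)

lemma ofReal_norm_sub_sq_le (z w : ℂ) : ENNReal.ofReal (‖z - w‖ ^ 2) ≤
    2 * (ENNReal.ofReal (‖z‖ ^ 2) + ENNReal.ofReal (‖w‖ ^ 2)) := by
  have h := ofReal_norm_add_sq_le z (-w)
  rwa [norm_neg, ← sub_eq_add_neg] at h

lemma sq_lintegral_le {α : Type*} [MeasurableSpace α] {μ : Measure α} {f : α → ℝ≥0∞}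
    (hf : Measurable f) : (∫⁻ a, f a ∂μ) ^ 2 ≤ 2 * (μ Set.univ * ∫⁻ a, f a ^ 2 ∂μ) := by
  have h1 : (∫⁻ a, f a ∂μ) ^ 2 = ∫⁻ a, ∫⁻ b, f a * f b ∂μ ∂μ := by
    simp_rw [lintegral_const_mul _ hf]
    rw [lintegral_mul_const _ hf, sq]
  rw [h1]
  refine (lintegral_mono fun a => lintegral_mono fun b => ennreal_mul_le_sq_add_sq _ _).trans ?_
  simp_rw [lintegral_add_right _ (hf.pow_const 2), lintegral_const]
  rw [lintegral_add_right _ measurable_const, lintegral_mul_const _ (hf.pow_const 2), lintegral_const,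
    two_mul, mul_comm (μ Set.univ)]

lemma ofReal_norm_intervalIntegral_sq_le {f : ℝ → ℂ} (hf : Measurable f) {a b c d L : ℝ} (hca : c ≤ a)
    (hab : a ≤ b) (hbd : b ≤ d) (hL : b - a ≤ L) :
    ENNReal.ofReal (‖∫ u in a..b, f u‖ ^ 2) ≤
      ENNReal.ofReal L * (2 * ∫⁻ u in Set.Icc c d, ENNReal.ofReal (‖f u‖ ^ 2)) := by
  have e : ∀ z : ℂ, ENNReal.ofReal (‖z‖ ^ 2) = ‖z‖ₑ ^ 2 := fun z => by
    rw [ENNReal.ofReal_pow (norm_nonneg _), ofReal_norm]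
  simp_rw [e]
  rw [intervalIntegral.integral_of_le hab]
  refine (pow_le_pow_left' (enorm_integral_le_lintegral_enorm _) 2).trans
    ((sq_lintegral_le hf.enorm).trans ?_)
  rw [Measure.restrict_apply_univ, Real.volume_Ioc, mul_left_comm]
  refine mul_le_mul' (ENNReal.ofReal_le_ofReal hL) (mul_le_mul' le_rfl ?_)
  exact lintegral_mono_set fun u hu => ⟨hca.trans hu.1.le, hu.2.trans hbd⟩

/-- The increments of `c` over `[0, T]` are those of `J` plus the integrals of `f`. -/
def HasDrift (c J f : ℝ → ℂ) (T : ℝ) : Prop :=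
  ∀ s t, 0 ≤ s → s ≤ t → t ≤ T →
    IntervalIntegrable f volume 0 t ∧ c t - c s = J t - J s + ∫ u in s..t, f u

/-- Cauchy-Schwarz extracts the length r; the random interval is then enlarged to a deterministic
one, on which moments can be taken at fixed times. -/
lemma HasDrift.increment_sq_le {c J f : ℝ → ℂ} {T : ℝ} (h : HasDrift c J f T)
    (hf : Measurable f) {τ S r : ℝ} (hτ0 : 0 ≤ τ) (hτS : τ ≤ S) (hr0 : 0 ≤ r) (hT : T = S + r) :
    ENNReal.ofReal (‖c (τ + r) - c τ‖ ^ 2) ≤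
      2 * (ENNReal.ofReal (‖J (τ + r) - J τ‖ ^ 2) +
        ENNReal.ofReal r * (2 * ∫⁻ u in Set.Icc 0 T, ENNReal.ofReal (‖f u‖ ^ 2))) := by
  rw [(h τ (τ + r) hτ0 (by linarith) (by linarith)).2]
  refine (ofReal_norm_add_sq_le _ _).trans (mul_le_mul' le_rfl (add_le_add le_rfl ?_))
  exact ofReal_norm_intervalIntegral_sq_le hf hτ0 (by linarith) (by linarith) (by linarith)

/-- For large r the previous bound would contain r times a window of length S + r. Subtracting the
increment over (0, r] leaves the integrals over (r, τ+r] and (0, τ], both of length at most S,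
besides c(r) - c(0), whose moments are bounded. -/
lemma HasDrift.increment_sq_le_of_window {c J f : ℝ → ℂ} {T : ℝ} (h : HasDrift c J f T)
    (hf : Measurable f) {τ S r : ℝ} (hτ0 : 0 ≤ τ) (hτS : τ ≤ S) (hr0 : 0 ≤ r) (hT : T = S + r) :
    ENNReal.ofReal (‖c (τ + r) - c τ‖ ^ 2) ≤
      8 * (((ENNReal.ofReal (‖J (τ + r) - J τ‖ ^ 2) + ENNReal.ofReal (‖J r - J 0‖ ^ 2)) +
        (ENNReal.ofReal S * (2 * ∫⁻ u in Set.Icc r T, ENNReal.ofReal (‖f u‖ ^ 2)) +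
        ENNReal.ofReal S * (2 * ∫⁻ u in Set.Icc 0 S, ENNReal.ofReal (‖f u‖ ^ 2)))) +
        (ENNReal.ofReal (‖c r‖ ^ 2) + ENNReal.ofReal (‖c 0‖ ^ 2))) := by
  have h1 := h τ (τ + r) hτ0 (by linarith) (by linarith)
  have h2 := h 0 r le_rfl hr0 (by linarith)
  have h3 := h 0 τ le_rfl hτ0 (by linarith)
  have e1 := intervalIntegral.integral_add_adjacent_intervals h3.1 (h3.1.symm.trans h1.1)
  have e2 := intervalIntegral.integral_add_adjacent_intervals h2.1 (h2.1.symm.trans h1.1)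
  have e3 : c (τ + r) - c τ = (((J (τ + r) - J τ) - (J r - J 0)) +
      ((∫ u in r..(τ + r), f u) - ∫ u in (0 : ℝ)..τ, f u)) + (c r - c 0) := by
    rw [h1.2, h2.2]
    linear_combination e1 - e2
  have hw1 := ofReal_norm_intervalIntegral_sq_le hf (le_refl r) (by linarith : r ≤ τ + r)
    (by linarith : τ + r ≤ T) (by linarith : τ + r - r ≤ S)
  have hw2 := ofReal_norm_intervalIntegral_sq_le hf (le_refl (0 : ℝ)) hτ0 hτS
    (by linarith : τ - 0 ≤ S)
  rw [e3]
  refine (ofReal_norm_add_sq_le _ _).trans ?_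
  refine (mul_le_mul' le_rfl (add_le_add ((ofReal_norm_add_sq_le _ _).trans (mul_le_mul' le_rfl
    (add_le_add (ofReal_norm_sub_sq_le _ _) ((ofReal_norm_sub_sq_le _ _).trans (mul_le_mul' le_rfl
      (add_le_add hw1 hw2)))))) (ofReal_norm_sub_sq_le _ _))).trans ?_
  generalize ENNReal.ofReal (‖J (τ + r) - J τ‖ ^ 2) = q1
  generalize ENNReal.ofReal (‖J r - J 0‖ ^ 2) = q2
  generalize ENNReal.ofReal (‖c r‖ ^ 2) = q3
  generalize ENNReal.ofReal (‖c 0‖ ^ 2) = q4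
  generalize ENNReal.ofReal S * (2 * ∫⁻ u in Set.Icc r T, ENNReal.ofReal (‖f u‖ ^ 2)) = q5
  generalize ENNReal.ofReal S * (2 * ∫⁻ u in Set.Icc 0 S, ENNReal.ofReal (‖f u‖ ^ 2)) = q6
  calc 2 * (2 * (2 * (q1 + q2) + 2 * (q5 + q6)) + 2 * (q3 + q4))
      = 8 * ((q1 + q2) + (q5 + q6)) + 4 * (q3 + q4) := by ring
    _ ≤ 8 * ((q1 + q2) + (q5 + q6)) + 8 * (q3 + q4) := by
        gcongr
        norm_num
    _ = _ := by ring

section Increments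

variable {Ω : Type*} [MeasurableSpace Ω] {init noise : MarkedPoints Ω} {M : ℝ}
  {x : Label → ℝ → Ω → Torus} {G : Set Ω} {T : ℝ} {m : ℕ} {θ : ℝ} {N : ℕ}
  {P : Measure Ω} [IsProbabilityMeasure P] {lam : ℝ≥0}

lemma measurable_coeffPath (hG : MeasurableSet G) (hgood : ∀ ω ∈ G, GoodPath init noise θ M N x ω)
    (hx : ∀ v t, 0 ≤ t → Measurable (x v t)) (k : Fin 2 → ℤ) :
    Measurable fun p : ℝ × Ω => coeffPath init noise M x G T m θ N k p.1 p.2 := by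
  refine Finset.measurable_fun_sum _ fun v _ => ?_
  have h1 := measurable_wgt init noise θ M N (lab m v)
  have h2 := (measurable_pi_apply v).comp (measurable_cutPos (T := T) (m := m) hG hgood hx)
  exact (Complex.measurable_ofReal.comp h1).fun_mul
    ((UnitAddTorus.mFourier k).continuous.measurable.comp h2)

lemma measurable_driftPath (hG : MeasurableSet G) (hgood : ∀ ω ∈ G, GoodPath init noise θ M N x ω)
    (hx : ∀ v t, 0 ≤ t → Measurable (x v t)) (k : Fin 2 → ℤ) :
    Measurable fun p : ℝ × Ω => driftPath init noise M x G T m θ N k p.1 p.2 := by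
  have hc := measurable_cutPos (T := T) (m := m) hG hgood hx
  refine ((measurable_coeffPath hG hgood hx k).const_mul (-(θ : ℂ))).fun_add
    (Finset.measurable_fun_sum _ fun p _ => ?_)
  have h1 := (measurable_wgt init noise θ M N (lab m p.1)).fun_mul
    (measurable_wgt init noise θ M N (lab m p.2))
  have h2 : Measurable fun z : ℝ × Ω => (cutPos init noise M x G T m z.1 z.2 p.1,
      cutPos init noise M x G T m z.1 z.2 p.2) :=
    ((measurable_pi_apply p.1).comp hc).prodMk ((measurable_pi_apply p.2).comp hc)
  have h3 := (measurable_symKernel k).comp h2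
  have h4 := Complex.measurable_ofReal.comp h1
  exact h4.fun_mul h3

lemma lintegral_drift_window_le (hG : MeasurableSet G)
    (hgood : ∀ ω ∈ G, GoodPath init noise θ M N x ω) (hx : ∀ v t, 0 ≤ t → Measurable (x v t))
    (k : Fin 2 → ℤ) {D : ℝ≥0∞} (hD : ∀ u, 0 ≤ u → u ≤ T →
      ∫⁻ ω, ENNReal.ofReal (‖driftPath init noise M x G T m θ N k u ω‖ ^ 2) ∂P ≤ D)
    {c d : ℝ} (hc : 0 ≤ c) (hd : d ≤ T) :
    ∫⁻ ω, (∫⁻ u in Set.Icc c d,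
      ENNReal.ofReal (‖driftPath init noise M x G T m θ N k u ω‖ ^ 2)) ∂P ≤
      ENNReal.ofReal (d - c) * D := by
  have hm : Measurable fun p : Ω × ℝ =>
      ENNReal.ofReal (‖driftPath init noise M x G T m θ N k p.2 p.1‖ ^ 2) :=
    (((measurable_driftPath hG hgood hx k).comp measurable_swap).norm.pow_const 2).ennreal_ofReal
  rw [lintegral_lintegral_swap hm.aemeasurable]
  refine (setLIntegral_mono' measurableSet_Icc fun u hu =>
    hD u (hc.trans hu.1) (hu.2.trans hd)).trans ?_
  rw [setLIntegral_const, Real.volume_Icc, mul_comm]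

lemma measurable_driftPath_right (hG : MeasurableSet G)
    (hgood : ∀ ω ∈ G, GoodPath init noise θ M N x ω) (hx : ∀ v t, 0 ≤ t → Measurable (x v t))
    (k : Fin 2 → ℤ) (ω : Ω) : Measurable fun u : ℝ => driftPath init noise M x G T m θ N k u ω :=
  (measurable_driftPath hG hgood hx k).of_uncurry_right (y := ω)

/-- The second moment of the increment of a Fourier coefficient after a stopping time. -/
theorem setLIntegral_coeffPath_sub_sq_le (hG : MeasurableSet G)
    (hgood : ∀ ω ∈ G, GoodPath init noise θ M N x ω) (hx : ∀ v t, 0 ≤ t → Measurable (x v t))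
    (hN1 : 1 ≤ N) (hN : noise.IsPoisson (N * lam) P)
    (hIN : IndepFun (fun ω i => (init.time i ω, init.mark i ω))
      (fun ω i => (noise.time i ω, noise.mark i ω)) P) {τ : Ω → ℝ≥0}
    (hτ : IsStoppingTime (vortexFiltration init noise M P) fun ω => (τ ω : WithTop ℝ≥0))
    {S r : ℝ≥0} (hτS : ∀ ω, τ ω ≤ S) (hT : T = S + r) (k : Fin 2 → ℤ) {D E : ℝ≥0∞}
    (hE : ∀ u, 0 ≤ u → u ≤ T →
      ∫⁻ ω, ENNReal.ofReal (‖coeffPath init noise M x G T m θ N k u ω‖ ^ 2) ∂P ≤ E)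
    (hD : ∀ u, 0 ≤ u → u ≤ T →
      ∫⁻ ω, ENNReal.ofReal (‖driftPath init noise M x G T m θ N k u ω‖ ^ 2) ∂P ≤ D) :
    ∫⁻ ω in horizonSet init noise M G T m, ENNReal.ofReal
      (‖coeffPath init noise M x G T m θ N k (τ ω + r) ω -
        coeffPath init noise M x G T m θ N k (τ ω) ω‖ ^ 2) ∂P ≤
      r * (32 * (lam + (S + 1) ^ 2 * D + E)) := by
  have hHm : MeasurableSet (horizonSet init noise M G T m) := measurableSet_horizonSet hG
  have hτm := measurable_of_isStoppingTime hτ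
  have hS0 : (0 : ℝ) ≤ S := S.2
  have hr0 : (0 : ℝ) ≤ r := r.2
  have hwin : ∀ c d : ℝ, Measurable fun ω => ∫⁻ u in Set.Icc c d,
      ENNReal.ofReal (‖driftPath init noise M x G T m θ N k u ω‖ ^ 2) := fun c d =>
    Measurable.lintegral_prod_right' (f := fun p : Ω × ℝ =>
      ENNReal.ofReal (‖driftPath init noise M x G T m θ N k p.2 p.1‖ ^ 2))
      (((measurable_driftPath hG hgood hx k).comp measurable_swap).norm.pow_const 2).ennreal_ofReal
  have hJm : ∀ f : Ω → ℝ≥0, Measurable f → Measurable fun ω => ENNReal.ofReal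
      (‖creation noise N m k (f ω + r) ω - creation noise N m k (f ω) ω‖ ^ 2) := by
    intro f hf
    have hs' : Measurable fun ω => (f ω : ℝ) := measurable_coe_nnreal_real.comp hf
    refine ((Measurable.sub ?_ ?_).norm.pow_const 2).ennreal_ofReal
    · exact (measurable_creation noise N m k).comp ((hs'.add_const _).prodMk measurable_id)
    · exact (measurable_creation noise N m k).comp (hs'.prodMk measurable_id)
  have hfm := measurable_driftPath_right (T := T) (m := m) hG hgood hx k
  have hτS' : ∀ ω, (τ ω : ℝ) ≤ S := fun ω => NNReal.coe_le_coe.2 (hτS ω)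
  have hdrift : ∀ ω ∈ horizonSet init noise M G T m,
      HasDrift (fun t => coeffPath init noise M x G T m θ N k t ω) (fun t => creation noise N m k t ω)
        (fun t => driftPath init noise M x G T m θ N k t ω) T :=
    fun ω hω s t hs hst ht => coeffPath_sub hgood hω hs hst ht k
  have hJ := lintegral_creation_sub_sq_le hN1 hN hIN hτ r m k
  -- For r ≤ 1 the horizon is at most S + 1. For r ≥ 1 quantities bounded independently of r are
  -- also bounded by r times the same constant.
  rcases le_total r 1 with hr1 | hr1
  · have hr1' : (r : ℝ) ≤ 1 := by exact_mod_cast hr1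
    have hpt := fun ω (hω : ω ∈ horizonSet init noise M G T m) =>
      (hdrift ω hω).increment_sq_le (hfm ω) (τ ω).coe_nonneg (hτS' ω) hr0 hT
    refine (setLIntegral_mono' hHm hpt).trans ((setLIntegral_le_lintegral _ _).trans ?_)
    rw [lintegral_const_mul' _ _ (by simp), lintegral_add_left (hJm τ hτm),
      lintegral_const_mul' _ _ ENNReal.ofReal_ne_top, lintegral_const_mul' _ _ (by simp)]
    have h2 := lintegral_drift_window_le hG hgood hx k hD le_rfl (le_refl T)
    have h3 : ENNReal.ofReal (T - 0) ≤ (S + 1) ^ 2 := by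
      have e : ((S : ℝ≥0∞) + 1) ^ 2 = ENNReal.ofReal (((S : ℝ) + 1) ^ 2) := by
        rw [ENNReal.ofReal_pow (by positivity), ENNReal.ofReal_add hS0 zero_le_one]
        simp
      rw [e]
      refine ENNReal.ofReal_le_ofReal ?_
      rw [sub_zero, hT]
      nlinarith
    calc _ ≤ 2 * (((lam * r : ℝ≥0) : ℝ≥0∞) + ENNReal.ofReal r * (2 * ((S + 1) ^ 2 * D))) := by
          gcongr
          exact h2.trans (mul_le_mul' h3 le_rfl)
      _ = r * (2 * lam + 4 * ((S + 1) ^ 2 * D)) := by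
          rw [ENNReal.ofReal_coe_nnreal]
          push_cast
          ring
      _ ≤ r * (32 * lam + 32 * ((S + 1) ^ 2 * D) + 32 * E) := by
          refine mul_le_mul' le_rfl (le_add_right (add_le_add ?_ ?_)) <;>
          exact mul_le_mul' (by norm_num) le_rfl
      _ = _ := by ring
  · have hr1' : (1 : ℝ) ≤ r := by exact_mod_cast hr1
    have hconst : IsStoppingTime (vortexFiltration init noise M P)
        fun _ => ((0 : ℝ≥0) : WithTop ℝ≥0) := isStoppingTime_const _ _
    have hJ0 := lintegral_creation_sub_sq_le hN1 hN hIN (τ := fun _ => 0) hconst r m k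
    have hJ0m := hJm (fun _ => 0) measurable_const
    simp only [NNReal.coe_zero, zero_add] at hJ0 hJ0m
    have hpt := fun ω (hω : ω ∈ horizonSet init noise M G T m) =>
      (hdrift ω hω).increment_sq_le_of_window (hfm ω) (τ ω).coe_nonneg (hτS' ω) hr0 hT
    refine (setLIntegral_mono' hHm hpt).trans ((setLIntegral_le_lintegral _ _).trans ?_)
    have hZm : ∀ u : ℝ, Measurable fun ω =>
        ENNReal.ofReal (‖coeffPath init noise M x G T m θ N k u ω‖ ^ 2) := fun u =>
      (((measurable_coeffPath hG hgood hx k).comp measurable_prodMk_left).norm.pow_const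
        2).ennreal_ofReal
    rw [lintegral_const_mul' _ _ (by simp), lintegral_add_right _ ((hZm _).fun_add (hZm _)),
      lintegral_add_left (hZm _), lintegral_add_left ((hJm τ hτm).fun_add hJ0m), lintegral_add_left (hJm τ hτm),
      lintegral_add_left (((hwin _ _).const_mul _).const_mul _),
      lintegral_const_mul' _ _ ENNReal.ofReal_ne_top, lintegral_const_mul' _ _ ENNReal.ofReal_ne_top,
      lintegral_const_mul' _ _ (by simp), lintegral_const_mul' _ _ (by simp)]
    have h2 := lintegral_drift_window_le hG hgood hx k hD hr0 (le_refl T)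
    have h3 := lintegral_drift_window_le hG hgood hx k hD le_rfl (by linarith : (S : ℝ) ≤ T)
    have e1 : ENNReal.ofReal (T - r) = S := by
      rw [hT, add_sub_cancel_right, ENNReal.ofReal_coe_nnreal]
    have e2 : ENNReal.ofReal ((S : ℝ) - 0) = S := by rw [sub_zero, ENNReal.ofReal_coe_nnreal]
    rw [e1] at h2
    rw [e2] at h3
    have h4 := hE r hr0 (by linarith)
    have h5 := hE 0 le_rfl (by linarith)
    have hr1'' : (1 : ℝ≥0∞) ≤ r := by exact_mod_cast hr1
    calc _ ≤ 8 * ((((lam * r : ℝ≥0) : ℝ≥0∞) + ((lam * r : ℝ≥0) : ℝ≥0∞)) +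
          (ENNReal.ofReal S * (2 * (S * D)) + ENNReal.ofReal S * (2 * (S * D))) + (E + E)) := by
          gcongr
      _ = r * (16 * lam) + 1 * (32 * (S ^ 2 * D) + 16 * E) := by
          rw [ENNReal.ofReal_coe_nnreal]
          push_cast
          ring
      _ ≤ r * (16 * lam) + r * (32 * ((S + 1) ^ 2 * D) + 16 * E) := by
          gcongr
          exact le_self_add
      _ = r * (16 * lam + 32 * ((S + 1) ^ 2 * D) + 16 * E) := by ring
      _ ≤ r * (32 * lam + 32 * ((S + 1) ^ 2 * D) + 32 * E) := by
          gcongr <;> norm_num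
      _ = _ := by ring

end Increments

/-! ### The Sobolev norm of the increments -/

lemma freqSq_neg (k : Fin 2 → ℤ) : freqSq (-k) = freqSq k := by simp [freqSq]

lemma norm_sq_le_freqSq (k : Fin 2 → ℤ) : ‖k‖ ^ 2 ≤ freqSq k := by
  obtain ⟨i, hi⟩ := Finite.exists_max fun i => ‖k i‖
  have h : ‖k‖ ≤ ‖k i‖ := (pi_norm_le_iff_of_nonneg (norm_nonneg _)).2 hi
  refine (pow_le_pow_left₀ (norm_nonneg _) h 2).trans ?_
  rw [Int.norm_eq_abs, sq_abs]
  exact Finset.single_le_sum (f := fun j => (k j : ℝ) ^ 2) (fun j _ => sq_nonneg _)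
    (Finset.mem_univ i)

/-- Comparison with the lattice sum of ‖k‖^(-2-2δ) in the sup norm; the zero frequency is treated
separately. -/
lemma summable_one_add_freqSq_rpow {δ : ℝ} (hδ : 0 < δ) :
    Summable fun k : Fin 2 → ℤ => (1 + freqSq k) ^ (-1 - δ) := by
  have h1 := EisensteinSeries.summable_one_div_norm_rpow (k := 2 + 2 * δ) (by linarith)
  have h2 : Summable fun k : Fin 2 → ℤ => if k = 0 then (1 : ℝ) else 0 := (hasSum_ite_eq 0 1).summable
  have h3 := fun k => freqSq_nonneg k
  refine (h1.add h2).of_nonneg_of_le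
    (fun k => Real.rpow_nonneg (by linarith [h3 k]) _) fun k => ?_
  by_cases hk : k = 0
  · subst hk
    have e : (1 : ℝ) + freqSq 0 = 1 := by simp [freqSq]
    rw [e, Real.one_rpow, if_pos rfl]
    exact le_add_of_nonneg_left (Real.rpow_nonneg (norm_nonneg _) _)
  · rw [if_neg hk, add_zero]
    have hk0 : 0 < ‖k‖ := norm_pos_iff.2 hk
    have e : ‖k‖ ^ (-(2 + 2 * δ)) = (‖k‖ ^ 2) ^ (-1 - δ) := by
      rw [← Real.rpow_natCast, ← Real.rpow_mul hk0.le]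
      congr 1
      push_cast
      ring
    rw [e]
    exact Real.rpow_le_rpow_of_nonpos (by positivity)
      ((norm_sq_le_freqSq k).trans (by linarith)) (by linarith)

/-- The constant of the increment bound in terms of a bound `C` for the symmetrised kernel. -/
def incrementBound (δ θ C : ℝ) (lam T : ℝ≥0) : ℝ≥0∞ :=
  (∑' k : Fin 2 → ℤ, ENNReal.ofReal ((1 + freqSq k) ^ (-1 - δ))) *
    (32 * (lam + (T + 1) ^ 2 * (ENNReal.ofReal (2 * θ ^ 2 + 4 * C ^ 2) * (1 + enstrophyBound θ lam)) +
      (1 + enstrophyBound θ lam)))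

lemma incrementBound_ne_top {δ θ : ℝ} (hδ : 0 < δ) (hθ : 0 < θ) (C : ℝ) (lam T : ℝ≥0) :
    incrementBound δ θ C lam T ≠ ⊤ := by
  have h1 : (1 : ℝ≥0∞) + enstrophyBound θ lam ≠ ⊤ :=
    ENNReal.add_ne_top.2 ⟨ENNReal.one_ne_top, enstrophyBound_ne_top hθ lam⟩
  have h2 : (∑' k : Fin 2 → ℤ, ENNReal.ofReal ((1 + freqSq k) ^ (-1 - δ))) ≠ ⊤ :=
    (summable_one_add_freqSq_rpow hδ).tsum_ofReal_ne_top
  refine ENNReal.mul_ne_top h2 (ENNReal.mul_ne_top (by simp) (ENNReal.add_ne_top.2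
    ⟨ENNReal.add_ne_top.2 ⟨ENNReal.coe_ne_top, ENNReal.mul_ne_top ?_
      (ENNReal.mul_ne_top ENNReal.ofReal_ne_top h1)⟩, h1⟩))
  exact ENNReal.pow_ne_top (ENNReal.add_ne_top.2 ⟨ENNReal.coe_ne_top, ENNReal.one_ne_top⟩)

section SobolevIncrement

variable {Ω : Type*} [MeasurableSpace Ω] {init noise : MarkedPoints Ω} {M : ℝ}
  {x : Label → ℝ → Ω → Torus} {G : Set Ω} {T : ℝ} {m : ℕ} {θ : ℝ} {N : ℕ}
  {P : Measure Ω} [IsProbabilityMeasure P] {lam : ℝ≥0}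

lemma GoodPath.eventually_mem_horizonSet (hgood : ∀ ω ∈ G, GoodPath init noise θ M N x ω) {ω : Ω}
    (hω : ω ∈ G) (T : ℝ) : ∀ᶠ m in Filter.atTop, ω ∈ horizonSet init noise M G T m := by
  have h := hgood ω hω
  obtain ⟨m₁, h1⟩ := Filter.eventually_atTop.1 (h.init_lim.eventually_gt_atTop M)
  obtain ⟨m₂, h2⟩ := Filter.eventually_atTop.1 (h.noise_lim.eventually_gt_atTop T)
  filter_upwards [Filter.eventually_ge_atTop (max m₁ m₂)] with m hm
  exact ⟨hω, fun i hi => h1 i ((le_max_left _ _).trans (hm.trans hi)),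
    fun j hj => h2 j ((le_max_right _ _).trans (hm.trans hj))⟩

lemma measurable_coeffPath_comp (hG : MeasurableSet G)
    (hgood : ∀ ω ∈ G, GoodPath init noise θ M N x ω)
    (hx : ∀ v t, 0 ≤ t → Measurable (x v t)) (k : Fin 2 → ℤ) {f : Ω → ℝ} (hf : Measurable f) :
    Measurable fun ω => coeffPath init noise M x G T m θ N k (f ω) ω := by
  have h1 := measurable_coeffPath (T := T) (m := m) hG hgood hx k
  have h2 := hf.prodMk (measurable_id (α := Ω))
  have h3 := h1.comp h2
  simpa only [Function.comp_def, id] using h3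

/-- The second moment of the increments of a Fourier coefficient, on the event that the first `m`
points of both processes are those that matter. -/
lemma setLIntegral_coeffPath_sub_sq_le_of_poisson (hθ : 0 < θ) (hN1 : 1 ≤ N)
    (hI : init.IsPoisson (N * lam) P) (hN : noise.IsPoisson (N * lam) P)
    (hIN : IndepFun (fun ω i => (init.time i ω, init.mark i ω))
      (fun ω i => (noise.time i ω, noise.mark i ω)) P)
    (hG : MeasurableSet G) (hG0 : ∀ᵐ ω ∂P, ω ∈ G)
    (hgood : ∀ ω ∈ G, GoodPath init noise θ M N x ω) (hx : ∀ v t, 0 ≤ t → Measurable (x v t))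
    {C : ℝ} (hC : ∀ k x y, ‖symKernel k x y‖ ≤ C * freqSq k) {τ : Ω → ℝ≥0}
    (hτ : IsStoppingTime (vortexFiltration init noise M P) fun ω => (τ ω : WithTop ℝ≥0))
    {S r : ℝ≥0} (hτS : ∀ ω, τ ω ≤ S) (hT : T = S + r) (k : Fin 2 → ℤ) :
    ∫⁻ ω in horizonSet init noise M G T m, ENNReal.ofReal
      (‖coeffPath init noise M x G T m θ N k (τ ω + r) ω -
        coeffPath init noise M x G T m θ N k (τ ω) ω‖ ^ 2) ∂P ≤
      r * (ENNReal.ofReal ((1 + freqSq k) ^ 2) * (32 * (lam + (S + 1) ^ 2 *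
        (ENNReal.ofReal (2 * θ ^ 2 + 4 * C ^ 2) * (1 + enstrophyBound θ lam)) +
          (1 + enstrophyBound θ lam)))) := by
  have hX := fun u => measurable_cutPos_apply (init := init) (noise := noise) (M := M) (T := T) (m := m) hG hx u
  have hlaw := fun u (hu0 : 0 ≤ u) (hu : u ≤ T) =>
    map_timesSigns_cutPos (m := m) hI hN hIN hG hG0 hgood hx hθ hN1 hu0 hu
  refine (setLIntegral_coeffPath_sub_sq_le hG hgood hx hN1 hN hIN hτ hτS hT k
    (fun u hu0 hu => lintegral_coeffPath_sq_le hθ hN1 hI hN u (hX u) (hlaw u hu0 hu) k)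
    fun u hu0 hu => lintegral_driftPath_sq_le hθ hN1 hI hN u (hX u) (hlaw u hu0 hu) hC k).trans ?_
  rw [ENNReal.ofReal_mul (by positivity)]
  have hF : 1 ≤ ENNReal.ofReal ((1 + freqSq k) ^ 2) := by
    rw [← ENNReal.ofReal_one]
    exact ENNReal.ofReal_le_ofReal (one_le_pow₀ (by linarith [freqSq_nonneg k]))
  generalize ENNReal.ofReal ((1 + freqSq k) ^ 2) = F at hF ⊢
  generalize ENNReal.ofReal (2 * θ ^ 2 + 4 * C ^ 2) = A
  generalize 1 + enstrophyBound θ lam = E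
  refine mul_le_mul' le_rfl ?_
  calc (32 : ℝ≥0∞) * (lam + (S + 1) ^ 2 * (A * F * E) + E)
      ≤ 32 * (F * lam + (S + 1) ^ 2 * (A * F * E) + F * E) := by
        gcongr
        · exact le_mul_of_one_le_left' hF
        · exact le_mul_of_one_le_left' hF
    _ = _ := by ring

/-- Almost every outcome belongs to the truncation events for all large m, where the Sobolev norm is
that of the truncated system. Fatou's lemma transfers the estimates, which are uniform in m. -/
theorem lintegral_sobolevNormSq_vorticity_sub_le (hθ : 0 < θ) (hN1 : 1 ≤ N)
    (hI : init.IsPoisson (N * lam) P) (hN : noise.IsPoisson (N * lam) P)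
    (hIN : IndepFun (fun ω i => (init.time i ω, init.mark i ω))
      (fun ω i => (noise.time i ω, noise.mark i ω)) P) (hx : IsVortexDynamics init noise θ M N x P)
    {C : ℝ} (hC : ∀ k x y, ‖symKernel k x y‖ ≤ C * freqSq k) {τ : Ω → ℝ≥0}
    (hτ : IsStoppingTime (vortexFiltration init noise M P) fun ω => (τ ω : WithTop ℝ≥0))
    {S : ℝ≥0} (hτS : ∀ ω, τ ω ≤ S) (r : ℝ≥0) (δ : ℝ) :
    ∫⁻ ω, sobolevNormSq (-3 - δ)
        (vorticity init noise θ M N x (τ ω + r) ω - vorticity init noise θ M N x (τ ω) ω) ∂P ≤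
      incrementBound δ θ C lam S * r := by
  obtain ⟨G, hG0, hG, hgood⟩ := (ae_goodPath hI hN hx).exists_measurable_mem
  have hxm := hx.measurable
  have hτm : Measurable fun ω => (τ ω : ℝ) :=
    measurable_coe_nnreal_real.comp (measurable_of_isStoppingTime hτ)
  set T : ℝ := S + r with hT
  set H : ℕ → Set Ω := fun m => horizonSet init noise M G T m with hH
  have hHm : ∀ m, MeasurableSet (H m) := fun m => measurableSet_horizonSet hG
  set D : ℕ → (Fin 2 → ℤ) → Ω → ℝ≥0∞ := fun m k ω => ENNReal.ofReal
    (‖coeffPath init noise M x G T m θ N k (τ ω + r) ω -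
      coeffPath init noise M x G T m θ N k (τ ω) ω‖ ^ 2) with hD
  have hDm : ∀ m k, Measurable (D m k) := fun m k =>
    (((measurable_coeffPath_comp hG hgood hxm k (hτm.add_const _)).fun_sub
      (measurable_coeffPath_comp hG hgood hxm k hτm)).norm.pow_const 2).ennreal_ofReal
  set F : ℕ → Ω → ℝ≥0∞ := fun m ω => ∑' k : Fin 2 → ℤ,
    ENNReal.ofReal ((1 + freqSq k) ^ (-3 - δ)) * (H m).indicator (D m (-k)) ω with hF
  have hFk : ∀ m (k : Fin 2 → ℤ), Measurable fun ω =>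
      ENNReal.ofReal ((1 + freqSq k) ^ (-3 - δ)) * (H m).indicator (D m (-k)) ω := fun m k =>
    ((hDm m (-k)).indicator (hHm m)).const_mul _
  have hFm : ∀ m, Measurable (F m) := fun m => Measurable.tsum (hFk m)
  have hle : ∀ᵐ ω ∂P, sobolevNormSq (-3 - δ)
      (vorticity init noise θ M N x (τ ω + r) ω - vorticity init noise θ M N x (τ ω) ω) ≤
      Filter.liminf (fun m => F m ω) Filter.atTop := by
    filter_upwards [hG0] with ω hω
    refine Filter.le_liminf_of_le (by isBoundedDefault) ?_
    filter_upwards [GoodPath.eventually_mem_horizonSet hgood hω T] with m hm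
    refine le_of_eq (tsum_congr fun k => ?_)
    have hτ0 : (0 : ℝ) ≤ τ ω := (τ ω).coe_nonneg
    have hr0 : (0 : ℝ) ≤ r := r.coe_nonneg
    have hτS' : (τ ω : ℝ) ≤ S := NNReal.coe_le_coe.2 (hτS ω)
    rw [fourierCoeffMeasure_vorticity_sub hgood hm hτ0 (by linarith) (by linarith) (by linarith) k,
      ENNReal.ofReal_mul (Real.rpow_nonneg (by linarith [freqSq_nonneg k]) _),
      Set.indicator_of_mem hm]
  refine (lintegral_mono_ae hle).trans ((lintegral_liminf_le hFm).trans ?_)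
  refine Filter.liminf_le_of_le (by isBoundedDefault) fun b hb => ?_
  obtain ⟨m, hm⟩ := hb.exists
  refine hm.trans ?_
  rw [lintegral_tsum fun k => (hFk m k).aemeasurable, incrementBound, mul_assoc,
    ← ENNReal.tsum_mul_right]
  refine ENNReal.tsum_le_tsum fun k => ?_
  rw [lintegral_const_mul' _ _ ENNReal.ofReal_ne_top, lintegral_indicator (hHm m)]
  have h := setLIntegral_coeffPath_sub_sq_le_of_poisson (m := m) hθ hN1 hI hN hIN hG hG0 hgood hxm hC
    hτ hτS hT (-k)
  refine (mul_le_mul' le_rfl h).trans (le_of_eq ?_)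
  have hF0 : 0 < 1 + freqSq k := by linarith [freqSq_nonneg k]
  -- The second moment of the drift uses up two of the three powers of 1 + |k|²; the remaining 1 + δ
  -- is just enough for summability over ℤ².
  have e : (1 + freqSq k) ^ (-1 - δ) = (1 + freqSq k) ^ (-3 - δ) * (1 + freqSq k) ^ 2 := by
    rw [← Real.rpow_natCast (1 + freqSq k) 2, ← Real.rpow_add hF0]
    congr 1
    push_cast
    ring
  rw [freqSq_neg, e, ENNReal.ofReal_mul (Real.rpow_nonneg hF0.le _)]
  ring

end SobolevIncrement

end PointVortex

end

/-! ### The theorem -/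

open PointVortex MeasureTheory ProbabilityTheory in
theorem proposition8 (θ : ℝ) (hθ : 0 < θ) (lam : ℝ≥0) (hlam : 0 < lam)
    (δ : ℝ) (hδ : 0 < δ) (T : ℝ≥0) (hT : 0 < T) :
    ∃ C : ℝ,
      ∀ (M : ℝ) (_ : 0 ≤ M) (N : ℕ) (_ : 1 ≤ N)
        (Ω : Type*) [MeasurableSpace Ω] (P : Measure Ω) [IsProbabilityMeasure P]
        (init noise : MarkedPoints Ω)
        (_ : init.IsPoisson (N * lam) P) (_ : noise.IsPoisson (N * lam) P)
        (_ : IndepFun (fun ω i => (init.time i ω, init.mark i ω))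
          (fun ω i => (noise.time i ω, noise.mark i ω)) P)
        (x : Label → ℝ → Ω → Torus) (_ : IsVortexDynamics init noise θ M N x P)
        (τ : Ω → ℝ≥0)
        (_ : IsStoppingTime (vortexFiltration init noise M P) (fun ω => (τ ω : WithTop ℝ≥0)))
        (_ : ∀ ω, τ ω ≤ T) (r : ℝ) (_ : 0 < r),
        ∫⁻ ω, sobolevNormSq (-3 - δ)
            (vorticity init noise θ M N x (τ ω + r) ω - vorticity init noise θ M N x (τ ω) ω) ∂P
          ≤ ENNReal.ofReal (C * r) := by
  obtain ⟨C, -, hC⟩ := exists_norm_symKernel_le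
  refine ⟨(incrementBound δ θ C lam T).toReal, ?_⟩
  intro M _ N hN1 Ω _ P _ init noise hI hN hIN x hx τ hτ hτT r hr
  lift r to ℝ≥0 using hr.le
  refine (lintegral_sobolevNormSq_vorticity_sub_le hθ hN1 hI hN hIN hx hC hτ hτT r δ).trans
    (le_of_eq ?_)
  rw [ENNReal.ofReal_mul ENNReal.toReal_nonneg,
    ENNReal.ofReal_toReal (incrementBound_ne_top hδ hθ C lam T), ENNReal.ofReal_coe_nnreal]
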